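/- Let $K=\overline{\mathbb Q}_3$, let $\zeta\in K$ be a primitive $23$rd root of unity, and let $g(X)=\prod_{r}(X-\zeta^r)$, where $r$ runs over the $11$ nonzero squares modulo $23$; then $g\in\mathbb Z_3[X]$. Let $\lambda\in\mathbb Z_3^\times$. For $m\ge 0$ let $C_m\subseteq(\mathbb Z/3^m\mathbb Z)^{24}$ be the lifted extended quadratic residue code of length $24$ modulo $3^m$: the set of words $(c_0,\dots,c_{22},c_\infty)$ such that $c_0+c_1X+\dots+c_{22}X^{22}$ is a multiple of $g$ modulo $3^m$ and $c_\infty=\lambda(c_0+\dots+c_{22})$. Let $C_m^\perp$ be its dual for the standard inner product. For a code $C$ modulo $3^m$ its symmetrized weight enumerator in variables $x_0,\dots,x_{m-1},z$ is $\sum_{c\in C}x_0^{n_0}\cdots x_{m-1}^{n_{m-1}}z^{n_\infty}$, where $n_i$ is the number of coordinates of $c$ of $3$-adic valuation $i$ and $n_\infty$ the number of zero coordinates. The disjoint weight enumerators $A_{m,\ell}(x_0,\dots,x_{m-1};y_0,\dots,y_{\ell-1};z)$, for $m,\ell\ge 0$, are defined inductively: $A_{0,\ell}$ is the symmetrized weight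 enumerator of $C_\ell^\perp$ in the variables $y_0,\dots,y_{\ell-1},z$, and \[A_{m+1,\ell}(x_0,\dots,x_m;y_0,\dots,y_{\ell-1};z)=\tfrac1{|C_1^\perp|}A_{m,\ell+1}(3x_0,\dots,3x_{m-1};y_0,\dots,y_{\ell-1},z-x_m;z+2x_m).\] The partial weight enumerator $D_{m,\ell}$ is the sum of those terms of $A_{m,\ell}$ whose monomial is divisible by $x_0$ (no condition if $m=0$) and by $y_0$ (no condition if $\ell=0$). Then, with $z$ and $x_0,x_1,\dots,y_0,y_1,\dots$ as variables, \begin{align*} D_{0,0}&=z^{24},\\ D_{1,0}&=4048z^{15}x_0^9+61824z^{12}x_0^{12}+242880z^9x_0^{15}+198352z^6x_0^{18}+24288z^3x_0^{21}+48x_0^{24},\\ D_{1,1}&=-16192z^6x_0^9y_0^9+12144z^3x_0^9y_0^{12}+12144z^3x_0^{12}y_0^9-1104x_0^{12}y_0^{12},\\ D_{2,1}&=4048\cdot18\,x_0^9y_0^9\bigl(-x_1^2z^4+x_1^3z^3+x_1^5z-x_1^6-x_0^3z^3+3x_0^3x_1z^2-3x_0^3x_1^2z+x_0^3x_1^3-x_1^3y_0^3\bigr),\\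 D_{2,2}&=4048\cdot117\,x_0^9y_0^9\,(-x_1^3y_1^3),\\ D_{3,2}&=4048\cdot27\,x_0^9y_0^9\bigl(-6x_1^2y_1^2x_2z+6x_1^2y_1^2x_2^2-x_1^3y_1^3\bigr), \end{align*} and $D_{m,\ell}=0$ for all $m,\ell\ge1$ with $m+\ell\ge6$ (in particular $D_{3,3}=0$, $D_{4,3}=0$, $D_{4,4}=0$, and so on). These determine the symmetrized weight enumerator of every $C_m$. Namely, for every $m\ge0$, $A_{m,0}$ is the symmetrized weight enumerator of $C_m$, and \[A_{m,0}(x_0,\dots,x_{m-1};-;z)=\sum_{i=0}^{m}D_{i,0}(x_{m-i},\dots,x_{m-1};-;z);\] for every $m\ge1$, \[D_{m+1,0}(x_0,\dots,x_m;-;z)=\tfrac1{3^{12}}\bigl(D_{m,0}(3x_0,\dots,3x_{m-1};-;z+2x_m)+D_{m,1}(3x_0,\dots,3x_{m-1};z-x_m;z+2x_m)\bigr);\] and for all $m,\ell\ge1$, \[D_{m+1,\ell}(x_0,\dots,x_m;y_0,\dots,y_{\ell-1};z)=\tfrac1{3^{12}}D_{m,\ell+1}(3x_0,\dots,3x_{m-1};y_0,\dots,y_{\ell-1},z-x_m;z+2x_m).\]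 For example, modulo $9$, with $W(u;z)$ denoting the polynomial $D_{1,0}$ above with $x_0=u$, the symmetrized weight enumerator of $C_2$ is \[A_{2,0}(x_0,x_1;-;z)=\tfrac1{3^{12}}A_{1,1}(3x_0;z-x_1;z+2x_1),\qquad A_{1,1}(x_0;y_0;z)=z^{24}+W(x_0;z)+W(y_0;z)+D_{1,1}(x_0;y_0;z).\] -/

import Mathlib

open Polynomial

noncomputable section

/-- `g` is the monic polynomial over the `p`-adic integers whose roots are the powers `ζ ^ r`,
with `r` running over the nonzero squares modulo `q`, of a primitive `q`-th root of unity `ζ` in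
an algebraic closure of `ℚ_[p]`: a lift of the generator polynomial of a quadratic residue code
of length `q` over `ZMod p`. (Replacing `ζ` by `ζ ^ s`, `s` not a square, gives the second code.) -/
def IsQRGenerator (p : ℕ) [Fact p.Prime] (q : ℕ) (g : ℤ_[p][X]) : Prop :=
  open Classical in
  ∃ ζ : AlgebraicClosure ℚ_[p], IsPrimitiveRoot ζ q ∧
    g.map ((algebraMap ℚ_[p] (AlgebraicClosure ℚ_[p])).comp (algebraMap ℤ_[p] ℚ_[p])) =
      ∏ r ∈ (Finset.range q).filter
          (fun r : ℕ => ((r : ℕ) : ZMod q) ≠ 0 ∧ IsSquare ((r : ℕ) : ZMod q)),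
        (X - C (ζ ^ r))

/-- The polynomial `c_0 + c_1 X + ⋯ + c_{q-1} X ^ (q-1)` of a word, where the extra coordinate
`none` is ignored. -/
def wordPoly {R : Type*} [CommRing R] {q : ℕ} (c : Option (Fin q) → R) : R[X] :=
  ∑ i : Fin q, C (c (some i)) * X ^ (i : ℕ)

/-- The extended cyclic code of length `q + 1` modulo `p ^ m`: the words
`(c_0, …, c_{q-1}, c_∞)` such that `c_0 + c_1 X + ⋯ + c_{q-1} X ^ (q-1)` is a multiple of `g`
modulo `p ^ m` (for a divisor `g` of `X ^ q - 1` this is the cyclic code generated by `g`), and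
`c_∞ = lam * (c_0 + ⋯ + c_{q-1})`. Here `lam = -1` is the usual parity check, and
`lam ^ 2 = -1 / q` is the choice that makes extended quadratic residue codes self-dual. -/
def extCyclicCode (p : ℕ) [Fact p.Prime] (q : ℕ) (g : ℤ_[p][X]) (lam : ℤ_[p]) (m : ℕ) :
    Submodule (ZMod (p ^ m)) (Option (Fin q) → ZMod (p ^ m)) where
  carrier := {c | g.map (PadicInt.toZModPow m) ∣ wordPoly c ∧
    c none = PadicInt.toZModPow m lam * ∑ i : Fin q, c (some i)}
  zero_mem' := by simp [wordPoly]
  add_mem' := by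
    rintro a b ⟨ha, ha'⟩ ⟨hb, hb'⟩
    refine ⟨?_, ?_⟩
    · have h : wordPoly (a + b) = wordPoly a + wordPoly b := by
        simp [wordPoly, add_mul, Finset.sum_add_distrib]
      rw [h]
      exact dvd_add ha hb
    · simp [ha', hb', Finset.sum_add_distrib, mul_add]
  smul_mem' := by
    rintro t a ⟨ha, ha'⟩
    refine ⟨?_, ?_⟩
    · have h : wordPoly (t • a) = C t * wordPoly a := by
        simp [wordPoly, Finset.mul_sum, mul_assoc]
      rw [h]
      exact Dvd.dvd.mul_left ha _
    · simp only [Pi.smul_apply, smul_eq_mul, ha', ← Finset.mul_sum]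
      ring

/-- The dual code, for the standard inner product. -/
def dualCode {R : Type*} [CommRing R] {ι : Type*} [Fintype ι] (K : Submodule R (ι → R)) :
    Submodule R (ι → R) where
  carrier := {v | ∀ c ∈ K, ∑ i, c i * v i = 0}
  zero_mem' := by simp
  add_mem' := by
    intro a b ha hb c hc
    simp [mul_add, Finset.sum_add_distrib, ha c hc, hb c hc]
  smul_mem' := by
    intro t a ha c hc
    have h : ∑ i, c i * (t • a) i = t * ∑ i, c i * a i := by
      simp only [Pi.smul_apply, smul_eq_mul, Finset.mul_sum]
      exact Finset.sum_congr rfl fun i _ => by ring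
    rw [h, ha c hc, mul_zero]

/-- The variables of the weight enumerators: `x_0, x_1, …`, `y_0, y_1, …` and `z`. -/
inductive WVar where
  | x (i : ℕ)
  | y (j : ℕ)
  | z

/-- The variable that records one letter `a` modulo `p ^ m`: `z` if `a = 0`, and `w i` if `a ≠ 0`
has `p`-adic valuation `i`. -/
def letterVar (p m : ℕ) (w : ℕ → WVar) (a : ZMod (p ^ m)) : WVar :=
  open Classical in if a = 0 then WVar.z else w (padicValNat p a.val)

/-- The symmetrized weight enumerator of a code modulo `p ^ m`, in the variables `w 0`, `w 1`, …,
`w (m - 1)` and `z`: each codeword contributes the monomial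
`(w 0) ^ n_0 * ⋯ * (w (m - 1)) ^ n_{m-1} * z ^ n_∞`, where `n_i` is its number of coordinates
with valuation `i`. -/
def swe (p : ℕ) [Fact p.Prime] {ι : Type*} [Fintype ι] (m : ℕ) (w : ℕ → WVar)
    (K : Submodule (ZMod (p ^ m)) (ι → ZMod (p ^ m))) : MvPolynomial WVar ℚ :=
  open Classical in
  ∑ c : ι → ZMod (p ^ m) with c ∈ K, ∏ i, MvPolynomial.X (letterVar p m w (c i))

/-- The substitution `x_i ↦ p x_i`, `y_ℓ ↦ z - x_m`, `y_j ↦ y_j` for `j ≠ ℓ`,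
`z ↦ z + (p - 1) x_m`. -/
def upSubst (p m ℓ : ℕ) : WVar → MvPolynomial WVar ℚ
  | WVar.x i => MvPolynomial.C (p : ℚ) * MvPolynomial.X (WVar.x i)
  | WVar.y j =>
      if j = ℓ then MvPolynomial.X WVar.z - MvPolynomial.X (WVar.x m)
      else MvPolynomial.X (WVar.y j)
  | WVar.z => MvPolynomial.X WVar.z + MvPolynomial.C ((p : ℚ) - 1) * MvPolynomial.X (WVar.x m)

/-- The disjoint weight enumerators `A_{m,ℓ}` of a family of codes `K m` modulo `p ^ m`.
`A_{0,ℓ}` is the dual weight enumerator `A(-; y_0, …, y_{ℓ-1}; z)` of `K ℓ`, and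
`A_{m+1,ℓ}(x_0, …, x_m; y_0, …, y_{ℓ-1}; z)
  = |(K 1)^⊥|⁻¹ A_{m,ℓ+1}(p x_0, …, p x_{m-1}; y_0, …, y_{ℓ-1}, z - x_m; z + (p - 1) x_m)`. -/
def disjointWE (p : ℕ) [Fact p.Prime] {ι : Type*} [Fintype ι]
    (K : (m : ℕ) → Submodule (ZMod (p ^ m)) (ι → ZMod (p ^ m))) :
    ℕ → ℕ → MvPolynomial WVar ℚ
  | 0, ℓ => swe p ℓ WVar.y (dualCode (K ℓ))
  | m + 1, ℓ =>
      MvPolynomial.C ((Nat.card (dualCode (K 1)) : ℚ)⁻¹) *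
        MvPolynomial.aeval (upSubst p m ℓ) (disjointWE p K m (ℓ + 1))

/-- The partial weight enumerator `D_{m,ℓ}`: the part of `A_{m,ℓ}` made of the monomials that are
divisible by `x_0` (if `m > 0`, so that the variable `x_0` is there) and by `y_0` (if `ℓ > 0`). -/
def partialWE (p : ℕ) [Fact p.Prime] {ι : Type*} [Fintype ι]
    (K : (m : ℕ) → Submodule (ZMod (p ^ m)) (ι → ZMod (p ^ m))) (m ℓ : ℕ) :
    MvPolynomial WVar ℚ :=
  ∑ s ∈ (disjointWE p K m ℓ).support with
      (m = 0 ∨ s (WVar.x 0) ≠ 0) ∧ (ℓ = 0 ∨ s (WVar.y 0) ≠ 0),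
    MvPolynomial.monomial s ((disjointWE p K m ℓ).coeff s)

/-- The renaming `x_i ↦ x_{i + k}`. -/
def shiftX (k : ℕ) : WVar → WVar
  | WVar.x i => WVar.x (i + k)
  | WVar.y j => WVar.y j
  | WVar.z => WVar.z

end

/-!
# Symmetrized weight enumerators of the lifted quadratic residue codes of length 24

*Self-dual towers.* Write `g = genPoly θ`, where `θ ^ 2 + θ + 6 = 0` in the `3`-adic integers
(`exists_eq_genPoly`). After a monomial change of coordinates, which does not affect weight
enumerators, the lifted codes are the row spaces `qrTower θ m` of one matrix with mutually
orthogonal rows (`exists_qrTower`). They are self-dual, and each is the reduction of the next ones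
(`SelfDualTower`).

*The disjoint weight enumerators as sums over pairs.* For such a tower, the recursion that defines
`A_{m,ℓ}` is a Fourier transform letter by letter, and orthogonality of characters turns `A_{m,ℓ}`
into a sum over the pairs of words `c` modulo `3 ^ m` and `d` modulo `3 ^ ℓ` of the codes that have
disjoint supports. The pair has the monomial of its letters, and its weight is a character of order
`3 ^ (m + ℓ)` evaluated at the inner product `s` of `c` with a lift of `d`. Averaged over
multiplications by units, the weight is `1` if `s = 0`, `-1 / 2` if `3 s = 0 ≠ s`, and `0` otherwise
(`SelfDualTower.disjointWE_eq_sum_pairs`, `avgPsi`). In these terms `D_{m,ℓ}` collects the pairs of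
words that are nonzero modulo three. The formal relations of the theorem follow: the recursions, the
symmetry under exchange of the words, and the sum formula, since a word either has a unit entry or
is three times a word of the previous code.

*The code modulo three.* Self-duality makes all weights divisible by three, a search shows that the
minimum weight is nine, and the MacWilliams identity then gives the weight distribution
(`wtCount_eq`). The two words of a pair in `D_{m,ℓ}` hence have `(9, 9)`, `(9, 12)`, `(9, 15)`,
`(12, 9)`, `(12, 12)` or `(15, 9)` unit entries (`partialWE_eq_six`).

*Pairs with a word of weight nine.* The change of all signs and the signed permutations that come
from the affine maps with square slope and from the inversion of the projective line over the field
with `23` elements preserve the codes modulo `3 ^ 5` and below, and the `4048` words of weight nine form one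
orbit (`weightSum_nine`). So it is enough to consider the pairs over one word `r` of weight nine,
and, up to units, those which are normalized to have certain entries equal to one. They are
enumerated modulo `(3, 3)`, `(9, 3)`, `(9, 9)`, `(27, 9)` and `(27, 27)` by lifting one digit at a
time: the new digits of a word form an affine space over the field with three elements, cut out by
the vanishing on the support of the other word. The programs for this work on words packed into
natural numbers, they are proved to enumerate what they should (`Enumerates`), and they are
evaluated by the kernel (`tallies_correct`). The resulting tallies of monomials and weights are the
coefficients of the theorem.

*Pairs of words of weight twelve.* They add up to one of the `48` words of weight `24`, which also
form one orbit, so that it is enough to decompose one such word. All inner products are nonzero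
modulo nine: only `D_{1,1}` has a term of this kind (`partWE_twelve_one_one`,
`partWE_twelve_eq_zero`).

*Vanishing.* If the inner product of a pair does not vanish at some level, then all pairs above it,
at higher levels, have weight zero (`pairWt_eq_zero_of_redMod`). Every normalized pair modulo `(27,
9)` which lifts to a pair modulo `(27, 27)` has nonzero inner product modulo `3 ^ 5`. Hence `D_{m,ℓ}
= 0` for `m, ℓ ≥ 3`, and the recursion and the symmetry extend this to `m + ℓ ≥ 6`.
-/

set_option linter.unusedSectionVars false

/-! ### Letters modulo prime powers and the iterated substitution -/

/-- The variable that records the residue class of `n` modulo a power of `p`, for a natural number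
`n` below that power. -/
noncomputable def natVar (p : ℕ) (w : ℕ → WVar) (n : ℕ) : WVar :=
  if n = 0 then WVar.z else w (padicValNat p n)

theorem letterVar_eq_natVar (p m : ℕ) [NeZero (p ^ m)] (w : ℕ → WVar) (a : ZMod (p ^ m)) :
    letterVar p m w a = natVar p w a.val := by
  unfold letterVar natVar
  by_cases h : a = 0
  · simp [h]
  · simp [h, ZMod.val_eq_zero]

theorem padicValNat_congr {p : ℕ} [hp : Fact p.Prime] {a b : ℕ} (ha : a ≠ 0) (hb : b ≠ 0)
    (h : ∀ k, p ^ k ∣ a ↔ p ^ k ∣ b) : padicValNat p a = padicValNat p b := by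
  apply le_antisymm
  · exact (padicValNat_dvd_iff_le hb).1 ((h _).1 pow_padicValNat_dvd)
  · exact (padicValNat_dvd_iff_le ha).1 ((h _).2 pow_padicValNat_dvd)

theorem padicValNat_of_modEq {p : ℕ} [hp : Fact p.Prime] {m a b : ℕ} (hab : a ≡ b [MOD p ^ m])
    (ha : ¬ p ^ m ∣ a) : padicValNat p a = padicValNat p b := by
  have hb : ¬ p ^ m ∣ b := fun h => ha ((hab.dvd_iff dvd_rfl).2 h)
  refine padicValNat_congr (fun h => ha (h ▸ dvd_zero _)) (fun h => hb (h ▸ dvd_zero _)) fun k => ?_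
  rcases le_total k m with hk | hk
  · exact hab.dvd_iff (pow_dvd_pow p hk)
  · exact ⟨fun h => absurd ((pow_dvd_pow p hk).trans h) ha,
      fun h => absurd ((pow_dvd_pow p hk).trans h) hb⟩

theorem padicValNat_eq_of_lt_pow {p : ℕ} [hp : Fact p.Prime] {ℓ n : ℕ} (hn : p ^ ℓ ∣ n)
    (hn' : ¬ p ^ (ℓ + 1) ∣ n) : padicValNat p n = ℓ := by
  have h0 : n ≠ 0 := fun h => hn' (h ▸ dvd_zero _)
  have h1 := (padicValNat_dvd_iff_le h0).1 hn
  have h2 : ¬ ℓ + 1 ≤ padicValNat p n := fun h => hn' ((padicValNat_dvd_iff_le h0).2 h)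
  omega

theorem sum_range_mul_add {M : Type*} [AddCommMonoid M] (m n : ℕ) (f : ℕ → M) :
    ∑ a ∈ Finset.range (m * n), f a
      = ∑ a ∈ Finset.range m, ∑ t ∈ Finset.range n, f (a + m * t) := by
  rw [Finset.sum_comm]
  induction n with
  | zero => simp
  | succ k ih =>
    rw [Finset.sum_range_succ, ← ih, Nat.mul_succ, Finset.sum_range_add]
    simp [add_comm]

/-- The image of the letter `n` under the substitutions that turn `A_{0, m + ℓ}` into
`A_{m, ℓ}`. -/
noncomputable def tau (p : ℕ) : ℕ → ℕ → ℕ → MvPolynomial WVar ℚ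
  | 0, _, n => MvPolynomial.X (natVar p WVar.y n)
  | m + 1, ℓ, n => MvPolynomial.aeval (upSubst p m ℓ) (tau p m (ℓ + 1) n)

/-- A primitive `p ^ N`-th root of unity. -/
noncomputable def zetaPow (p N : ℕ) : ℂ := Complex.exp (2 * Real.pi * Complex.I / (p ^ N : ℕ))

theorem zetaPow_primitive (p N : ℕ) [hp : Fact p.Prime] :
    IsPrimitiveRoot (zetaPow p N) (p ^ N) :=
  Complex.isPrimitiveRoot_exp _ (pow_ne_zero _ hp.out.ne_zero)

theorem map_aeval_upSubst (p m ℓ : ℕ) (f : MvPolynomial WVar ℚ) :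
    MvPolynomial.map (algebraMap ℚ ℂ) (MvPolynomial.aeval (upSubst p m ℓ) f)
      = MvPolynomial.aeval (fun v => MvPolynomial.map (algebraMap ℚ ℂ) (upSubst p m ℓ v))
          (MvPolynomial.map (algebraMap ℚ ℂ) f) := by
  induction f using MvPolynomial.induction_on with
  | C a => simp [MvPolynomial.algebraMap_eq]
  | add f g hf hg => simp only [map_add, hf, hg]
  | mul_X f i hf => simp only [map_mul, hf, MvPolynomial.aeval_X, MvPolynomial.map_X]

/-- A letter is transformed by a Fourier transform over `ZMod (p ^ m)` if it is divisible by
`p ^ ℓ`, and is kept otherwise. -/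
theorem map_tau (p : ℕ) [hp : Fact p.Prime] (m ℓ n : ℕ) (hn : n < p ^ (m + ℓ)) :
    MvPolynomial.map (algebraMap ℚ ℂ) (tau p m ℓ n) =
      if p ^ ℓ ∣ n then ∑ a ∈ Finset.range (p ^ m), MvPolynomial.C (zetaPow p (m + ℓ) ^ (a * n)) *
        MvPolynomial.X (natVar p WVar.x a)
      else MvPolynomial.X (natVar p WVar.y n) := by
  have hp0 : p ≠ 0 := hp.out.ne_zero
  induction m generalizing ℓ with
  | zero =>
    simp only [tau, MvPolynomial.map_X, zero_add] at hn ⊢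
    split_ifs with h
    · have : n = 0 := Nat.eq_zero_of_dvd_of_lt h hn
      simp [this, natVar]
    · rfl
  | succ m ih =>
    have hN : m + 1 + ℓ = m + (ℓ + 1) := by omega
    rw [hN] at hn ⊢
    have hprim := zetaPow_primitive p (m + (ℓ + 1))
    set ζ := zetaPow p (m + (ℓ + 1)) with hζ
    rw [tau, map_aeval_upSubst, ih (ℓ + 1) hn]
    have hval : ∀ a ∈ Finset.range (p ^ m), a ≠ 0 → ∀ t,
        natVar p WVar.x (a + p ^ m * t) = natVar p WVar.x a := by
      intro a ha h0 t
      have hlt := Finset.mem_range.1 ha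
      simp only [natVar, h0, if_false, Nat.add_eq_zero_iff, false_and]
      congr 1
      refine (padicValNat_of_modEq (m := m) ?_ fun h => h0 (Nat.eq_zero_of_dvd_of_lt h hlt)).symm
      simp [Nat.ModEq]
    have hval0 : ∀ t ∈ Finset.range p, t ≠ 0 → natVar p WVar.x (0 + p ^ m * t) = WVar.x m := by
      intro t ht h0
      have : p ^ m * t ≠ 0 := mul_ne_zero (pow_ne_zero _ hp0) h0
      simp only [zero_add, natVar, this, if_false]
      congr 1
      refine padicValNat_eq_of_lt_pow (dvd_mul_right _ _) fun h => h0 ?_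
      rw [pow_succ] at h
      exact Nat.eq_zero_of_dvd_of_lt (Nat.dvd_of_mul_dvd_mul_left (by positivity) h)
        (Finset.mem_range.1 ht)
    have hsplit : ∀ {M : Type} [AddCommMonoid M] (F : ℕ → M), ∑ t ∈ Finset.range p, F t
        = ∑ t ∈ Finset.range (p - 1), F (t + 1) + F 0 := by
      intro M _ F
      conv_lhs => rw [← Nat.succ_pred hp0]
      exact Finset.sum_range_succ' _ _
    by_cases h1 : p ^ (ℓ + 1) ∣ n
    · have h2 : p ^ ℓ ∣ n := (pow_dvd_pow p (Nat.le_succ ℓ)).trans h1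
      rw [if_pos h1, if_pos h2, pow_succ, sum_range_mul_add, map_sum]
      refine Finset.sum_congr rfl fun a ha => ?_
      have hper : ∀ t, ζ ^ ((a + p ^ m * t) * n) = ζ ^ (a * n) := by
        intro t
        obtain ⟨k, rfl⟩ := h1
        rw [add_mul, pow_add, show p ^ m * t * (p ^ (ℓ + 1) * k) = p ^ (m + (ℓ + 1)) * (t * k) by
          rw [pow_add]; ring, pow_mul ζ (p ^ (m + (ℓ + 1))), hprim.pow_eq_one, one_pow, mul_one]
      simp only [hper, map_mul, MvPolynomial.aeval_X, MvPolynomial.aeval_C,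
        MvPolynomial.algebraMap_eq, ← Finset.mul_sum]
      congr 1
      by_cases ha0 : a = 0
      · subst ha0
        rw [hsplit, Finset.sum_congr rfl (g := fun _ => MvPolynomial.X (R := ℂ) (WVar.x m))]
        · simp [natVar, upSubst, Nat.cast_pred (Nat.pos_of_ne_zero hp0), add_comm]
        · intro t ht
          rw [hval0 (t + 1) (by simp at ht ⊢; omega) (by omega)]
      · rw [Finset.sum_congr rfl fun t _ => by rw [hval a ha ha0 t]]
        simp [natVar, ha0, upSubst]
    · rw [if_neg h1]
      have hn0 : n ≠ 0 := fun h => h1 (h ▸ dvd_zero _)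
      rw [MvPolynomial.aeval_X]
      by_cases h2 : p ^ ℓ ∣ n
      · rw [if_pos h2, pow_succ, sum_range_mul_add]
        have hv := padicValNat_eq_of_lt_pow h2 h1
        set ω := ζ ^ (p ^ m * n) with hω
        have hω1 : ω ≠ 1 := by
          intro h
          have := (hprim.pow_eq_one_iff_dvd _).1 h
          rw [pow_add] at this
          exact h1 (Nat.dvd_of_mul_dvd_mul_left (by positivity) this)
        have hωp : ω ^ p = 1 := by
          rw [hω, ← pow_mul, hprim.pow_eq_one_iff_dvd]
          obtain ⟨k, rfl⟩ := h2
          exact ⟨k, by rw [pow_add, pow_succ]; ring⟩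
        have hsum : ∑ t ∈ Finset.range p, ω ^ t = 0 := by
          have := mul_geom_sum ω p
          rw [hωp, sub_self] at this
          exact (mul_eq_zero.1 this).resolve_left (sub_ne_zero.2 hω1)
        have hper : ∀ a t, ζ ^ ((a + p ^ m * t) * n) = ζ ^ (a * n) * ω ^ t := by
          intro a t
          rw [hω, ← pow_mul, ← pow_add]
          congr 1; ring
        simp only [hper]
        rw [Finset.sum_eq_single 0]
        · rw [hsplit] at hsum ⊢
          rw [Finset.sum_congr rfl (g := fun t => MvPolynomial.C (ω ^ (t + 1)) *
            MvPolynomial.X (R := ℂ) (WVar.x m)), ← Finset.sum_mul, ← map_sum,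
            eq_neg_of_add_eq_zero_left hsum]
          · simp [natVar, hn0, hv, upSubst]
            ring
          · intro t ht
            rw [hval0 (t + 1) (by simp at ht ⊢; omega) (by omega)]
            simp
        · intro a ha ha0
          rw [Finset.sum_congr rfl fun t _ => by rw [hval a ha ha0 t], ← Finset.sum_mul, ← map_sum,
            ← Finset.mul_sum, hsum]
          simp
        · intro h
          exact absurd (Finset.mem_range.2 (by positivity)) h
      · rw [if_neg h2]
        have : padicValNat p n ≠ ℓ := fun h => h2 (h ▸ pow_padicValNat_dvd)
        simp [natVar, hn0, upSubst, this]

/-! ### Arithmetic of reductions modulo prime powers -/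

/-- Reduction modulo a smaller power of `p`. -/
def redMod (p : ℕ) {m N : ℕ} (h : m ≤ N) : ZMod (p ^ N) →+* ZMod (p ^ m) :=
  ZMod.castHom (pow_dvd_pow p h) _

/-- Multiplication by `p ^ (N - m)`, as a map from residues modulo `p ^ m` to residues modulo
`p ^ N`. -/
def embMod (p : ℕ) {m : ℕ} (N : ℕ) (x : ZMod (p ^ m)) : ZMod (p ^ N) :=
  (p : ZMod (p ^ N)) ^ (N - m) * (x.val : ZMod (p ^ N))

theorem embMod_zero (p m N : ℕ) : embMod p N (0 : ZMod (p ^ m)) = 0 := by simp [embMod]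

section Arith

variable {p : ℕ} [hp : Fact p.Prime] {m ℓ N : ℕ}

theorem redMod_eq_natCast (h : m ≤ N) (x : ZMod (p ^ N)) :
    redMod p h x = (x.val : ZMod (p ^ m)) := by
  conv_lhs => rw [← ZMod.natCast_zmod_val x]
  exact map_natCast _ _

theorem redMod_eq_zero_iff (h : m ≤ N) (x : ZMod (p ^ N)) : redMod p h x = 0 ↔ p ^ m ∣ x.val := by
  rw [redMod_eq_natCast, ZMod.natCast_eq_zero_iff]

theorem redMod_natCast_val (h : m ≤ N) (x : ZMod (p ^ m)) :
    redMod p h (x.val : ZMod (p ^ N)) = x := by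
  rw [map_natCast, ZMod.natCast_zmod_val]

theorem redMod_redMod {k : ℕ} (h : m ≤ N) (h' : k ≤ m) (x : ZMod (p ^ N)) :
    redMod p h' (redMod p h x) = redMod p (h'.trans h) x := by
  rw [← ZMod.natCast_zmod_val x]
  simp only [map_natCast]

theorem mul_eq_zero_of_redMod (hN : N = m + ℓ) {x y : ZMod (p ^ N)}
    (hx : redMod p (show m ≤ N by omega) x = 0) (hy : redMod p (show ℓ ≤ N by omega) y = 0) :
    x * y = 0 := by
  rw [redMod_eq_zero_iff] at hx hy
  rw [← ZMod.natCast_zmod_val x, ← ZMod.natCast_zmod_val y, ← Nat.cast_mul,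
    ZMod.natCast_eq_zero_iff]
  generalize x.val = a at *
  generalize y.val = b at *
  rw [hN, pow_add]
  exact mul_dvd_mul hx hy

theorem pow_mul_eq_zero_iff (h : m ≤ N) (x : ZMod (p ^ N)) :
    (p : ZMod (p ^ N)) ^ (N - m) * x = 0 ↔ redMod p h x = 0 := by
  obtain ⟨ℓ, rfl⟩ := Nat.exists_eq_add_of_le h
  rw [redMod_eq_zero_iff]
  conv_lhs => rw [← ZMod.natCast_zmod_val x]
  rw [← Nat.cast_pow, ← Nat.cast_mul, ZMod.natCast_eq_zero_iff]
  generalize x.val = a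
  rw [add_comm m ℓ, Nat.add_sub_cancel, pow_add]
  exact Nat.mul_dvd_mul_iff_left (pow_pos hp.out.pos _)

theorem embMod_redMod (h : m ≤ N) (y : ZMod (p ^ N)) :
    embMod p N (redMod p h y) = (p : ZMod (p ^ N)) ^ (N - m) * y := by
  rw [embMod, ← sub_eq_zero, ← mul_sub, pow_mul_eq_zero_iff h, map_sub, redMod_natCast_val,
    sub_self]

theorem embMod_add (h : m ≤ N) (x y : ZMod (p ^ m)) :
    embMod p N (x + y) = embMod p N x + embMod p N y := by
  rw [← redMod_natCast_val h x, ← redMod_natCast_val h y, ← map_add]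
  simp only [embMod_redMod, mul_add]

theorem embMod_eq_zero_iff (h : m ≤ N) (x : ZMod (p ^ m)) : embMod p N x = 0 ↔ x = 0 := by
  rw [embMod, pow_mul_eq_zero_iff h, redMod_natCast_val]

theorem redMod_embMod (hN : N = m + ℓ) (x : ZMod (p ^ m)) :
    redMod p (show ℓ ≤ N by omega) (embMod p N x) = 0 := by
  subst hN
  rw [redMod_eq_natCast, embMod, ← redMod_eq_natCast (by omega : ℓ ≤ m + ℓ), map_mul, map_pow,
    map_natCast, Nat.add_sub_cancel_left, ← Nat.cast_pow, ZMod.natCast_self, zero_mul]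

theorem exists_embMod (hN : N = m + ℓ) {y : ZMod (p ^ N)}
    (hy : redMod p (show ℓ ≤ N by omega) y = 0) : ∃ x : ZMod (p ^ m), embMod p N x = y := by
  rw [redMod_eq_zero_iff] at hy
  obtain ⟨k, hk⟩ := hy
  refine ⟨redMod p (by omega) (k : ZMod (p ^ N)), ?_⟩
  rw [embMod_redMod, ← ZMod.natCast_zmod_val y, hk, hN, Nat.add_sub_cancel_left]
  push_cast
  rfl

theorem embMod_injective (h : m ≤ N) : Function.Injective (embMod p N : ZMod (p ^ m) → _) := by
  intro x y hxy
  have : embMod p N (x - y) + embMod p N y = embMod p N x := by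
    rw [← embMod_add h, sub_add_cancel]
  rw [hxy] at this
  have h0 := (embMod_eq_zero_iff h _).1 (add_eq_right.1 this)
  exact sub_eq_zero.1 h0

end Arith

/-! ### Towers of self-dual codes -/

/-- A family of self-dual codes modulo the powers of `p`, each of which is the reduction of the
next ones. -/
structure SelfDualTower (p : ℕ) [Fact p.Prime] {ι : Type*} [Fintype ι]
    (K : (m : ℕ) → Submodule (ZMod (p ^ m)) (ι → ZMod (p ^ m))) : Prop where
  dual : ∀ m, dualCode (K m) = K m
  red : ∀ {m N : ℕ} (h : m ≤ N) (c), c ∈ K N → (fun i => redMod p h (c i)) ∈ K m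
  lift : ∀ {m N : ℕ} (h : m ≤ N) (c), c ∈ K m → ∃ C ∈ K N, (fun i => redMod p h (C i)) = c

section Tower

variable {p : ℕ} [hp : Fact p.Prime] {ι : Type*} [Fintype ι]
  {K : (m : ℕ) → Submodule (ZMod (p ^ m)) (ι → ZMod (p ^ m))}

open Classical in
/-- A word of `K N` that reduces to the word `d` of `K ℓ`. -/
noncomputable def liftWord (K : (m : ℕ) → Submodule (ZMod (p ^ m)) (ι → ZMod (p ^ m)))
    {ℓ : ℕ} (N : ℕ) (d : ι → ZMod (p ^ ℓ)) : ι → ZMod (p ^ N) :=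
  if h : ∃ hN : ℓ ≤ N, ∃ C ∈ K N, (fun i => redMod p hN (C i)) = d then h.choose_spec.choose else 0

theorem SelfDualTower.liftWord_mem (hK : SelfDualTower p K) {ℓ N : ℕ} (h : ℓ ≤ N)
    {d : ι → ZMod (p ^ ℓ)} (hd : d ∈ K ℓ) : liftWord K N d ∈ K N := by
  have : ∃ hN : ℓ ≤ N, ∃ C ∈ K N, (fun i => redMod p hN (C i)) = d := ⟨h, hK.lift h d hd⟩
  rw [liftWord, dif_pos this]
  exact this.choose_spec.choose_spec.1

theorem SelfDualTower.redMod_liftWord (hK : SelfDualTower p K) {ℓ N : ℕ} (h : ℓ ≤ N)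
    {d : ι → ZMod (p ^ ℓ)} (hd : d ∈ K ℓ) (i : ι) : redMod p h (liftWord K N d i) = d i := by
  have : ∃ hN : ℓ ≤ N, ∃ C ∈ K N, (fun i => redMod p hN (C i)) = d := ⟨h, hK.lift h d hd⟩
  rw [liftWord, dif_pos this]
  exact congrFun this.choose_spec.choose_spec.2 i

/-- The inner product of a word modulo `p ^ m`, with each residue represented by a natural number,
and a word modulo `p ^ N`. -/
def pairing {m N : ℕ} (c : ι → ZMod (p ^ m)) (D : ι → ZMod (p ^ N)) : ZMod (p ^ N) :=
  ∑ i, ((c i).val : ZMod (p ^ N)) * D i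

theorem SelfDualTower.mem_iff (hK : SelfDualTower p K) {m : ℕ} (v : ι → ZMod (p ^ m)) :
    v ∈ K m ↔ ∀ c ∈ K m, ∑ i, c i * v i = 0 := by
  conv_lhs => rw [← hK.dual m]
  exact Iff.rfl

theorem SelfDualTower.embMod_mem (hK : SelfDualTower p K) {m N : ℕ} (h : m ≤ N)
    {e : ι → ZMod (p ^ m)} (he : e ∈ K m) : (fun i => embMod p N (e i)) ∈ K N := by
  obtain ⟨E, hE, rfl⟩ := hK.lift h e he
  simp only [embMod_redMod]
  exact (K N).smul_mem ((p : ZMod (p ^ N)) ^ (N - m)) hE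

theorem SelfDualTower.exists_embMod (hK : SelfDualTower p K) {m ℓ N : ℕ} (hN : N = m + ℓ)
    {d : ι → ZMod (p ^ N)} (hd : d ∈ K N) (h0 : ∀ i, redMod p (show ℓ ≤ N by omega) (d i) = 0) :
    ∃ e ∈ K m, (fun i => embMod p N (e i)) = d := by
  have hm : m ≤ N := by omega
  choose e he using fun i => _root_.exists_embMod hN (h0 i)
  refine ⟨e, ?_, funext he⟩
  rw [hK.mem_iff]
  intro c hc
  obtain ⟨C, hC, rfl⟩ := hK.lift hm c hc
  have := (hK.mem_iff d).1 hd C hC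
  have h2 : (p : ZMod (p ^ N)) ^ (N - m) * ∑ i, C i * ((e i).val : ZMod (p ^ N)) = 0 := by
    rw [← this, Finset.mul_sum]
    refine Finset.sum_congr rfl fun i _ => ?_
    rw [← he i, embMod]
    ring
  rw [pow_mul_eq_zero_iff hm, map_sum] at h2
  rw [← h2]
  refine Finset.sum_congr rfl fun i _ => ?_
  rw [map_mul, redMod_natCast_val]

open Classical in
/-- The words of `K N` that reduce to a given word of `K ℓ` are a coset of a copy of `K m`, where
`N = m + ℓ`. -/
theorem SelfDualTower.sum_fiber (hK : SelfDualTower p K) {m ℓ N : ℕ} (hN : N = m + ℓ)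
    {M : Type*} [AddCommMonoid M] (F : (ι → ZMod (p ^ N)) → M) {D : ι → ZMod (p ^ N)}
    (hD : D ∈ K N) {b : ι → ZMod (p ^ ℓ)}
    (hDb : ∀ i, redMod p (show ℓ ≤ N by omega) (D i) = b i) :
    ∑ d : ι → ZMod (p ^ N) with
        d ∈ K N ∧ (fun i => redMod p (show ℓ ≤ N by omega) (d i)) = b, F d
      = ∑ e : ι → ZMod (p ^ m) with e ∈ K m, F (fun i => D i + embMod p N (e i)) := by
  have hm : m ≤ N := by omega
  symm
  refine Finset.sum_bij (fun e _ => fun i => D i + embMod p N (e i)) ?_ ?_ ?_ fun _ _ => rfl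
  · intro e he
    simp only [Finset.mem_filter, Finset.mem_univ, true_and] at he ⊢
    refine ⟨(K N).add_mem hD (hK.embMod_mem hm he), funext fun i => ?_⟩
    rw [map_add, redMod_embMod hN, add_zero, hDb]
  · intro e _ e' _ h
    funext i
    exact embMod_injective hm (add_left_cancel (congrFun h i))
  · intro d hd
    simp only [Finset.mem_filter, Finset.mem_univ, true_and] at hd
    obtain ⟨e, he, hed⟩ := hK.exists_embMod hN ((K N).sub_mem hd.1 hD) (fun i => by
      rw [Pi.sub_apply, map_sub, hDb, congrFun hd.2 i, sub_self])
    refine ⟨e, by simpa using he, funext fun i => ?_⟩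
    rw [congrFun hed i, Pi.sub_apply, add_sub_cancel]

theorem SelfDualTower.card_eq (hK : SelfDualTower p K) (m : ℕ) :
    Nat.card (K m) = Nat.card (K 1) ^ m := by
  classical
  have hcard : ∀ m, Nat.card (K m) = ∑ d : ι → ZMod (p ^ m) with d ∈ K m, 1 := by
    intro m
    rw [Finset.sum_const, smul_eq_mul, mul_one, Nat.card_eq_fintype_card, Fintype.card_subtype]
  induction m with
  | zero =>
    rw [pow_zero (Nat.card (K 1)), Nat.card_eq_one_iff_unique]
    have : Subsingleton (ZMod (p ^ 0)) := by rw [pow_zero]; infer_instance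
    exact ⟨⟨fun a b => Subtype.ext (funext fun i => Subsingleton.elim _ _)⟩, ⟨0⟩⟩
  | succ m ih =>
    rw [hcard, ← Finset.sum_fiberwise_of_maps_to
      (g := fun d => fun i => redMod p (Nat.le_succ m) (d i))
      (t := Finset.univ.filter fun c : ι → ZMod (p ^ m) => c ∈ K m)]
    · rw [Finset.sum_congr rfl (g := fun _ => Nat.card (K 1)), Finset.sum_const, smul_eq_mul,
        pow_succ (Nat.card (K 1)), ← ih, Nat.card_eq_fintype_card (α := K m), Fintype.card_subtype]
      intro c hc
      simp only [Finset.mem_filter, Finset.mem_univ, true_and] at hc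
      obtain ⟨D, hD, hDc⟩ := hK.lift (Nat.le_succ m) c hc
      rw [Finset.filter_filter, hK.sum_fiber (m := 1) (by omega) (fun _ => 1) hD (congrFun hDc),
        hcard]
    · intro d hd
      simp only [Finset.mem_filter, Finset.mem_univ, true_and] at hd ⊢
      exact hK.red _ d hd

theorem pairing_add {m N : ℕ} (c : ι → ZMod (p ^ m)) (D E : ι → ZMod (p ^ N)) :
    pairing c (fun i => D i + E i) = pairing c D + pairing c E := by
  simp [pairing, mul_add, Finset.sum_add_distrib]

theorem pairing_embMod_eq_zero_iff {m N : ℕ} (h : m ≤ N) (c e : ι → ZMod (p ^ m)) :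
    pairing c (fun i => embMod p N (e i)) = 0 ↔ ∑ i, e i * c i = 0 := by
  have : pairing c (fun i => embMod p N (e i))
      = (p : ZMod (p ^ N)) ^ (N - m) * ∑ i, ((e i).val : ZMod (p ^ N)) * ((c i).val) := by
    rw [pairing, Finset.mul_sum]
    exact Finset.sum_congr rfl fun i _ => by rw [embMod]; ring
  rw [this, pow_mul_eq_zero_iff h, map_sum]
  simp only [map_mul, redMod_natCast_val]

/-- The pairing of a word of `K m` with a word of `K (m + ℓ)` only depends on the latter modulo
`p ^ ℓ`. -/
theorem SelfDualTower.pairing_congr (hK : SelfDualTower p K) {m ℓ N : ℕ} (hN : N = m + ℓ)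
    {c : ι → ZMod (p ^ m)} (hc : c ∈ K m) {D E : ι → ZMod (p ^ N)} (hD : D ∈ K N) (hE : E ∈ K N)
    (h : ∀ i, redMod p (show ℓ ≤ N by omega) (D i) = redMod p (show ℓ ≤ N by omega) (E i)) :
    pairing c D = pairing c E := by
  obtain ⟨e, he, hed⟩ := hK.exists_embMod hN ((K N).sub_mem hD hE) (fun i => by
      rw [Pi.sub_apply, map_sub, h, sub_self])
  have h1 : D = fun i => E i + embMod p N (e i) := by
    funext i
    rw [congrFun hed i, Pi.sub_apply, add_sub_cancel]
  rw [h1, pairing_add, (pairing_embMod_eq_zero_iff (by omega) c e).2 ((hK.mem_iff c).1 hc e he),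
    add_zero]

end Tower

/-! ### Disjoint weight enumerators as sums over pairs of words with disjoint supports -/

theorem addChar_sum {A R ι : Type*} [AddCommMonoid A] [CommMonoid R] (χ : AddChar A R)
    (s : Finset ι) (f : ι → A) : χ (∑ i ∈ s, f i) = ∏ i ∈ s, χ (f i) := by
  classical
  induction s using Finset.induction_on with
  | empty => simp [AddChar.map_zero_eq_one]
  | insert a s ha ih => rw [Finset.sum_insert ha, Finset.prod_insert ha, AddChar.map_add_eq_mul, ih]

theorem sum_range_eq_sum_zmod {M : Type*} [AddCommMonoid M] (n : ℕ) [NeZero n] (f : ℕ → M) :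
    ∑ a ∈ Finset.range n, f a = ∑ a : ZMod n, f a.val := by
  symm
  refine Finset.sum_bij (fun a _ => a.val) (fun a _ => Finset.mem_range.2 (ZMod.val_lt a))
    (fun a _ b _ h => ZMod.val_injective n h) (fun b hb => ⟨(b : ZMod n), Finset.mem_univ _, ?_⟩)
    fun _ _ => rfl
  exact ZMod.val_cast_of_lt (Finset.mem_range.1 hb)

/-- The words `c` and `d` have disjoint supports. -/
def DisjSupp {p : ℕ} {ι : Type*} {m ℓ : ℕ} (c : ι → ZMod (p ^ m)) (d : ι → ZMod (p ^ ℓ)) : Prop :=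
  ∀ i, c i = 0 ∨ d i = 0

theorem DisjSupp.symm {p : ℕ} {ι : Type*} {m ℓ : ℕ} {c : ι → ZMod (p ^ m)} {d : ι → ZMod (p ^ ℓ)}
    (h : DisjSupp c d) : DisjSupp d c := fun i => (h i).symm

section Pairs

variable {p : ℕ} [hp : Fact p.Prime] {ι : Type*} [Fintype ι]
  {K : (m : ℕ) → Submodule (ZMod (p ^ m)) (ι → ZMod (p ^ m))}

open Classical in
/-- The variable that records a pair of letters, at most one of which is nonzero. -/
noncomputable def pairVar (p : ℕ) {m ℓ : ℕ} (a : ZMod (p ^ m)) (b : ZMod (p ^ ℓ)) : WVar :=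
  if a = 0 then natVar p WVar.y b.val else WVar.x (padicValNat p a.val)

/-- The monomial of a pair of words with disjoint supports. -/
noncomputable def pairMon (R : Type*) [CommSemiring R] (p : ℕ) {ι : Type*} [Fintype ι] {m ℓ : ℕ}
    (c : ι → ZMod (p ^ m)) (d : ι → ZMod (p ^ ℓ)) : MvPolynomial WVar R :=
  ∏ i, MvPolynomial.X (pairVar p (c i) (d i))

/-- The additive character of `ZMod (p ^ N)` given by a primitive root of unity. -/
noncomputable def psi (p N : ℕ) [Fact p.Prime] : AddChar (ZMod (p ^ N)) ℂ :=
  AddChar.zmodChar (p ^ N) (zetaPow_primitive p N).pow_eq_one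

theorem psi_eq_one_iff (N : ℕ) (s : ZMod (p ^ N)) : psi p N s = 1 ↔ s = 0 := by
  rw [psi, AddChar.zmodChar_apply, (zetaPow_primitive p N).pow_eq_one_iff_dvd]
  constructor
  · intro h
    exact (ZMod.val_eq_zero s).1 (Nat.eq_zero_of_dvd_of_lt h (ZMod.val_lt s))
  · rintro rfl
    simp

open Classical in
/-- The image of a letter, as a sum over the letters `a` that may stand above it: the sum over `a`
is the Fourier transform if `d` vanishes modulo `p ^ ℓ`, and has the single term `a = 0` otherwise.
-/
theorem map_tau_eq_sum {m ℓ N : ℕ} (hN : N = m + ℓ) (d : ZMod (p ^ N)) :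
    MvPolynomial.map (algebraMap ℚ ℂ) (tau p m ℓ d.val) = ∑ a : ZMod (p ^ m),
      if a = 0 ∨ redMod p (show ℓ ≤ N by omega) d = 0 then
        MvPolynomial.C (psi p N ((a.val : ZMod (p ^ N)) * d)) *
          MvPolynomial.X (pairVar p a (redMod p (show ℓ ≤ N by omega) d))
      else 0 := by
  have hlt : d.val < p ^ (m + ℓ) := by
    have := ZMod.val_lt d
    rwa [← hN]
  have hpsi : ∀ a : ZMod (p ^ m), zetaPow p (m + ℓ) ^ (a.val * d.val)
      = psi p N ((a.val : ZMod (p ^ N)) * d) := by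
    intro a
    conv_rhs => rw [← ZMod.natCast_zmod_val d, ← Nat.cast_mul, psi, AddChar.zmodChar_apply']
    generalize d.val = k
    rw [hN]
  rw [map_tau p m ℓ _ hlt]
  split_ifs with h
  · have h0 := (redMod_eq_zero_iff (show ℓ ≤ N by omega) d).2 h
    rw [sum_range_eq_sum_zmod]
    refine Finset.sum_congr rfl fun a _ => ?_
    rw [if_pos (Or.inr h0), hpsi, h0]
    congr 2
    by_cases ha : a = 0
    · simp [ha, pairVar, natVar]
    · simp [ha, pairVar, natVar, ZMod.val_eq_zero]
  · have h0 : redMod p (show ℓ ≤ N by omega) d ≠ 0 := fun h' => h ((redMod_eq_zero_iff _ d).1 h')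
    simp only [h0, or_false]
    rw [Finset.sum_ite_eq' Finset.univ (0 : ZMod (p ^ m)), if_pos (Finset.mem_univ _)]
    simp only [ZMod.val_zero, Nat.cast_zero, zero_mul, AddChar.map_zero_eq_one, map_one, one_mul]
    congr 1
    have hd : d.val ≠ 0 := fun hd => h (hd ▸ dvd_zero _)
    have hd' : (redMod p (show ℓ ≤ N by omega) d).val ≠ 0 := by
      rwa [Ne, ZMod.val_eq_zero]
    rw [pairVar, if_pos rfl, natVar, natVar, if_neg hd, if_neg hd']
    congr 1
    refine padicValNat_of_modEq (m := ℓ) ?_ h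
    rw [redMod_eq_natCast, ZMod.val_natCast]
    exact (Nat.mod_modEq _ _).symm

open Classical in
theorem SelfDualTower.disjointWE_eq (hK : SelfDualTower p K) (m ℓ N : ℕ) (hN : N = m + ℓ) :
    disjointWE p K m ℓ = MvPolynomial.C ((Nat.card (K 1) : ℚ)⁻¹ ^ m) *
      ∑ d : ι → ZMod (p ^ N) with d ∈ K N, ∏ i, tau p m ℓ (d i).val := by
  induction m generalizing ℓ N with
  | zero =>
    obtain rfl : N = ℓ := by omega
    rw [disjointWE, swe, hK.dual, pow_zero, map_one, one_mul]
    simp only [letterVar_eq_natVar, tau]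
  | succ m ih =>
    rw [disjointWE, ih (ℓ + 1) N (by omega), hK.dual, map_mul,
      pow_succ' ((Nat.card (K 1) : ℚ)⁻¹), map_mul, mul_assoc]
    congr 2
    · simp [MvPolynomial.algebraMap_eq]
    · simp only [map_sum, map_prod, tau]

open Classical in
/-- Orthogonality of characters: the sum of the character given by a word `a` over the copy of
`K m` in `K N` detects whether `a` belongs to the self-dual code `K m`. -/
theorem SelfDualTower.sum_psi (hK : SelfDualTower p K) {m N : ℕ} (h : m ≤ N)
    (a : ι → ZMod (p ^ m)) :
    ∑ e : ι → ZMod (p ^ m) with e ∈ K m, psi p N (pairing a (fun i => embMod p N (e i)))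
      = if a ∈ K m then (Nat.card (K m) : ℂ) else 0 := by
  split_ifs with ha
  · rw [Finset.sum_congr rfl (g := fun _ => (1 : ℂ)), Finset.sum_const, nsmul_eq_mul, mul_one,
      Nat.card_eq_fintype_card, Fintype.card_subtype]
    intro e he
    simp only [Finset.mem_filter, Finset.mem_univ, true_and] at he
    rw [psi_eq_one_iff, pairing_embMod_eq_zero_iff h]
    exact (hK.mem_iff a).1 ha e he
  · rw [hK.mem_iff] at ha
    push Not at ha
    obtain ⟨e0, he0, hne⟩ := ha
    set S := ∑ e : ι → ZMod (p ^ m) with e ∈ K m, psi p N (pairing a (fun i => embMod p N (e i)))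
      with hS
    have h1 : S = psi p N (pairing a (fun i => embMod p N (e0 i))) * S := by
      conv_lhs => rw [hS]
      rw [hS, Finset.mul_sum]
      symm
      refine Finset.sum_bij (fun e _ => e0 + e) ?_ ?_ ?_ ?_
      · intro e he
        simp only [Finset.mem_filter, Finset.mem_univ, true_and] at he ⊢
        exact (K m).add_mem he0 he
      · intro e _ e' _ hee
        exact add_left_cancel hee
      · intro e he
        simp only [Finset.mem_filter, Finset.mem_univ, true_and] at he
        exact ⟨e - e0, by simpa using (K m).sub_mem he he0, by simp⟩
      · intro e _
        rw [← AddChar.map_add_eq_mul, ← pairing_add]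
        simp only [Pi.add_apply, embMod_add h]
    have h2 : psi p N (pairing a (fun i => embMod p N (e0 i))) ≠ 1 := by
      rw [Ne, psi_eq_one_iff, pairing_embMod_eq_zero_iff h]
      exact hne
    have h3 : (psi p N (pairing a (fun i => embMod p N (e0 i))) - 1) * S = 0 := by
      rw [sub_mul, one_mul, ← h1, sub_self]
    exact (mul_eq_zero.1 h3).resolve_left (sub_ne_zero.2 h2)

open Classical in
/-- Over the complex numbers, `A_{m,ℓ}` is a sum over the pairs of codewords with disjoint supports,
weighted by a character of their pairing. Expanding the product of the transformed letters gives a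
sum over all words `c` modulo `p ^ m`; summing over the lifts `D` of `d` then leaves the codewords
`c`, by orthogonality of characters. -/
theorem SelfDualTower.map_disjointWE (hK : SelfDualTower p K) {m ℓ N : ℕ} (hN : N = m + ℓ) :
    MvPolynomial.map (algebraMap ℚ ℂ) (disjointWE p K m ℓ) =
      ∑ c : ι → ZMod (p ^ m) with c ∈ K m, ∑ d : ι → ZMod (p ^ ℓ) with d ∈ K ℓ,
        if DisjSupp c d then
          MvPolynomial.C (psi p N (pairing c (liftWord K N d))) * pairMon ℂ p c d
        else 0 := by
  have hℓ : ℓ ≤ N := by omega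
  have hm : m ≤ N := by omega
  have hcard : (Nat.card (K 1) : ℂ) ≠ 0 := by
    have : Nat.card (K 1) ≠ 0 := Nat.card_pos.ne'
    exact_mod_cast this
  -- The product of the transformed letters of a word, expanded.
  have hprod : ∀ d : ι → ZMod (p ^ N),
      ∏ i, MvPolynomial.map (algebraMap ℚ ℂ) (tau p m ℓ (d i).val)
        = ∑ a : ι → ZMod (p ^ m), if DisjSupp a (fun i => redMod p hℓ (d i)) then
            MvPolynomial.C (psi p N (pairing a d)) *
              pairMon ℂ p a (fun i => redMod p hℓ (d i)) else 0 := by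
    intro d
    simp only [map_tau_eq_sum hN]
    rw [Finset.prod_univ_sum, Fintype.piFinset_univ]
    refine Finset.sum_congr rfl fun a _ => ?_
    rw [Finset.prod_ite_zero]
    simp only [DisjSupp, Finset.mem_univ, true_imp_iff]
    congr 1
    rw [Finset.prod_mul_distrib, ← map_prod, pairing, addChar_sum]
    rfl
  -- Sum over the lifts `d` of each word `b` of `K ℓ`: the characters cancel unless `a` is in `K m`.
  have key : ∀ a : ι → ZMod (p ^ m), ∑ d : ι → ZMod (p ^ N) with d ∈ K N,
      (if DisjSupp a (fun i => redMod p hℓ (d i)) then MvPolynomial.C (psi p N (pairing a d)) *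
              pairMon ℂ p a (fun i => redMod p hℓ (d i)) else 0)
      = if a ∈ K m then MvPolynomial.C (Nat.card (K m) : ℂ) *
          ∑ b : ι → ZMod (p ^ ℓ) with b ∈ K ℓ, if DisjSupp a b then
            MvPolynomial.C (psi p N (pairing a (liftWord K N b))) * pairMon ℂ p a b else 0
        else 0 := by
    intro a
    rw [← Finset.sum_fiberwise_of_maps_to (g := fun d => fun i => redMod p hℓ (d i))
      (t := Finset.univ.filter fun b : ι → ZMod (p ^ ℓ) => b ∈ K ℓ)]
    · have : ∀ b ∈ Finset.univ.filter (fun b : ι → ZMod (p ^ ℓ) => b ∈ K ℓ),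
          ∑ d ∈ (Finset.univ.filter fun d : ι → ZMod (p ^ N) => d ∈ K N) with
            (fun i => redMod p hℓ (d i)) = b,
            (if DisjSupp a (fun i => redMod p hℓ (d i)) then
              MvPolynomial.C (psi p N (pairing a d)) *
                pairMon ℂ p a (fun i => redMod p hℓ (d i)) else 0)
          = MvPolynomial.C (if a ∈ K m then (Nat.card (K m) : ℂ) else 0) *
            if DisjSupp a b then
              MvPolynomial.C (psi p N (pairing a (liftWord K N b))) * pairMon ℂ p a b else 0 := by
        intro b hb
        simp only [Finset.mem_filter, Finset.mem_univ, true_and] at hb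
        rw [Finset.filter_filter]
        have hF : ∀ d ∈ Finset.univ.filter (fun d : ι → ZMod (p ^ N) =>
            d ∈ K N ∧ (fun i => redMod p hℓ (d i)) = b),
            (if DisjSupp a (fun i => redMod p hℓ (d i)) then
              MvPolynomial.C (psi p N (pairing a d)) *
                pairMon ℂ p a (fun i => redMod p hℓ (d i)) else 0)
            = MvPolynomial.C (psi p N (pairing a d)) *
              if DisjSupp a b then pairMon ℂ p a b else 0 := by
          intro d hd
          rw [(Finset.mem_filter.1 hd).2.2, mul_ite, mul_zero]
        rw [Finset.sum_congr rfl hF, ← Finset.sum_mul, ← map_sum,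
          hK.sum_fiber hN (fun d => psi p N (pairing a d)) (hK.liftWord_mem hℓ hb)
            (fun i => hK.redMod_liftWord hℓ hb i)]
        simp only [pairing_add, AddChar.map_add_eq_mul]
        rw [← Finset.mul_sum, hK.sum_psi hm, map_mul]
        split_ifs <;> ring
      rw [Finset.sum_congr rfl this, ← Finset.mul_sum]
      split_ifs <;> simp
    · intro d hd
      simp only [Finset.mem_filter, Finset.mem_univ, true_and] at hd ⊢
      exact hK.red _ d hd
  rw [hK.disjointWE_eq m ℓ N hN]
  simp only [map_mul, MvPolynomial.map_C, map_sum, map_prod, hprod]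
  rw [Finset.sum_comm, Finset.sum_congr rfl fun a _ => key a, ← Finset.sum_filter, ← Finset.mul_sum,
    ← mul_assoc, ← map_mul, hK.card_eq m]
  simp only [map_pow, map_inv₀, map_natCast, Nat.cast_pow]
  rw [← mul_pow, inv_mul_cancel₀ hcard, one_pow, map_one, one_mul]

end Pairs

/-! ### Averaging over units -/

/-- The average of `psi p N (u * s)` over the units `u` modulo `p ^ N`. -/
def avgPsi (p N : ℕ) (s : ZMod (p ^ N)) : ℚ :=
  if s = 0 then 1 else if (p : ZMod (p ^ N)) * s = 0 then -1 / ((p : ℚ) - 1) else 0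

section Units

variable {p : ℕ} [hp : Fact p.Prime] {N : ℕ}

theorem isNilpotent_cast (p N : ℕ) : IsNilpotent (p : ZMod (p ^ N)) :=
  ⟨N, by rw [← Nat.cast_pow, ZMod.natCast_self]⟩

theorem isUnit_iff_not_dvd_val (hN : N ≠ 0) (a : ZMod (p ^ N)) : IsUnit a ↔ ¬ p ∣ a.val := by
  conv_lhs => rw [← ZMod.natCast_zmod_val a, ZMod.isUnit_iff_coprime]
  rw [Nat.coprime_comm, Nat.coprime_pow_left_iff (Nat.pos_of_ne_zero hN),
    hp.out.coprime_iff_not_dvd]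

theorem avgPsi_unit_mul (u : (ZMod (p ^ N))ˣ) (s : ZMod (p ^ N)) :
    avgPsi p N (u * s) = avgPsi p N s := by
  have h1 : (u : ZMod (p ^ N)) * s = 0 ↔ s = 0 := Units.mul_right_eq_zero u
  have h2 : (p : ZMod (p ^ N)) * (u * s) = 0 ↔ (p : ZMod (p ^ N)) * s = 0 := by
    rw [mul_left_comm, Units.mul_right_eq_zero]
  simp only [avgPsi, h1, h2]

theorem avgPsi_neg (s : ZMod (p ^ N)) : avgPsi p N (-s) = avgPsi p N s := by
  simp only [avgPsi, neg_eq_zero, mul_neg]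

/-- Sums of a character over the units (Ramanujan sums modulo a prime power). -/
theorem sum_units_psi (s : ZMod (p ^ N)) :
    ∑ u : (ZMod (p ^ N))ˣ, psi p N (u * s) = (p ^ N).totient * (avgPsi p N s : ℂ) := by
  by_cases h0 : s = 0
  · simp [h0, avgPsi, ZMod.card_units_eq_totient, AddChar.map_zero_eq_one]
  by_cases h1 : (p : ZMod (p ^ N)) * s = 0
  · have hN : N ≠ 0 := by
      rintro rfl
      have : Subsingleton (ZMod (p ^ 0)) := by rw [pow_zero]; infer_instance
      exact h0 (Subsingleton.elim _ _)
    rw [avgPsi, if_neg h0, if_pos h1]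
    -- The sum over all residues vanishes, and the residues that are not units contribute `1` each.
    have htot : ∑ a : ZMod (p ^ N), psi p N (a * s) = 0 := by
      have h2 : ∑ a : ZMod (p ^ N), psi p N (a * s)
          = psi p N s * ∑ a : ZMod (p ^ N), psi p N (a * s) := by
        rw [Finset.mul_sum]
        symm
        refine Fintype.sum_equiv (Equiv.addRight 1) _ _ fun a => ?_
        rw [← AddChar.map_add_eq_mul, Equiv.coe_addRight, add_mul, one_mul, add_comm]
      have h3 : (psi p N s - 1) * ∑ a : ZMod (p ^ N), psi p N (a * s) = 0 := by
        rw [sub_mul, one_mul, ← h2, sub_self]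
      exact (mul_eq_zero.1 h3).resolve_left (sub_ne_zero.2 fun h => h0 ((psi_eq_one_iff N s).1 h))
    classical
    have hu : ∑ u : (ZMod (p ^ N))ˣ, psi p N (u * s)
        = ∑ a : ZMod (p ^ N) with IsUnit a, psi p N (a * s) := by
      refine Finset.sum_bij (fun u _ => (u : ZMod (p ^ N))) ?_ ?_ ?_ ?_
      · intro u _; simp
      · intro u _ v _ h; exact Units.ext h
      · intro a ha
        simp only [Finset.mem_filter, Finset.mem_univ, true_and] at ha
        exact ⟨ha.unit, Finset.mem_univ _, rfl⟩
      · intro u _; rfl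
    have hnu : ∑ a : ZMod (p ^ N) with ¬ IsUnit a, psi p N (a * s)
        = ((p ^ N : ℕ) : ℂ) - (p ^ N).totient := by
      rw [Finset.sum_congr rfl (g := fun _ => (1 : ℂ))]
      · rw [Finset.sum_const, nsmul_eq_mul, mul_one, eq_sub_iff_add_eq]
        have h4 := Finset.card_filter_add_card_filter_not (s := (Finset.univ :
          Finset (ZMod (p ^ N))))
          (fun a => IsUnit a)
        have h5 : (Finset.univ.filter fun a : ZMod (p ^ N) => IsUnit a).card = (p ^ N).totient := by
          rw [← ZMod.card_units_eq_totient, ← Finset.card_univ]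
          symm
          refine Finset.card_bij (fun u _ => (u : ZMod (p ^ N))) ?_ ?_ ?_
          · intro u _; simp
          · intro u _ v _ h; exact Units.ext h
          · intro a ha
            simp only [Finset.mem_filter, Finset.mem_univ, true_and] at ha
            exact ⟨ha.unit, Finset.mem_univ _, rfl⟩
        rw [h5, Finset.card_univ, ZMod.card] at h4
        rw [← Nat.cast_add, add_comm, h4]
      · intro a ha
        simp only [Finset.mem_filter, Finset.mem_univ, true_and, isUnit_iff_not_dvd_val hN,
          not_not] at ha
        obtain ⟨k, hk⟩ := ha
        rw [psi_eq_one_iff, ← ZMod.natCast_zmod_val a, hk, Nat.cast_mul, mul_right_comm, h1,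
          zero_mul]
    have h6 := Finset.sum_filter_add_sum_filter_not (Finset.univ : Finset (ZMod (p ^ N)))
      (fun a => IsUnit a) (fun a => psi p N (a * s))
    rw [htot, ← hu, hnu] at h6
    rw [eq_neg_of_add_eq_zero_left h6]
    obtain ⟨n, rfl⟩ := Nat.exists_eq_succ_of_ne_zero hN
    rw [Nat.totient_prime_pow_succ hp.out]
    have h7 : ((p : ℂ) - 1) ≠ 0 := by
      rw [sub_ne_zero]
      exact_mod_cast hp.out.one_lt.ne'
    generalize hq : (p ^ (n + 1) : ℕ) = q
    have hq' : (q : ℂ) = p ^ n * p := by rw [← hq]; push_cast; ring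
    push_cast [Nat.cast_pred hp.out.pos]
    rw [hq']
    field_simp
    ring
  · rw [avgPsi, if_neg h0, if_neg h1]
    -- The translation `u ↦ u + p` permutes the units and multiplies the sum by `psi p N (p * s) ≠
    -- 1`.
    set S := ∑ u : (ZMod (p ^ N))ˣ, psi p N (u * s) with hS
    have hunit : ∀ (u : (ZMod (p ^ N))ˣ), IsUnit ((u : ZMod (p ^ N)) + p) := fun u =>
      IsNilpotent.isUnit_add_left_of_commute (isNilpotent_cast p N) u.isUnit (Commute.all _ _)
    have h2 : S = psi p N (p * s) * S := by
      conv_rhs => rw [hS]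
      rw [Finset.mul_sum, hS]
      symm
      refine Finset.sum_bij (fun u _ => (hunit u).unit) (fun _ _ => Finset.mem_univ _) ?_ ?_ ?_
      · intro u _ v _ h
        have := congrArg Units.val h
        simp only [IsUnit.unit_spec, add_left_inj] at this
        exact Units.ext this
      · have hinj : Function.Injective fun u : (ZMod (p ^ N))ˣ => (hunit u).unit := by
          intro u v h
          have := congrArg Units.val h
          simp only [IsUnit.unit_spec, add_left_inj] at this
          exact Units.ext this
        intro v _
        obtain ⟨u, hu⟩ := (Finite.injective_iff_surjective.1 hinj) v
        exact ⟨u, Finset.mem_univ _, hu⟩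
      · intro u _
        rw [← AddChar.map_add_eq_mul, IsUnit.unit_spec, add_mul, add_comm]
    have h3 : (psi p N (p * s) - 1) * S = 0 := by
      rw [sub_mul, one_mul, ← h2, sub_self]
    rw [(mul_eq_zero.1 h3).resolve_left (sub_ne_zero.2 fun h => h1 ((psi_eq_one_iff N _).1 h))]
    simp

theorem pow_dvd_val_iff {ℓ : ℕ} {b : ZMod (p ^ ℓ)} (hb : b ≠ 0) (k : ℕ) :
    p ^ k ∣ b.val ↔ ∃ h : k ≤ ℓ, redMod p h b = 0 := by
  constructor
  · intro h
    have hk : k ≤ ℓ := by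
      by_contra hk
      have h1 : p ^ ℓ ∣ b.val := (pow_dvd_pow p (by omega)).trans h
      exact hb ((ZMod.val_eq_zero b).1 (Nat.eq_zero_of_dvd_of_lt h1 (ZMod.val_lt b)))
    exact ⟨hk, (redMod_eq_zero_iff hk b).2 h⟩
  · rintro ⟨hk, h⟩
    exact (redMod_eq_zero_iff hk b).1 h

theorem padicValNat_unit_mul {ℓ : ℕ} {u : ZMod (p ^ ℓ)} (hu : IsUnit u) (b : ZMod (p ^ ℓ)) :
    padicValNat p (u * b).val = padicValNat p b.val := by
  by_cases hb : b = 0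
  · simp [hb]
  have hub : u * b ≠ 0 := fun h => hb ((IsUnit.mul_right_eq_zero hu).1 h)
  refine padicValNat_congr (fun h => hub ((ZMod.val_eq_zero _).1 h))
    (fun h => hb ((ZMod.val_eq_zero _).1 h)) fun k => ?_
  rw [pow_dvd_val_iff hub, pow_dvd_val_iff hb]
  refine exists_congr fun hk => ?_
  rw [map_mul, IsUnit.mul_right_eq_zero (hu.map _)]

theorem natVar_unit_mul {ℓ : ℕ} (w : ℕ → WVar) {u : ZMod (p ^ ℓ)} (hu : IsUnit u)
    (b : ZMod (p ^ ℓ)) : natVar p w (u * b).val = natVar p w b.val := by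
  simp only [natVar, padicValNat_unit_mul hu, ZMod.val_eq_zero, IsUnit.mul_right_eq_zero hu]

theorem pairVar_unit_mul {m ℓ : ℕ} {u : ZMod (p ^ m)} (hu : IsUnit u) {v : ZMod (p ^ ℓ)}
    (hv : IsUnit v) (a : ZMod (p ^ m)) (b : ZMod (p ^ ℓ)) :
    pairVar p (u * a) (v * b) = pairVar p a b := by
  simp only [pairVar, padicValNat_unit_mul hu, natVar_unit_mul _ hv, IsUnit.mul_right_eq_zero hu]

end Units

/-! ### The rational formula for the disjoint weight enumerators -/

section PairFormula

variable {p : ℕ} [hp : Fact p.Prime] {ι : Type*} [Fintype ι]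
  {K : (m : ℕ) → Submodule (ZMod (p ^ m)) (ι → ZMod (p ^ m))}

open Classical in
/-- The weight with which a pair of words modulo `p ^ m` and `p ^ ℓ` contributes to `A_{m,ℓ}`, where
`N` stands for `m + ℓ`. -/
noncomputable def pairWt (K : (m : ℕ) → Submodule (ZMod (p ^ m)) (ι → ZMod (p ^ m))) (N : ℕ)
    {m ℓ : ℕ} (c : ι → ZMod (p ^ m)) (d : ι → ZMod (p ^ ℓ)) : ℚ :=
  if DisjSupp c d then avgPsi p N (pairing c (liftWord K N d)) else 0

theorem DisjSupp.unit_smul_right_iff {m ℓ : ℕ} {c : ι → ZMod (p ^ m)} {d : ι → ZMod (p ^ ℓ)}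
    {u : ZMod (p ^ ℓ)} (hu : IsUnit u) : DisjSupp c (u • d) ↔ DisjSupp c d := by
  simp [DisjSupp, IsUnit.mul_right_eq_zero hu]

theorem pairMon_unit_smul (R : Type*) [CommSemiring R] {m ℓ : ℕ} {u : ZMod (p ^ m)} (hu : IsUnit u)
    {v : ZMod (p ^ ℓ)} (hv : IsUnit v) (c : ι → ZMod (p ^ m)) (d : ι → ZMod (p ^ ℓ)) :
    pairMon R p (u • c) (v • d) = pairMon R p c d := by
  simp only [pairMon, Pi.smul_apply, smul_eq_mul, pairVar_unit_mul hu hv]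

theorem pairing_smul {m N : ℕ} (c : ι → ZMod (p ^ m)) (u : ZMod (p ^ N)) (D : ι → ZMod (p ^ N)) :
    pairing c (u • D) = u * pairing c D := by
  simp only [pairing, Pi.smul_apply, smul_eq_mul, Finset.mul_sum]
  exact Finset.sum_congr rfl fun i _ => by ring

theorem SelfDualTower.pairing_liftWord (hK : SelfDualTower p K) {m ℓ N : ℕ} (hN : N = m + ℓ)
    {c : ι → ZMod (p ^ m)} (hc : c ∈ K m) {d : ι → ZMod (p ^ ℓ)} {D : ι → ZMod (p ^ N)}
    (hD : D ∈ K N) (h : ∀ i, redMod p (show ℓ ≤ N by omega) (D i) = d i) :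
    pairing c (liftWord K N d) = pairing c D := by
  have hd : d ∈ K ℓ := by
    rw [← funext h]; exact hK.red _ D hD
  refine hK.pairing_congr hN hc (hK.liftWord_mem (by omega) hd) hD fun i => ?_
  rw [hK.redMod_liftWord _ hd, h]

open Classical in
/-- The formula of `SelfDualTower.map_disjointWE`, averaged over the multiples of `d` by units. The
averaging is possible since neither the monomial of a pair nor the code changes, and makes the
weights rational. -/
theorem SelfDualTower.disjointWE_eq_sum_pairs (hK : SelfDualTower p K) {m ℓ N : ℕ}
    (hN : N = m + ℓ) :
    disjointWE p K m ℓ =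
      ∑ c : ι → ZMod (p ^ m) with c ∈ K m, ∑ d : ι → ZMod (p ^ ℓ) with d ∈ K ℓ,
        MvPolynomial.C (pairWt K N c d) * pairMon ℚ p c d := by
  apply MvPolynomial.map_injective (algebraMap ℚ ℂ) (algebraMap ℚ ℂ).injective
  rw [hK.map_disjointWE hN, map_sum]
  refine Finset.sum_congr rfl fun c hc => ?_
  simp only [Finset.mem_filter, Finset.mem_univ, true_and] at hc
  have hℓ : ℓ ≤ N := by omega
  set S := ∑ d : ι → ZMod (p ^ ℓ) with d ∈ K ℓ, (if DisjSupp c d then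
          MvPolynomial.C (psi p N (pairing c (liftWord K N d))) * pairMon ℂ p c d
        else 0) with hS
  have hu : ∀ u : (ZMod (p ^ N))ˣ, S = ∑ d : ι → ZMod (p ^ ℓ) with d ∈ K ℓ,
      (if DisjSupp c d then
          MvPolynomial.C (psi p N (u * pairing c (liftWord K N d))) * pairMon ℂ p c d
        else 0) := by
    intro u
    have hv : IsUnit (redMod p hℓ (u : ZMod (p ^ N))) := u.isUnit.map _
    rw [hS]
    symm
    refine Finset.sum_bij (fun d _ => redMod p hℓ (u : ZMod (p ^ N)) • d) ?_ ?_ ?_ ?_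
    · intro d hd
      simp only [Finset.mem_filter, Finset.mem_univ, true_and] at hd ⊢
      exact (K ℓ).smul_mem _ hd
    · intro d _ d' _ h
      exact (hv.smul_left_cancel).1 h
    · intro d hd
      simp only [Finset.mem_filter, Finset.mem_univ, true_and] at hd
      refine ⟨(hv.unit⁻¹ : (ZMod (p ^ ℓ))ˣ) • d, ?_, ?_⟩
      · simp only [Finset.mem_filter, Finset.mem_univ, true_and]
        exact (K ℓ).smul_mem _ hd
      · change hv.unit • (hv.unit⁻¹ • d) = d
        rw [smul_inv_smul]
    · intro d hd
      simp only [Finset.mem_filter, Finset.mem_univ, true_and] at hd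
      rw [hK.pairing_liftWord hN hc (d := redMod p hℓ (u : ZMod (p ^ N)) • d)
        ((K N).smul_mem (u : ZMod (p ^ N)) (hK.liftWord_mem hℓ hd)), pairing_smul]
      · have h2 : pairMon ℂ p c (redMod p hℓ (u : ZMod (p ^ N)) • d) = pairMon ℂ p c d := by
          have := pairMon_unit_smul ℂ (isUnit_one : IsUnit (1 : ZMod (p ^ m))) hv c d
          rwa [one_smul] at this
        rw [h2]
        simp only [DisjSupp.unit_smul_right_iff hv]
      · intro i
        rw [Pi.smul_apply, smul_eq_mul, map_mul, hK.redMod_liftWord hℓ hd, Pi.smul_apply,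
          smul_eq_mul]
  have hcard : ((p ^ N).totient : ℂ) ≠ 0 := by
    exact_mod_cast (Nat.totient_pos.2 (pow_pos hp.out.pos N)).ne'
  have hsum : MvPolynomial.C ((p ^ N).totient : ℂ) * S = MvPolynomial.C ((p ^ N).totient : ℂ) *
      ∑ d : ι → ZMod (p ^ ℓ) with d ∈ K ℓ,
        MvPolynomial.map (algebraMap ℚ ℂ) (MvPolynomial.C (pairWt K N c d) * pairMon ℚ p c d) := by
    have h1 : MvPolynomial.C ((p ^ N).totient : ℂ) * S = ∑ _u : (ZMod (p ^ N))ˣ, S := by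
      rw [Finset.sum_const, Finset.card_univ, ZMod.card_units_eq_totient, nsmul_eq_mul, map_natCast]
    rw [h1, Finset.sum_congr rfl fun u _ => hu u, Finset.sum_comm, Finset.mul_sum]
    refine Finset.sum_congr rfl fun d _ => ?_
    have hmon : MvPolynomial.map (algebraMap ℚ ℂ) (pairMon ℚ p c d) = pairMon ℂ p c d := by
      simp [pairMon]
    rw [map_mul, hmon, MvPolynomial.map_C, pairWt]
    split_ifs with h
    · rw [← Finset.sum_mul, ← map_sum, sum_units_psi, map_mul, mul_assoc]
      rfl
    · simp
  rw [map_sum]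
  refine mul_left_cancel₀ ?_ hsum
  rw [Ne, MvPolynomial.C_eq_zero]
  exact hcard

end PairFormula

/-! ### Symmetries of the weights of pairs -/

section Symmetry

variable {p : ℕ} [hp : Fact p.Prime] {ι : Type*} [Fintype ι]
  {K : (m : ℕ) → Submodule (ZMod (p ^ m)) (ι → ZMod (p ^ m))}

open Classical in
/-- On words with disjoint supports the pairing can be computed from arbitrary lifts, as the part of
their inner product that is supported by the first word. -/
theorem pairing_eq_sum_lifts {m ℓ N : ℕ} (hN : N = m + ℓ) {c : ι → ZMod (p ^ m)}
    {C D : ι → ZMod (p ^ N)} (hC : ∀ i, redMod p (show m ≤ N by omega) (C i) = c i)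
    (hD : ∀ i, c i = 0 ∨ redMod p (show ℓ ≤ N by omega) (D i) = 0) :
    pairing c D = ∑ i, if c i = 0 then 0 else C i * D i := by
  refine Finset.sum_congr rfl fun i _ => ?_
  split_ifs with h
  · simp [h]
  · rw [← sub_eq_zero, ← sub_mul]
    refine mul_eq_zero_of_redMod hN ?_ ((hD i).resolve_left h)
    rw [map_sub, redMod_natCast_val, hC, sub_self]

theorem pairWt_eq_zero_of_not_disjSupp {N m ℓ : ℕ} {c : ι → ZMod (p ^ m)} {d : ι → ZMod (p ^ ℓ)}
    (h : ¬ DisjSupp c d) : pairWt K N c d = 0 := if_neg h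

theorem SelfDualTower.pairWt_eq (hK : SelfDualTower p K) {m ℓ N : ℕ} (hN : N = m + ℓ)
    {c : ι → ZMod (p ^ m)} (hc : c ∈ K m) {d : ι → ZMod (p ^ ℓ)} {D : ι → ZMod (p ^ N)}
    (hD : D ∈ K N) (hDd : ∀ i, redMod p (show ℓ ≤ N by omega) (D i) = d i) (h : DisjSupp c d) :
    pairWt K N c d = avgPsi p N (pairing c D) := by
  rw [pairWt, if_pos h, hK.pairing_liftWord hN hc hD hDd]

/-- The pairings of `c` with `d` and of `d` with `c` add up to the inner product of lifts of `c` and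
`d` to the self-dual code modulo `p ^ N`, hence are negatives of each other. -/
theorem SelfDualTower.pairWt_swap (hK : SelfDualTower p K) {m ℓ N : ℕ} (hN : N = m + ℓ)
    {c : ι → ZMod (p ^ m)} (hc : c ∈ K m) {d : ι → ZMod (p ^ ℓ)} (hd : d ∈ K ℓ) :
    pairWt K N d c = pairWt K N c d := by
  classical
  by_cases h : DisjSupp c d
  · obtain ⟨C, hC, hCc⟩ := hK.lift (show m ≤ N by omega) c hc
    obtain ⟨D, hD, hDd⟩ := hK.lift (show ℓ ≤ N by omega) d hd
    rw [hK.pairWt_eq hN hc hD (congrFun hDd) h,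
      hK.pairWt_eq (show N = ℓ + m by omega) hd hC (congrFun hCc) h.symm, ← avgPsi_neg]
    congr 1
    rw [neg_eq_iff_add_eq_zero, add_comm,
      pairing_eq_sum_lifts hN (congrFun hCc) (fun i => by rw [congrFun hDd i]; exact h i),
      pairing_eq_sum_lifts (show N = ℓ + m by omega) (congrFun hDd)
        (fun i => by rw [congrFun hCc i]; exact (h i).symm), ← Finset.sum_add_distrib]
    refine Eq.trans ?_ ((hK.mem_iff D).1 hD C hC)
    refine Finset.sum_congr rfl fun i _ => ?_
    by_cases h1 : c i = 0
    · by_cases h2 : d i = 0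
      · rw [if_pos h1, if_pos h2, mul_eq_zero_of_redMod hN ((congrFun hCc i).trans h1)
          ((congrFun hDd i).trans h2), add_zero]
      · rw [if_pos h1, if_neg h2, zero_add, mul_comm]
    · rw [if_neg h1, if_pos ((h i).resolve_left h1), add_zero]
  · rw [pairWt_eq_zero_of_not_disjSupp h, pairWt_eq_zero_of_not_disjSupp fun h' => h h'.symm]

theorem isUnit_redMod_iff {m N : ℕ} (h : m ≤ N) (hm : m ≠ 0) (u : ZMod (p ^ N)) :
    IsUnit (redMod p h u) ↔ IsUnit u := by
  rw [isUnit_iff_not_dvd_val hm, isUnit_iff_not_dvd_val (by omega), redMod_eq_natCast,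
    ZMod.val_natCast]
  have : p ∣ p ^ m := dvd_pow_self p hm
  rw [Nat.dvd_mod_iff this]

theorem isUnit_natCast_val {m N : ℕ} (h : m ≤ N) (hm : m ≠ 0) {u : ZMod (p ^ m)} (hu : IsUnit u) :
    IsUnit ((u.val : ZMod (p ^ N))) := by
  rw [← isUnit_redMod_iff h hm, redMod_natCast_val]
  exact hu

theorem SelfDualTower.pairWt_unit_smul_left (hK : SelfDualTower p K) {m ℓ N : ℕ} (hN : N = m + ℓ)
    {c : ι → ZMod (p ^ m)} (hc : c ∈ K m) {d : ι → ZMod (p ^ ℓ)} (hd : d ∈ K ℓ) {u : ZMod (p ^ m)}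
    (hu : IsUnit u) : pairWt K N (u • c) d = pairWt K N c d := by
  classical
  rcases Nat.eq_zero_or_pos m with rfl | hm
  · have : Subsingleton (ZMod (p ^ 0)) := by rw [pow_zero]; infer_instance
    rw [Subsingleton.elim u 1, one_smul]
  have hsupp : DisjSupp (u • c) d ↔ DisjSupp c d := by
    simp [DisjSupp, IsUnit.mul_right_eq_zero hu]
  by_cases h : DisjSupp c d
  · obtain ⟨C, hC, hCc⟩ := hK.lift (show m ≤ N by omega) c hc
    obtain ⟨D, hD, hDd⟩ := hK.lift (show ℓ ≤ N by omega) d hd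
    have hmN : m ≤ N := by omega
    have hU := isUnit_natCast_val hmN hm.ne' hu
    rw [hK.pairWt_eq hN hc hD (congrFun hDd) h,
      hK.pairWt_eq hN ((K m).smul_mem u hc) hD (congrFun hDd) (hsupp.2 h),
      ← avgPsi_unit_mul hU.unit (pairing c D), IsUnit.unit_spec]
    congr 1
    rw [pairing_eq_sum_lifts hN (congrFun hCc) (fun i => by rw [congrFun hDd i]; exact h i),
      pairing_eq_sum_lifts hN (C := (u.val : ZMod (p ^ N)) • C) _
        (fun i => by rw [congrFun hDd i]; exact hsupp.2 h i), Finset.mul_sum]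
    · refine Finset.sum_congr rfl fun i _ => ?_
      simp only [Pi.smul_apply, smul_eq_mul, IsUnit.mul_right_eq_zero hu, mul_ite, mul_zero,
        mul_assoc]
    · intro i
      simp only [Pi.smul_apply, smul_eq_mul, map_mul, redMod_natCast_val, congrFun hCc i]
  · rw [pairWt_eq_zero_of_not_disjSupp h, pairWt_eq_zero_of_not_disjSupp fun h' => h (hsupp.1 h')]

theorem SelfDualTower.pairWt_unit_smul_right (hK : SelfDualTower p K) {m ℓ N : ℕ} (hN : N = m + ℓ)
    {c : ι → ZMod (p ^ m)} (hc : c ∈ K m) {d : ι → ZMod (p ^ ℓ)} (hd : d ∈ K ℓ) {u : ZMod (p ^ ℓ)}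
    (hu : IsUnit u) : pairWt K N c (u • d) = pairWt K N c d := by
  rw [← hK.pairWt_swap hN hc ((K ℓ).smul_mem u hd),
    hK.pairWt_unit_smul_left (show N = ℓ + m by omega) hd hc hu, hK.pairWt_swap hN hc hd]

/-- A signed permutation of the coordinates, acting on words over `ZMod n`. -/
def signedPerm (σ : Equiv.Perm ι) (ε : ι → ℤˣ) {n : ℕ} (c : ι → ZMod n) : ι → ZMod n :=
  fun i => ((ε i : ℤ) : ZMod n) * c (σ i)

end Symmetry

section SignedPerm

variable {p : ℕ} [hp : Fact p.Prime] {ι : Type*}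

theorem isUnit_sign (e : ℤˣ) (n : ℕ) : IsUnit (((e : ℤ) : ZMod n)) :=
  (Units.isUnit e).map (Int.castRingHom (ZMod n))

theorem signedPerm_eq_zero_iff (σ : Equiv.Perm ι) (ε : ι → ℤˣ) {n : ℕ} (c : ι → ZMod n) (i : ι) :
    signedPerm σ ε c i = 0 ↔ c (σ i) = 0 :=
  IsUnit.mul_right_eq_zero (isUnit_sign (ε i) n)

theorem redMod_signedPerm (σ : Equiv.Perm ι) (ε : ι → ℤˣ) {m N : ℕ} (h : m ≤ N)
    (c : ι → ZMod (p ^ N)) (i : ι) :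
    redMod p h (signedPerm σ ε c i) = signedPerm σ ε (fun i => redMod p h (c i)) i := by
  simp [signedPerm]

theorem signedPerm_injective (σ : Equiv.Perm ι) (ε : ι → ℤˣ) (n : ℕ) :
    Function.Injective (signedPerm σ ε : (ι → ZMod n) → ι → ZMod n) := by
  intro c d h
  funext i
  have := congrFun h (σ.symm i)
  simp only [signedPerm, Equiv.apply_symm_apply] at this
  exact (isUnit_sign _ n).mul_left_cancel this

variable [Fintype ι] {K : (m : ℕ) → Submodule (ZMod (p ^ m)) (ι → ZMod (p ^ m))}

theorem pairMon_signedPerm (R : Type*) [CommSemiring R] (σ : Equiv.Perm ι) (ε : ι → ℤˣ) {m ℓ : ℕ}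
    (c : ι → ZMod (p ^ m)) (d : ι → ZMod (p ^ ℓ)) :
    pairMon R p (signedPerm σ ε c) (signedPerm σ ε d) = pairMon R p c d := by
  unfold pairMon
  refine Fintype.prod_equiv σ _ _ fun i => ?_
  rw [signedPerm, signedPerm, pairVar_unit_mul (isUnit_sign _ _) (isUnit_sign _ _)]

theorem disjSupp_signedPerm_iff (σ : Equiv.Perm ι) (ε : ι → ℤˣ) {m ℓ : ℕ}
    {c : ι → ZMod (p ^ m)} {d : ι → ZMod (p ^ ℓ)} :
    DisjSupp (signedPerm σ ε c) (signedPerm σ ε d) ↔ DisjSupp c d := by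
  simp only [DisjSupp, signedPerm_eq_zero_iff]
  exact σ.forall_congr_left.trans (by simp)

theorem SelfDualTower.pairWt_signedPerm (hK : SelfDualTower p K) (σ : Equiv.Perm ι) (ε : ι → ℤˣ)
    {m ℓ N : ℕ} (hN : N = m + ℓ) (hm : ∀ c ∈ K m, signedPerm σ ε c ∈ K m)
    (hσN : ∀ c ∈ K N, signedPerm σ ε c ∈ K N)
    {c : ι → ZMod (p ^ m)} (hc : c ∈ K m) {d : ι → ZMod (p ^ ℓ)} (hd : d ∈ K ℓ) :
    pairWt K N (signedPerm σ ε c) (signedPerm σ ε d) = pairWt K N c d := by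
  classical
  by_cases h : DisjSupp c d
  · have h' := (disjSupp_signedPerm_iff σ ε).2 h
    obtain ⟨C, hC, hCc⟩ := hK.lift (show m ≤ N by omega) c hc
    obtain ⟨D, hD, hDd⟩ := hK.lift (show ℓ ≤ N by omega) d hd
    have hD' : ∀ i, redMod p (show ℓ ≤ N by omega) (signedPerm σ ε D i) = signedPerm σ ε d i := by
      intro i
      rw [redMod_signedPerm, hDd]
    rw [hK.pairWt_eq hN hc hD (congrFun hDd) h,
      hK.pairWt_eq hN (hm c hc) (hσN D hD) hD' h']
    congr 1
    rw [pairing_eq_sum_lifts hN (congrFun hCc) (fun i => by rw [congrFun hDd i]; exact h i),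
      pairing_eq_sum_lifts hN (C := signedPerm σ ε C) _ (fun i => by rw [hD' i]; exact h' i)]
    · refine Fintype.sum_equiv σ _ _ fun i => ?_
      simp only [signedPerm_eq_zero_iff]
      congr 1
      simp only [signedPerm]
      rw [mul_mul_mul_comm, ← Int.cast_mul, ← Units.val_mul, Int.units_mul_self]
      simp
    · intro i
      rw [redMod_signedPerm, hCc]
  · rw [pairWt_eq_zero_of_not_disjSupp h,
      pairWt_eq_zero_of_not_disjSupp fun h' => h ((disjSupp_signedPerm_iff σ ε).1 h')]

/-- Compatibility of the pairings of a pair of words with disjoint supports and of a reduction of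
this pair. -/
theorem redMod_pairing {m ℓ N m' ℓ' N' : ℕ} (hN : N = m + ℓ)
    (hN' : N' = m' + ℓ') (hm : m' ≤ m) (hℓ : ℓ' ≤ ℓ) {c : ι → ZMod (p ^ m)}
    {D : ι → ZMod (p ^ N)} (h : ∀ i, c i = 0 ∨ redMod p (show ℓ ≤ N by omega) (D i) = 0) :
    redMod p (show N' ≤ N by omega) (pairing c D)
      = pairing (fun i => redMod p hm (c i)) (fun i => redMod p (show N' ≤ N by omega) (D i)) := by
  simp only [pairing, map_sum, map_mul, map_natCast]
  refine Finset.sum_congr rfl fun i _ => ?_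
  rcases h i with h | h
  · simp [h]
  · rw [← sub_eq_zero, ← sub_mul]
    refine mul_eq_zero_of_redMod hN' ?_ ?_
    · rw [map_sub, map_natCast, redMod_natCast_val, sub_eq_zero, redMod_eq_natCast]
    · rw [redMod_redMod, ← redMod_redMod (show ℓ ≤ N by omega) hℓ, h, map_zero]

end SignedPerm

/-! ### Gradings by the exponents of `x_0` and `y_0` -/

/-- The homomorphism that marks the variable `x_0`: the coefficients of the image of a polynomial
are its components of given degree in `x_0`. -/
noncomputable def markX : MvPolynomial WVar ℚ →ₐ[ℚ] (MvPolynomial WVar ℚ)[X] :=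
  MvPolynomial.aeval fun v => match v with
    | WVar.x 0 => C (MvPolynomial.X (WVar.x 0)) * X
    | v => C (MvPolynomial.X v)

/-- The homomorphism that marks the variable `y_0`. -/
noncomputable def markY : MvPolynomial WVar ℚ →ₐ[ℚ] (MvPolynomial WVar ℚ)[X] :=
  MvPolynomial.aeval fun v => match v with
    | WVar.y 0 => C (MvPolynomial.X (WVar.y 0)) * X
    | v => C (MvPolynomial.X v)

/-- The component of degree `a` in `x_0`. -/
noncomputable def xComp (a : ℕ) (f : MvPolynomial WVar ℚ) : MvPolynomial WVar ℚ := (markX f).coeff a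

/-- The component of degree `b` in `y_0`. -/
noncomputable def yComp (b : ℕ) (f : MvPolynomial WVar ℚ) : MvPolynomial WVar ℚ := (markY f).coeff b

theorem markX_C (q : ℚ) : markX (MvPolynomial.C q) = C (MvPolynomial.C q) := by
  rw [markX, MvPolynomial.aeval_C]; rfl

theorem markY_C (q : ℚ) : markY (MvPolynomial.C q) = C (MvPolynomial.C q) := by
  rw [markY, MvPolynomial.aeval_C]; rfl

theorem markX_aeval_upSubst {m ℓ : ℕ} (hm : m ≠ 0) (f : MvPolynomial WVar ℚ) :
    markX (MvPolynomial.aeval (upSubst 3 m ℓ) f)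
      = (markX f).map (MvPolynomial.aeval (upSubst 3 m ℓ)).toRingHom := by
  obtain ⟨m, rfl⟩ := Nat.exists_eq_succ_of_ne_zero hm
  have key : ∀ v : WVar, markX (MvPolynomial.aeval (upSubst 3 (m + 1) ℓ) (MvPolynomial.X v :
    MvPolynomial WVar ℚ))
      = (markX (MvPolynomial.X v)).map (MvPolynomial.aeval (upSubst 3 (m + 1) ℓ)).toRingHom := by
    intro v
    rcases v with (_ | i) | j | _
    · simp [markX, upSubst, Polynomial.algebraMap_apply, MvPolynomial.algebraMap_eq, mul_assoc]
    · simp [markX, upSubst, Polynomial.algebraMap_apply, MvPolynomial.algebraMap_eq]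
    · simp only [markX, upSubst, MvPolynomial.aeval_X, Polynomial.map_C]
      split_ifs <;> simp [upSubst, *]
    · simp [markX, upSubst, Polynomial.algebraMap_apply, MvPolynomial.algebraMap_eq]
  induction f using MvPolynomial.induction_on with
  | C q => simp [ MvPolynomial.algebraMap_eq]
  | add f g hf hg => simp only [map_add, hf, hg, Polynomial.map_add]
  | mul_X f v hf =>
    rw [map_mul, map_mul, hf, key, map_mul, Polynomial.map_mul]

theorem markY_aeval_upSubst {m ℓ : ℕ} (hℓ : ℓ ≠ 0) (f : MvPolynomial WVar ℚ) :
    markY (MvPolynomial.aeval (upSubst 3 m ℓ) f)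
      = (markY f).map (MvPolynomial.aeval (upSubst 3 m ℓ)).toRingHom := by
  have key : ∀ v : WVar, markY (MvPolynomial.aeval (upSubst 3 m ℓ) (MvPolynomial.X v :
    MvPolynomial WVar ℚ))
      = (markY (MvPolynomial.X v)).map (MvPolynomial.aeval (upSubst 3 m ℓ)).toRingHom := by
    intro v
    rcases v with i | (_ | j) | _
    · simp [markY, upSubst, Polynomial.algebraMap_apply, MvPolynomial.algebraMap_eq]
    · simp [markY, upSubst, hℓ.symm]
    · simp only [markY, upSubst, MvPolynomial.aeval_X, Polynomial.map_C]
      split_ifs <;> simp [upSubst, *]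
    · simp [markY, upSubst, Polynomial.algebraMap_apply, MvPolynomial.algebraMap_eq]
  induction f using MvPolynomial.induction_on with
  | C q => simp [ MvPolynomial.algebraMap_eq]
  | add f g hf hg => simp only [map_add, hf, hg, Polynomial.map_add]
  | mul_X f v hf =>
    rw [map_mul, map_mul, hf, key, map_mul, Polynomial.map_mul]

theorem xComp_aeval_upSubst {m ℓ : ℕ} (hm : m ≠ 0) (a : ℕ) (f : MvPolynomial WVar ℚ) :
    xComp a (MvPolynomial.aeval (upSubst 3 m ℓ) f)
      = MvPolynomial.aeval (upSubst 3 m ℓ) (xComp a f) := by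
  rw [xComp, markX_aeval_upSubst hm, Polynomial.coeff_map]
  rfl

theorem yComp_aeval_upSubst {m ℓ : ℕ} (hℓ : ℓ ≠ 0) (b : ℕ) (f : MvPolynomial WVar ℚ) :
    yComp b (MvPolynomial.aeval (upSubst 3 m ℓ) f)
      = MvPolynomial.aeval (upSubst 3 m ℓ) (yComp b f) := by
  rw [yComp, markY_aeval_upSubst hℓ, Polynomial.coeff_map]
  rfl

theorem xComp_C_mul (a : ℕ) (q : ℚ) (f : MvPolynomial WVar ℚ) :
    xComp a (MvPolynomial.C q * f) = MvPolynomial.C q * xComp a f := by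
  rw [xComp, map_mul, markX_C, Polynomial.coeff_C_mul, xComp]

theorem yComp_C_mul (b : ℕ) (q : ℚ) (f : MvPolynomial WVar ℚ) :
    yComp b (MvPolynomial.C q * f) = MvPolynomial.C q * yComp b f := by
  rw [yComp, map_mul, markY_C, Polynomial.coeff_C_mul, yComp]

theorem xComp_sum {ι : Type*} (a : ℕ) (s : Finset ι) (f : ι → MvPolynomial WVar ℚ) :
    xComp a (∑ i ∈ s, f i) = ∑ i ∈ s, xComp a (f i) := by
  simp only [xComp, map_sum, Polynomial.finsetSum_coeff]

theorem yComp_sum {ι : Type*} (b : ℕ) (s : Finset ι) (f : ι → MvPolynomial WVar ℚ) :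
    yComp b (∑ i ∈ s, f i) = ∑ i ∈ s, yComp b (f i) := by
  simp only [yComp, map_sum, Polynomial.finsetSum_coeff]

/-- The number of coordinates of a word that are not divisible by `p`. -/
def unitWt {p : ℕ} {ι : Type*} [Fintype ι] {m : ℕ} (c : ι → ZMod (p ^ m)) : ℕ :=
  (Finset.univ.filter fun i => ¬ p ∣ (c i).val).card

section Pairs

variable {ι : Type*} [Fintype ι]

theorem pairVar_eq_x_zero_iff {m ℓ : ℕ} (a : ZMod (3 ^ m)) (b : ZMod (3 ^ ℓ)) :
    pairVar 3 a b = WVar.x 0 ↔ ¬ 3 ∣ a.val := by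
  unfold pairVar natVar
  split_ifs with h1 h2
  · simp [h1]
  · simp [h1]
  · have : a.val ≠ 0 := by rwa [Ne, ZMod.val_eq_zero]
    simp [padicValNat.eq_zero_iff, this]

theorem pairVar_eq_y_zero_iff {m ℓ : ℕ} {a : ZMod (3 ^ m)} {b : ZMod (3 ^ ℓ)} (h : a = 0 ∨ b = 0) :
    pairVar 3 a b = WVar.y 0 ↔ ¬ 3 ∣ b.val := by
  unfold pairVar natVar
  split_ifs with h1 h2
  · simp [h2]
  · simp [padicValNat.eq_zero_iff, h2]
  · simp [h.resolve_left h1]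

open Classical in
theorem markX_pairMon {m ℓ : ℕ} (c : ι → ZMod (3 ^ m)) (d : ι → ZMod (3 ^ ℓ)) :
    markX (pairMon ℚ 3 c d) = C (pairMon ℚ 3 c d) * X ^ unitWt c := by
  have h : ∀ v : WVar, markX (MvPolynomial.X v)
      = C (MvPolynomial.X v) * (if v = WVar.x 0 then X else 1) := by
    rintro ((_ | i) | j | _) <;> simp [markX]
  rw [pairMon, map_prod, Finset.prod_congr rfl fun i _ => h _, Finset.prod_mul_distrib, ← map_prod,
    Finset.prod_ite, Finset.prod_const_one, mul_one, Finset.prod_const, unitWt]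
  simp only [pairVar_eq_x_zero_iff]

open Classical in
theorem markY_pairMon {m ℓ : ℕ} {c : ι → ZMod (3 ^ m)} {d : ι → ZMod (3 ^ ℓ)} (hd : DisjSupp c d) :
    markY (pairMon ℚ 3 c d) = C (pairMon ℚ 3 c d) * X ^ unitWt d := by
  have h : ∀ v : WVar, markY (MvPolynomial.X v)
      = C (MvPolynomial.X v) * (if v = WVar.y 0 then X else 1) := by
    rintro (i | (_ | j) | _) <;> simp [markY]
  rw [pairMon, map_prod, Finset.prod_congr rfl fun i _ => h _, Finset.prod_mul_distrib, ← map_prod,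
    Finset.prod_ite, Finset.prod_const_one, mul_one, Finset.prod_const, unitWt]
  simp only [fun i => pairVar_eq_y_zero_iff (hd i)]

theorem xComp_pairMon {m ℓ : ℕ} (a : ℕ) (q : ℚ) (c : ι → ZMod (3 ^ m)) (d : ι → ZMod (3 ^ ℓ)) :
    xComp a (MvPolynomial.C q * pairMon ℚ 3 c d)
      = if unitWt c = a then MvPolynomial.C q * pairMon ℚ 3 c d else 0 := by
  rw [xComp_C_mul, xComp, markX_pairMon, Polynomial.coeff_C_mul, Polynomial.coeff_X_pow]
  simp [eq_comm]

theorem yComp_pairMon {m ℓ : ℕ} (b : ℕ) (q : ℚ) {c : ι → ZMod (3 ^ m)} {d : ι → ZMod (3 ^ ℓ)}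
    (hd : q ≠ 0 → DisjSupp c d) :
    yComp b (MvPolynomial.C q * pairMon ℚ 3 c d)
      = if unitWt d = b then MvPolynomial.C q * pairMon ℚ 3 c d else 0 := by
  by_cases hq : q = 0
  · simp [hq, yComp]
  rw [yComp_C_mul, yComp, markY_pairMon (hd hq), Polynomial.coeff_C_mul, Polynomial.coeff_X_pow]
  simp [eq_comm]

/-- The exponent vector of the monomial of a pair of words. -/
noncomputable def pairExp {m ℓ : ℕ} (c : ι → ZMod (3 ^ m)) (d : ι → ZMod (3 ^ ℓ)) : WVar →₀ ℕ :=
  ∑ i, Finsupp.single (pairVar 3 (c i) (d i)) 1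

theorem pairMon_eq_monomial {m ℓ : ℕ} (c : ι → ZMod (3 ^ m)) (d : ι → ZMod (3 ^ ℓ)) :
    pairMon ℚ 3 c d = MvPolynomial.monomial (pairExp c d) 1 := by
  rw [pairMon, pairExp]
  symm
  exact MvPolynomial.monomial_sum_one _ _

theorem pairExp_x_zero {m ℓ : ℕ} (c : ι → ZMod (3 ^ m)) (d : ι → ZMod (3 ^ ℓ)) :
    pairExp c d (WVar.x 0) = unitWt c := by
  classical
  rw [pairExp, Finsupp.finsetSum_apply, unitWt, Finset.card_filter]
  refine Finset.sum_congr rfl fun i _ => ?_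
  rw [Finsupp.single_apply]
  simp only [pairVar_eq_x_zero_iff]

theorem pairExp_y_zero {m ℓ : ℕ} {c : ι → ZMod (3 ^ m)} {d : ι → ZMod (3 ^ ℓ)}
    (hd : DisjSupp c d) : pairExp c d (WVar.y 0) = unitWt d := by
  classical
  rw [pairExp, Finsupp.finsetSum_apply, unitWt, Finset.card_filter]
  refine Finset.sum_congr rfl fun i _ => ?_
  rw [Finsupp.single_apply]
  simp only [pairVar_eq_y_zero_iff (hd i)]

end Pairs

/-! ### Partial weight enumerators as sums over pairs -/

section Partial

variable {ι : Type*} [Fintype ι] {K : (m : ℕ) → Submodule (ZMod (3 ^ m)) (ι → ZMod (3 ^ m))}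

theorem disjSupp_of_pairWt_ne_zero {N m ℓ : ℕ} {c : ι → ZMod (3 ^ m)} {d : ι → ZMod (3 ^ ℓ)}
    (h : pairWt K N c d ≠ 0) : DisjSupp c d := by
  by_contra h'
  exact h (pairWt_eq_zero_of_not_disjSupp h')

open Classical in
/-- The partial weight enumerators come from the pairs of words none of which vanishes modulo three.
-/
theorem SelfDualTower.partialWE_eq (hK : SelfDualTower 3 K) {m ℓ N : ℕ} (hN : N = m + ℓ) :
    partialWE 3 K m ℓ =
      ∑ c : ι → ZMod (3 ^ m) with c ∈ K m ∧ (m = 0 ∨ unitWt c ≠ 0),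
        ∑ d : ι → ZMod (3 ^ ℓ) with d ∈ K ℓ ∧ (ℓ = 0 ∨ unitWt d ≠ 0),
          MvPolynomial.C (pairWt K N c d) * pairMon ℚ 3 c d := by
  ext s
  have h1 : MvPolynomial.coeff s (partialWE 3 K m ℓ)
      = if (m = 0 ∨ s (WVar.x 0) ≠ 0) ∧ (ℓ = 0 ∨ s (WVar.y 0) ≠ 0) then
          MvPolynomial.coeff s (disjointWE 3 K m ℓ) else 0 := by
    rw [partialWE, MvPolynomial.coeff_sum]
    simp only [MvPolynomial.coeff_monomial]
    rw [Finset.sum_ite_eq']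
    simp only [Finset.mem_filter, MvPolynomial.mem_support_iff]
    by_cases h : MvPolynomial.coeff s (disjointWE 3 K m ℓ) = 0 <;> simp [h]
  rw [h1, hK.disjointWE_eq_sum_pairs hN]
  simp only [MvPolynomial.coeff_sum, pairMon_eq_monomial, MvPolynomial.coeff_C_mul,
    MvPolynomial.coeff_monomial]
  simp only [Finset.sum_filter]
  rw [← Finset.sum_filter (p := fun c : ι → ZMod (3 ^ m) => c ∈ K m), ite_and]
  have h2 : ∀ (c : ι → ZMod (3 ^ m)) (d : ι → ZMod (3 ^ ℓ)),
      (if (m = 0 ∨ s (WVar.x 0) ≠ 0) then if (ℓ = 0 ∨ s (WVar.y 0) ≠ 0) then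
        (pairWt K N c d * if pairExp c d = s then 1 else 0) else 0 else 0)
      = if (m = 0 ∨ unitWt c ≠ 0) then if (ℓ = 0 ∨ unitWt d ≠ 0) then
        (pairWt K N c d * if pairExp c d = s then 1 else 0) else 0 else 0 := by
    intro c d
    by_cases h : pairWt K N c d = 0
    · simp [h]
    by_cases he : pairExp c d = s
    · subst he
      rw [pairExp_x_zero, pairExp_y_zero (disjSupp_of_pairWt_ne_zero h)]
    · simp [he]
  have h3 : ∀ (P : Prop) [Decidable P] {α : Type _} (t : Finset α) (f : α → ℚ),
      (if P then ∑ a ∈ t, f a else 0) = ∑ a ∈ t, if P then f a else 0 := by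
    intro P _ α t f
    split_ifs <;> simp
  have h4 : ∀ (P Q R : Prop) [Decidable P] [Decidable Q] [Decidable R] (x : ℚ),
      (if P then if Q then if R then x else 0 else 0 else 0)
        = if R then if P then if Q then x else 0 else 0 else 0 := by
    intros
    split_ifs <;> rfl
  rw [h3 (ℓ = 0 ∨ _), h3 (m = 0 ∨ _), Finset.sum_filter]
  refine Finset.sum_congr rfl fun c _ => ?_
  rw [ite_and]
  congr 1
  rw [h3, h3, h3]
  refine Finset.sum_congr rfl fun d _ => ?_
  have h5 := h2 c d
  generalize (pairWt K N c d * if pairExp c d = s then (1 : ℚ) else 0) = x at h5 ⊢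
  grind

end Partial

/-! ### Formal relations between the partial weight enumerators -/

section Relations

variable {ι : Type*} [Fintype ι] {K : (m : ℕ) → Submodule (ZMod (3 ^ m)) (ι → ZMod (3 ^ m))}

open Classical in
/-- The part of `A_{m,ℓ}` contributed by the pairs of words with `a` and `b` unit coordinates. -/
noncomputable def partWE (K : (m : ℕ) → Submodule (ZMod (3 ^ m)) (ι → ZMod (3 ^ m)))
    (m ℓ a b : ℕ) : MvPolynomial WVar ℚ :=
  ∑ c : ι → ZMod (3 ^ m) with c ∈ K m ∧ unitWt c = a,
    ∑ d : ι → ZMod (3 ^ ℓ) with d ∈ K ℓ ∧ unitWt d = b,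
      MvPolynomial.C (pairWt K (m + ℓ) c d) * pairMon ℚ 3 c d

theorem SelfDualTower.yComp_xComp_disjointWE (hK : SelfDualTower 3 K) (m ℓ a b : ℕ) :
    yComp b (xComp a (disjointWE 3 K m ℓ)) = partWE K m ℓ a b := by
  classical
  rw [hK.disjointWE_eq_sum_pairs rfl, partWE, xComp_sum, yComp_sum, Finset.sum_filter,
    Finset.sum_filter]
  refine Finset.sum_congr rfl fun c _ => ?_
  rw [ite_and]
  congr 1
  rw [xComp_sum, yComp_sum]
  simp only [xComp_pairMon]
  split_ifs with h
  · rw [Finset.sum_filter, Finset.sum_filter]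
    refine Finset.sum_congr rfl fun d _ => ?_
    rw [ite_and]
    congr 1
    exact yComp_pairMon b _ disjSupp_of_pairWt_ne_zero
  · simp [yComp]

theorem SelfDualTower.disjointWE_succ (hK : SelfDualTower 3 K) (m ℓ : ℕ) :
    disjointWE 3 K (m + 1) ℓ = MvPolynomial.C ((Nat.card (K 1) : ℚ)⁻¹) *
      MvPolynomial.aeval (upSubst 3 m ℓ) (disjointWE 3 K m (ℓ + 1)) := by
  rw [disjointWE, hK.dual]

theorem SelfDualTower.partWE_succ (hK : SelfDualTower 3 K) {m ℓ : ℕ} (hm : m ≠ 0) (hℓ : ℓ ≠ 0)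
    (a b : ℕ) : partWE K (m + 1) ℓ a b = MvPolynomial.C ((Nat.card (K 1) : ℚ)⁻¹) *
      MvPolynomial.aeval (upSubst 3 m ℓ) (partWE K m (ℓ + 1) a b) := by
  rw [← hK.yComp_xComp_disjointWE, hK.disjointWE_succ, xComp_C_mul, yComp_C_mul,
    xComp_aeval_upSubst hm, yComp_aeval_upSubst hℓ, hK.yComp_xComp_disjointWE]

theorem SelfDualTower.partialWE_eq_sum_partWE (hK : SelfDualTower 3 K) {m ℓ : ℕ} (hm : m ≠ 0)
    (hℓ : ℓ ≠ 0) : partialWE 3 K m ℓ =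
      ∑ a ∈ Finset.Icc 1 (Fintype.card ι), ∑ b ∈ Finset.Icc 1 (Fintype.card ι),
        partWE K m ℓ a b := by
  classical
  rw [hK.partialWE_eq rfl, ← Finset.sum_fiberwise_of_maps_to (g := fun c => unitWt c)
    (t := Finset.Icc 1 (Fintype.card ι))]
  · refine Finset.sum_congr rfl fun a ha => ?_
    have h1 : ∀ c : ι → ZMod (3 ^ m), ∑ d : ι → ZMod (3 ^ ℓ) with d ∈ K ℓ ∧ (ℓ = 0 ∨ unitWt d ≠ 0),
          MvPolynomial.C (pairWt K (m + ℓ) c d) * pairMon ℚ 3 c d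
        = ∑ b ∈ Finset.Icc 1 (Fintype.card ι), ∑ d : ι → ZMod (3 ^ ℓ) with d ∈ K ℓ ∧ unitWt d = b,
          MvPolynomial.C (pairWt K (m + ℓ) c d) * pairMon ℚ 3 c d := by
      intro c
      rw [← Finset.sum_fiberwise_of_maps_to (g := fun c => unitWt c)
        (t := Finset.Icc 1 (Fintype.card ι))]
      · refine Finset.sum_congr rfl fun b hb => Finset.sum_congr ?_ fun _ _ => rfl
        ext d
        have := (Finset.mem_Icc.1 hb).1
        simp only [Finset.mem_filter, Finset.mem_univ, true_and]
        constructor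
        · rintro ⟨⟨h, _⟩, h'⟩; exact ⟨h, h'⟩
        · rintro ⟨h, h'⟩; exact ⟨⟨h, Or.inr (by omega)⟩, h'⟩
      · intro d hd
        have h2 := ((Finset.mem_filter.1 hd).2.2).resolve_left hℓ
        exact Finset.mem_Icc.2 ⟨by omega, Finset.card_le_univ _⟩
    simp only [h1]
    simp only [partWE]
    rw [Finset.sum_comm]
    refine Finset.sum_congr rfl fun b hb => ?_
    refine Finset.sum_congr ?_ fun _ _ => rfl
    ext d
    have := (Finset.mem_Icc.1 ha).1
    simp only [Finset.mem_filter, Finset.mem_univ, true_and]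
    constructor
    · rintro ⟨⟨h, _⟩, h'⟩; exact ⟨h, h'⟩
    · rintro ⟨h, h'⟩; exact ⟨⟨h, Or.inr (by omega)⟩, h'⟩
  · intro d hd
    have h2 := ((Finset.mem_filter.1 hd).2.2).resolve_left hm
    exact Finset.mem_Icc.2 ⟨by omega, Finset.card_le_univ _⟩

theorem SelfDualTower.partialWE_succ (hK : SelfDualTower 3 K) {m ℓ : ℕ} (hm : m ≠ 0)
    (hℓ : ℓ ≠ 0) : partialWE 3 K (m + 1) ℓ = MvPolynomial.C ((Nat.card (K 1) : ℚ)⁻¹) *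
      MvPolynomial.aeval (upSubst 3 m ℓ) (partialWE 3 K m (ℓ + 1)) := by
  rw [hK.partialWE_eq_sum_partWE (by omega) hℓ, hK.partialWE_eq_sum_partWE hm (by omega)]
  simp only [map_sum, Finset.mul_sum, hK.partWE_succ hm hℓ]

/-- The exchange of the variables `x_i` and `y_i`. -/
def swapVar : WVar → WVar
  | WVar.x i => WVar.y i
  | WVar.y i => WVar.x i
  | WVar.z => WVar.z

theorem swapVar_pairVar {m ℓ : ℕ} {a : ZMod (3 ^ m)} {b : ZMod (3 ^ ℓ)} (h : a = 0 ∨ b = 0) :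
    swapVar (pairVar 3 a b) = pairVar 3 b a := by
  unfold pairVar natVar
  by_cases ha : a = 0 <;> by_cases hb : b = 0 <;>
    simp_all [swapVar, ZMod.val_eq_zero]

theorem rename_swapVar_pairMon {m ℓ : ℕ} {c : ι → ZMod (3 ^ m)} {d : ι → ZMod (3 ^ ℓ)}
    (h : DisjSupp c d) :
    MvPolynomial.rename swapVar (pairMon ℚ 3 c d) = pairMon ℚ 3 d c := by
  simp only [pairMon, map_prod, MvPolynomial.rename_X, fun i => swapVar_pairVar (h i)]

theorem SelfDualTower.rename_swapVar_term (hK : SelfDualTower 3 K) {m ℓ N : ℕ} (hN : N = m + ℓ)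
    {c : ι → ZMod (3 ^ m)} (hc : c ∈ K m) {d : ι → ZMod (3 ^ ℓ)} (hd : d ∈ K ℓ) :
    MvPolynomial.rename swapVar (MvPolynomial.C (pairWt K N c d) * pairMon ℚ 3 c d)
      = MvPolynomial.C (pairWt K N d c) * pairMon ℚ 3 d c := by
  rw [map_mul, MvPolynomial.rename_C, hK.pairWt_swap hN hc hd]
  by_cases h : pairWt K N c d = 0
  · simp [h]
  · rw [rename_swapVar_pairMon (disjSupp_of_pairWt_ne_zero h)]

/-- The symmetry of the disjoint weight enumerators under the exchange of the two words. -/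
theorem SelfDualTower.partWE_swap (hK : SelfDualTower 3 K) (m ℓ a b : ℕ) :
    partWE K ℓ m b a = MvPolynomial.rename swapVar (partWE K m ℓ a b) := by
  classical
  rw [partWE, partWE, Finset.sum_comm, map_sum]
  refine Finset.sum_congr rfl fun c hc => ?_
  rw [map_sum]
  refine Finset.sum_congr rfl fun d hd => ?_
  rw [hK.rename_swapVar_term rfl (Finset.mem_filter.1 hc).2.1 (Finset.mem_filter.1 hd).2.1,
    add_comm m ℓ]

/-- The monomial of a word. -/
noncomputable def wordMon {m : ℕ} (c : ι → ZMod (3 ^ m)) : MvPolynomial WVar ℚ :=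
  ∏ i, MvPolynomial.X (natVar 3 WVar.x (c i).val)

theorem pairMon_zero_right {m : ℕ} (ℓ : ℕ) (c : ι → ZMod (3 ^ m)) :
    pairMon ℚ 3 c (0 : ι → ZMod (3 ^ ℓ)) = wordMon c := by
  refine Finset.prod_congr rfl fun i _ => ?_
  unfold pairVar natVar
  by_cases h : c i = 0 <;> simp [h, ZMod.val_eq_zero]

theorem SelfDualTower.pairWt_zero_right (hK : SelfDualTower 3 K) {m ℓ N : ℕ} (hN : N = m + ℓ)
    {c : ι → ZMod (3 ^ m)} (hc : c ∈ K m) : pairWt K N c (0 : ι → ZMod (3 ^ ℓ)) = 1 := by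
  rw [hK.pairWt_eq hN hc (d := 0) (D := 0) (K N).zero_mem (fun i => by simp) (fun i => Or.inr rfl)]
  simp [pairing, avgPsi]

theorem eq_zero_of_subsingleton (d : ι → ZMod (3 ^ 0)) : d = 0 := by
  have : Subsingleton (ZMod (3 ^ 0)) := by rw [pow_zero]; infer_instance
  exact Subsingleton.elim _ _

theorem unitWt_eq_zero_iff (c : ι → ZMod (3 ^ 1)) : unitWt c = 0 ↔ c = 0 := by
  rw [unitWt, Finset.card_eq_zero, Finset.filter_eq_empty_iff, funext_iff]
  refine forall_congr' fun i => ?_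
  simp only [Finset.mem_univ, true_imp_iff, not_not, Pi.zero_apply]
  constructor
  · intro h
    exact (ZMod.val_eq_zero _).1 (Nat.eq_zero_of_dvd_of_lt h (ZMod.val_lt (c i)))
  · intro h
    simp [h]

open Classical in
theorem sum_filter_zero {M : Type*} [AddCommMonoid M] {n : ℕ} [NeZero n]
    (L : Submodule (ZMod n) (ι → ZMod n)) (f : (ι → ZMod n) → M) :
    ∑ d : ι → ZMod n with d ∈ L ∧ d = 0, f d = f 0 := by
  rw [Finset.sum_eq_single 0]
  · intro d hd h
    exact absurd (Finset.mem_filter.1 hd).2.2 h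
  · intro h
    exact absurd (Finset.mem_filter.2 ⟨Finset.mem_univ _, L.zero_mem, rfl⟩) h

open Classical in
theorem SelfDualTower.partialWE_zero_right (hK : SelfDualTower 3 K) (m : ℕ) :
    partialWE 3 K m 0 = ∑ c : ι → ZMod (3 ^ m) with c ∈ K m ∧ (m = 0 ∨ unitWt c ≠ 0),
      wordMon c := by
  rw [hK.partialWE_eq (N := m) rfl]
  refine Finset.sum_congr rfl fun c hc => ?_
  rw [Finset.sum_eq_single 0]
  · rw [hK.pairWt_zero_right (Nat.add_zero m).symm (Finset.mem_filter.1 hc).2.1, pairMon_zero_right,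
      map_one, one_mul]
  · intro d _ h
    exact absurd (eq_zero_of_subsingleton d) h
  · intro h
    exact absurd (Finset.mem_filter.2 ⟨Finset.mem_univ _, (K 0).zero_mem, Or.inl rfl⟩) h

open Classical in
theorem SelfDualTower.disjointWE_zero_right (hK : SelfDualTower 3 K) (m : ℕ) :
    disjointWE 3 K m 0 = ∑ c : ι → ZMod (3 ^ m) with c ∈ K m, wordMon c := by
  rw [hK.disjointWE_eq_sum_pairs (N := m) rfl]
  refine Finset.sum_congr rfl fun c hc => ?_
  rw [Finset.sum_eq_single 0]
  · rw [hK.pairWt_zero_right (Nat.add_zero m).symm (Finset.mem_filter.1 hc).2, pairMon_zero_right,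
      map_one, one_mul]
  · intro d _ h
    exact absurd (eq_zero_of_subsingleton d) h
  · intro h
    exact absurd (Finset.mem_filter.2 ⟨Finset.mem_univ _, (K 0).zero_mem⟩) h

open Classical in
theorem swe_eq_sum_wordMon (m : ℕ) :
    swe 3 m WVar.x (K m) = ∑ c : ι → ZMod (3 ^ m) with c ∈ K m, wordMon c := by
  rw [swe]
  simp only [letterVar_eq_natVar, wordMon]

theorem SelfDualTower.disjointWE_zero_right_eq_swe (hK : SelfDualTower 3 K) (m : ℕ) :
    disjointWE 3 K m 0 = swe 3 m WVar.x (K m) := by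
  rw [hK.disjointWE_zero_right, swe_eq_sum_wordMon]

/-! ### The weight enumerators of the lifts -/

theorem natVar_embMod {m : ℕ} (e : ZMod (3 ^ m)) :
    natVar 3 WVar.x (embMod 3 (m + 1) e).val = shiftX 1 (natVar 3 WVar.x e.val) := by
  by_cases h : e = 0
  · simp [h, embMod_zero, natVar, shiftX]
  have h1 : e.val ≠ 0 := by rwa [Ne, ZMod.val_eq_zero]
  have hv : (embMod 3 (m + 1) e).val = 3 * e.val := by
    rw [embMod, Nat.add_sub_cancel_left, pow_one, ← Nat.cast_mul, ZMod.val_cast_of_lt]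
    have := ZMod.val_lt e
    rw [pow_succ]
    generalize e.val = k at *
    omega
  rw [hv, natVar, natVar, if_neg (by omega), if_neg h1, padicValNat.mul (by norm_num) h1,
    padicValNat_self, shiftX, add_comm]

theorem unitWt_eq_zero_iff_redMod {m : ℕ} (c : ι → ZMod (3 ^ (m + 1))) :
    unitWt c = 0 ↔ ∀ i, redMod 3 (show 1 ≤ m + 1 by omega) (c i) = 0 := by
  rw [unitWt, Finset.card_eq_zero, Finset.filter_eq_empty_iff]
  refine forall_congr' fun i => ?_
  rw [redMod_eq_zero_iff, pow_one]
  simp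

open Classical in
/-- A word modulo `3 ^ (m + 1)` either has an entry that is a unit, or is three times a word modulo
`3 ^ m`. -/
theorem SelfDualTower.swe_succ (hK : SelfDualTower 3 K) (m : ℕ) :
    swe 3 (m + 1) WVar.x (K (m + 1)) = partialWE 3 K (m + 1) 0 +
      MvPolynomial.rename (shiftX 1) (swe 3 m WVar.x (K m)) := by
  rw [swe_eq_sum_wordMon, swe_eq_sum_wordMon, hK.partialWE_zero_right,
    ← Finset.sum_filter_add_sum_filter_not _ (fun c => unitWt c ≠ 0), Finset.filter_filter,
    Finset.filter_filter]
  congr 1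
  · simp
  · symm
    rw [map_sum]
    refine Finset.sum_bij (fun e _ => fun i => embMod 3 (m + 1) (e i)) ?_ ?_ ?_ ?_
    · intro e he
      simp only [Finset.mem_filter, Finset.mem_univ, true_and, not_not] at he ⊢
      refine ⟨hK.embMod_mem (by omega) he, ?_⟩
      rw [unitWt_eq_zero_iff_redMod]
      exact fun i => redMod_embMod rfl (e i)
    · intro e _ e' _ h
      funext i
      exact embMod_injective (by omega) (congrFun h i)
    · intro c hc
      simp only [Finset.mem_filter, Finset.mem_univ, true_and, not_not] at hc
      obtain ⟨e, he, hec⟩ := hK.exists_embMod rfl hc.1 ((unitWt_eq_zero_iff_redMod c).1 hc.2)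
      exact ⟨e, by simpa using he, hec⟩
    · intro e _
      rw [wordMon, wordMon, map_prod]
      simp only [MvPolynomial.rename_X, natVar_embMod]

theorem shiftX_comp (a b : ℕ) : shiftX a ∘ shiftX b = shiftX (b + a) := by
  funext v
  rcases v with i | j | _ <;> simp [shiftX, add_assoc]

theorem SelfDualTower.swe_eq_sum_partialWE (hK : SelfDualTower 3 K) (m : ℕ) :
    swe 3 m WVar.x (K m) = ∑ i ∈ Finset.range (m + 1),
      MvPolynomial.rename (shiftX (m - i)) (partialWE 3 K i 0) := by
  classical
  have hid : shiftX 0 = id := by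
    funext v
    rcases v with i | j | _ <;> simp [shiftX]
  induction m with
  | zero =>
    rw [swe_eq_sum_wordMon, Finset.sum_range_one, hK.partialWE_zero_right, hid,
      MvPolynomial.rename_id_apply]
    simp
  | succ m ih =>
    rw [hK.swe_succ, ih, Finset.sum_range_succ _ (m + 1), Nat.sub_self, hid,
      MvPolynomial.rename_id_apply, add_comm, map_sum]
    congr 1
    refine Finset.sum_congr rfl fun i hi => ?_
    have := Finset.mem_range.1 hi
    rw [MvPolynomial.rename_rename, shiftX_comp, show m - i + 1 = m + 1 - i by omega]

theorem SelfDualTower.partialWE_add (hK : SelfDualTower 3 K) {m : ℕ} (hm : m ≠ 0) :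
    partialWE 3 K m 0 + partialWE 3 K m 1
      = disjointWE 3 K m 1 - xComp 0 (disjointWE 3 K m 1) := by
  classical
  rw [hK.partialWE_zero_right, hK.partialWE_eq rfl, hK.disjointWE_eq_sum_pairs rfl, xComp_sum,
    ← Finset.sum_sub_distrib, ← Finset.sum_add_distrib, Finset.sum_filter, Finset.sum_filter]
  refine Finset.sum_congr rfl fun c _ => ?_
  by_cases hc : c ∈ K m
  swap
  · simp [hc]
  simp only [hc, true_and, hm, false_or, if_true, xComp_sum, xComp_pairMon]
  by_cases h : unitWt c = 0
  · simp [h]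
  · simp only [h, ne_eq, not_false_eq_true, if_true, if_false, Finset.sum_const_zero, sub_zero,
      unitWt_eq_zero_iff, one_ne_zero, false_or]
    rw [← Finset.sum_filter_add_sum_filter_not (Finset.univ.filter fun d : ι → ZMod (3 ^ 1) =>
      d ∈ K 1) (fun d => d = 0), Finset.filter_filter, Finset.filter_filter, sum_filter_zero,
      hK.pairWt_zero_right rfl hc, pairMon_zero_right, map_one, one_mul]

theorem SelfDualTower.partialWE_succ_zero (hK : SelfDualTower 3 K) {m : ℕ} (hm : m ≠ 0) :
    partialWE 3 K (m + 1) 0 = MvPolynomial.C ((Nat.card (K 1) : ℚ)⁻¹) *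
      MvPolynomial.aeval (upSubst 3 m 0) (partialWE 3 K m 0 + partialWE 3 K m 1) := by
  classical
  have h1 : partialWE 3 K (m + 1) 0
      = disjointWE 3 K (m + 1) 0 - xComp 0 (disjointWE 3 K (m + 1) 0) := by
    rw [hK.partialWE_zero_right, hK.disjointWE_zero_right, xComp_sum, ← Finset.sum_sub_distrib,
      Finset.sum_filter, Finset.sum_filter]
    refine Finset.sum_congr rfl fun c _ => ?_
    have h2 := xComp_pairMon 0 1 c (0 : ι → ZMod (3 ^ 0))
    rw [map_one, one_mul, pairMon_zero_right] at h2
    rw [h2, ite_and]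
    congr 1
    by_cases h : unitWt c = 0 <;> simp [h]
  rw [h1, hK.partialWE_add hm, hK.disjointWE_succ, map_sub, mul_sub, xComp_C_mul,
    xComp_aeval_upSubst hm]

theorem wordMon_zero (m : ℕ) : wordMon (0 : ι → ZMod (3 ^ m))
    = MvPolynomial.X WVar.z ^ Fintype.card ι := by
  simp [wordMon, natVar, Finset.card_univ]

theorem SelfDualTower.partialWE_zero_zero (hK : SelfDualTower 3 K) :
    partialWE 3 K 0 0 = MvPolynomial.X WVar.z ^ Fintype.card ι := by
  classical
  rw [hK.partialWE_zero_right, Finset.sum_eq_single 0, wordMon_zero]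
  · intro d _ h
    exact absurd (eq_zero_of_subsingleton d) h
  · intro h
    exact absurd (Finset.mem_filter.2 ⟨Finset.mem_univ _, (K 0).zero_mem, Or.inl rfl⟩) h

theorem SelfDualTower.disjointWE_one_one (hK : SelfDualTower 3 K) :
    disjointWE 3 K 1 1 = MvPolynomial.X WVar.z ^ Fintype.card ι + partialWE 3 K 1 0
      + MvPolynomial.rename swapVar (partialWE 3 K 1 0) + partialWE 3 K 1 1 := by
  classical
  have hswap : MvPolynomial.rename swapVar (partialWE 3 K 1 0)
      = ∑ d : ι → ZMod (3 ^ 1) with d ∈ K 1 ∧ (1 = 0 ∨ unitWt d ≠ 0),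
          MvPolynomial.C (pairWt K 2 (0 : ι → ZMod (3 ^ 1)) d) *
            pairMon ℚ 3 (0 : ι → ZMod (3 ^ 1)) d := by
    rw [hK.partialWE_zero_right, map_sum]
    refine Finset.sum_congr rfl fun d hd => ?_
    have hd' := (Finset.mem_filter.1 hd).2.1
    rw [← hK.rename_swapVar_term (show 2 = 1 + 1 from rfl) hd' (K 1).zero_mem,
      hK.pairWt_zero_right (show 2 = 1 + 1 from rfl) hd', pairMon_zero_right, map_one, one_mul]
  have hsplit : ∀ f : (ι → ZMod (3 ^ 1)) → MvPolynomial WVar ℚ,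
      ∑ d : ι → ZMod (3 ^ 1) with d ∈ K 1, f d = f 0 +
        ∑ d : ι → ZMod (3 ^ 1) with d ∈ K 1 ∧ (1 = 0 ∨ unitWt d ≠ 0), f d := by
    intro f
    rw [← Finset.sum_filter_add_sum_filter_not (Finset.univ.filter fun d : ι → ZMod (3 ^ 1) =>
      d ∈ K 1) (fun d => d = 0), Finset.filter_filter, Finset.filter_filter, sum_filter_zero]
    simp only [unitWt_eq_zero_iff, one_ne_zero, false_or, ne_eq]
  rw [hswap, hK.partialWE_eq (m := 1) (ℓ := 1) (N := 2) rfl, hK.partialWE_zero_right,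
    hK.disjointWE_eq_sum_pairs (N := 2) rfl, hsplit]
  simp only [hsplit (fun d => MvPolynomial.C (pairWt K 2 _ d) * pairMon ℚ 3 _ d)]
  rw [Finset.sum_add_distrib, hK.pairWt_zero_right (show 2 = 1 + 1 from rfl) (K 1).zero_mem,
    pairMon_zero_right,
    wordMon_zero, map_one, one_mul]
  have h3 : ∑ c : ι → ZMod (3 ^ 1) with c ∈ K 1 ∧ (1 = 0 ∨ unitWt c ≠ 0),
      MvPolynomial.C (pairWt K 2 c (0 : ι → ZMod (3 ^ 1))) * pairMon ℚ 3 c (0 : ι → ZMod (3 ^ 1))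
      = ∑ c : ι → ZMod (3 ^ 1) with c ∈ K 1 ∧ (1 = 0 ∨ unitWt c ≠ 0), wordMon c := by
    refine Finset.sum_congr rfl fun c hc => ?_
    rw [hK.pairWt_zero_right (show 2 = 1 + 1 from rfl) (Finset.mem_filter.1 hc).2.1,
      pairMon_zero_right, map_one, one_mul]
  rw [h3]
  ring

end Relations

/-! ### The extended quadratic residue code over a ring with a root of `X ^ 2 + X + 6` -/

/-- The integers `a_k` with `g = ∑ (a_k + b_k θ) X ^ k`. -/
def genA (k : ℕ) : ℤ := [-1, -1, 2, 4, 4, 3, -1, -3, -4, -3, 0, 1].getD k 0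

/-- The integers `b_k` with `g = ∑ (a_k + b_k θ) X ^ k`. -/
def genB (k : ℕ) : ℤ := [0, -1, -1, 0, 1, 2, 2, 1, 0, -1, -1, 0].getD k 0

/-- The integral part of the entries of the generator matrix. -/
def rowA (i : Fin 12) (j : Fin 24) : ℤ :=
  if j = 23 then 1 else if i.val ≤ j.val then genA (j.val - i.val) else 0

/-- The `θ`-part of the entries of the generator matrix. -/
def rowB (i : Fin 12) (j : Fin 24) : ℤ :=
  if j = 23 then 0 else if i.val ≤ j.val then genB (j.val - i.val) else 0

section Code

variable {R : Type*} [CommRing R]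

/-- The rows of the generator matrix: the shifts of the coefficient vector of `g`, extended by `1`
at the last coordinate, which stands for infinity. -/
def qrRow (θ : R) (i : Fin 12) (j : Fin 24) : R := (rowA i j : R) + (rowB i j : R) * θ

/-- The extended quadratic residue code, normalized such that `g` is extended by `1`. -/
def qrCode (θ : R) : Submodule R (Fin 24 → R) := Submodule.span R (Set.range (qrRow θ))

theorem mem_qrCode {θ : R} {v : Fin 24 → R} :
    v ∈ qrCode θ ↔ ∃ u : Fin 12 → R, v = fun j => ∑ i, u i * qrRow θ i j := by
  rw [qrCode, Submodule.mem_span_range_iff_exists_fun]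
  refine exists_congr fun u => ?_
  rw [eq_comm, funext_iff, funext_iff]
  simp [Finset.sum_apply]

theorem qrRow_mem (θ : R) (i : Fin 12) : qrRow θ i ∈ qrCode θ :=
  Submodule.subset_span ⟨i, rfl⟩

theorem sum_qrRow_mul_qrRow {θ : R} (hθ : θ ^ 2 + θ + 6 = 0) (i k : Fin 12) :
    ∑ j, qrRow θ i j * qrRow θ k j = 0 := by
  -- The components of the inner product with respect to `1` and `θ`, reduced by `θ ^ 2 = -θ - 6`.
  have h1 : ∀ i k : Fin 12, ∑ j, (rowA i j * rowA k j - 6 * (rowB i j * rowB k j)) = 0 := by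
    decide +kernel
  have h2 : ∀ i k : Fin 12,
      ∑ j, (rowA i j * rowB k j + rowB i j * rowA k j - rowB i j * rowB k j) = 0 := by
    decide +kernel
  have h3 : ∀ j, qrRow θ i j * qrRow θ k j
      = ((rowA i j * rowA k j - 6 * (rowB i j * rowB k j) : ℤ) : R)
        + ((rowA i j * rowB k j + rowB i j * rowA k j - rowB i j * rowB k j : ℤ) : R) * θ := by
    intro j
    simp only [qrRow]
    push_cast
    linear_combination (rowB i j : R) * (rowB k j : R) * hθ
  rw [Finset.sum_congr rfl fun j _ => h3 j, Finset.sum_add_distrib, ← Finset.sum_mul,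
    ← Int.cast_sum, ← Int.cast_sum, h1, h2]
  simp

/-- The splitting of the coordinates into the information set `{11, …, 22}` and its complement. -/
noncomputable def coordSplit : Fin 12 ⊕ Fin 12 ≃ Fin 24 :=
  Equiv.ofBijective (Sum.elim (fun j : Fin 12 => if j.val < 11 then ⟨j.val, by omega⟩ else 23)
    (fun i : Fin 12 => ⟨11 + i.val, by omega⟩)) (by decide)

/-- The columns of the generator matrix outside the information set. -/
noncomputable def leftMat (θ : R) : Matrix (Fin 12) (Fin 12) R :=
  Matrix.of fun i j => qrRow θ i (coordSplit (Sum.inl j))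

/-- The columns of the generator matrix in the information set. -/
noncomputable def rightMat (θ : R) : Matrix (Fin 12) (Fin 12) R :=
  Matrix.of fun i j => qrRow θ i (coordSplit (Sum.inr j))

/-- The matrix is triangular with the leading coefficient of `g` on the diagonal. -/
theorem det_rightMat (θ : R) : (rightMat θ).det = 1 := by
  have hA : ∀ i j : Fin 12, i < j → rowA i ⟨11 + j.val, by omega⟩ = 0 := by decide
  have hB : ∀ i j : Fin 12, i < j → rowB i ⟨11 + j.val, by omega⟩ = 0 := by decide
  have hA' : ∀ i : Fin 12, rowA i ⟨11 + i.val, by omega⟩ = 1 := by decide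
  have hB' : ∀ i : Fin 12, rowB i ⟨11 + i.val, by omega⟩ = 0 := by decide
  have he : ∀ j : Fin 12, coordSplit (Sum.inr j) = ⟨11 + j.val, by omega⟩ := fun _ => rfl
  rw [Matrix.det_of_isLowerTriangular]
  · refine Finset.prod_eq_one fun i _ => ?_
    simp [rightMat, he, qrRow, hA', hB']
  · intro i j hij
    simp [rightMat, he, qrRow, hA i j hij, hB i j hij]

theorem leftMat_mul_transpose {θ : R} (hθ : θ ^ 2 + θ + 6 = 0) :
    leftMat θ * (leftMat θ).transpose = -(rightMat θ * (rightMat θ).transpose) := by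
  rw [eq_neg_iff_add_eq_zero]
  ext i k
  have := sum_qrRow_mul_qrRow hθ i k
  rw [← Equiv.sum_comp coordSplit, Fintype.sum_sum_type] at this
  simpa [Matrix.mul_apply, leftMat, rightMat] using this

/-- By orthogonality, `det L ^ 2 = det (-R * Rᵀ) = 1` for the two parts `L`, `R` of the matrix. -/
theorem isUnit_det_leftMat {θ : R} (hθ : θ ^ 2 + θ + 6 = 0) : IsUnit (leftMat θ).det := by
  have h := congrArg Matrix.det (leftMat_mul_transpose hθ)
  rw [Matrix.det_neg, Matrix.det_mul, Matrix.det_mul, Matrix.det_transpose, Matrix.det_transpose,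
    det_rightMat, mul_one, mul_one] at h
  refine isUnit_of_mul_isUnit_left (y := (leftMat θ).det) ?_
  rw [h]
  exact (isUnit_one.neg).pow _

/-- The rows are orthogonal to each other, and the columns of the generator matrix in the
information set, as well as the remaining ones, form invertible square matrices; so a word of the
dual code is determined by its entries in the information set. -/
theorem dualCode_qrCode {θ : R} (hθ : θ ^ 2 + θ + 6 = 0) : dualCode (qrCode θ) = qrCode θ := by
  ext v
  constructor
  · intro hv
    have hT : IsUnit (rightMat θ).transpose.det := by
      rw [Matrix.det_transpose, det_rightMat]; exact isUnit_one
    set vI : Fin 12 → R := fun k => v (coordSplit (Sum.inr k)) with hvI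
    set u := (rightMat θ).transpose⁻¹.mulVec vI with hu
    have hTu : (rightMat θ).transpose.mulVec u = vI := by
      rw [hu, Matrix.mulVec_mulVec, Matrix.mul_nonsing_inv _ hT, Matrix.one_mulVec]
    set w : Fin 24 → R := fun j => v j - ∑ i, u i * qrRow θ i j with hw
    have hwI : ∀ k, w (coordSplit (Sum.inr k)) = 0 := by
      intro k
      have := congrFun hTu k
      rw [hw, sub_eq_zero]
      rw [hvI] at this
      simp only at this ⊢
      rw [← this]
      simp [Matrix.mulVec, dotProduct, rightMat, mul_comm]
    have hworth : ∀ i, ∑ j, qrRow θ i j * w j = 0 := by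
      intro i
      simp only [hw, mul_sub, Finset.sum_sub_distrib]
      rw [hv _ (qrRow_mem θ i), zero_sub, neg_eq_zero]
      simp only [Finset.mul_sum]
      rw [Finset.sum_comm]
      refine Finset.sum_eq_zero fun k _ => ?_
      rw [← mul_zero (u k), ← sum_qrRow_mul_qrRow hθ i k, Finset.mul_sum]
      exact Finset.sum_congr rfl fun j _ => by ring
    have hwJ : (leftMat θ).mulVec (fun k => w (coordSplit (Sum.inl k))) = 0 := by
      funext i
      have := hworth i
      rw [← Equiv.sum_comp coordSplit, Fintype.sum_sum_type] at this
      simpa [hwI, Matrix.mulVec, dotProduct, leftMat] using this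
    have hwJ0 := Matrix.mulVec_injective_of_isUnit
      ((Matrix.isUnit_iff_isUnit_det _).2 (isUnit_det_leftMat hθ))
      (hwJ.trans (Matrix.mulVec_zero _).symm)
    refine mem_qrCode.2 ⟨u, funext fun j => ?_⟩
    rw [← sub_eq_zero]
    change w j = 0
    obtain ⟨s, rfl⟩ := coordSplit.surjective j
    rcases s with k | k
    · exact congrFun hwJ0 k
    · exact hwI k
  · intro hv c hc
    obtain ⟨u, rfl⟩ := mem_qrCode.1 hv
    obtain ⟨u', rfl⟩ := mem_qrCode.1 hc
    simp only [Finset.sum_mul, Finset.mul_sum]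
    rw [Finset.sum_comm]
    refine Finset.sum_eq_zero fun i _ => ?_
    rw [Finset.sum_comm]
    refine Finset.sum_eq_zero fun k _ => ?_
    rw [← mul_zero (u' k * u i), ← sum_qrRow_mul_qrRow hθ k i, Finset.mul_sum]
    exact Finset.sum_congr rfl fun j _ => by ring

theorem qrCode_coeff_injective (θ : R) :
    Function.Injective fun (u : Fin 12 → R) (j : Fin 24) => ∑ i, u i * qrRow θ i j := by
  intro u u' h
  have hT : IsUnit (rightMat θ).transpose.det := by
    rw [Matrix.det_transpose, det_rightMat]; exact isUnit_one
  refine Matrix.mulVec_injective_of_isUnit ((Matrix.isUnit_iff_isUnit_det _).2 hT)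
    (funext fun k => ?_)
  have := congrFun h (coordSplit (Sum.inr k))
  simpa [Matrix.mulVec, dotProduct, rightMat, mul_comm] using this

end Code

/-! ### The tower of quadratic residue codes modulo the powers of three -/

/-- The extended quadratic residue code modulo `3 ^ m`. -/
noncomputable def qrTower (θ : ℤ_[3]) (m : ℕ) : Submodule (ZMod (3 ^ m)) (Fin 24 → ZMod (3 ^ m)) :=
  qrCode (PadicInt.toZModPow m θ)

theorem redMod_toZModPow {p : ℕ} [Fact p.Prime] {m N : ℕ} (h : m ≤ N) (t : ℤ_[p]) :
    redMod p h (PadicInt.toZModPow N t) = PadicInt.toZModPow m t := by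
  have := PadicInt.zmod_cast_comp_toZModPow m N h (p := p)
  exact DFunLike.congr_fun this t

theorem toZModPow_root {θ : ℤ_[3]} (hθ : θ ^ 2 + θ + 6 = 0) (m : ℕ) :
    (PadicInt.toZModPow m θ) ^ 2 + PadicInt.toZModPow m θ + 6 = 0 := by
  have := congrArg (PadicInt.toZModPow m) hθ
  simpa only [map_add, map_pow, map_ofNat, map_zero] using this

theorem redMod_qrRow (θ : ℤ_[3]) {m N : ℕ} (h : m ≤ N) (i : Fin 12) (j : Fin 24) :
    redMod 3 h (qrRow (PadicInt.toZModPow N θ) i j) = qrRow (PadicInt.toZModPow m θ) i j := by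
  simp [qrRow, redMod_toZModPow]

theorem selfDualTower_qrTower {θ : ℤ_[3]} (hθ : θ ^ 2 + θ + 6 = 0) :
    SelfDualTower 3 (qrTower θ) where
  dual m := dualCode_qrCode (toZModPow_root hθ m)
  red := by
    intro m N h c hc
    obtain ⟨u, rfl⟩ := mem_qrCode.1 hc
    refine mem_qrCode.2 ⟨fun i => redMod 3 h (u i), funext fun j => ?_⟩
    simp [redMod_qrRow]
  lift := by
    intro m N h c hc
    obtain ⟨u, rfl⟩ := mem_qrCode.1 hc
    refine ⟨fun j => ∑ i, ((u i).val : ZMod (3 ^ N)) * qrRow (PadicInt.toZModPow N θ) i j,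
      mem_qrCode.2 ⟨_, rfl⟩, funext fun j => ?_⟩
    rw [map_sum]
    refine Finset.sum_congr rfl fun i _ => ?_
    rw [map_mul, redMod_natCast_val, redMod_qrRow]

theorem card_qrTower_one (θ : ℤ_[3]) : Nat.card (qrTower θ 1) = 3 ^ 12 := by
  have h : Set.range (fun (u : Fin 12 → ZMod (3 ^ 1)) (j : Fin 24) =>
      ∑ i, u i * qrRow (PadicInt.toZModPow 1 θ) i j) = (qrTower θ 1 : Set _) := by
    ext v
    rw [SetLike.mem_coe, qrTower, mem_qrCode, Set.mem_range]
    exact exists_congr fun u => eq_comm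
  have h2 := Nat.card_range_of_injective (qrCode_coeff_injective (PadicInt.toZModPow 1 θ))
  rw [h] at h2
  refine h2.trans ?_
  rw [Nat.card_eq_fintype_card, Fintype.card_fun, ZMod.card, Fintype.card_fin]
  norm_num

/-! ### Quadratic residue generators -/

/-- The polynomial `g` attached to a root `θ` of `X ^ 2 + X + 6`. -/
noncomputable def genPoly {R : Type*} [CommRing R] (θ : R) : R[X] :=
  ∑ k ∈ Finset.range 12, C ((genA k : R) + (genB k : R) * θ) * X ^ k

section Gen

variable {R : Type*} [CommRing R]

theorem genPoly_coeff (θ : R) (k : ℕ) :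
    (genPoly θ).coeff k = (genA k : R) + (genB k : R) * θ := by
  rw [genPoly, Polynomial.finsetSum_coeff]
  simp only [Polynomial.coeff_C_mul_X_pow]
  rw [Finset.sum_ite_eq]
  split_ifs with h
  · rfl
  · have : 12 ≤ k := by simpa using h
    have h1 : genA k = 0 := List.getD_eq_default _ _ this
    have h2 : genB k = 0 := List.getD_eq_default _ _ this
    simp [h1, h2]

theorem genPoly_map {S : Type*} [CommRing S] (f : R →+* S) (θ : R) :
    (genPoly θ).map f = genPoly (f θ) := by
  ext k
  simp [genPoly_coeff]

theorem genPoly_eval (θ x : R) : (genPoly θ).eval x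
    = (-1 - x + 2 * x ^ 2 + 4 * x ^ 3 + 4 * x ^ 4 + 3 * x ^ 5 - x ^ 6 - 3 * x ^ 7 - 4 * x ^ 8
        - 3 * x ^ 9 + x ^ 11)
      + (-x - x ^ 2 + x ^ 4 + 2 * x ^ 5 + 2 * x ^ 6 + x ^ 7 - x ^ 9 - x ^ 10) * θ := by
  simp [genPoly, Finset.sum_range_succ, genA, genB]
  ring

theorem genPoly_natDegree_le (θ : R) : (genPoly θ).degree < (12 : ℕ) := by
  rw [Polynomial.degree_lt_iff_coeff_zero]
  intro k hk
  have h1 : genA k = 0 := List.getD_eq_default _ _ hk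
  have h2 : genB k = 0 := List.getD_eq_default _ _ hk
  simp [genPoly_coeff, h1, h2]

theorem genPoly_monic (θ : R) : (genPoly θ).Monic := by
  refine Polynomial.monic_of_degree_le 11 ?_ ?_
  · exact Order.lt_succ_iff.1 (genPoly_natDegree_le θ)
  · simp [genPoly_coeff, genA, genB]

theorem genPoly_eval_mul {θ : R} (hθ : θ ^ 2 + θ + 6 = 0) (x : R) :
    (x - 1) * ((genPoly θ).eval x * (genPoly (-1 - θ)).eval x) = x ^ 23 - 1 := by
  rw [genPoly_eval, genPoly_eval]
  linear_combination
    -(x - 1) * (-x - x ^ 2 + x ^ 4 + 2 * x ^ 5 + 2 * x ^ 6 + x ^ 7 - x ^ 9 - x ^ 10) ^ 2 * hθ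

/-- The roots of `genPoly θ` are closed under squaring. -/
theorem genPoly_eval_sq {θ : R} (hθ : θ ^ 2 + θ + 6 = 0) (x : R) :
    (genPoly θ).eval (x ^ 2) = -((genPoly θ).eval x * (genPoly θ).eval (-x)) := by
  rw [genPoly_eval, genPoly_eval, genPoly_eval]
  linear_combination
    (-x - x ^ 2 + x ^ 4 + 2 * x ^ 5 + 2 * x ^ 6 + x ^ 7 - x ^ 9 - x ^ 10) *
      (x - x ^ 2 + x ^ 4 - 2 * x ^ 5 + 2 * x ^ 6 - x ^ 7 + x ^ 9 - x ^ 10) * hθ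

theorem genPoly_eval_one_sq {θ : R} (hθ : θ ^ 2 + θ + 6 = 0) :
    (genPoly θ).eval 1 ^ 2 = -23 := by
  rw [genPoly_eval]
  linear_combination 4 * hθ

end Gen

theorem square_mod_twentyThree_iff : ∀ r < 23,
    (((r : ℕ) : ZMod 23) ≠ 0 ∧ IsSquare ((r : ℕ) : ZMod 23)) ↔
      r ∈ ({1, 2, 3, 4, 6, 8, 9, 12, 13, 16, 18} : Finset ℕ) := by
  decide

theorem filter_eq_of_forall {s t : Finset ℕ} {P : ℕ → Prop} (inst : DecidablePred P)
    (h : ∀ r, r ∈ t ↔ r ∈ s ∧ P r) : s.filter P = t := by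
  ext r
  rw [Finset.mem_filter, h]

/-- As `2` generates the squares modulo `23`, one root `ζ` of `genPoly θ` gives all the roots `ζ ^
r`. -/
theorem prod_eq_genPoly {F : Type*} [Field F] {θ ζ : F} (hθ : θ ^ 2 + θ + 6 = 0)
    (hζ : IsPrimitiveRoot ζ 23) (h : (genPoly θ).eval ζ = 0) :
    ∏ r ∈ ({1, 2, 3, 4, 6, 8, 9, 12, 13, 16, 18} : Finset ℕ), (X - C (ζ ^ r)) = genPoly θ := by
  have hstep : ∀ r, (genPoly θ).eval (ζ ^ r) = 0 → (genPoly θ).eval (ζ ^ (2 * r)) = 0 := by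
    intro r hr
    rw [mul_comm, pow_mul, genPoly_eval_sq hθ, hr, zero_mul, neg_zero]
  have hred : ∀ r, ζ ^ (r + 23) = ζ ^ r := fun r => by rw [pow_add, hζ.pow_eq_one, mul_one]
  -- The powers of `2` modulo `23` are `1, 2, 4, 8, 16, 9, 18, 13, 3, 6, 12`.
  have h1 : (genPoly θ).eval (ζ ^ 1) = 0 := by rwa [pow_one]
  have h2 := hstep 1 h1
  have h4 := hstep 2 h2
  have h8 := hstep 4 h4
  have h16 := hstep 8 h8
  have h9 := hstep 16 h16
  rw [show 2 * 16 = 9 + 23 from rfl, hred] at h9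
  have h18 := hstep 9 h9
  have h13 := hstep 18 h18
  rw [show 2 * 18 = 13 + 23 from rfl, hred] at h13
  have h3 := hstep 13 h13
  rw [show 2 * 13 = 3 + 23 from rfl, hred] at h3
  have h6 := hstep 3 h3
  have h12 := hstep 6 h6
  set S : Finset ℕ := {1, 2, 3, 4, 6, 8, 9, 12, 13, 16, 18} with hS
  have hcard : S.card = 11 := by rw [hS]; decide
  have hlt : ∀ r ∈ S, r < 23 := by rw [hS]; decide
  have hinj : Set.InjOn (fun r => ζ ^ r) (S : Set ℕ) := fun a ha b hb hab =>
    hζ.pow_inj (hlt a ha) (hlt b hb) hab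
  have hmon : (∏ r ∈ S, (X - C (ζ ^ r))).Monic := monic_prod_of_monic _ _ fun r _ => monic_X_sub_C _
  have hdeg : (∏ r ∈ S, (X - C (ζ ^ r))).degree = ((11 : ℕ) : WithBot ℕ) := by
    rw [degree_prod, Finset.sum_congr rfl fun r _ => degree_X_sub_C (ζ ^ r), Finset.sum_const,
      hcard]
    rfl
  have hdeg' : (genPoly θ).degree = ((11 : ℕ) : WithBot ℕ) := by
    refine le_antisymm (Order.lt_succ_iff.1 (genPoly_natDegree_le θ)) (le_degree_of_ne_zero ?_)
    simp [genPoly_coeff, genA, genB]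
  refine Polynomial.eq_of_degree_sub_lt_of_eval_index_eq S hinj ?_ ?_
  · rw [hcard, ← hdeg]
    refine degree_sub_lt_left (hdeg.trans hdeg'.symm) hmon.ne_zero ?_
    rw [hmon.leadingCoeff, (genPoly_monic θ).leadingCoeff]
  · intro r hr
    rw [eval_prod, Finset.prod_eq_zero hr (by simp)]
    symm
    simp only [hS, Finset.mem_insert, Finset.mem_singleton] at hr
    rcases hr with rfl | rfl | rfl | rfl | rfl | rfl | rfl | rfl | rfl | rfl | rfl <;> assumption

/-- A quadratic residue generator for `q = 23`, `p = 3` is one of the two polynomials `genPoly θ`;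
the root `θ` can be read off from a coefficient. -/
theorem exists_eq_genPoly {g : ℤ_[3][X]} (hg : IsQRGenerator 3 23 g) :
    ∃ θ : ℤ_[3], θ ^ 2 + θ + 6 = 0 ∧ g = genPoly θ := by
  obtain ⟨ζ, hζ, h⟩ := hg
  have hlt : ∀ r ∈ ({1, 2, 3, 4, 6, 8, 9, 12, 13, 16, 18} : Finset ℕ), r < 23 := by decide
  replace h := h.trans (Finset.prod_congr
    (s₂ := ({1, 2, 3, 4, 6, 8, 9, 12, 13, 16, 18} : Finset ℕ)) (filter_eq_of_forall _
      fun r => ⟨fun hr => ⟨Finset.mem_range.2 (hlt r hr),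
        (square_mod_twentyThree_iff r (hlt r hr)).2 hr⟩,
          fun hr => (square_mod_twentyThree_iff r (Finset.mem_range.1 hr.1)).1 hr.2⟩) fun _ _ => rfl)
  set φ := (algebraMap ℚ_[3] (AlgebraicClosure ℚ_[3])).comp (algebraMap ℤ_[3] ℚ_[3]) with hφ
  have hinj : Function.Injective φ :=
    (algebraMap ℚ_[3]
      (AlgebraicClosure ℚ_[3])).injective.comp (IsFractionRing.injective ℤ_[3] ℚ_[3])
  obtain ⟨η, hη⟩ : ∃ η : AlgebraicClosure ℚ_[3], η ^ 2 + η + 6 = 0 := by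
    have hd : (X ^ 2 + X + 6 : (AlgebraicClosure ℚ_[3])[X]).degree ≠ 0 := by
      have : (X ^ 2 + X + 6 : (AlgebraicClosure ℚ_[3])[X]).degree = 2 := by
        rw [show (6 : (AlgebraicClosure ℚ_[3])[X]) = C 6 from rfl]
        compute_degree!
      rw [this]
      decide
    obtain ⟨η, hη⟩ := IsAlgClosed.exists_root _ hd
    exact ⟨η, by simpa using hη⟩
  have hroot : (genPoly η).eval ζ = 0 ∨ (genPoly (-1 - η)).eval ζ = 0 := by
    have h1 := genPoly_eval_mul hη ζ
    rw [hζ.pow_eq_one, sub_self] at h1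
    rcases mul_eq_zero.1 h1 with h2 | h2
    · exact absurd (sub_eq_zero.1 h2) (hζ.ne_one (by norm_num))
    · exact mul_eq_zero.1 h2
  obtain ⟨η, hη, h1⟩ : ∃ η : AlgebraicClosure ℚ_[3], η ^ 2 + η + 6 = 0 ∧
      (genPoly η).eval ζ = 0 := by
    rcases hroot with h1 | h1
    · exact ⟨η, hη, h1⟩
    · exact ⟨-1 - η, by linear_combination hη, h1⟩
  rw [prod_eq_genPoly hη hζ h1] at h
  -- The coefficient of `X ^ 9` in `genPoly η` is `-3 - η`.
  have h9 : φ (-3 - g.coeff 9) = η := by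
    have := congrArg (fun f => f.coeff 9) h
    simp only [coeff_map, genPoly_coeff] at this
    rw [map_sub, this, map_neg, map_ofNat]
    simp [genA, genB]
  refine ⟨-3 - g.coeff 9, hinj ?_, Polynomial.map_injective φ hinj ?_⟩
  · rw [map_add, map_add, map_pow, h9, map_ofNat, map_zero, hη]
  · rw [h, genPoly_map, h9]

/-! ### Monomially equivalent codes -/

/-- The monomial map that moves the coordinates along `e` and scales them by the units `a`. -/
def monomialEquiv {R : Type*} [CommRing R] {ι κ : Type*} (e : ι ≃ κ) (a : κ → Rˣ) :
    (ι → R) ≃ (κ → R) where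
  toFun c k := a k * c (e.symm k)
  invFun d i := (a (e i))⁻¹ * d (e i)
  left_inv c := by funext i; simp
  right_inv d := by funext i; simp

section Equivalence

variable {ι κ : Type*} [Fintype ι] [Fintype κ]

theorem dualCode_monomialEquiv {R : Type*} [CommRing R] (e : ι ≃ κ) (a : κ → Rˣ)
    {L : Submodule R (ι → R)} {L' : Submodule R (κ → R)}
    (h : ∀ c, c ∈ L ↔ monomialEquiv e a c ∈ L') (d : ι → R) :
    d ∈ dualCode L ↔ monomialEquiv e a⁻¹ d ∈ dualCode L' := by
  have key : ∀ c, ∑ k, monomialEquiv e a c k * monomialEquiv e a⁻¹ d k = ∑ i, c i * d i := by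
    intro c
    symm
    refine Fintype.sum_equiv e _ _ fun i => ?_
    simp only [monomialEquiv, Equiv.coe_fn_mk, Equiv.symm_apply_apply, Pi.inv_apply]
    rw [mul_mul_mul_comm, Units.mul_inv, one_mul]
  constructor
  · intro hd c' hc'
    obtain ⟨c, rfl⟩ := (monomialEquiv e a).surjective c'
    rw [key]
    exact hd c ((h c).2 hc')
  · intro hd c hc
    rw [← key]
    exact hd _ ((h c).1 hc)

theorem swe_monomialEquiv {p : ℕ} [hp : Fact p.Prime] {m : ℕ} (w : ℕ → WVar) (e : ι ≃ κ)
    (a : κ → (ZMod (p ^ m))ˣ) {L : Submodule (ZMod (p ^ m)) (ι → ZMod (p ^ m))}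
    {L' : Submodule (ZMod (p ^ m)) (κ → ZMod (p ^ m))}
    (h : ∀ c, c ∈ L ↔ monomialEquiv e a c ∈ L') : swe p m w L = swe p m w L' := by
  classical
  rw [swe, swe]
  refine Finset.sum_equiv (monomialEquiv e a) (fun c => by simp [h c]) fun c _ => ?_
  refine Fintype.prod_equiv e _ _ fun i => ?_
  rw [letterVar_eq_natVar, letterVar_eq_natVar]
  simp only [monomialEquiv, Equiv.coe_fn_mk, Equiv.symm_apply_apply]
  rw [natVar_unit_mul w (Units.isUnit _)]

theorem disjointWE_congr {p : ℕ} [hp : Fact p.Prime]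
    {K : (m : ℕ) → Submodule (ZMod (p ^ m)) (ι → ZMod (p ^ m))}
    {K' : (m : ℕ) → Submodule (ZMod (p ^ m)) (κ → ZMod (p ^ m))}
    (hswe : ∀ m, swe p m WVar.y (dualCode (K m)) = swe p m WVar.y (dualCode (K' m)))
    (hcard : Nat.card (dualCode (K 1)) = Nat.card (dualCode (K' 1))) (m ℓ : ℕ) :
    disjointWE p K m ℓ = disjointWE p K' m ℓ := by
  induction m generalizing ℓ with
  | zero => exact hswe ℓ
  | succ m ih => rw [disjointWE, disjointWE, ih, hcard]

end Equivalence

/-! ### The lifted code and the normalized code -/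

section Transfer

variable {R : Type*} [CommRing R]

/-- The entries of the generator matrix at the finite coordinates. -/
def shiftCoeff (θ : R) (i k : ℕ) : R :=
  if i ≤ k then (genA (k - i) : R) + (genB (k - i) : R) * θ else 0

theorem coeff_genPoly_mul_sum (θ : R) (u : Fin 12 → R) (k : ℕ) :
    (genPoly θ * ∑ i : Fin 12, C (u i) * X ^ (i : ℕ)).coeff k = ∑ i, u i * shiftCoeff θ i k := by
  rw [Finset.mul_sum, finsetSum_coeff]
  refine Finset.sum_congr rfl fun i _ => ?_
  rw [mul_left_comm, coeff_C_mul, coeff_mul_X_pow', genPoly_coeff, shiftCoeff]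

theorem wordPoly_coeff (c : Option (Fin 23) → R) (k : Fin 23) :
    (wordPoly c).coeff k = c (some k) := by
  rw [wordPoly, finsetSum_coeff]
  simp only [coeff_C_mul_X_pow, ← Fin.ext_iff]
  simp

theorem wordPoly_degree_lt (c : Option (Fin 23) → R) : (wordPoly c).degree < (23 : ℕ) := by
  rw [degree_lt_iff_coeff_zero]
  intro k hk
  rw [wordPoly, finsetSum_coeff]
  refine Finset.sum_eq_zero fun i _ => ?_
  rw [coeff_C_mul_X_pow, if_neg]
  have := i.isLt
  have hk' : 23 ≤ k := hk
  omega

/-- The multiples of `g` of degree below `23` are the combinations of the twelve shifts of `g`. -/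
theorem genPoly_dvd_wordPoly_iff [Nontrivial R] (θ : R) (c : Option (Fin 23) → R) :
    genPoly θ ∣ wordPoly c ↔
      ∃ u : Fin 12 → R, ∀ j : Fin 23, c (some j) = ∑ i, u i * shiftCoeff θ i j := by
  constructor
  · rintro ⟨q, hq⟩
    have hdeg : q.degree < (12 : ℕ) := by
      have h1 := wordPoly_degree_lt c
      have hg : (genPoly θ).degree = ((11 : ℕ) : WithBot ℕ) := by
        refine le_antisymm (Order.lt_succ_iff.1 (genPoly_natDegree_le θ)) (le_degree_of_ne_zero ?_)
        simp [genPoly_coeff, genA, genB]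
      rw [hq, (genPoly_monic θ).degree_mul_comm, (genPoly_monic θ).degree_mul, hg] at h1
      by_cases h0 : q = 0
      · rw [h0, degree_zero]
        exact WithBot.bot_lt_coe 12
      · rw [degree_eq_natDegree h0] at h1 ⊢
        norm_cast at h1 ⊢
        omega
    refine ⟨fun i => q.coeff i, fun j => ?_⟩
    rw [← wordPoly_coeff c, hq, ← coeff_genPoly_mul_sum]
    congr 2
    ext k
    rw [finsetSum_coeff]
    simp only [coeff_C_mul_X_pow]
    by_cases hk : k < 12
    · rw [Finset.sum_eq_single ⟨k, hk⟩]
      · simp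
      · intro i _ hi
        rw [if_neg]
        rintro rfl
        exact hi rfl
      · simp
    · rw [(degree_lt_iff_coeff_zero _ _).1 hdeg k (by simpa using hk), Finset.sum_eq_zero]
      intro i _
      rw [if_neg]
      have := i.isLt
      omega
  · rintro ⟨u, hu⟩
    refine ⟨∑ i : Fin 12, C (u i) * X ^ (i : ℕ), ?_⟩
    ext k
    rw [coeff_genPoly_mul_sum]
    by_cases hk : k < 23
    · rw [← hu ⟨k, hk⟩, ← wordPoly_coeff c ⟨k, hk⟩]
    · rw [(degree_lt_iff_coeff_zero _ _).1 (wordPoly_degree_lt c) k (by simpa using hk)]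
      symm
      refine Finset.sum_eq_zero fun i _ => ?_
      have := i.isLt
      have h1 : genA (k - i) = 0 := List.getD_eq_default _ _ (by simp; omega)
      have h2 : genB (k - i) = 0 := List.getD_eq_default _ _ (by simp; omega)
      simp [shiftCoeff, h1, h2]

theorem sum_shiftCoeff (θ : R) (i : Fin 12) :
    ∑ j : Fin 23, shiftCoeff θ i j = (genPoly θ).eval 1 := by
  have hA : ∀ i : Fin 12, ∑ j : Fin 23, (if i.val ≤ j.val then genA (j - i) else 0) = 1 := by
    decide +kernel
  have hB : ∀ i : Fin 12, ∑ j : Fin 23, (if i.val ≤ j.val then genB (j - i) else 0) = 2 := by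
    decide +kernel
  have h1 : ∀ j : Fin 23, shiftCoeff θ i j = ((if i.val ≤ j.val then genA (j - i) else 0 : ℤ) : R)
      + ((if i.val ≤ j.val then genB (j - i) else 0 : ℤ) : R) * θ := by
    intro j
    unfold shiftCoeff
    split_ifs <;> simp
  rw [Finset.sum_congr rfl fun j _ => h1 j, Finset.sum_add_distrib, ← Finset.sum_mul,
    ← Int.cast_sum, ← Int.cast_sum, hA, hB, genPoly_eval]
  push_cast
  ring

theorem qrRow_castSucc (θ : R) (i : Fin 12) (j : Fin 23) :
    qrRow θ i j.castSucc = shiftCoeff θ i j := by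
  have h : j.castSucc ≠ (23 : Fin 24) := Fin.ne_of_lt (Fin.castSucc_lt_last j)
  simp only [qrRow, rowA, rowB, shiftCoeff, h, if_false, Fin.val_castSucc]
  split_ifs <;> simp

theorem qrRow_last (θ : R) (i : Fin 12) : qrRow θ i 23 = 1 := by
  simp [qrRow, rowA, rowB]

theorem mem_qrCode_iff_shiftCoeff {θ : R} {v : Fin 24 → R} : v ∈ qrCode θ ↔ ∃ u : Fin 12 → R,
    (∀ j : Fin 23, v j.castSucc = ∑ i, u i * shiftCoeff θ i j) ∧ v 23 = ∑ i, u i := by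
  rw [mem_qrCode]
  refine exists_congr fun u => ?_
  rw [funext_iff, Fin.forall_fin_succ']
  simp only [qrRow_castSucc]
  exact and_congr_right fun _ => by
    change v 23 = ∑ i, u i * qrRow θ i 23 ↔ _
    simp only [qrRow_last, mul_one]

theorem sum_word_eq {θ : R} {f : Fin 23 → R} {u : Fin 12 → R}
    (h : ∀ j : Fin 23, f j = ∑ i, u i * shiftCoeff θ i j) :
    ∑ j, f j = (genPoly θ).eval 1 * ∑ i, u i := by
  simp only [h]
  rw [Finset.sum_comm, Finset.mul_sum]
  refine Finset.sum_congr rfl fun i _ => ?_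
  rw [← Finset.mul_sum, sum_shiftCoeff, mul_comm]

/-- The two polynomials `genPoly θ` and `genPoly (-1 - θ)` are negatives of each other's
reversals. -/
theorem shiftCoeff_rev (θ : R) (i : Fin 12) (j : Fin 23) :
    shiftCoeff θ (i.rev : Fin 12) (j.rev : Fin 23) = -shiftCoeff (-1 - θ) i j := by
  have hA : ∀ (i : Fin 12) (j : Fin 23),
      (if i.rev.val ≤ j.rev.val then genA (j.rev - i.rev : ℕ) else 0)
        = (if i.val ≤ j.val then genB (j - i) - genA (j - i) else 0) := by
    decide +kernel
  have hB : ∀ (i : Fin 12) (j : Fin 23),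
      (if i.rev.val ≤ j.rev.val then genB (j.rev - i.rev : ℕ) else 0)
        = (if i.val ≤ j.val then genB (j - i) else 0) := by
    decide +kernel
  have h1 : ∀ (i j : ℕ), shiftCoeff θ i j = ((if i ≤ j then genA (j - i) else 0 : ℤ) : R)
      + ((if i ≤ j then genB (j - i) else 0 : ℤ) : R) * θ := by
    intro i j
    unfold shiftCoeff
    split_ifs <;> simp
  rw [h1, hA, hB, shiftCoeff]
  split_ifs
  · push_cast; ring
  · simp

/-- The coordinates of the extended code in their natural order. -/
def coordEquiv : Option (Fin 23) ≃ Fin 24 := finSuccEquivLast.symm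

/-- The coordinates of the extended code, with the finite ones in reversed order. -/
def coordEquivRev : Option (Fin 23) ≃ Fin 24 :=
  (Equiv.optionCongr Fin.revPerm).trans finSuccEquivLast.symm

end Transfer

theorem mem_extCyclicCode_iff {θ lam : ℤ_[3]} {m : ℕ} [Nontrivial (ZMod (3 ^ m))]
    (c : Option (Fin 23) → ZMod (3 ^ m)) :
    c ∈ extCyclicCode 3 23 (genPoly θ) lam m ↔ ∃ u : Fin 12 → ZMod (3 ^ m),
      (∀ j : Fin 23, c (some j) = ∑ i, u i * shiftCoeff (PadicInt.toZModPow m θ) i j) ∧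
      c none = PadicInt.toZModPow m lam *
        ((genPoly (PadicInt.toZModPow m θ)).eval 1 * ∑ i, u i) := by
  change (genPoly θ).map (PadicInt.toZModPow m) ∣ wordPoly c ∧
    c none = PadicInt.toZModPow m lam * ∑ i : Fin 23, c (some i) ↔ _
  rw [genPoly_map, genPoly_dvd_wordPoly_iff]
  constructor
  · rintro ⟨⟨u, hu⟩, h⟩
    exact ⟨u, hu, by rw [h, sum_word_eq hu]⟩
  · rintro ⟨u, hu, h⟩
    exact ⟨⟨u, hu⟩, by rw [h, sum_word_eq hu]⟩

/-- The square of `g(1)` is `-23`. -/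
theorem isUnit_eval_one {θ : ℤ_[3]} (hθ : θ ^ 2 + θ + 6 = 0) (m : ℕ) :
    IsUnit ((genPoly (PadicInt.toZModPow m θ)).eval 1) := by
  have h := genPoly_eval_one_sq (toZModPow_root hθ m)
  have h23 : IsUnit ((23 : ℕ) : ZMod (3 ^ m)) := by
    rw [ZMod.isUnit_iff_coprime]
    exact Nat.Coprime.pow_right m (by norm_num)
  have h2 : IsUnit ((genPoly (PadicInt.toZModPow m θ)).eval 1 ^ 2) := by
    rw [h]
    exact_mod_cast h23.neg
  exact (isUnit_pow_iff two_ne_zero).1 h2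

/-- The lifted extended quadratic residue code is monomially equivalent to the normalized one. -/
theorem exists_monomialEquiv {g : ℤ_[3][X]} (hg : IsQRGenerator 3 23 g) {lam : ℤ_[3]}
    (hlam : IsUnit lam) : ∃ θ : ℤ_[3], θ ^ 2 + θ + 6 = 0 ∧ PadicInt.toZModPow 1 θ = 0 ∧
      ∀ m, ∃ (e : Option (Fin 23) ≃ Fin 24) (a : Fin 24 → (ZMod (3 ^ m))ˣ),
        ∀ c, c ∈ extCyclicCode 3 23 g lam m ↔ monomialEquiv e a c ∈ qrTower θ m := by
  obtain ⟨θ, hθ, rfl⟩ := exists_eq_genPoly hg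
  -- One of the two roots `θ`, `-1 - θ` is divisible by three; if it is the second one, then the
  -- order
  -- of the finite coordinates is reversed. The ring of residues modulo `3 ^ 0` is trivial.
  have hmod : PadicInt.toZModPow 1 θ = 0 ∨ PadicInt.toZModPow 1 (-1 - θ) = 0 := by
    have h1 : ∀ t : ZMod (3 ^ 1), t ^ 2 + t + 6 = 0 → t = 0 ∨ -1 - t = 0 := by decide
    have h2 := h1 _ (toZModPow_root hθ 1)
    rwa [map_sub, map_neg, map_one]
  have hsub : ∀ m, m = 0 → Subsingleton (ZMod (3 ^ m)) := by
    rintro m rfl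
    rw [pow_zero]
    infer_instance
  have hnt : ∀ m, m ≠ 0 → Nontrivial (ZMod (3 ^ m)) := fun m hm => by
    have : Fact (1 < 3 ^ m) := ⟨Nat.one_lt_pow hm (by norm_num)⟩
    infer_instance
  have htriv : ∀ (θ' : ℤ_[3]) (m : ℕ), m = 0 →
      ∃ (e : Option (Fin 23) ≃ Fin 24) (a : Fin 24 → (ZMod (3 ^ m))ˣ),
        ∀ c, c ∈ extCyclicCode 3 23 (genPoly θ) lam m ↔ monomialEquiv e a c ∈ qrTower θ' m := by
    intro θ' m hm
    have := hsub m hm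
    refine ⟨coordEquiv, 1, fun c => ?_⟩
    rw [Subsingleton.elim c 0, Subsingleton.elim (monomialEquiv coordEquiv 1 0) 0]
    exact iff_of_true (Submodule.zero_mem _) (Submodule.zero_mem _)
  have hs : ∀ m, IsUnit (PadicInt.toZModPow m lam *
      (genPoly (PadicInt.toZModPow m θ)).eval 1) := fun m => (hlam.map _).mul (isUnit_eval_one hθ m)
  rcases hmod with h0 | h0
  · refine ⟨θ, hθ, h0, fun m => ?_⟩
    by_cases hm : m = 0
    · exact htriv θ m hm
    have := hnt m hm
    refine ⟨coordEquiv, fun j => if j = 23 then (hs m).unit⁻¹ else 1, fun c => ?_⟩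
    rw [mem_extCyclicCode_iff, qrTower, mem_qrCode_iff_shiftCoeff]
    refine exists_congr fun u => and_congr (forall_congr' fun j => ?_) ?_
    · have h : j.castSucc ≠ (23 : Fin 24) := Fin.ne_of_lt (Fin.castSucc_lt_last j)
      simp [monomialEquiv, h, coordEquiv]
    · have h1 : monomialEquiv coordEquiv (fun j => if j = 23 then (hs m).unit⁻¹ else 1) c 23
          = ((hs m).unit⁻¹ : (ZMod (3 ^ m))ˣ) * c none := by
        simp only [monomialEquiv, Equiv.coe_fn_mk, if_true]
        congr 2
      rw [h1, Units.inv_mul_eq_iff_eq_mul, IsUnit.unit_spec, mul_assoc]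
  · refine ⟨-1 - θ, by linear_combination hθ, h0, fun m => ?_⟩
    by_cases hm : m = 0
    · exact htriv _ m hm
    have := hnt m hm
    refine ⟨coordEquivRev, fun j => if j = 23 then -(hs m).unit⁻¹ else 1, fun c => ?_⟩
    rw [mem_extCyclicCode_iff, qrTower, mem_qrCode_iff_shiftCoeff]
    have hrev : ∀ (u : Fin 12 → ZMod (3 ^ m)) (j : Fin 23),
        ∑ i, u i * shiftCoeff (PadicInt.toZModPow m θ) i (j.rev : Fin 23)
          = ∑ i : Fin 12, -u i.rev * shiftCoeff (PadicInt.toZModPow m (-1 - θ)) i j := by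
      intro u j
      refine Fintype.sum_equiv Fin.revPerm _ _ fun i => ?_
      have := shiftCoeff_rev (PadicInt.toZModPow m θ) i.rev j
      rw [Fin.rev_rev] at this
      rw [this, Fin.revPerm_apply, Fin.rev_rev, map_sub, map_neg, map_one]
      ring
    have hsum : ∀ u : Fin 12 → ZMod (3 ^ m), ∑ i : Fin 12, -u i.rev = -∑ i, u i := by
      intro u
      rw [Finset.sum_neg_distrib]
      congr 1
      exact Fintype.sum_equiv Fin.revPerm _ _ fun i => rfl
    have h1 : monomialEquiv coordEquivRev (fun j => if j = 23 then -(hs m).unit⁻¹ else 1) c 23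
        = (-(hs m).unit⁻¹ : (ZMod (3 ^ m))ˣ) * c none := by
      simp only [monomialEquiv, Equiv.coe_fn_mk, if_true]
      congr 2
    have h2 : ∀ j : Fin 23, monomialEquiv coordEquivRev
        (fun j => if j = 23 then -(hs m).unit⁻¹ else 1) c j.castSucc = c (some j.rev) := by
      intro j
      have h : j.castSucc ≠ (23 : Fin 24) := Fin.ne_of_lt (Fin.castSucc_lt_last j)
      simp [monomialEquiv, h, coordEquivRev]
      rfl
    have hiff : ∀ u : Fin 12 → ZMod (3 ^ m),
        ((∀ j : Fin 23, c (some j) = ∑ i, u i * shiftCoeff (PadicInt.toZModPow m θ) i j) ∧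
          c none = PadicInt.toZModPow m lam *
            ((genPoly (PadicInt.toZModPow m θ)).eval 1 * ∑ i, u i)) ↔
        ((∀ j : Fin 23, c (some j.rev)
            = ∑ i : Fin 12, -u i.rev * shiftCoeff (PadicInt.toZModPow m (-1 - θ)) i j) ∧
          (-(hs m).unit⁻¹ : (ZMod (3 ^ m))ˣ) * c none = ∑ i : Fin 12, -u i.rev) := by
      intro u
      refine and_congr ?_ ?_
      · simp only [← hrev]
        exact Fin.revPerm.forall_congr_left.trans (by simp)
      · rw [hsum, Units.val_neg, neg_mul, neg_inj, Units.inv_mul_eq_iff_eq_mul, IsUnit.unit_spec,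
          mul_assoc]
    rw [h1]
    simp only [h2]
    constructor
    · rintro ⟨u, hu⟩
      exact ⟨_, (hiff u).1 hu⟩
    · rintro ⟨u, hu⟩
      refine ⟨fun i => -u i.rev, (hiff _).2 ?_⟩
      simpa only [Fin.rev_rev, neg_neg] using hu

/-- The weight enumerators of the lifted codes are those of the normalized tower. -/
theorem exists_qrTower {g : ℤ_[3][X]} (hg : IsQRGenerator 3 23 g) {lam : ℤ_[3]}
    (hlam : IsUnit lam) : ∃ θ : ℤ_[3], θ ^ 2 + θ + 6 = 0 ∧ PadicInt.toZModPow 1 θ = 0 ∧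
      disjointWE 3 (extCyclicCode 3 23 g lam) = disjointWE 3 (qrTower θ) ∧
      ∀ m, swe 3 m WVar.x (extCyclicCode 3 23 g lam m) = swe 3 m WVar.x (qrTower θ m) := by
  obtain ⟨θ, hθ, h0, h⟩ := exists_monomialEquiv hg hlam
  refine ⟨θ, hθ, h0, funext fun m => funext fun ℓ => disjointWE_congr (fun m => ?_) ?_ m ℓ,
    fun m => ?_⟩
  · obtain ⟨e, a, hea⟩ := h m
    exact swe_monomialEquiv _ e a⁻¹ (dualCode_monomialEquiv e a hea)
  · obtain ⟨e, a, hea⟩ := h 1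
    exact Nat.card_congr ((monomialEquiv e a⁻¹).subtypeEquiv (dualCode_monomialEquiv e a hea))
  · obtain ⟨e, a, hea⟩ := h m
    exact swe_monomialEquiv _ e a hea

/-! ### Packed words -/

/-- The base `2 ^ 64` in which words are packed into natural numbers. -/
def laneBase : ℕ := 18446744073709551616

/-- The entry with index `i` of a word that is packed into one natural number, with 64 binary digits
for each entry. -/
def lane (v i : ℕ) : ℕ := Nat.mod (Nat.shiftRight v (Nat.mul 64 i)) laneBase

/-- The residue modulo three of an entry of a packed word. -/
def tri (v i : ℕ) : ℕ := Nat.mod (lane v i) 3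

/-- The linear combination `v + t * w` of packed words. -/
def addMul (t v w : ℕ) : ℕ := Nat.add v (Nat.mul t w)

/-- The word over `ZMod n` given by a packed word. -/
def unpack (n v : ℕ) : Fin 24 → ZMod n := fun i => (lane v i : ZMod n)

/-- `v` is a packed word with entries at most `M`. -/
def IsPacked (M v : ℕ) : Prop :=
  ∃ f : ℕ → ℕ, (∀ i, f i ≤ M) ∧ v = ∑ i ∈ Finset.range 24, f i * laneBase ^ i

theorem addMul_eq (t v w : ℕ) : addMul t v w = v + t * w := rfl

theorem lane_eq (v i : ℕ) : lane v i = v / laneBase ^ i % laneBase := by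
  change (v >>> (64 * i)) % _ = _
  rw [Nat.shiftRight_eq_div_pow, pow_mul]
  rfl

theorem laneBase_pos : 0 < laneBase := by norm_num [laneBase]

theorem lane_sum {f : ℕ → ℕ} (hf : ∀ i, f i < laneBase) (n i : ℕ) (hi : i < n) :
    lane (∑ i ∈ Finset.range n, f i * laneBase ^ i) i = f i := by
  rw [lane_eq]
  induction i generalizing n f with
  | zero =>
    obtain ⟨n, rfl⟩ := Nat.exists_eq_succ_of_ne_zero hi.ne'
    rw [Finset.sum_range_succ']
    simp only [pow_zero, mul_one, Nat.div_one, pow_succ, ← mul_assoc, ← Finset.sum_mul]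
    rw [Nat.mul_add_mod_self_right, Nat.mod_eq_of_lt (hf 0)]
  | succ i ih =>
    obtain ⟨n, rfl⟩ := Nat.exists_eq_succ_of_ne_zero (Nat.ne_of_gt (Nat.zero_lt_of_lt hi))
    rw [Finset.sum_range_succ']
    simp only [pow_zero, mul_one, pow_succ, ← mul_assoc, ← Finset.sum_mul]
    rw [mul_comm (laneBase ^ i), ← Nat.div_div_eq_div_mul, add_comm,
      Nat.add_mul_div_right _ _ laneBase_pos, Nat.div_eq_of_lt (hf 0), zero_add]
    exact ih (fun j => hf (j + 1)) n (by omega)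

theorem IsPacked.mono {M M' v : ℕ} (h : IsPacked M v) (hM : M ≤ M') : IsPacked M' v := by
  obtain ⟨f, hf, hv⟩ := h
  exact ⟨f, fun i => (hf i).trans hM, hv⟩

theorem IsPacked.addMul {M M' t v w : ℕ} (hv : IsPacked M v) (hw : IsPacked M' w) :
    IsPacked (M + t * M') (addMul t v w) := by
  obtain ⟨f, hf, hv⟩ := hv
  obtain ⟨g, hg, hw⟩ := hw
  refine ⟨fun i => f i + t * g i, fun i => Nat.add_le_add (hf i) (Nat.mul_le_mul_left t (hg i)), ?_⟩
  rw [addMul_eq, hv, hw, Finset.mul_sum, ← Finset.sum_add_distrib]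
  exact Finset.sum_congr rfl fun i _ => by ring

theorem lane_addMul {M M' t v w : ℕ} (hv : IsPacked M v) (hw : IsPacked M' w)
    (h : M + t * M' < laneBase) {i : ℕ} (hi : i < 24) :
    lane (addMul t v w) i = lane v i + t * lane w i := by
  obtain ⟨f, hf, hv⟩ := hv
  obtain ⟨g, hg, hw⟩ := hw
  have h1 : ∀ i, f i + t * g i ≤ M + t * M' := fun i =>
    Nat.add_le_add (hf i) (Nat.mul_le_mul_left t (hg i))
  have h2 : addMul t v w = ∑ i ∈ Finset.range 24, (f i + t * g i) * laneBase ^ i := by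
    rw [addMul_eq, hv, hw, Finset.mul_sum, ← Finset.sum_add_distrib]
    exact Finset.sum_congr rfl fun i _ => by ring
  rw [h2, hv, hw, lane_sum (f := fun i => f i + t * g i) (fun i => (h1 i).trans_lt h) 24 i hi,
    lane_sum (fun i => by have := hf i; omega) 24 i hi]
  rcases Nat.eq_zero_or_pos t with rfl | ht
  · simp
  · rw [lane_sum (fun i => ?_) 24 i hi]
    have := hg i
    have : g i ≤ t * M' := this.trans (Nat.le_mul_of_pos_left M' ht)
    omega

theorem unpack_addMul (n : ℕ) {M M' t v w : ℕ} (hv : IsPacked M v) (hw : IsPacked M' w)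
    (h : M + t * M' < laneBase) :
    unpack n (addMul t v w) = unpack n v + (t : ZMod n) • unpack n w := by
  funext i
  simp only [unpack, lane_addMul hv hw h i.isLt, Pi.add_apply, Pi.smul_apply, smul_eq_mul]
  push_cast
  rfl

theorem natCast_tri (v : ℕ) (i : Fin 24) : ((tri v i : ℕ) : ZMod 3) = unpack 3 v i := by
  change ((lane v i % 3 : ℕ) : ZMod 3) = _
  rw [ZMod.natCast_mod]
  rfl

theorem tri_lt (v i : ℕ) : tri v i < 3 := Nat.mod_lt _ (by norm_num)

theorem tri_eq_zero_iff (v : ℕ) (i : Fin 24) : tri v i = 0 ↔ unpack 3 v i = 0 := by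
  rw [← natCast_tri, ZMod.natCast_eq_zero_iff]
  constructor
  · intro h; simp [h]
  · intro h; exact Nat.eq_zero_of_dvd_of_lt h (tri_lt v i)

/-! ### Sums over affine spaces over the field with three elements -/

section AffineSum

variable {E M : Type} [AddCommGroup E] [Module (ZMod 3) E] [AddCommMonoid M]

/-- The sum of the values of `f` at the vectors `o + ∑ t_j b_j`, over all coefficients `t_j`. -/
def affineSum : E → List E → (E → M) → M
  | o, [], f => f o
  | o, b :: B, f => ∑ t : ZMod 3, affineSum (o + t • b) B f

theorem affineSum_perm {B B' : List E} (h : B.Perm B') (o : E) (f : E → M) :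
    affineSum o B f = affineSum o B' f := by
  induction h generalizing o with
  | nil => rfl
  | cons b _ ih => simp only [affineSum, ih]
  | swap a b l =>
    simp only [affineSum]
    rw [Finset.sum_comm]
    simp only [add_right_comm]
  | trans _ _ ih1 ih2 => rw [ih1, ih2]

/-- Adding multiples of `b` to the other vectors does not change the affine space. -/
theorem sum_affineSum_map (b : E) (s : E → ZMod 3) (B : List E) (o : E) (f : E → M) :
    ∑ t : ZMod 3, affineSum (o + t • b) (B.map fun x => x + s x • b) f
      = ∑ t : ZMod 3, affineSum (o + t • b) B f := by
  induction B generalizing o with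
  | nil => rfl
  | cons x B ih =>
    simp only [List.map_cons, affineSum]
    rw [Finset.sum_comm, Finset.sum_comm (f := fun t t' => affineSum (o + t • b + t' • x) B f)]
    refine Finset.sum_congr rfl fun t' _ => ?_
    rw [← Equiv.sum_comp (Equiv.addRight (-(t' * s x)))]
    have h1 : ∀ t : ZMod 3, o + (Equiv.addRight (-(t' * s x))) t • b + t' • (x + s x • b)
        = (o + t' • x) + t • b := by
      intro t
      simp only [Equiv.coe_addRight, add_smul, neg_smul, smul_add, smul_smul]
      abel
    simp only [h1, ih]
    exact Finset.sum_congr rfl fun t _ => by rw [add_right_comm]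

theorem affineSum_ite (φ : E →ₗ[ZMod 3] ZMod 3) (P : ZMod 3 → Prop) [DecidablePred P] {B : List E}
    (hB : ∀ b ∈ B, φ b = 0) (o : E) (f : E → M) :
    affineSum o B (fun w => if P (φ w) then f w else 0)
      = if P (φ o) then affineSum o B f else 0 := by
  induction B generalizing o with
  | nil => rfl
  | cons b B ih =>
    simp only [affineSum]
    have h1 : ∀ t : ZMod 3, φ (o + t • b) = φ o := by
      intro t
      rw [map_add, map_smul, hB b List.mem_cons_self, smul_zero, add_zero]
    simp only [ih fun b hb => hB b (List.mem_cons_of_mem _ hb), h1]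
    split_ifs <;> simp

theorem affineSum_ofFn {n : ℕ} (g : Fin n → E) (o : E) (f : E → M) :
    affineSum o (List.ofFn g) f = ∑ u : Fin n → ZMod 3, f (o + ∑ i, u i • g i) := by
  induction n generalizing o with
  | zero => simp [affineSum]
  | succ n ih =>
    rw [List.ofFn_succ, affineSum, ← Equiv.sum_comp (Fin.consEquiv fun _ => ZMod 3),
      Fintype.sum_prod_type]
    refine Finset.sum_congr rfl fun t _ => ?_
    rw [ih]
    refine Finset.sum_congr rfl fun u _ => ?_
    simp [Fin.sum_univ_succ, Fin.consEquiv, add_assoc]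

end AffineSum

/-! ### Enumeration of the words of a ternary code with prescribed entries -/

/-- Removes from a list the first packed word whose entry with index `i` is nonzero modulo three. -/
def popPivot (i : ℕ) : List ℕ → Option (ℕ × List ℕ)
  | [] => none
  | b :: B => match tri b i with
    | 0 => match popPivot i B with
      | none => none
      | some (c, B') => some (c, b :: B')
    | _ + 1 => some (b, B)

/-- Adds to each word of a list the multiple of `b` that makes the entry with index `i` divisible by
three; here `s` stands for twice the entry of `b`. -/
def elimAll (i s b : ℕ) : List ℕ → List ℕ
  | [] => []
  | c :: B => addMul (Nat.mod (Nat.mul s (tri c i)) 3) c b :: elimAll i s b B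

/-- The affine subspace of `o + ⟨B⟩` on which the entry with index `i` is `a`, if not empty. -/
def restrictEntry (i a o : ℕ) (B : List ℕ) : Option (ℕ × List ℕ) :=
  match popPivot i B with
  | none => cond (Nat.beq (tri o i) a) (some (o, B)) none
  | some (b, B') => some (addMul (Nat.mod (Nat.mul (Nat.add a (Nat.mul 2 (tri o i)))
    (tri b i)) 3) o b,
      elimAll i (Nat.mul 2 (tri b i)) b B')

/-- The words of the affine space `o + ⟨B⟩`. -/
def combos : List ℕ → ℕ → List ℕ
  | [], o => [o]
  | b :: B, o => combos B o ++ (combos B (addMul 1 o b) ++ combos B (addMul 2 o b))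

/-- The budget that is left after the letter `a` was used: nonzero letters cost one. -/
def payLetter : ℕ → ℕ → Option ℕ
  | 0, k => some k
  | _ + 1, 0 => none
  | _ + 1, k + 1 => some k

/-- The words of `o + ⟨B⟩` whose entries with the given indices are among the given letters, at most
`k` of them nonzero. -/
def searchWords : List (ℕ × List ℕ) → ℕ → ℕ → List ℕ → List ℕ
  | [], _, o, B => combos B o
  | c :: cs, k, o, B => c.2.flatMap fun a => match payLetter a k with
    | none => []
    | some k' => match restrictEntry c.1 a o B with
      | none => []
      | some (o', B') => searchWords cs k' o' B'

/-- The property of a word that `searchWords` looks for. -/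
def Matches : List (ℕ × List ℕ) → ℕ → (Fin 24 → ZMod 3) → Prop
  | [], _, _ => True
  | c :: cs, k, w => ∃ a ∈ c.2, (a : ZMod 3) = w (Fin.ofNat 24 c.1) ∧
      ∃ k', payLetter a k = some k' ∧ Matches cs k' w

/-- `v` packs, with entries at most `M`, a word in the submodule `W`. -/
structure Packs {n : ℕ} (W : Submodule (ZMod n) (Fin 24 → ZMod n)) (M v : ℕ) : Prop where
  packed : IsPacked M v
  mem : unpack n v ∈ W

section Search

variable {n : ℕ} {W : Submodule (ZMod n) (Fin 24 → ZMod n)}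

theorem Packs.mono {M M' v : ℕ} (h : Packs W M v) (hM : M ≤ M') : Packs W M' v :=
  ⟨h.packed.mono hM, h.mem⟩

theorem Packs.addMul {M M' t v w : ℕ} (hv : Packs W M v) (hw : Packs W M' w)
    (h : M + t * M' < laneBase) : Packs W (M + t * M') (addMul t v w) := by
  refine ⟨hv.packed.addMul hw.packed, ?_⟩
  rw [unpack_addMul n hv.packed hw.packed h]
  exact W.add_mem hv.mem (W.smul_mem _ hw.mem)

/-- The entries of the packed words `o` and `B` are so small that no combination with coefficients
at most two, also one that results from elimination, has an entry that exceeds `L`. -/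
def Bounded (W : Submodule (ZMod n) (Fin 24 → ZMod n)) (L o : ℕ) (B : List ℕ) : Prop :=
  ∃ M, Packs W M o ∧ (∀ b ∈ B, Packs W M b) ∧ M * 3 ^ B.length ≤ L

theorem Packs.addMul_three {M t v w : ℕ} (hv : Packs W M v) (hw : Packs W M w) (ht : t < 3)
    (h : 3 * M < laneBase) : Packs W (3 * M) (_root_.addMul t v w) ∧
      unpack 3 (_root_.addMul t v w) = unpack 3 v + (t : ZMod 3) • unpack 3 w := by
  have h1 : t * M ≤ 2 * M := Nat.mul_le_mul_right _ (by omega)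
  exact ⟨(hv.addMul hw (t := t) (by omega)).mono (by omega),
    unpack_addMul 3 hv.packed hw.packed (by omega)⟩

theorem popPivot_none {i : ℕ} {B : List ℕ} (h : popPivot i B = none) : ∀ b ∈ B, tri b i = 0 := by
  induction B with
  | nil => simp
  | cons b B ih =>
    rw [popPivot] at h
    rcases ht : tri b i with _ | t
    · rw [ht] at h
      rcases hp : popPivot i B with _ | ⟨c, B'⟩
      · intro c hc
        rcases List.mem_cons.1 hc with rfl | hc
        · exact ht
        · exact ih hp c hc
      · rw [hp] at h; simp at h
    · rw [ht] at h; simp at h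

theorem popPivot_some {i : ℕ} {B B' : List ℕ} {c : ℕ} (h : popPivot i B = some (c, B')) :
    tri c i ≠ 0 ∧ B.Perm (c :: B') := by
  induction B generalizing B' with
  | nil => simp [popPivot] at h
  | cons b B ih =>
    rw [popPivot] at h
    rcases ht : tri b i with _ | t
    · rw [ht] at h
      rcases hp : popPivot i B with _ | ⟨d, B''⟩
      · rw [hp] at h; simp at h
      · rw [hp] at h
        simp only [Option.some.injEq, Prod.mk.injEq] at h
        obtain ⟨rfl, rfl⟩ := h
        obtain ⟨h1, h2⟩ := ih hp
        exact ⟨h1, (h2.cons b).trans (List.Perm.swap _ _ _)⟩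
    · rw [ht] at h
      simp only [Option.some.injEq, Prod.mk.injEq] at h
      obtain ⟨rfl, rfl⟩ := h
      exact ⟨by omega, List.Perm.refl _⟩

theorem elimAll_eq (i s b : ℕ) (B : List ℕ) :
    elimAll i s b B = B.map fun c => addMul (s * tri c i % 3) c b := by
  induction B with
  | nil => rfl
  | cons c B ih => rw [elimAll, ih]; rfl

variable {M' : Type} [AddCommMonoid M']

/-- The entry with index `i`, as a linear form. -/
def entryForm (i : Fin 24) : (Fin 24 → ZMod 3) →ₗ[ZMod 3] ZMod 3 := LinearMap.proj i

theorem entryForm_unpack {i : ℕ} (hi : i < 24) (v : ℕ) :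
    entryForm (Fin.ofNat 24 i) (unpack 3 v) = ((tri v i : ℕ) : ZMod 3) := by
  have := natCast_tri v (Fin.ofNat 24 i)
  rw [show (Fin.ofNat 24 i : Fin 24).val = i from Nat.mod_eq_of_lt hi] at this
  rw [this]
  rfl

theorem sum_affineSum_pivot {E : Type} [AddCommGroup E] [Module (ZMod 3) E]
    (φ : E →ₗ[ZMod 3] ZMod 3)
    (a : ZMod 3) (b : E) (B : List E) (s : E → ZMod 3) (hs : ∀ x ∈ B, φ (x + s x • b) = 0)
    (o : E) (t₀ : ZMod 3) (hb : φ b ≠ 0) (ht₀ : φ (o + t₀ • b) = a) (f : E → M') :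
    ∑ t : ZMod 3, affineSum (o + t • b) B (fun w => if φ w = a then f w else 0)
      = affineSum (o + t₀ • b) (B.map fun x => x + s x • b) f := by
  rw [← sum_affineSum_map b s B o]
  have h1 : ∀ t : ZMod 3, φ (o + t • b) = a ↔ t = t₀ := by
    intro t
    rw [← ht₀]
    simp only [map_add, map_smul, smul_eq_mul, add_right_inj]
    exact mul_left_inj' hb
  rw [Finset.sum_congr rfl fun t _ => affineSum_ite φ (fun y => y = a) (by simpa using hs) _ f]
  simp only [h1]
  simp

/-- If `restrictEntry` fails then no word of the affine space has the prescribed entry. -/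
theorem restrictEntry_none {i a o : ℕ} {B : List ℕ} (hi : i < 24) (ha : a < 3)
    (h : restrictEntry i a o B = none) (f : (Fin 24 → ZMod 3) → M') :
    affineSum (unpack 3 o) (B.map (unpack 3))
      (fun w => if w (Fin.ofNat 24 i) = a then f w else 0) = 0 := by
  have hi' : (Fin.ofNat 24 i : Fin 24).val = i := Nat.mod_eq_of_lt hi
  rw [restrictEntry] at h
  rcases hp : popPivot i B with _ | ⟨c, B'⟩
  · rw [hp] at h
    have hB := popPivot_none hp
    have h2 := affineSum_ite (entryForm (Fin.ofNat 24 i)) (fun y => y = (a : ZMod 3))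
      (B := B.map (unpack 3)) (by
        intro b hb
        obtain ⟨c, hc, rfl⟩ := List.mem_map.1 hb
        exact (tri_eq_zero_iff c _).1 (by rw [hi']; exact hB c hc)) (unpack 3 o) f
    refine h2.trans (if_neg fun h3 => ?_)
    have h4 : ((tri o i : ℕ) : ZMod 3) = a := by
      rw [← h3, entryForm_unpack hi]
    rw [ZMod.natCast_eq_natCast_iff', Nat.mod_eq_of_lt (tri_lt o i), Nat.mod_eq_of_lt ha] at h4
    rw [h4] at h
    simp at h
  · rw [hp] at h; simp at h

/-- Restricting an entry of the words of an affine space leads to the smaller affine space that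
`restrictEntry` computes. -/
theorem restrictEntry_some {i a o o' L : ℕ} {B B' : List ℕ} (hi : i < 24)
    (hL : L < laneBase) (hB : Bounded W L o B) (h : restrictEntry i a o B = some (o', B'))
    (f : (Fin 24 → ZMod 3) → M') :
    Bounded W L o' B' ∧ affineSum (unpack 3 o) (B.map (unpack 3))
      (fun w => if w (Fin.ofNat 24 i) = a then f w else 0)
        = affineSum (unpack 3 o') (B'.map (unpack 3)) f := by
  have hi' : (Fin.ofNat 24 i : Fin 24).val = i := Nat.mod_eq_of_lt hi
  rw [restrictEntry] at h
  rcases hp : popPivot i B with _ | ⟨c, B''⟩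
  · rw [hp] at h
    simp only at h
    rcases hbq : Nat.beq (tri o i) a with _ | _
    · rw [hbq] at h; simp at h
    · rw [hbq] at h
      simp only [cond_true, Option.some.injEq, Prod.mk.injEq] at h
      obtain ⟨rfl, rfl⟩ := h
      refine ⟨hB, ?_⟩
      have hB' := popPivot_none hp
      have h2 := affineSum_ite (entryForm (Fin.ofNat 24 i)) (fun y => y = (a : ZMod 3))
        (B := B.map (unpack 3)) (by
          intro b hb
          obtain ⟨c, hc, rfl⟩ := List.mem_map.1 hb
          exact (tri_eq_zero_iff c _).1 (by rw [hi']; exact hB' c hc)) (unpack 3 o) f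
      refine h2.trans (if_pos ?_)
      rw [← Nat.eq_of_beq_eq_true hbq, entryForm_unpack hi]
  · rw [hp] at h
    simp only [Option.some.injEq, Prod.mk.injEq] at h
    obtain ⟨ho', hB'⟩ := h
    obtain ⟨hc, hperm⟩ := popPivot_some hp
    obtain ⟨M, hMo, hMB, hML⟩ := hB
    have hMc : Packs W M c := hMB c (hperm.mem_iff.2 List.mem_cons_self)
    have hMB'' : ∀ b ∈ B'', Packs W M b := fun b hb =>
      hMB b (hperm.mem_iff.2 (List.mem_cons_of_mem _ hb))
    have hlen : B.length = B''.length + 1 := by rw [hperm.length_eq, List.length_cons]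
    have hML' : 3 * M * 3 ^ B''.length ≤ L := by
      rw [hlen, pow_succ] at hML
      calc 3 * M * 3 ^ B''.length = M * (3 ^ B''.length * 3) := by ring
        _ ≤ L := hML
    have h3M : 3 * M < laneBase :=
      lt_of_le_of_lt ((Nat.le_mul_of_pos_right _ (by positivity)).trans hML') hL
    rw [elimAll_eq] at hB'
    have hstep : ∀ t v, t < 3 → Packs W M v → _ := fun t v ht hv => hv.addMul_three hMc ht h3M
    have ho2 := hstep ((a + 2 * tri o i) * tri c i % 3) o (Nat.mod_lt _ (by norm_num)) hMo
    have ho'' : o' = addMul ((a + 2 * tri o i) * tri c i % 3) o c := ho'.symm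
    have hB3 : B' = B''.map fun x => addMul (2 * tri c i * tri x i % 3) x c := hB'.symm
    refine ⟨⟨3 * M, ?_, ?_, ?_⟩, ?_⟩
    · rw [ho'']; exact ho2.1
    · intro b hb
      rw [hB3] at hb
      obtain ⟨x, hx, hxb⟩ := List.mem_map.1 hb
      rw [← hxb]
      exact (hstep _ x (Nat.mod_lt _ (by norm_num)) (hMB'' x hx)).1
    · rw [hB3, List.length_map]; exact hML'
    · set φ := entryForm (Fin.ofNat 24 i) with hφ
      have hφt : ∀ v, φ (unpack 3 v) = ((tri v i : ℕ) : ZMod 3) := entryForm_unpack hi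
      have hcne : φ (unpack 3 c) ≠ 0 := by
        rw [hφt, Ne, ZMod.natCast_eq_zero_iff]
        exact fun hd => hc (Nat.eq_zero_of_dvd_of_lt hd (tri_lt c i))
      have hsq : φ (unpack 3 c) * φ (unpack 3 c) = 1 := by
        revert hcne; generalize φ (unpack 3 c) = y; revert y; decide
      have h3 : (3 : ZMod 3) = 0 := by decide
      rw [affineSum_perm (hperm.map _)]
      refine (sum_affineSum_pivot φ (a : ZMod 3) (unpack 3 c) (B''.map (unpack 3))
        (fun x => 2 * φ (unpack 3 c) * φ x) ?_ (unpack 3 o)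
        ((a + 2 * φ (unpack 3 o)) * φ (unpack 3 c)) hcne ?_ f).trans ?_
      · intro x _
        rw [map_add, map_smul, smul_eq_mul]
        linear_combination (2 * φ x) * hsq + φ x * h3
      · rw [map_add, map_smul, smul_eq_mul]
        linear_combination ((a : ZMod 3) + 2 * φ (unpack 3 o)) * hsq + φ (unpack 3 o) * h3
      · rw [ho'', ho2.2, hB3, List.map_map, List.map_map]
        congr 1
        · rw [ZMod.natCast_mod, hφt, hφt]; push_cast; rfl
        · refine List.map_congr_left fun x hx => ?_
          simp only [Function.comp_apply]
          rw [(hstep _ x (Nat.mod_lt _ (by norm_num)) (hMB'' x hx)).2, ZMod.natCast_mod, hφt, hφt]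
          push_cast; rfl

theorem sum_combos {L o : ℕ} {B : List ℕ} (hL : L < laneBase) (hB : Bounded W L o B) :
    (∀ v ∈ combos B o, Packs W L v) ∧ ∀ f : (Fin 24 → ZMod 3) → M',
    ((combos B o).map fun v => f (unpack 3 v)).sum
      = affineSum (unpack 3 o) (B.map (unpack 3)) f := by
  induction B generalizing o with
  | nil =>
    obtain ⟨M, hMo, -, hML⟩ := hB
    refine ⟨?_, fun f => by simp [combos, affineSum]⟩
    intro v hv
    rw [combos, List.mem_singleton] at hv
    rw [hv]
    exact hMo.mono (by simpa using hML)
  | cons b B ih =>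
    obtain ⟨M, hMo, hMB, hML⟩ := hB
    have hML' : 3 * M * 3 ^ B.length ≤ L := by
      rw [List.length_cons, pow_succ] at hML
      calc 3 * M * 3 ^ B.length = M * (3 ^ B.length * 3) := by ring
        _ ≤ L := hML
    have h3M : 3 * M < laneBase :=
      lt_of_le_of_lt ((Nat.le_mul_of_pos_right _ (by positivity)).trans hML') hL
    have hMb : Packs W M b := hMB b List.mem_cons_self
    have hMB' : ∀ x ∈ B, Packs W (3 * M) x := fun x hx =>
      (hMB x (List.mem_cons_of_mem _ hx)).mono (by omega)
    have h1 := hMo.addMul_three hMb (t := 1) (by norm_num) h3M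
    have h2 := hMo.addMul_three hMb (t := 2) (by norm_num) h3M
    have e0 := ih ⟨3 * M, hMo.mono (by omega), hMB', hML'⟩
    have e1 := ih ⟨3 * M, h1.1, hMB', hML'⟩
    have e2 := ih ⟨3 * M, h2.1, hMB', hML'⟩
    refine ⟨?_, fun f => ?_⟩
    · intro v hv
      rw [combos, List.mem_append, List.mem_append] at hv
      rcases hv with hv | hv | hv
      · exact e0.1 v hv
      · exact e1.1 v hv
      · exact e2.1 v hv
    · rw [combos, List.map_append, List.map_append, List.sum_append, List.sum_append, e0.2, e1.2,
        e2.2, h1.2, h2.2, List.map_cons, affineSum]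
      have hu : (Finset.univ : Finset (ZMod 3)) = {0, 1, 2} := by decide
      rw [hu, Finset.sum_insert (by decide), Finset.sum_insert (by decide), Finset.sum_singleton]
      simp

theorem sum_ite_matches {c : ℕ × List ℕ} {cs : List (ℕ × List ℕ)} {k : ℕ} (hnd : c.2.Nodup)
    (hlt : ∀ a ∈ c.2, a < 3) (w : Fin 24 → ZMod 3) (x : M') [Decidable (Matches (c :: cs) k w)] :
    (if Matches (c :: cs) k w then x else 0) = (c.2.map fun a : ℕ =>
      if w (Fin.ofNat 24 c.1) = a then
        open Classical in
        if ∃ k', payLetter a k = some k' ∧ Matches cs k' w then x else 0 else 0).sum := by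
  classical
  by_cases hex : ∃ a ∈ c.2, (a : ZMod 3) = w (Fin.ofNat 24 c.1)
  · obtain ⟨a, ha, haw⟩ := hex
    have huniq : ∀ a' ∈ c.2, w (Fin.ofNat 24 c.1) = a' → a' = a := by
      intro a' ha' h
      rw [← haw, ZMod.natCast_eq_natCast_iff', Nat.mod_eq_of_lt (hlt a ha),
        Nat.mod_eq_of_lt (hlt a' ha')] at h
      exact h.symm
    rw [List.sum_map_eq_nsmul_single a _ (fun a' hne ha' => if_neg fun h => hne (huniq a' ha' h)),
      List.count_eq_one_of_mem hnd ha, one_smul, if_pos haw.symm]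
    refine if_congr ?_ rfl rfl
    rw [Matches]
    constructor
    · rintro ⟨a', ha', h1, h2⟩
      rwa [← huniq a' ha' h1.symm]
    · intro h
      exact ⟨a, ha, haw, h⟩
  · rw [if_neg, eq_comm]
    · refine List.sum_eq_zero fun y hy => ?_
      obtain ⟨a, ha, rfl⟩ := List.mem_map.1 hy
      exact if_neg fun h => hex ⟨a, ha, h.symm⟩
    · rintro ⟨a, ha, h, -⟩
      exact hex ⟨a, ha, h⟩

theorem affineSum_list_sum {E : Type} [AddCommGroup E] [Module (ZMod 3) E] (l : List ℕ)
    (o : E) (B : List E) (F : ℕ → E → M') :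
    affineSum o B (fun w => (l.map fun a => F a w).sum)
      = (l.map fun a => affineSum o B (F a)).sum := by
  induction B generalizing o with
  | nil => rfl
  | cons b B ih =>
    simp only [affineSum, ih]
    clear ih
    induction l with
    | nil => simp
    | cons a l ihl => simp only [List.map_cons, List.sum_cons, Finset.sum_add_distrib, ihl]

theorem affineSum_zero {E : Type} [AddCommGroup E] [Module (ZMod 3) E] (o : E) (B : List E) :
    affineSum o B (fun _ => (0 : M')) = 0 := by
  induction B generalizing o with
  | nil => rfl
  | cons b B ih => simp only [affineSum, ih, Finset.sum_const_zero]

open Classical in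
/-- The list `searchWords cs k o B` enumerates, with multiplicities, the matching words among the
combinations `o + ∑ t_j b_j`; its members pack words of every submodule that contains `o` and `B`.
-/
theorem sum_searchWords {cs : List (ℕ × List ℕ)}
    (hcs : ∀ c ∈ cs, c.1 < 24 ∧ c.2.Nodup ∧ ∀ a ∈ c.2, a < 3) {L o : ℕ} {B : List ℕ} (k : ℕ)
    (hL : L < laneBase) (hB : Bounded W L o B) :
    (∀ v ∈ searchWords cs k o B, Packs W L v) ∧ ∀ f : (Fin 24 → ZMod 3) → M',
    ((searchWords cs k o B).map fun v => f (unpack 3 v)).sum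
      = affineSum (unpack 3 o) (B.map (unpack 3)) (fun w => if Matches cs k w then f w else 0) := by
  induction cs generalizing k o B with
  | nil => simpa [searchWords, Matches] using sum_combos (M' := M') hL hB
  | cons c cs ih =>
    obtain ⟨hc1, hnd, hlt⟩ := hcs c List.mem_cons_self
    have hcs' : ∀ c ∈ cs, c.1 < 24 ∧ c.2.Nodup ∧ ∀ a ∈ c.2, a < 3 := fun c hc =>
      hcs c (List.mem_cons_of_mem _ hc)
    constructor
    · intro v hv
      rw [searchWords, List.mem_flatMap] at hv
      obtain ⟨a, ha, hv⟩ := hv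
      rcases hp : payLetter a k with _ | k'
      · rw [hp] at hv; simp at hv
      · rw [hp] at hv
        rcases hr : restrictEntry c.1 a o B with _ | ⟨o', B'⟩
        · rw [hr] at hv; simp at hv
        · rw [hr] at hv
          exact (ih hcs' k' (restrictEntry_some hc1 hL hB hr
            (fun _ => (0 : M'))).1).1 v hv
    · intro f
      simp only [sum_ite_matches hnd hlt]
      rw [affineSum_list_sum, searchWords, List.flatMap_def, List.map_flatten, List.sum_flatten,
        List.map_map, List.map_map]
      refine congrArg List.sum (List.map_congr_left fun a ha => ?_)
      simp only [Function.comp_apply]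
      rcases hp : payLetter a k with _ | k'
      · simp [affineSum_zero]
      · simp only [Option.some.injEq, exists_eq_left']
        rcases hr : restrictEntry c.1 a o B with _ | ⟨o', B'⟩
        · rw [restrictEntry_none hc1 (hlt a ha) hr]; simp
        · obtain ⟨h1, h2⟩ := restrictEntry_some hc1 hL hB hr
            (fun w => if Matches cs k' w then f w else 0)
          rw [h2]
          exact (ih hcs' k' h1).2 f

end Search

/-! ### The generator matrix in packed form -/

/-- The coefficients of `g` modulo `3 ^ 5`. -/
def genList : List ℕ := [242, 149, 152, 4, 97, 189, 185, 90, 239, 147, 150, 1]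

/-- The coefficients of `g` modulo `3 ^ 5` as a packed word. -/
def genWord : ℕ := genList.foldr (fun a s => Nat.add a (Nat.mul laneBase s)) 0

/-- A row of the generator matrix modulo `3 ^ 5` as a packed word. -/
def codeRow (i : ℕ) : ℕ :=
  Nat.add (Nat.mul (Nat.pow laneBase i) genWord) (Nat.pow laneBase 23)

/-- The rows of the generator matrix modulo `3 ^ 5` as packed words. -/
def codeRows : List ℕ := [codeRow 0, codeRow 1, codeRow 2, codeRow 3, codeRow 4, codeRow 5,
    codeRow 6,
  codeRow 7, codeRow 8, codeRow 9, codeRow 10, codeRow 11]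

theorem codeRows_eq : codeRows = List.ofFn fun i : Fin 12 => codeRow i := by
  simp only [List.ofFn_succ, List.ofFn_zero]
  rfl

theorem isPacked_codeRow (i : Fin 12) : IsPacked 242 (codeRow i) := by
  refine ⟨fun j => if j = 23 then 1 else if i.val ≤ j then genList.getD (j - i.val) 0 else 0,
    fun j => ?_, ?_⟩
  · have h : ∀ k, genList.getD k 0 ≤ 242 := by
      intro k
      by_cases hk : k < 12
      · revert k; decide
      · rw [List.getD_eq_default _ _ (by simpa [genList] using hk)]
        norm_num
    dsimp only
    split_ifs
    · norm_num
    · exact h _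
    · norm_num
  · revert i; decide +kernel

theorem unpack_codeRow_five (i : Fin 12) :
    unpack (3 ^ 5) (codeRow i) = qrRow (93 : ZMod (3 ^ 5)) i := by
  have h : ∀ (i : Fin 12) (j : Fin 24),
      unpack (3 ^ 5) (codeRow i) j = qrRow (93 : ZMod (3 ^ 5)) i j := by decide +kernel
  exact funext (h i)

theorem unpack_codeRow_three (i : Fin 12) : unpack 3 (codeRow i) = qrRow (0 : ZMod 3) i := by
  have h : ∀ (i : Fin 12) (j : Fin 24),
      unpack 3 (codeRow i) j = qrRow (0 : ZMod 3) i j := by decide +kernel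
  exact funext (h i)

theorem toZModPow_five {θ : ℤ_[3]} (hθ : θ ^ 2 + θ + 6 = 0) (h1 : PadicInt.toZModPow 1 θ = 0) :
    PadicInt.toZModPow 5 θ = 93 := by
  have h2 := toZModPow_root hθ 5
  have h3 : redMod 3 (show 1 ≤ 5 by norm_num) (PadicInt.toZModPow 5 θ) = 0 := by
    rw [redMod_toZModPow, h1]
  rw [redMod_eq_zero_iff] at h3
  have h : ∀ t : ZMod (3 ^ 5), t ^ 2 + t + 6 = 0 → 3 ^ 1 ∣ t.val → t = 93 := by decide +kernel
  exact h _ h2 h3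

/-- The assumptions on the root `θ` that determine the tower of codes: it is the root of
`X ^ 2 + X + 6` that is divisible by three. -/
structure IsCodeRoot (θ : ℤ_[3]) : Prop where
  root : θ ^ 2 + θ + 6 = 0
  red : PadicInt.toZModPow 1 θ = 0

section Rows

variable {θ : ℤ_[3]}

theorem IsCodeRoot.tower (hθ : IsCodeRoot θ) : SelfDualTower 3 (qrTower θ) :=
  selfDualTower_qrTower hθ.root

theorem IsCodeRoot.packs_codeRow (hθ : IsCodeRoot θ) (i : Fin 12) :
    Packs (qrTower θ 5) 242 (codeRow i) := by
  refine ⟨isPacked_codeRow i, ?_⟩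
  rw [unpack_codeRow_five, ← toZModPow_five hθ.root hθ.red]
  exact qrRow_mem _ i

theorem isPacked_zero (M : ℕ) : IsPacked M 0 := ⟨fun _ => 0, fun _ => Nat.zero_le _, by simp⟩

theorem unpack_zero (n : ℕ) : unpack n 0 = 0 := by
  funext i
  simp [unpack, lane_eq]

/-- A bound for the entries of all packed words that result from the rows of the generator matrix by
elimination. -/
def rowBound : ℕ := 242 * 3 ^ 12

theorem IsCodeRoot.bounded_codeRows (hθ : IsCodeRoot θ) :
    Bounded (qrTower θ 5) rowBound 0 codeRows := by
  refine ⟨242, ⟨isPacked_zero _, ?_⟩, ?_, le_rfl⟩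
  · rw [unpack_zero]; exact zero_mem _
  · intro b hb
    rw [codeRows_eq, List.mem_ofFn] at hb
    obtain ⟨i, rfl⟩ := hb
    exact hθ.packs_codeRow i

/-- The identification of the residues modulo `3` with those modulo `3 ^ 1`. -/
def upOne : ZMod 3 ≃+* ZMod (3 ^ 1) := ZMod.ringEquivCongr (pow_one 3).symm

theorem IsCodeRoot.sum_levelOne (hθ : IsCodeRoot θ) {M : Type} [AddCommMonoid M]
    (F : (Fin 24 → ZMod (3 ^ 1)) → M) [DecidablePred (· ∈ qrTower θ 1)] :
    ∑ c : Fin 24 → ZMod (3 ^ 1) with c ∈ qrTower θ 1, F c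
      = affineSum 0 (codeRows.map (unpack 3)) (fun w => F fun i => upOne (w i)) := by
  rw [codeRows_eq, List.map_ofFn, affineSum_ofFn]
  symm
  refine Finset.sum_bij (fun u _ => fun j => ∑ i, upOne (u i) * qrRow (0 : ZMod (3 ^ 1)) i j)
    ?_ ?_ ?_ ?_
  · intro u _
    rw [Finset.mem_filter]
    refine ⟨Finset.mem_univ _, mem_qrCode.2 ⟨fun i => upOne (u i), ?_⟩⟩
    rw [hθ.red]
  · intro u _ u' _ h
    have := qrCode_coeff_injective (0 : ZMod (3 ^ 1)) h
    exact funext fun i => upOne.injective (congrFun this i)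
  · intro c hc
    obtain ⟨u, hu⟩ := mem_qrCode.1 (Finset.mem_filter.1 hc).2
    rw [hθ.red] at hu
    exact ⟨fun i => upOne.symm (u i), Finset.mem_univ _, by simp [hu]⟩
  · intro u _
    congr 1
    funext j
    simp only [Function.comp_apply, unpack_codeRow_three, zero_add, Finset.sum_apply, Pi.smul_apply,
      smul_eq_mul, map_sum, map_mul]
    refine Finset.sum_congr rfl fun i _ => ?_
    simp [qrRow]

theorem upOne_natCast (a : ℕ) : upOne (a : ZMod 3) = a := map_natCast upOne a

open Classical in
/-- The sum over the words modulo three with prescribed entries. -/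
theorem IsCodeRoot.sum_matches (hθ : IsCodeRoot θ) {M : Type} [AddCommMonoid M]
    {cs : List (ℕ × List ℕ)} (hcs : ∀ c ∈ cs, c.1 < 24 ∧ c.2.Nodup ∧ ∀ a ∈ c.2, a < 3) (k : ℕ)
    (F : (Fin 24 → ZMod (3 ^ 1)) → M) :
    ∑ c : Fin 24 → ZMod (3 ^ 1) with c ∈ qrTower θ 1,
        (if Matches cs k (fun i => upOne.symm (c i)) then F c else 0)
      = ((searchWords cs k 0 codeRows).map fun v => F (unpack (3 ^ 1) v)).sum := by
  rw [hθ.sum_levelOne]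
  have h := (sum_searchWords (M' := M) hcs k (by norm_num [rowBound, laneBase])
    hθ.bounded_codeRows).2 (fun w => F fun i => upOne (w i))
  rw [unpack_zero] at h
  simp only [RingEquiv.symm_apply_apply]
  rw [← h]
  refine congrArg List.sum (List.map_congr_left fun v _ => ?_)
  refine congrArg F (funext fun i => ?_)
  simp [unpack]

theorem IsCodeRoot.packs_searchWords (hθ : IsCodeRoot θ) {cs : List (ℕ × List ℕ)}
    (hcs : ∀ c ∈ cs, c.1 < 24 ∧ c.2.Nodup ∧ ∀ a ∈ c.2, a < 3) (k : ℕ) {v : ℕ}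
    (hv : v ∈ searchWords cs k 0 codeRows) : Packs (qrTower θ 5) rowBound v :=
  (sum_searchWords (M' := ℕ) hcs k (by norm_num [rowBound, laneBase])
    hθ.bounded_codeRows).1 v hv

open Classical in
theorem IsCodeRoot.matches_of_mem (hθ : IsCodeRoot θ) {cs : List (ℕ × List ℕ)}
    (hcs : ∀ c ∈ cs, c.1 < 24 ∧ c.2.Nodup ∧ ∀ a ∈ c.2, a < 3) (k : ℕ) {v : ℕ}
    (hv : v ∈ searchWords cs k 0 codeRows) : Matches cs k (unpack 3 v) := by
  by_contra hcon
  have h := (sum_searchWords (M' := ℕ) hcs k (by norm_num [rowBound, laneBase])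
    hθ.bounded_codeRows).2 (fun w => if Matches cs k w then 0 else 1)
  have h2 : ∀ w : Fin 24 → ZMod 3,
      (if Matches cs k w then (if Matches cs k w then 0 else 1) else 0) = 0 := by
    intro w; split_ifs <;> rfl
  simp only [h2, affineSum_zero] at h
  have h3 := List.sum_eq_zero_iff.1 h _ (List.mem_map_of_mem hv)
  rw [if_neg hcon] at h3
  exact one_ne_zero h3

theorem matches_iff {cs : List (ℕ × List ℕ)} {k : ℕ} (hk : cs.length ≤ k) (w : Fin 24 → ZMod 3) :
    Matches cs k w ↔ ∀ c ∈ cs, ∃ a ∈ c.2, (a : ZMod 3) = w (Fin.ofNat 24 c.1) := by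
  induction cs generalizing k with
  | nil => simp [Matches]
  | cons c cs ih =>
    rw [List.length_cons] at hk
    rw [Matches, List.forall_mem_cons]
    obtain ⟨k, rfl⟩ := Nat.exists_eq_succ_of_ne_zero (show k ≠ 0 by omega)
    constructor
    · rintro ⟨a, ha, h1, k', hp, h2⟩
      refine ⟨⟨a, ha, h1⟩, (ih ?_).1 h2⟩
      rcases a with _ | a <;> simp only [payLetter, Option.some.injEq] at hp <;> omega
    · rintro ⟨⟨a, ha, h1⟩, h2⟩
      rcases a with _ | a
      · exact ⟨0, ha, h1, k + 1, rfl, (ih (by omega)).2 h2⟩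
      · exact ⟨a + 1, ha, h1, k, rfl, (ih (by omega)).2 h2⟩

end Rows

/-! ### Lifts of a word with support disjoint from a given word -/

/-- The indices of the coordinates. -/
def positions : List ℕ := List.range 24

/-- The entries modulo three that a word `k` must have for `c + q₁ k` to vanish modulo `3 q₁`
wherever `d` does not vanish modulo `q₂`. -/
def fixEntries (q₁ q₂ c d : ℕ) : List ℕ → List (ℕ × List ℕ)
  | [] => []
  | i :: P => match Nat.mod (lane d i) q₂ with
    | 0 => fixEntries q₁ q₂ c d P
    | _ + 1 => (i, [Nat.mod (Nat.mul 2 (Nat.div (lane c i) q₁)) 3]) :: fixEntries q₁ q₂ c d P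

/-- The index of the first entry that is not divisible by three. -/
def leadIndex (c : ℕ) : ℕ := (positions.find? fun i => Nat.blt 0 (tri c i)).getD 0

/-- The conditions on `k` for `c + q₁ k` to have the entry `1` at `s` and to vanish wherever `d`
does not. -/
def liftEntries (s q₁ q₂ c d : ℕ) : List (ℕ × List ℕ) :=
  (s, [Nat.mod (Nat.mul 2 (Nat.div (Nat.sub (lane c s) 1) q₁)) 3]) ::
    fixEntries q₁ q₂ c d positions

/-- The codewords `c + q₁ k` modulo `3 q₁` with entry `1` at `s` that vanish wherever `d` does not
vanish modulo `q₂`. -/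
def liftsOf (s q₁ q₂ c d : ℕ) : List ℕ :=
  (searchWords (liftEntries s q₁ q₂ c d) 25 0 codeRows).map fun k => addMul q₁ c k

theorem mem_fixEntries {q₁ q₂ c d : ℕ} {P : List ℕ} {x : ℕ × List ℕ} :
    x ∈ fixEntries q₁ q₂ c d P ↔
      ∃ i ∈ P, lane d i % q₂ ≠ 0 ∧ (i, [2 * (lane c i / q₁) % 3]) = x := by
  induction P with
  | nil => simp [fixEntries]
  | cons i P ih =>
    rw [fixEntries, List.exists_mem_cons_iff]
    rcases h : Nat.mod (lane d i) q₂ with _ | t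
    · change lane d i % q₂ = 0 at h
      simp [ih, h]
    · change lane d i % q₂ = t + 1 at h
      simp only [List.mem_cons, ih, h]
      refine or_congr ⟨fun h => ⟨by omega, h.symm⟩, fun h => h.2.symm⟩ Iff.rfl

theorem length_fixEntries (q₁ q₂ c d : ℕ) (P : List ℕ) :
    (fixEntries q₁ q₂ c d P).length ≤ P.length := by
  induction P with
  | nil => rfl
  | cons i P ih =>
    rw [fixEntries]
    rcases Nat.mod (lane d i) q₂ with _ | t <;> simp <;> omega

theorem fixEntries_valid (q₁ q₂ c d : ℕ) : ∀ x ∈ fixEntries q₁ q₂ c d positions,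
    x.1 < 24 ∧ x.2.Nodup ∧ ∀ a ∈ x.2, a < 3 := by
  intro x hx
  obtain ⟨i, hi, -, rfl⟩ := mem_fixEntries.1 hx
  refine ⟨List.mem_range.1 hi, List.nodup_singleton _, ?_⟩
  intro a ha
  rw [List.mem_singleton.1 ha]
  exact Nat.mod_lt _ (by norm_num)

theorem liftEntries_valid {s : ℕ} (hs : s < 24) (q₁ q₂ c d : ℕ) : ∀ x ∈ liftEntries s q₁ q₂ c d,
    x.1 < 24 ∧ x.2.Nodup ∧ ∀ a ∈ x.2, a < 3 := by
  intro x hx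
  rcases List.mem_cons.1 hx with rfl | hx
  · refine ⟨hs, List.nodup_singleton _, ?_⟩
    intro a ha
    rw [List.mem_singleton.1 ha]
    exact Nat.mod_lt _ (by norm_num)
  · exact fixEntries_valid _ _ _ _ x hx

theorem unpack_eq_zero_iff (n v : ℕ) (i : Fin 24) : unpack n v i = 0 ↔ lane v i % n = 0 := by
  rw [unpack, ZMod.natCast_eq_zero_iff, Nat.dvd_iff_mod_eq_zero]

theorem redMod_unpack {m N : ℕ} (h : m ≤ N) (v : ℕ) (i : Fin 24) :
    redMod 3 h (unpack (3 ^ N) v i) = unpack (3 ^ m) v i := map_natCast _ _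

theorem forall_positions {P : Fin 24 → Prop} :
    (∀ i ∈ positions, P (Fin.ofNat 24 i)) ↔ ∀ i, P i := by
  constructor
  · intro h i
    have := h i.val (List.mem_range.2 i.isLt)
    rwa [show Fin.ofNat 24 i.val = i from Fin.ext (Nat.mod_eq_of_lt i.isLt)] at this
  · exact fun h i _ => h _

theorem add_pow_mul_eq_iff {m a t q : ℕ} (ha : a = t + 3 ^ m * q) (e : ℕ) :
    ((a : ZMod (3 ^ (m + 1))) + 3 ^ m * e = t) ↔ ((2 * q % 3 : ℕ) : ZMod 3) = e := by
  have h1 : ((a : ZMod (3 ^ (m + 1))) + 3 ^ m * e = t)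
      ↔ ((3 ^ m * (q + e) : ℕ) : ZMod (3 ^ (m + 1))) = 0 := by
    rw [ha, ← sub_eq_zero]
    push_cast
    ring_nf
  rw [h1, ZMod.natCast_eq_zero_iff, pow_succ, Nat.mul_dvd_mul_iff_left (by positivity),
    ZMod.natCast_eq_natCast_iff']
  omega

section Lifts

variable {θ : ℤ_[3]}

theorem embMod_unpack (m : ℕ) (v : ℕ) (i : Fin 24) :
    embMod 3 (m + 1) (unpack (3 ^ 1) v i) = 3 ^ m * unpack (3 ^ (m + 1)) v i := by
  rw [← redMod_unpack (show 1 ≤ m + 1 by omega), embMod_redMod]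
  simp

/-- The conditions in `liftEntries` say what they should. -/
theorem matches_liftEntries_iff {m ℓ s c d : ℕ} (hs : s < 24)
    (hcs : unpack (3 ^ m) c (Fin.ofNat 24 s) = 1) (hm : m ≠ 0)
    (hcd : DisjSupp (unpack (3 ^ m) c) (unpack (3 ^ ℓ) d)) (e : Fin 24 → ZMod (3 ^ 1)) :
    Matches (liftEntries s (3 ^ m) (3 ^ ℓ) c d) 25 (fun i => upOne.symm (e i)) ↔
      unpack (3 ^ (m + 1)) c (Fin.ofNat 24 s) + embMod 3 (m + 1) (e (Fin.ofNat 24 s)) = 1 ∧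
      DisjSupp (fun i => unpack (3 ^ (m + 1)) c i + embMod 3 (m + 1) (e i)) (unpack (3 ^ ℓ) d) := by
  have hs' : (Fin.ofNat 24 s : Fin 24).val = s := Nat.mod_eq_of_lt hs
  have hlen : (liftEntries s (3 ^ m) (3 ^ ℓ) c d).length ≤ 25 := by
    have := length_fixEntries (3 ^ m) (3 ^ ℓ) c d positions
    simp only [liftEntries, List.length_cons, positions, List.length_range] at this ⊢
    omega
  have hup : ∀ x : ZMod (3 ^ 1), upOne.symm x = (x.val : ZMod 3) := by
    intro x
    rw [RingEquiv.symm_apply_eq, upOne_natCast, ZMod.natCast_zmod_val]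
  rw [matches_iff hlen, liftEntries, List.forall_mem_cons]
  refine and_congr ?_ ?_
  · have h1 : lane c s = 1 + 3 ^ m * ((lane c s - 1) / 3 ^ m) := by
      have h2 : ((lane c s : ℕ) : ZMod (3 ^ m)) = (1 : ℕ) := by
        rw [Nat.cast_one, ← hcs, unpack, hs']
      rw [ZMod.natCast_eq_natCast_iff'] at h2
      have h3 : 1 < 3 ^ m := Nat.one_lt_pow hm (by norm_num)
      rw [Nat.mod_eq_of_lt h3] at h2
      have h5 := Nat.div_add_mod (lane c s) (3 ^ m)
      rw [h2] at h5
      rw [Nat.mul_div_cancel']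
      · omega
      · exact ⟨lane c s / 3 ^ m, by omega⟩
    have h4 := add_pow_mul_eq_iff h1 (e (Fin.ofNat 24 s)).val
    simp only [List.mem_singleton, exists_eq_left]
    rw [hup]
    refine h4.symm.trans ?_
    rw [Nat.cast_one, embMod, unpack, hs']
    simp
  · rw [DisjSupp, ← forall_positions]
    constructor
    · intro h i hi
      have hi' : (Fin.ofNat 24 i : Fin 24).val = i := Nat.mod_eq_of_lt (List.mem_range.1 hi)
      by_cases hd : unpack (3 ^ ℓ) d (Fin.ofNat 24 i) = 0
      · exact Or.inr hd
      · left
        have hc := (hcd (Fin.ofNat 24 i)).resolve_right hd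
        rw [unpack_eq_zero_iff, hi'] at hc hd
        obtain ⟨a, ha, hae⟩ := h _ (mem_fixEntries.2 ⟨i, hi, hd, rfl⟩)
        rw [List.mem_singleton] at ha
        rw [ha, hup] at hae
        have h1 : lane c i = 0 + 3 ^ m * (lane c i / 3 ^ m) := by
          rw [zero_add, Nat.mul_div_cancel' (Nat.dvd_of_mod_eq_zero hc)]
        have := (add_pow_mul_eq_iff h1 _).2 hae
        rw [embMod, unpack, hi']
        simpa using this
    · intro h x hx
      obtain ⟨i, hi, hd, rfl⟩ := mem_fixEntries.1 hx
      have hi' : (Fin.ofNat 24 i : Fin 24).val = i := Nat.mod_eq_of_lt (List.mem_range.1 hi)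
      have hd' : ¬ unpack (3 ^ ℓ) d (Fin.ofNat 24 i) = 0 := by rwa [unpack_eq_zero_iff, hi']
      have hc := (hcd (Fin.ofNat 24 i)).resolve_right hd'
      rw [unpack_eq_zero_iff, hi'] at hc
      have h1 : lane c i = 0 + 3 ^ m * (lane c i / 3 ^ m) := by
        rw [zero_add, Nat.mul_div_cancel' (Nat.dvd_of_mod_eq_zero hc)]
      refine ⟨_, List.mem_singleton_self _, ?_⟩
      rw [hup]
      refine (add_pow_mul_eq_iff h1 _).1 ?_
      have := (h i hi).resolve_right hd'
      rw [embMod, unpack, hi'] at this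
      simpa using this

theorem unpack_addMul_pow {m L c v : ℕ} (hc : IsPacked L c) (hv : IsPacked rowBound v)
    (hL : L + 3 ^ m * rowBound < laneBase) (i : Fin 24) :
    unpack (3 ^ (m + 1)) (addMul (3 ^ m) c v) i
      = unpack (3 ^ (m + 1)) c i + embMod 3 (m + 1) (unpack (3 ^ 1) v i) := by
  rw [unpack_addMul _ hc hv hL, embMod_unpack]
  simp

theorem IsCodeRoot.mem_liftsOf (hθ : IsCodeRoot θ) {m ℓ s c d L v : ℕ} (hs : s < 24)
    (hcs : unpack (3 ^ m) c (Fin.ofNat 24 s) = 1) (hm : m ≠ 0)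
    (hcd : DisjSupp (unpack (3 ^ m) c) (unpack (3 ^ ℓ) d)) (hc : Packs (qrTower θ 5) L c)
    (hL : L + 3 ^ m * rowBound < laneBase) (hv : v ∈ liftsOf s (3 ^ m) (3 ^ ℓ) c d) :
    Packs (qrTower θ 5) (L + 3 ^ m * rowBound) v ∧
      unpack (3 ^ (m + 1)) v (Fin.ofNat 24 s) = 1 ∧
      DisjSupp (unpack (3 ^ (m + 1)) v) (unpack (3 ^ ℓ) d) ∧
      unpack (3 ^ m) v = unpack (3 ^ m) c := by
  obtain ⟨k, hk, hkv⟩ := List.mem_map.1 hv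
  have hk1 := hθ.packs_searchWords (liftEntries_valid hs _ _ _ _) 25 hk
  have hk2 := hθ.matches_of_mem (liftEntries_valid hs _ _ _ _) 25 hk
  have hk3 : unpack 3 k = fun i => upOne.symm (unpack (3 ^ 1) k i) := by
    funext i
    rw [RingEquiv.eq_symm_apply, unpack, upOne_natCast, unpack]
  rw [hk3, matches_liftEntries_iff hs hcs hm hcd] at hk2
  have h4 := unpack_addMul_pow hc.packed hk1.packed hL
  have h5 : (fun i => unpack (3 ^ (m + 1)) c i + embMod 3 (m + 1) (unpack (3 ^ 1) k i))
      = unpack (3 ^ (m + 1)) v := by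
    rw [← hkv]; exact (funext h4).symm
  rw [h5] at hk2
  refine ⟨?_, ?_, hk2.2, ?_⟩
  · rw [← hkv]; exact hc.addMul hk1 hL
  · rw [← hkv, h4]; exact hk2.1
  · funext i
    rw [← redMod_unpack (Nat.le_succ m), ← congrFun h5 i, map_add, redMod_unpack,
      redMod_embMod (m := 1) (by omega), add_zero]

open Classical in
/-- The words that `liftsOf` lists are the normalized lifts of `c` whose supports are disjoint from
that of `d`. -/
theorem IsCodeRoot.sum_liftsOf (hθ : IsCodeRoot θ) {m ℓ s c d L : ℕ} (hs : s < 24)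
    (hcs : unpack (3 ^ m) c (Fin.ofNat 24 s) = 1) (hm : m ≠ 0) (hm5 : m + 1 ≤ 5)
    (hcd : DisjSupp (unpack (3 ^ m) c) (unpack (3 ^ ℓ) d)) (hc : Packs (qrTower θ 5) L c)
    (hL : L + 3 ^ m * rowBound < laneBase) {M : Type} [AddCommMonoid M]
    (G : (Fin 24 → ZMod (3 ^ (m + 1))) → M) :
    ∑ c' : Fin 24 → ZMod (3 ^ (m + 1)) with (c' ∈ qrTower θ (m + 1) ∧
        (fun i => redMod 3 (Nat.le_succ m) (c' i)) = unpack (3 ^ m) c) ∧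
        c' (Fin.ofNat 24 s) = 1 ∧ DisjSupp c' (unpack (3 ^ ℓ) d), G c'
      = ((liftsOf s (3 ^ m) (3 ^ ℓ) c d).map fun v => G (unpack (3 ^ (m + 1)) v)).sum := by
  have hmem : unpack (3 ^ (m + 1)) c ∈ qrTower θ (m + 1) := by
    have := hθ.tower.red hm5 _ hc.mem
    simpa only [redMod_unpack] using this
  rw [← Finset.filter_filter, Finset.sum_filter]
  have hfib := hθ.tower.sum_fiber (m := 1) (ℓ := m) (N := m + 1) (by omega)
    (fun c' => if c' (Fin.ofNat 24 s) = 1 ∧ DisjSupp c' (unpack (3 ^ ℓ) d) then G c' else 0) hmem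
      (fun i => redMod_unpack (Nat.le_succ m) c i)
  refine (Eq.trans (by congr!) hfib).trans ?_
  simp only [← matches_liftEntries_iff hs hcs hm hcd]
  have hsum := hθ.sum_matches (liftEntries_valid hs (3 ^ m) (3 ^ ℓ) c d) 25
    (fun e => G fun i => unpack (3 ^ (m + 1)) c i + embMod 3 (m + 1) (e i))
  refine (Eq.trans (by congr!) hsum).trans ?_
  rw [liftsOf, List.map_map]
  refine congrArg List.sum (List.map_congr_left fun k hk => ?_)
  rw [Function.comp_apply]
  refine congrArg G (funext fun i => ?_)
  exact (unpack_addMul_pow hc.packed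
    (hθ.packs_searchWords (liftEntries_valid hs _ _ _ _) 25 hk).packed hL i).symm

end Lifts

/-! ### Enumeration of pairs of words with disjoint supports -/

/-- The reduction of a word modulo three. -/
def residue {ι : Type*} {m : ℕ} (c : ι → ZMod (3 ^ m)) (i : ι) : ZMod 3 := ((c i).val : ZMod 3)

theorem residue_eq_zero_iff {ι : Type*} {m : ℕ} (c : ι → ZMod (3 ^ m)) (i : ι) :
    residue c i = 0 ↔ 3 ∣ (c i).val := ZMod.natCast_eq_zero_iff _ _

theorem unitWt_eq_card_residue {ι : Type*} [Fintype ι] {m : ℕ} (c : ι → ZMod (3 ^ m)) :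
    unitWt c = (Finset.univ.filter fun i => residue c i ≠ 0).card := by
  simp only [unitWt, residue_eq_zero_iff, Ne]

theorem residue_redMod {ι : Type*} {m N : ℕ} (h : m ≤ N) (hm : m ≠ 0) (c : ι → ZMod (3 ^ N)) :
    residue (fun i => redMod 3 h (c i)) = residue c := by
  funext i
  have h3 : 3 ∣ 3 ^ m := dvd_pow_self 3 hm
  rw [residue, residue, redMod_eq_natCast, ZMod.val_natCast, ZMod.natCast_eq_natCast_iff',
    Nat.mod_mod_of_dvd _ h3]

theorem residue_unpack {m : ℕ} (hm : m ≠ 0) (v : ℕ) : residue (unpack (3 ^ m) v) = unpack 3 v := by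
  funext i
  have h3 : 3 ∣ 3 ^ m := dvd_pow_self 3 hm
  rw [residue, unpack, unpack, ZMod.val_natCast, ZMod.natCast_eq_natCast_iff',
    Nat.mod_mod_of_dvd _ h3]

/-- The first entry of the word that is not divisible by three is `1`. -/
def IsNormalized {m : ℕ} (d : Fin 24 → ZMod (3 ^ m)) : Prop :=
  ∃ s, d s = 1 ∧ ∀ j < s, residue d j = 0

theorem residue_eq_one {m : ℕ} (hm : m ≠ 0) {d : Fin 24 → ZMod (3 ^ m)} {s : Fin 24} (h : d s = 1) :
    residue d s = 1 := by
  have h1 : 1 < 3 ^ m := Nat.one_lt_pow hm (by norm_num)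
  have : Fact (1 < 3 ^ m) := ⟨h1⟩
  rw [residue, h, ZMod.val_one, Nat.cast_one]

theorem leadIndex_eq {v s : ℕ} (hs : s < 24) (h1 : tri v s ≠ 0) (h2 : ∀ j < s, tri v j = 0) :
    leadIndex v = s := by
  have : positions.find? (fun i => Nat.blt 0 (tri v i)) = some s := by
    rw [positions, List.find?_range_eq_some]
    refine ⟨?_, List.mem_range.2 hs, fun j hj => ?_⟩
    · simp [Nat.pos_of_ne_zero h1]
    · rw [h2 j hj]; rfl
  rw [leadIndex, this, Option.getD_some]

theorem IsNormalized.leadIndex {m v : ℕ} (hm : m ≠ 0) (h : IsNormalized (unpack (3 ^ m) v)) :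
    leadIndex v < 24 ∧ unpack (3 ^ m) v (Fin.ofNat 24 (leadIndex v)) = 1 ∧
      ∀ j < Fin.ofNat 24 (_root_.leadIndex v), unpack 3 v j = 0 := by
  obtain ⟨s, hs1, hs2⟩ := h
  rw [residue_unpack hm] at hs2
  have h1 := residue_eq_one hm hs1
  rw [residue_unpack hm] at h1
  have h3 : _root_.leadIndex v = s.val := by
    refine leadIndex_eq s.isLt ?_ ?_
    · rw [Ne, tri_eq_zero_iff, h1]; decide
    · intro j hj
      exact (tri_eq_zero_iff v ⟨j, by omega⟩).2 (hs2 ⟨j, by omega⟩ hj)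
  rw [h3, show Fin.ofNat 24 s.val = s from Fin.ext (Nat.mod_eq_of_lt s.isLt)]
  exact ⟨s.isLt, hs1, hs2⟩

theorem isNormalized_unpack_one_iff (v : ℕ) :
    IsNormalized (unpack (3 ^ 1) v) ↔ Nat.beq (tri v (leadIndex v)) 1 = true := by
  have hone : ∀ i : Fin 24, unpack (3 ^ 1) v i = 1 ↔ tri v i = 1 := by
    intro i
    rw [unpack, ← Nat.cast_one (R := ZMod (3 ^ 1)), ZMod.natCast_eq_natCast_iff']
    exact Iff.rfl
  constructor
  · intro h
    obtain ⟨h1, h2, -⟩ := h.leadIndex one_ne_zero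
    rw [hone, show (Fin.ofNat 24 (leadIndex v) : Fin 24).val = leadIndex v from
      Nat.mod_eq_of_lt h1] at h2
    rw [h2]; rfl
  · intro h
    have h1 : tri v (leadIndex v) = 1 := Nat.eq_of_beq_eq_true h
    rcases hf : positions.find? (fun i => Nat.blt 0 (tri v i)) with _ | s
    · have h0 : leadIndex v = 0 := by rw [leadIndex, hf, Option.getD_none]
      rw [List.find?_eq_none] at hf
      have := hf 0 (by decide)
      rw [h0] at h1
      rw [h1] at this
      exact absurd rfl this
    · have h0 : leadIndex v = s := by rw [leadIndex, hf, Option.getD_some]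
      rw [positions, List.find?_range_eq_some] at hf
      obtain ⟨-, hs, hj⟩ := hf
      refine ⟨⟨s, List.mem_range.1 hs⟩, (hone _).2 (h0 ▸ h1), fun j hjs => ?_⟩
      rw [residue_unpack one_ne_zero, ← tri_eq_zero_iff]
      have := hj j.val hjs
      by_contra hne
      have hpos : Nat.blt 0 (tri v j.val) = true := by simp [Nat.pos_of_ne_zero hne]
      rw [hpos] at this
      exact absurd this (by decide)

/-- The list `l` of pairs of packed words enumerates the pairs `(c, d)` of codewords modulo `3 ^ m`
and `3 ^ ℓ` with disjoint supports, where `c` reduces to the packed word `r` modulo three and is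
normalized by `c 0 = 1`, and `d` is normalized as well. The packed words have entries at most `L`
and are codewords modulo `3 ^ 5`. -/
structure Enumerates (θ : ℤ_[3]) (r m ℓ L : ℕ) (l : List (ℕ × ℕ)) : Prop where
  packs : ∀ p ∈ l, Packs (qrTower θ 5) L p.1 ∧ Packs (qrTower θ 5) L p.2
  disj : ∀ p ∈ l, DisjSupp (unpack (3 ^ m) p.1) (unpack (3 ^ ℓ) p.2)
  normalized : ∀ p ∈ l, unpack (3 ^ m) p.1 0 = 1 ∧ IsNormalized (unpack (3 ^ ℓ) p.2)
  sum : open Classical in ∀ {M : Type} [AddCommMonoid M]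
    (F : (Fin 24 → ZMod (3 ^ m)) → (Fin 24 → ZMod (3 ^ ℓ)) → M),
    ∑ c : Fin 24 → ZMod (3 ^ m) with c ∈ qrTower θ m ∧ residue c = unpack 3 r ∧ c 0 = 1,
      ∑ d : Fin 24 → ZMod (3 ^ ℓ) with (d ∈ qrTower θ ℓ ∧ IsNormalized d) ∧ DisjSupp c d, F c d
    = (l.map fun p => F (unpack (3 ^ m) p.1) (unpack (3 ^ ℓ) p.2)).sum

/-- The pairs of words modulo three with first word `r`. -/
def pairsOne (r : ℕ) : List (ℕ × ℕ) :=
  ((searchWords (fixEntries 3 3 0 r positions) 25 0 codeRows).filter fun d =>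
    Nat.beq (tri d (leadIndex d)) 1).map fun d => (r, d)

/-- The lifts of the first words of pairs. -/
def liftLeft (q₁ q₂ : ℕ) (l : List (ℕ × ℕ)) : List (ℕ × ℕ) :=
  l.flatMap fun p => (liftsOf 0 q₁ q₂ p.1 p.2).map fun c => (c, p.2)

/-- The lifts of the second words of pairs. -/
def liftRight (q₁ q₂ : ℕ) (l : List (ℕ × ℕ)) : List (ℕ × ℕ) :=
  l.flatMap fun p => (liftsOf (leadIndex p.2) q₂ q₁ p.2 p.1).map fun d => (p.1, d)

section Enumeration

open Classical in
theorem sum_fiber_left {α β γ M : Type*} [AddCommMonoid M] (π : α → γ) {S' : Finset α}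
    {S : Finset γ}
    (hπ : ∀ x ∈ S', π x ∈ S) (T : Finset β) {R' : α → β → Prop} {R : γ → β → Prop}
    (hR : ∀ x ∈ S', ∀ d, R' x d → R (π x) d) (F : α → β → M) :
    ∑ x ∈ S', ∑ d ∈ T with R' x d, F x d
      = ∑ c ∈ S, ∑ d ∈ T with R c d, ∑ x ∈ S' with π x = c ∧ R' x d, F x d := by
  rw [← Finset.sum_fiberwise_of_maps_to hπ]
  refine Finset.sum_congr rfl fun c _ => ?_
  simp only [Finset.sum_filter]
  rw [← Finset.sum_filter, Finset.sum_comm]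
  refine Finset.sum_congr rfl fun d _ => ?_
  rw [Finset.sum_filter]
  by_cases h : R c d
  · rw [if_pos h]
    refine Finset.sum_congr rfl fun x _ => ?_
    by_cases h1 : π x = c <;> by_cases h2 : R' x d <;> simp [h1, h2]
  · rw [if_neg h]
    refine Finset.sum_eq_zero fun x hx => ?_
    by_cases h1 : π x = c
    · rw [if_pos h1, if_neg fun h2 => h (h1 ▸ hR x hx d h2)]
    · rw [if_neg h1]

open Classical in
theorem sum_fiber_right {α β γ M : Type*} [AddCommMonoid M] (π : β → γ) (S : Finset α)
    {T' : Finset β} {T : Finset γ} (hπ : ∀ y ∈ T', π y ∈ T) {R' : α → β → Prop}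
    {R : α → γ → Prop} (hR : ∀ x, ∀ y ∈ T', R' x y → R x (π y)) (F : α → β → M) :
    ∑ x ∈ S, ∑ y ∈ T' with R' x y, F x y
      = ∑ x ∈ S, ∑ d ∈ T with R x d, ∑ y ∈ T' with π y = d ∧ R' x y, F x y := by
  refine Finset.sum_congr rfl fun x _ => ?_
  rw [← Finset.sum_fiberwise_of_maps_to (t := T.filter fun d => R x d) (g := π)]
  · refine Finset.sum_congr rfl fun d _ => ?_
    rw [Finset.filter_filter]
    refine Finset.sum_congr (Finset.filter_congr fun y _ => and_comm) fun _ _ => rfl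
  · intro y hy
    rw [Finset.mem_filter] at hy ⊢
    exact ⟨hπ y hy.1, hR x y hy.1 hy.2⟩

theorem sum_map_flatMap {α β γ M : Type*} [AddCommMonoid M] (l : List α) (f : α → List β)
    (e : α → β → γ) (F : γ → M) :
    (((l.flatMap fun p => (f p).map (e p)).map F).sum
      = (l.map fun p => ((f p).map fun v => F (e p v)).sum).sum) := by
  rw [List.flatMap_def, List.map_flatten, List.sum_flatten, List.map_map, List.map_map]
  refine congrArg List.sum (List.map_congr_left fun p _ => ?_)
  simp [Function.comp_def]

variable {θ : ℤ_[3]}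

open Classical in
theorem filter_disjSupp (m ℓ : ℕ) (c : Fin 24 → ZMod (3 ^ m)) :
    (Finset.univ.filter fun d : Fin 24 → ZMod (3 ^ ℓ) =>
      (d ∈ qrTower θ ℓ ∧ IsNormalized d) ∧ DisjSupp c d)
    = (Finset.univ.filter fun d => d ∈ qrTower θ ℓ ∧ IsNormalized d).filter (DisjSupp c) := by
  ext d
  simp

theorem DisjSupp.redMod_left {m N ℓ : ℕ} (h : m ≤ N) {c : Fin 24 → ZMod (3 ^ N)}
    {d : Fin 24 → ZMod (3 ^ ℓ)} (hcd : DisjSupp c d) :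
    DisjSupp (fun i => redMod 3 h (c i)) d := fun i =>
  (hcd i).imp_left fun hc => by simp only [hc, map_zero]

open Classical in
/-- An enumeration of pairs modulo `(3 ^ m, 3 ^ ℓ)` gives one modulo `(3 ^ (m + 1), 3 ^ ℓ)`. -/
theorem IsCodeRoot.enumerates_liftLeft (hθ : IsCodeRoot θ) {r m ℓ L : ℕ} {l : List (ℕ × ℕ)}
    (hl : Enumerates θ r m ℓ L l) (hm : m ≠ 0) (hm5 : m + 1 ≤ 5)
    (hL : L + 3 ^ m * rowBound < laneBase) :
    Enumerates θ r (m + 1) ℓ (L + 3 ^ m * rowBound) (liftLeft (3 ^ m) (3 ^ ℓ) l) := by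
  have hmem : ∀ p ∈ liftLeft (3 ^ m) (3 ^ ℓ) l, ∃ p' ∈ l,
      p.1 ∈ liftsOf 0 (3 ^ m) (3 ^ ℓ) p'.1 p'.2 ∧ p.2 = p'.2 := by
    intro p hp
    obtain ⟨p', hp', hpp⟩ := List.mem_flatMap.1 hp
    obtain ⟨v, hv, hvp⟩ := List.mem_map.1 hpp
    exact ⟨p', hp', by rw [← hvp]; exact ⟨hv, rfl⟩⟩
  have hlift : ∀ p' ∈ l, ∀ v ∈ liftsOf 0 (3 ^ m) (3 ^ ℓ) p'.1 p'.2, _ := fun p' hp' v hv =>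
    hθ.mem_liftsOf (by norm_num) (hl.normalized p' hp').1 hm (hl.disj p' hp') (hl.packs p' hp').1
      hL hv
  refine ⟨?_, ?_, ?_, ?_⟩
  · intro p hp
    obtain ⟨p', hp', h1, h2⟩ := hmem p hp
    refine ⟨(hlift p' hp' _ h1).1, ?_⟩
    rw [h2]
    exact (hl.packs p' hp').2.mono (Nat.le_add_right _ _)
  · intro p hp
    obtain ⟨p', hp', h1, h2⟩ := hmem p hp
    rw [h2]
    exact (hlift p' hp' _ h1).2.2.1
  · intro p hp
    obtain ⟨p', hp', h1, h2⟩ := hmem p hp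
    rw [h2]
    exact ⟨(hlift p' hp' _ h1).2.1, (hl.normalized p' hp').2⟩
  · intro M _ F
    rw [liftLeft, sum_map_flatMap]
    have h := hl.sum (fun c d => ∑ c' : Fin 24 → ZMod (3 ^ (m + 1)) with
      (c' ∈ qrTower θ (m + 1) ∧ (fun i => redMod 3 (Nat.le_succ m) (c' i)) = c) ∧
        c' 0 = 1 ∧ DisjSupp c' d, F c' d)
    have hr : ∀ p ∈ l, (∑ c' : Fin 24 → ZMod (3 ^ (m + 1)) with
      (c' ∈ qrTower θ (m + 1) ∧ (fun i => redMod 3 (Nat.le_succ m) (c' i)) = unpack (3 ^ m) p.1) ∧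
        c' 0 = 1 ∧ DisjSupp c' (unpack (3 ^ ℓ) p.2), F c' (unpack (3 ^ ℓ) p.2))
        = ((liftsOf 0 (3 ^ m) (3 ^ ℓ) p.1 p.2).map fun v =>
            F (unpack (3 ^ (m + 1)) v) (unpack (3 ^ ℓ) p.2)).sum := by
      intro p hp
      exact hθ.sum_liftsOf (by norm_num) (hl.normalized p hp).1 hm hm5 (hl.disj p hp)
        (hl.packs p hp).1 hL (fun c' => F c' (unpack (3 ^ ℓ) p.2))
    rw [List.map_congr_left hr] at h
    refine Eq.trans ?_ h
    simp only [filter_disjSupp]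
    refine (sum_fiber_left (S := Finset.univ.filter fun c =>
      c ∈ qrTower θ m ∧ residue c = unpack 3 r ∧ c 0 = 1)
      (fun c' i => redMod 3 (Nat.le_succ m) (c' i)) ?_ _
      (fun c' _ d hd => DisjSupp.redMod_left _ hd) F).trans ?_
    · intro c' hc'
      obtain ⟨-, h1, h2, h3⟩ := Finset.mem_filter.1 hc'
      refine Finset.mem_filter.2 ⟨Finset.mem_univ _, hθ.tower.red _ _ h1, ?_, ?_⟩
      · rw [residue_redMod _ hm, h2]
      · dsimp only; rw [h3, map_one]
    · refine Finset.sum_congr rfl fun c hc => Finset.sum_congr rfl fun d _ => ?_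
      refine Finset.sum_congr ?_ fun _ _ => rfl
      obtain ⟨-, h1, h2, h3⟩ := Finset.mem_filter.1 hc
      ext c'
      simp only [Finset.mem_filter, Finset.mem_univ, true_and]
      constructor
      · rintro ⟨⟨h4, h5, h6⟩, h7, h8⟩
        exact ⟨⟨h4, h7⟩, h6, h8⟩
      · rintro ⟨⟨h4, h7⟩, h6, h8⟩
        refine ⟨⟨h4, ?_, h6⟩, h7, h8⟩
        rw [← h2, ← h7, residue_redMod _ hm]

open Classical in
/-- An enumeration of pairs modulo `(3 ^ m, 3 ^ ℓ)` gives one modulo `(3 ^ m, 3 ^ (ℓ + 1))`. -/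
theorem IsCodeRoot.enumerates_liftRight (hθ : IsCodeRoot θ) {r m ℓ L : ℕ} {l : List (ℕ × ℕ)}
    (hl : Enumerates θ r m ℓ L l) (hm : ℓ ≠ 0) (hm5 : ℓ + 1 ≤ 5)
    (hL : L + 3 ^ ℓ * rowBound < laneBase) :
    Enumerates θ r m (ℓ + 1) (L + 3 ^ ℓ * rowBound) (liftRight (3 ^ m) (3 ^ ℓ) l) := by
  have hmem : ∀ p ∈ liftRight (3 ^ m) (3 ^ ℓ) l, ∃ p' ∈ l,
      p.2 ∈ liftsOf (leadIndex p'.2) (3 ^ ℓ) (3 ^ m) p'.2 p'.1 ∧ p.1 = p'.1 := by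
    intro p hp
    obtain ⟨p', hp', hpp⟩ := List.mem_flatMap.1 hp
    obtain ⟨v, hv, hvp⟩ := List.mem_map.1 hpp
    exact ⟨p', hp', by rw [← hvp]; exact ⟨hv, rfl⟩⟩
  have hlead : ∀ p' ∈ l, _ := fun p' hp' => (hl.normalized p' hp').2.leadIndex hm
  have hlift : ∀ p' ∈ l, ∀ v ∈ liftsOf (leadIndex p'.2) (3 ^ ℓ) (3 ^ m) p'.2 p'.1, _ :=
    fun p' hp' v hv => hθ.mem_liftsOf (hlead p' hp').1 (hlead p' hp').2.1 hm
      (hl.disj p' hp').symm (hl.packs p' hp').2 hL hv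
  refine ⟨?_, ?_, ?_, ?_⟩
  · intro p hp
    obtain ⟨p', hp', h1, h2⟩ := hmem p hp
    refine ⟨?_, (hlift p' hp' _ h1).1⟩
    rw [h2]
    exact (hl.packs p' hp').1.mono (Nat.le_add_right _ _)
  · intro p hp
    obtain ⟨p', hp', h1, h2⟩ := hmem p hp
    rw [h2]
    exact (hlift p' hp' _ h1).2.2.1.symm
  · intro p hp
    obtain ⟨p', hp', h1, h2⟩ := hmem p hp
    rw [h2]
    have h3 := hlift p' hp' _ h1
    refine ⟨(hl.normalized p' hp').1, _, h3.2.1, fun j hj => ?_⟩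
    rw [← residue_redMod (Nat.le_succ ℓ) hm]
    simp only [redMod_unpack]
    rw [show (fun i => unpack (3 ^ ℓ) p.2 i) = unpack (3 ^ ℓ) p'.2 from h3.2.2.2,
      residue_unpack hm]
    exact (hlead p' hp').2.2 j hj
  · intro M _ F
    rw [liftRight, sum_map_flatMap]
    have h := hl.sum (fun c d => ∑ y : Fin 24 → ZMod (3 ^ (ℓ + 1)) with
      (y ∈ qrTower θ (ℓ + 1) ∧ (fun i => redMod 3 (Nat.le_succ ℓ) (y i)) = d) ∧
        IsNormalized y ∧ DisjSupp c y, F c y)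
    have hnorm : ∀ {d : Fin 24 → ZMod (3 ^ ℓ)} {y : Fin 24 → ZMod (3 ^ (ℓ + 1))} {s : Fin 24},
        d s = 1 → (∀ j < s, residue d j = 0) → (fun i => redMod 3 (Nat.le_succ ℓ) (y i)) = d →
        (IsNormalized y ↔ y s = 1) := by
      intro d y s hd1 hd2 hy
      have hres : residue y = residue d := by rw [← hy, residue_redMod _ hm]
      constructor
      · rintro ⟨s', h1, h2⟩
        rw [hres] at h2
        have h3 := residue_eq_one (by omega) h1
        rw [hres] at h3
        have h4 := residue_eq_one hm hd1
        have h5 : s' = s := by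
          refine le_antisymm (not_lt.1 fun hlt => ?_) (not_lt.1 fun hlt => ?_)
          · rw [h2 _ hlt] at h4; exact absurd h4 (by decide)
          · rw [hd2 _ hlt] at h3; exact absurd h3 (by decide)
        rw [← h5]; exact h1
      · intro h
        exact ⟨s, h, fun j hj => by rw [hres]; exact hd2 j hj⟩
    have hr : ∀ p ∈ l, (∑ y : Fin 24 → ZMod (3 ^ (ℓ + 1)) with
      (y ∈ qrTower θ (ℓ + 1) ∧ (fun i => redMod 3 (Nat.le_succ ℓ) (y i)) = unpack (3 ^ ℓ) p.2) ∧
        IsNormalized y ∧ DisjSupp (unpack (3 ^ m) p.1) y, F (unpack (3 ^ m) p.1) y)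
        = ((liftsOf (leadIndex p.2) (3 ^ ℓ) (3 ^ m) p.2 p.1).map fun v =>
            F (unpack (3 ^ m) p.1) (unpack (3 ^ (ℓ + 1)) v)).sum := by
      intro p hp
      refine Eq.trans ?_ (hθ.sum_liftsOf (hlead p hp).1 (hlead p hp).2.1 hm hm5 (hl.disj p hp).symm
        (hl.packs p hp).2 hL (fun y => F (unpack (3 ^ m) p.1) y))
      refine Finset.sum_congr (Finset.filter_congr fun y _ => ?_) fun _ _ => rfl
      refine and_congr_right fun hy => and_congr ?_ ⟨DisjSupp.symm, DisjSupp.symm⟩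
      refine hnorm (hlead p hp).2.1 ?_ hy.2
      rw [residue_unpack hm]
      exact (hlead p hp).2.2
    rw [List.map_congr_left hr] at h
    refine Eq.trans ?_ h
    simp only [filter_disjSupp]
    refine (sum_fiber_right (T := Finset.univ.filter fun d => d ∈ qrTower θ ℓ ∧ IsNormalized d)
      (fun y i => redMod 3 (Nat.le_succ ℓ) (y i)) _ ?_
      (fun c y _ hy => (DisjSupp.redMod_left (Nat.le_succ ℓ) (DisjSupp.symm hy :
        DisjSupp y c)).symm) F).trans ?_
    · intro y hy
      obtain ⟨-, h1, s, h2, h3⟩ := Finset.mem_filter.1 hy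
      refine Finset.mem_filter.2 ⟨Finset.mem_univ _, hθ.tower.red _ _ h1, s, ?_, ?_⟩
      · dsimp only; rw [h2, map_one]
      · rw [residue_redMod _ hm]; exact h3
    · refine Finset.sum_congr rfl fun c _ => Finset.sum_congr rfl fun d _ => ?_
      refine Finset.sum_congr ?_ fun _ _ => rfl
      ext y
      simp only [Finset.mem_filter, Finset.mem_univ, true_and]
      tauto

open Classical in
/-- The start of the enumeration: all pairs modulo three. -/
theorem IsCodeRoot.enumerates_pairsOne (hθ : IsCodeRoot θ) {r L : ℕ} (hL : rowBound ≤ L)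
    (hr : Packs (qrTower θ 5) L r) (hr0 : tri r 0 = 1) : Enumerates θ r 1 1 L (pairsOne r) := by
  have hvalid := fixEntries_valid 3 3 0 r
  have hr0' : unpack (3 ^ 1) r 0 = 1 := by
    have : ((lane r 0 % 3 : ℕ) : ZMod (3 ^ 1)) = (1 : ℕ) := by
      rw [show lane r 0 % 3 = 1 from hr0]
    rw [unpack]
    rw [Nat.cast_one] at this
    rw [← this]
    exact (ZMod.natCast_mod (lane r 0) (3 ^ 1)).symm
  have hmatch : ∀ e : Fin 24 → ZMod (3 ^ 1),
      Matches (fixEntries 3 3 0 r positions) 25 (fun i => upOne.symm (e i)) ↔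
        DisjSupp (unpack (3 ^ 1) r) e := by
    intro e
    have hlen := (length_fixEntries 3 3 0 r positions).trans
      (show positions.length ≤ 25 by simp [positions])
    rw [matches_iff hlen, DisjSupp, ← forall_positions]
    have hz : ∀ i ∈ positions, 2 * (lane 0 i / 3) % 3 = 0 := by
      intro i _
      rw [lane_eq]; simp
    constructor
    · intro h i hi
      rw [unpack_eq_zero_iff, show (Fin.ofNat 24 i : Fin 24).val = i from
        Nat.mod_eq_of_lt (List.mem_range.1 hi)]
      by_cases hd : lane r i % 3 = 0
      · exact Or.inl hd
      · obtain ⟨a, ha, hae⟩ := h _ (mem_fixEntries.2 ⟨i, hi, hd, rfl⟩)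
        rw [List.mem_singleton, hz i hi] at ha
        rw [ha, Nat.cast_zero, eq_comm, map_eq_zero_iff _ upOne.symm.injective] at hae
        exact Or.inr hae
    · intro h x hx
      obtain ⟨i, hi, hd, rfl⟩ := mem_fixEntries.1 hx
      refine ⟨_, List.mem_singleton_self _, ?_⟩
      have := (h i hi).resolve_left (by
        rwa [unpack_eq_zero_iff, show (Fin.ofNat 24 i : Fin 24).val = i from
          Nat.mod_eq_of_lt (List.mem_range.1 hi)])
      rw [hz i hi, Nat.cast_zero]
      dsimp only
      rw [this, map_zero]
  have hmem : ∀ p ∈ pairsOne r, p.1 = r ∧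
      p.2 ∈ searchWords (fixEntries 3 3 0 r positions) 25 0 codeRows ∧
      IsNormalized (unpack (3 ^ 1) p.2) := by
    intro p hp
    obtain ⟨d, hd, hdp⟩ := List.mem_map.1 hp
    rw [List.mem_filter] at hd
    rw [← hdp]
    exact ⟨rfl, hd.1, (isNormalized_unpack_one_iff d).2 hd.2⟩
  refine ⟨?_, ?_, ?_, ?_⟩
  · intro p hp
    obtain ⟨h1, h2, -⟩ := hmem p hp
    rw [h1]
    exact ⟨hr, (hθ.packs_searchWords hvalid 25 h2).mono hL⟩
  · intro p hp
    obtain ⟨h1, h2, -⟩ := hmem p hp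
    rw [h1, ← hmatch]
    have h3 : (fun i => upOne.symm (unpack (3 ^ 1) p.2 i)) = unpack 3 p.2 := by
      funext i
      rw [RingEquiv.symm_apply_eq, unpack, unpack, upOne_natCast]
    rw [h3]
    exact hθ.matches_of_mem hvalid 25 h2
  · intro p hp
    obtain ⟨h1, h2, h3⟩ := hmem p hp
    rw [h1]
    exact ⟨hr0', h3⟩
  · intro M _ F
    have hset : (Finset.univ.filter fun c : Fin 24 → ZMod (3 ^ 1) =>
        c ∈ qrTower θ 1 ∧ residue c = unpack 3 r ∧ c 0 = 1) = {unpack (3 ^ 1) r} := by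
      ext c
      simp only [Finset.mem_filter, Finset.mem_univ, true_and, Finset.mem_singleton]
      constructor
      · rintro ⟨-, h, -⟩
        funext i
        have := congrFun h i
        rw [residue, unpack] at this
        have h2 := congrArg upOne this
        rwa [upOne_natCast, upOne_natCast, ZMod.natCast_zmod_val] at h2
      · rintro rfl
        refine ⟨?_, residue_unpack one_ne_zero r, hr0'⟩
        have := hθ.tower.red (show 1 ≤ 5 by norm_num) _ hr.mem
        simpa only [redMod_unpack] using this
    rw [hset, Finset.sum_singleton]
    have hsum := hθ.sum_matches hvalid 25 (fun d : Fin 24 → ZMod (3 ^ 1) =>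
      if IsNormalized d then F (unpack (3 ^ 1) r) d else 0)
    rw [pairsOne, List.map_map]
    have hfil : ∀ (l : List ℕ) (G : ℕ → M), ((l.filter fun d =>
        Nat.beq (tri d (leadIndex d)) 1).map G).sum
          = (l.map fun d => if IsNormalized (unpack (3 ^ 1) d) then G d else 0).sum := by
      intro l G
      induction l with
      | nil => rfl
      | cons d l ih =>
        rw [List.filter_cons, List.map_cons, List.sum_cons, ← ih]
        by_cases hd : IsNormalized (unpack (3 ^ 1) d)
        · rw [if_pos ((isNormalized_unpack_one_iff d).1 hd), if_pos hd, List.map_cons,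
            List.sum_cons]
        · rw [if_neg fun h => hd ((isNormalized_unpack_one_iff d).2 h), if_neg hd, zero_add]
    rw [hfil]
    refine Eq.trans ?_ hsum
    rw [Finset.sum_filter, Finset.sum_filter]
    refine Finset.sum_congr rfl fun d _ => ?_
    rw [hmatch]
    by_cases h1 : d ∈ qrTower θ 1 <;> by_cases h2 : IsNormalized d <;> simp [h1, h2]

end Enumeration

/-! ### Monomials and weights of enumerated pairs -/

/-- The number `∑ c_i d_i`, over the indices where `c` does not vanish modulo `q₁`. -/
def pairSum (q₁ c d : ℕ) : List ℕ → ℕ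
  | [] => 0
  | i :: P => match Nat.mod (lane c i) q₁ with
    | 0 => pairSum q₁ c d P
    | _ + 1 => Nat.add (Nat.mul (lane c i) (lane d i)) (pairSum q₁ c d P)

/-- The `3`-adic valuation of a number that is not divisible by `27`. -/
def valSlot (a : ℕ) : ℕ := match Nat.mod a 3 with
  | _ + 1 => 0
  | 0 => match Nat.mod a 9 with
    | _ + 1 => 1
    | 0 => 2

/-- The position of the variable of a pair of letters in the list `z, x_0, x_1, x_2, y_0, y_1`. -/
def pairSlot (q₁ q₂ a b : ℕ) : ℕ := match Nat.mod a q₁ with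
  | _ + 1 => Nat.add 1 (valSlot a)
  | 0 => match Nat.mod b q₂ with
    | 0 => 0
    | _ + 1 => match Nat.mod b 3 with
      | _ + 1 => 4
      | 0 => 5

/-- The variables `z, x_0, x_1, x_2, y_0, y_1`. -/
def slotVar : ℕ → WVar
  | 0 => WVar.z
  | 1 => WVar.x 0
  | 2 => WVar.x 1
  | 3 => WVar.x 2
  | 4 => WVar.y 0
  | _ => WVar.y 1

/-- The exponents of the monomial of a pair, packed into one number. -/
def slotKey (q₁ q₂ c d : ℕ) : List ℕ → ℕ
  | [] => 0
  | i :: P => Nat.add (Nat.pow laneBase (pairSlot q₁ q₂ (lane c i) (lane d i)))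
      (slotKey q₁ q₂ c d P)

/-- A code for the weight of a residue `s` modulo `q`. -/
def weightCode (q s : ℕ) : ℕ := match Nat.mod s q with
  | 0 => 2
  | _ + 1 => match Nat.mod (Nat.mul 3 s) q with
    | 0 => 1
    | _ + 1 => 0

/-- The weight with the given code. -/
def weightVal : ℕ → ℚ
  | 0 => 0
  | 1 => -1 / 2
  | _ => 1

/-- The exponents of the monomial of a pair and the code of its weight, packed into one number. -/
def pairKey (q₁ q₂ q : ℕ) (p : ℕ × ℕ) : ℕ :=
  Nat.add (slotKey q₁ q₂ p.1 p.2 positions)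
    (Nat.mul (weightCode q (pairSum q₁ p.1 p.2 positions)) (Nat.pow laneBase 6))

/-- The term with the exponents and the weight code given by `n`. -/
noncomputable def keyTerm (n : ℕ → ℕ) : MvPolynomial WVar ℚ :=
  MvPolynomial.C (weightVal (n 6)) * ∏ j ∈ Finset.range 6, MvPolynomial.X (slotVar j) ^ n j

theorem sum_positions {M : Type*} [AddCommMonoid M] (f : ℕ → M) :
    (positions.map f).sum = ∑ i : Fin 24, f i := by
  rw [← Finset.sum_range]
  rfl

theorem slotKey_eq (q₁ q₂ c d : ℕ) (P : List ℕ) : slotKey q₁ q₂ c d P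
    = (P.map fun i => laneBase ^ pairSlot q₁ q₂ (lane c i) (lane d i)).sum := by
  induction P with
  | nil => rfl
  | cons i P ih => rw [slotKey, ih, List.map_cons, List.sum_cons]; rfl

theorem pairSum_eq (q₁ c d : ℕ) (P : List ℕ) : pairSum q₁ c d P
    = (P.map fun i => if lane c i % q₁ = 0 then 0 else lane c i * lane d i).sum := by
  induction P with
  | nil => rfl
  | cons i P ih =>
    rw [pairSum, ih, List.map_cons, List.sum_cons]
    rcases h : Nat.mod (lane c i) q₁ with _ | t <;> change lane c i % q₁ = _ at h
    · rw [if_pos h, zero_add]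
    · rw [if_neg (by omega)]; rfl

theorem valSlot_eq (a : ℕ) :
    valSlot a = if a % 3 ≠ 0 then 0 else if a % 9 ≠ 0 then 1 else 2 := by
  unfold valSlot
  rcases h : Nat.mod a 3 with _ | t <;> change a % 3 = _ at h
  · rcases h' : Nat.mod a 9 with _ | t <;> change a % 9 = _ at h'
    · rw [if_neg (by omega), if_neg (by omega)]
    · rw [if_neg (by omega), if_pos (by omega)]
  · rw [if_pos (by omega)]

theorem pairSlot_eq (q₁ q₂ a b : ℕ) : pairSlot q₁ q₂ a b = if a % q₁ ≠ 0 then 1 + valSlot a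
    else if b % q₂ = 0 then 0 else if b % 3 ≠ 0 then 4 else 5 := by
  unfold pairSlot
  rcases h : Nat.mod a q₁ with _ | t <;> change a % q₁ = _ at h
  · rw [if_neg (by omega)]
    rcases h' : Nat.mod b q₂ with _ | t <;> change b % q₂ = _ at h'
    · rw [if_pos h']
    · rw [if_neg (by omega)]
      rcases h'' : Nat.mod b 3 with _ | t <;> change b % 3 = _ at h''
      · rw [if_neg (by omega)]
      · rw [if_pos (by omega)]
  · rw [if_pos (by omega)]
    rfl

theorem pairSlot_lt (q₁ q₂ a b : ℕ) : pairSlot q₁ q₂ a b < 6 := by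
  rw [pairSlot_eq, valSlot_eq]
  split_ifs <;> omega

theorem weightCode_eq (q s : ℕ) :
    weightCode q s = if s % q = 0 then 2 else if 3 * s % q = 0 then 1 else 0 := by
  unfold weightCode
  rcases h : Nat.mod s q with _ | t <;> change s % q = _ at h
  · rw [if_pos h]
  · rw [if_neg (by omega)]
    rcases h' : Nat.mod (Nat.mul 3 s) q with _ | t <;> change 3 * s % q = _ at h'
    · rw [if_pos h']
    · rw [if_neg (by omega)]

theorem avgPsi_natCast (N s : ℕ) :
    avgPsi 3 N (s : ZMod (3 ^ N)) = weightVal (weightCode (3 ^ N) s) := by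
  rw [avgPsi, weightCode_eq]
  have h1 : ((s : ZMod (3 ^ N)) = 0) ↔ s % 3 ^ N = 0 := by
    rw [ZMod.natCast_eq_zero_iff, Nat.dvd_iff_mod_eq_zero]
  have h2 : (((3 : ℕ) : ZMod (3 ^ N)) * s = 0) ↔ 3 * s % 3 ^ N = 0 := by
    rw [← Nat.cast_mul, ZMod.natCast_eq_zero_iff, Nat.dvd_iff_mod_eq_zero]
  simp only [h1, h2]
  split_ifs
  · rfl
  · norm_num [weightVal]
  · rfl

theorem padicValNat_three_eq {n v : ℕ} (h1 : 3 ^ v ∣ n) (h2 : ¬ 3 ^ (v + 1) ∣ n) :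
    padicValNat 3 n = v := by
  have : Fact (Nat.Prime 3) := ⟨Nat.prime_three⟩
  have hn : n ≠ 0 := by rintro rfl; exact h2 (dvd_zero _)
  rw [padicValNat_dvd_iff_le hn] at h1 h2
  omega

theorem pairVar_unpack {m ℓ : ℕ} (hm : m ≠ 0) (hm3 : m ≤ 3) (hℓ : ℓ ≠ 0) (hℓ2 : ℓ ≤ 2) (c d : ℕ)
    (i : Fin 24) : pairVar 3 (unpack (3 ^ m) c i) (unpack (3 ^ ℓ) d i)
      = slotVar (pairSlot (3 ^ m) (3 ^ ℓ) (lane c i) (lane d i)) := by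
  rw [pairSlot_eq, pairVar]
  simp only [unpack_eq_zero_iff]
  simp only [natVar, unpack, ZMod.val_natCast]
  generalize lane c i = a
  generalize lane d i = b
  by_cases ha : a % 3 ^ m = 0
  · rw [if_pos ha, if_neg (not_not.2 ha)]
    by_cases hb : b % 3 ^ ℓ = 0
    · rw [if_pos hb, if_pos hb]; rfl
    · rw [if_neg hb, if_neg hb]
      by_cases hb3 : b % 3 = 0
      · rw [if_neg (by simpa using hb3), padicValNat_three_eq (v := 1)]
        · rfl
        · interval_cases ℓ <;> omega
        · interval_cases ℓ <;> omega
      · rw [if_pos hb3, padicValNat_three_eq (v := 0)]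
        · rfl
        · exact one_dvd _
        · interval_cases ℓ <;> omega
  · rw [if_neg ha, if_pos ha, valSlot_eq]
    by_cases ha3 : a % 3 = 0
    · rw [if_neg (by simpa using ha3)]
      by_cases ha9 : a % 9 = 0
      · rw [if_neg (by simpa using ha9), padicValNat_three_eq (v := 2)]
        · rfl
        · interval_cases m <;> omega
        · interval_cases m <;> omega
      · rw [if_pos ha9, padicValNat_three_eq (v := 1)]
        · rfl
        · interval_cases m <;> omega
        · interval_cases m <;> omega
    · rw [if_pos ha3, padicValNat_three_eq (v := 0)]
      · rfl
      · exact one_dvd _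
      · interval_cases m <;> omega

theorem add_mul_pow_laneBase (a b k : ℕ) :
    Nat.add a (Nat.mul b (Nat.pow laneBase k)) = a + b * laneBase ^ k := rfl

theorem sum_pow_eq_sum_card (B : ℕ) {slot : Fin 24 → ℕ} (hslot : ∀ i, slot i < 6) (w : ℕ) :
    ∑ i, B ^ slot i + w * B ^ 6 = ∑ j ∈ Finset.range 7,
      (if j < 6 then (Finset.univ.filter fun i => slot i = j).card else w) * B ^ j := by
  rw [Finset.sum_range_succ, if_neg (by norm_num), ← Finset.sum_fiberwise_of_maps_to
    (t := Finset.range 6) (g := slot) (fun i _ => Finset.mem_range.2 (hslot i))]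
  congr 1
  refine Finset.sum_congr rfl fun j hj => ?_
  rw [if_pos (Finset.mem_range.1 hj), Finset.sum_congr rfl fun i hi => by
    rw [(Finset.mem_filter.1 hi).2], Finset.sum_const, smul_eq_mul]

theorem lane_sum_pow {slot : Fin 24 → ℕ} (hslot : ∀ i, slot i < 6) {w : ℕ} (hw : w ≤ 2) {j : ℕ}
    (hj : j < 7) : lane (∑ i, laneBase ^ slot i + w * laneBase ^ 6) j
      = if j < 6 then (Finset.univ.filter fun i => slot i = j).card else w := by
  have h25 : 25 ≤ laneBase := by norm_num [laneBase]
  rw [sum_pow_eq_sum_card laneBase hslot w]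
  refine lane_sum (f := fun j => if j < 6 then
    (Finset.univ.filter fun i => slot i = j).card else w) (fun j => lt_of_lt_of_le ?_ h25) 7 j hj
  have h24 : (Finset.univ.filter fun i => slot i = j).card ≤ 24 :=
    (Finset.card_le_univ _).trans_eq (Fintype.card_fin 24)
  split_ifs <;> omega

theorem lane_pairKey (q₁ q₂ q : ℕ) (p : ℕ × ℕ) {j : ℕ} (hj : j < 7) :
    lane (pairKey q₁ q₂ q p) j = if j < 6 then
      (Finset.univ.filter fun i : Fin 24 => pairSlot q₁ q₂ (lane p.1 i) (lane p.2 i) = j).card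
      else weightCode q (pairSum q₁ p.1 p.2 positions) := by
  have hw : weightCode q (pairSum q₁ p.1 p.2 positions) ≤ 2 := by
    rw [weightCode_eq]; split_ifs <;> omega
  rw [pairKey, add_mul_pow_laneBase, slotKey_eq, sum_positions,
    lane_sum_pow (fun i => pairSlot_lt _ _ _ _) hw hj]

section Keys

variable {θ : ℤ_[3]}

theorem pairMon_unpack {m ℓ : ℕ} (hm : m ≠ 0) (hm3 : m ≤ 3) (hℓ : ℓ ≠ 0) (hℓ2 : ℓ ≤ 2) (q : ℕ)
    (p : ℕ × ℕ) : pairMon ℚ 3 (unpack (3 ^ m) p.1) (unpack (3 ^ ℓ) p.2)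
      = ∏ j ∈ Finset.range 6, MvPolynomial.X (slotVar j) ^ lane (pairKey (3 ^ m)
        (3 ^ ℓ) q p) j := by
  rw [pairMon, Finset.prod_congr rfl fun i _ => by rw [pairVar_unpack hm hm3 hℓ hℓ2],
    ← Finset.prod_fiberwise_of_maps_to (t := Finset.range 6)
      (g := fun i : Fin 24 => pairSlot (3 ^ m) (3 ^ ℓ) (lane p.1 i) (lane p.2 i))
      (fun i _ => Finset.mem_range.2 (pairSlot_lt _ _ _ _))]
  refine Finset.prod_congr rfl fun j hj => ?_
  rw [lane_pairKey _ _ _ _ (by have := Finset.mem_range.1 hj; omega),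
    if_pos (Finset.mem_range.1 hj), Finset.prod_congr rfl fun i hi => by
      rw [(Finset.mem_filter.1 hi).2], Finset.prod_const]

theorem unitWt_unpack {m ℓ : ℕ} (hℓ : ℓ ≠ 0) (q : ℕ) {p : ℕ × ℕ}
    (h : DisjSupp (unpack (3 ^ m) p.1) (unpack (3 ^ ℓ) p.2)) :
    unitWt (unpack (3 ^ ℓ) p.2) = lane (pairKey (3 ^ m) (3 ^ ℓ) q p) 4 := by
  rw [lane_pairKey _ _ _ _ (by norm_num), if_pos (by norm_num), unitWt_eq_card_residue,
    residue_unpack hℓ]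
  congr 1
  refine Finset.filter_congr fun i _ => ?_
  have h1 := h i
  rw [unpack_eq_zero_iff, unpack_eq_zero_iff] at h1
  rw [pairSlot_eq, valSlot_eq, Ne, unpack_eq_zero_iff]
  have h3 : lane p.2 i % 3 ^ ℓ = 0 → lane p.2 i % 3 = 0 := fun h =>
    Nat.mod_eq_zero_of_dvd ((dvd_pow_self 3 hℓ).trans (Nat.dvd_of_mod_eq_zero h))
  split_ifs <;> first | omega | tauto

theorem IsCodeRoot.mem_unpack (hθ : IsCodeRoot θ) {m L v : ℕ} (hm : m ≤ 5)
    (hv : Packs (qrTower θ 5) L v) : unpack (3 ^ m) v ∈ qrTower θ m := by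
  have := hθ.tower.red hm _ hv.mem
  simpa only [redMod_unpack] using this

theorem pairing_unpack {m ℓ N : ℕ} (hN : N = m + ℓ)
    {p : ℕ × ℕ} (h : DisjSupp (unpack (3 ^ m) p.1) (unpack (3 ^ ℓ) p.2)) :
    pairing (unpack (3 ^ m) p.1) (unpack (3 ^ N) p.2)
      = (pairSum (3 ^ m) p.1 p.2 positions : ℕ) := by
  rw [pairing_eq_sum_lifts hN (C := unpack (3 ^ N) p.1) (fun i => redMod_unpack _ _ _)
    (fun i => by rw [redMod_unpack]; exact h i), pairSum_eq, sum_positions, Nat.cast_sum]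
  refine Finset.sum_congr rfl fun i _ => ?_
  by_cases h0 : lane p.1 i % 3 ^ m = 0
  · rw [if_pos h0, if_pos ((unpack_eq_zero_iff _ _ _).2 h0), Nat.cast_zero]
  · rw [if_neg h0, if_neg fun h1 => h0 ((unpack_eq_zero_iff _ _ _).1 h1), Nat.cast_mul]
    rfl

theorem IsCodeRoot.pairWt_unpack (hθ : IsCodeRoot θ) {m ℓ N L : ℕ} (hN : N = m + ℓ) (hN5 : N ≤ 5)
    {p : ℕ × ℕ} (hp : Packs (qrTower θ 5) L p.1 ∧ Packs (qrTower θ 5) L p.2)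
    (h : DisjSupp (unpack (3 ^ m) p.1) (unpack (3 ^ ℓ) p.2)) :
    pairWt (qrTower θ) N (unpack (3 ^ m) p.1) (unpack (3 ^ ℓ) p.2)
      = weightVal (lane (pairKey (3 ^ m) (3 ^ ℓ) (3 ^ N) p) 6) := by
  rw [lane_pairKey _ _ _ _ (by norm_num), if_neg (by norm_num),
    hθ.tower.pairWt_eq hN (hθ.mem_unpack (by omega) hp.1) (hθ.mem_unpack hN5 hp.2)
      (fun i => redMod_unpack _ _ _) h, pairing_unpack hN h, avgPsi_natCast]

/-- A list of exponents packed into one number. -/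
def tallyKey (l : List ℕ) : ℕ := l.foldr (fun a s => Nat.add a (Nat.mul laneBase s)) 0

theorem lane_tallyKey {l : List ℕ} (hl : ∀ a ∈ l, a < laneBase) (j : ℕ) :
    lane (tallyKey l) j = l.getD j 0 := by
  rw [lane_eq]
  induction l generalizing j with
  | nil => simp [tallyKey]
  | cons a l ih =>
    have ha : a < laneBase := hl a List.mem_cons_self
    have h1 : tallyKey (a :: l) = a + laneBase * tallyKey l := rfl
    rw [h1]
    cases j with
    | zero =>
      rw [pow_zero, Nat.div_one, Nat.add_mul_mod_self_left, Nat.mod_eq_of_lt ha]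
      rfl
    | succ j =>
      rw [pow_succ', ← Nat.div_div_eq_div_mul, Nat.add_mul_div_left _ _ laneBase_pos,
        Nat.div_eq_of_lt ha, zero_add, ih fun b hb => hl b (List.mem_cons_of_mem _ hb)]
      rfl

/-- The term of a pair of words in the disjoint weight enumerator. -/
noncomputable def pairTerm (θ : ℤ_[3]) (m ℓ : ℕ) (c : Fin 24 → ZMod (3 ^ m))
    (d : Fin 24 → ZMod (3 ^ ℓ)) : MvPolynomial WVar ℚ :=
  MvPolynomial.C (pairWt (qrTower θ) (m + ℓ) c d) * pairMon ℚ 3 c d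

/-- The list in which each exponent list occurs, packed, as often as the given tally says. -/
def expandTally (l : List (ℕ × List ℕ)) : List ℕ :=
  l.flatMap fun t => List.replicate t.1 (tallyKey t.2)

/-- The sum of the terms of a tally. -/
noncomputable def tallySum (b : ℕ) (l : List (ℕ × List ℕ)) : MvPolynomial WVar ℚ :=
  (l.map fun t => if t.2.getD 4 0 = b then (t.1 : MvPolynomial WVar ℚ) *
    keyTerm (fun j => t.2.getD j 0) else 0).sum

theorem IsCodeRoot.pairTerm_unpack (hθ : IsCodeRoot θ) {m ℓ L : ℕ} (hm : m ≠ 0) (hm3 : m ≤ 3)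
    (hℓ : ℓ ≠ 0) (hℓ2 : ℓ ≤ 2) {p : ℕ × ℕ}
    (hp : Packs (qrTower θ 5) L p.1 ∧ Packs (qrTower θ 5) L p.2)
    (h : DisjSupp (unpack (3 ^ m) p.1) (unpack (3 ^ ℓ) p.2)) :
    pairTerm θ m ℓ (unpack (3 ^ m) p.1) (unpack (3 ^ ℓ) p.2)
      = keyTerm (lane (pairKey (3 ^ m) (3 ^ ℓ) (3 ^ (m + ℓ)) p)) := by
  rw [pairTerm, hθ.pairWt_unpack rfl (by omega) hp h, pairMon_unpack hm hm3 hℓ hℓ2 (3 ^ (m + ℓ)) p]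
  rfl

open Classical in
/-- The sum of the terms of normalized pairs, in terms of the tally of their exponents. -/
theorem IsCodeRoot.sum_eq_tallySum (hθ : IsCodeRoot θ) {r m ℓ L : ℕ} {l : List (ℕ × ℕ)}
    (hl : Enumerates θ r m ℓ L l) (hm : m ≠ 0) (hm3 : m ≤ 3) (hℓ : ℓ ≠ 0) (hℓ2 : ℓ ≤ 2)
    {t : List (ℕ × List ℕ)} (ht : ∀ x ∈ t, ∀ a ∈ x.2, a < 25)
    (hperm : (expandTally t).isPerm (l.map (pairKey (3 ^ m) (3 ^ ℓ) (3 ^ (m + ℓ)))) = true)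
    (b : ℕ) :
    (l.map fun p => if unitWt (unpack (3 ^ ℓ) p.2) = b then pairTerm θ m ℓ
      (unpack (3 ^ m) p.1) (unpack (3 ^ ℓ) p.2) else 0).sum = tallySum b t := by
  set g : ℕ → MvPolynomial WVar ℚ := fun k => if lane k 4 = b then keyTerm (lane k) else 0 with hg
  have h1 : ∀ p ∈ l, (if unitWt (unpack (3 ^ ℓ) p.2) = b then pairTerm θ m ℓ
      (unpack (3 ^ m) p.1) (unpack (3 ^ ℓ) p.2) else 0)
      = (g ∘ pairKey (3 ^ m) (3 ^ ℓ) (3 ^ (m + ℓ))) p := by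
    intro p hp
    rw [Function.comp_apply, hg, unitWt_unpack hℓ (3 ^ (m + ℓ)) (hl.disj p hp),
      hθ.pairTerm_unpack hm hm3 hℓ hℓ2 (hl.packs p hp) (hl.disj p hp)]
  rw [List.map_congr_left h1, ← List.map_map,
    ← ((List.isPerm_iff.1 hperm).map _).sum_eq, expandTally, List.flatMap_def, List.map_flatten,
    List.sum_flatten, List.map_map, List.map_map, tallySum]
  refine congrArg List.sum (List.map_congr_left fun x hx => ?_)
  have h2 : lane (tallyKey x.2) = fun j => x.2.getD j 0 := funext fun j =>
    lane_tallyKey (fun a ha => (ht x hx a ha).trans (by norm_num [laneBase])) j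
  simp only [Function.comp_apply, List.map_replicate, List.sum_replicate, hg, h2, nsmul_eq_mul]
  split_ifs <;> simp

end Keys

/-! ### Automorphisms of the code -/

/-- The images of the coordinates under a signed permutation, with the signs `1` and `2 = -1`. -/
def signedPos (l : List ℕ) : List (ℕ × ℕ) := l.map fun i => (i, 1)

/-- The cyclic shift `x ↦ x + 1`. -/
def shiftMap : List (ℕ × ℕ) := signedPos [22, 0, 1, 2, 3, 4, 5, 6, 7, 8, 9, 10, 11, 12, 13, 14, 15,
    16,
  17, 18, 19, 20, 21, 23]

/-- The multiplication of the indices by the square `2`. -/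
def doubleMap : List (ℕ × ℕ) := signedPos [0, 2, 4, 6, 8, 10, 12, 14, 16, 18, 20, 22, 1, 3, 5, 7, 9,
    11,
  13, 15, 17, 19, 21, 23]

/-- The inversion `x ↦ -1 / x` of the projective line over the field with `23` elements, with the
signs that make it an automorphism: essentially the quadratic character of the index. -/
def invMap : List (ℕ × ℕ) := [(23, 2), (22, 2), (11, 2), (15, 2), (17, 2), (9, 1), (19, 2), (13, 1),
  (20, 2), (5, 2), (16, 1), (2, 1), (21, 2), (7, 2), (18, 1), (3, 1), (10, 2), (4, 1), (14, 2),
  (6, 1), (8, 1), (12, 1), (1, 1), (0, 1)]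

/-- The change of all signs. -/
def negMap : List (ℕ × ℕ) := (List.range 24).map fun i => (i, 2)

/-- The source index of a coordinate. -/
def sourceIndex (l : List (ℕ × ℕ)) (j : Fin 24) : Fin 24 := Fin.ofNat 24 (l.getD j (0, 0)).1

/-- The sign of a coordinate. -/
def sourceSign (l : List (ℕ × ℕ)) (j : Fin 24) : ℤˣ := if (l.getD j (0, 0)).2 = 2 then -1 else 1

/-- The inner product modulo `3 ^ 5` of a packed word `s` and the image of a packed word `r` under a
signed permutation; the factor `241 e - 240` is `1` for `e = 1` and `242 = -1` for `e = 2`. -/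
def crossSum (r s : ℕ) : List (ℕ × ℕ) → ℕ → ℕ
  | [], _ => 0
  | x :: l, j => Nat.add (Nat.mul (Nat.mul (Nat.sub (Nat.mul 241 x.2) 240) (lane r x.1)) (lane s j))
      (crossSum r s l (Nat.succ j))

/-- The list describes a signed permutation that maps the code modulo `3 ^ 5` to its dual. -/
structure IsCodeAut (l : List (ℕ × ℕ)) : Prop where
  bijective : Function.Bijective (sourceIndex l)
  length : l.length = 24
  valid : ∀ x ∈ l, x.1 < 24 ∧ (x.2 = 1 ∨ x.2 = 2)
  orthogonal : (codeRows.all fun r => codeRows.all fun s =>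
    Nat.beq (Nat.mod (crossSum r s l 0) 243) 0) = true

theorem isCodeAut_shiftMap : IsCodeAut shiftMap :=
  ⟨by decide +kernel, rfl, by decide, by decide +kernel⟩

theorem isCodeAut_doubleMap : IsCodeAut doubleMap :=
  ⟨by decide +kernel, rfl, by decide, by decide +kernel⟩

theorem isCodeAut_invMap : IsCodeAut invMap :=
  ⟨by decide +kernel, rfl, by decide, by decide +kernel⟩

theorem isCodeAut_negMap : IsCodeAut negMap :=
  ⟨by decide +kernel, rfl, by decide, by decide +kernel⟩

theorem natCast_crossSum (r s : ℕ) (l : List (ℕ × ℕ)) (hl : ∀ x ∈ l, x.2 = 1 ∨ x.2 = 2) (j : ℕ) :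
    ((crossSum r s l j : ℕ) : ZMod (3 ^ 5)) = ∑ k ∈ Finset.range l.length,
      (((if (l.getD k (0, 0)).2 = 2 then -1 else 1 : ℤˣ) : ℤ) : ZMod (3 ^ 5)) *
        lane r (l.getD k (0, 0)).1 * lane s (j + k) := by
  induction l generalizing j with
  | nil => simp [crossSum]
  | cons x l ih =>
    have h1 : crossSum r s (x :: l) j
        = (241 * x.2 - 240) * lane r x.1 * lane s j + crossSum r s l (j + 1) := rfl
    rw [h1, Nat.cast_add, ih (fun y hy => hl y (List.mem_cons_of_mem _ hy)), List.length_cons,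
      Finset.sum_range_succ', add_comm]
    congr 1
    · refine Finset.sum_congr rfl fun k _ => ?_
      rw [List.getD_cons_succ, show j + 1 + k = j + (k + 1) by omega]
    · rw [List.getD_cons_zero, add_zero, Nat.cast_mul, Nat.cast_mul]
      have h2 : ((241 * x.2 - 240 : ℕ) : ZMod (3 ^ 5))
          = (((if x.2 = 2 then -1 else 1 : ℤˣ) : ℤ) : ZMod (3 ^ 5)) := by
        rcases hl x List.mem_cons_self with h | h <;> rw [h] <;> decide
      rw [h2]

theorem IsCodeAut.sum_eq_zero {l : List (ℕ × ℕ)} (hl : IsCodeAut l) (i k : Fin 12) :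
    ∑ j, ((sourceSign l j : ℤ) : ZMod (3 ^ 5)) *
      qrRow (93 : ZMod (3 ^ 5)) i (sourceIndex l j) * qrRow (93 : ZMod (3 ^ 5)) k j = 0 := by
  have hmem : ∀ i : Fin 12, codeRow i ∈ codeRows := fun i => by
    rw [codeRows_eq]; exact List.mem_ofFn.2 ⟨i, rfl⟩
  have h := List.all_eq_true.1 (List.all_eq_true.1 hl.orthogonal _ (hmem i)) _ (hmem k)
  have h1 : crossSum (codeRow i) (codeRow k) l 0 % 243 = 0 := Nat.eq_of_beq_eq_true h
  have h2 : ((crossSum (codeRow i) (codeRow k) l 0 : ℕ) : ZMod (3 ^ 5)) = 0 :=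
    (ZMod.natCast_eq_zero_iff _ _).2 (Nat.dvd_of_mod_eq_zero h1)
  rw [natCast_crossSum _ _ _ (fun x hx => (hl.valid x hx).2), hl.length, Finset.sum_range] at h2
  rw [← h2]
  refine Finset.sum_congr rfl fun j _ => ?_
  rw [← unpack_codeRow_five, ← unpack_codeRow_five, zero_add]
  have h3 : (l.getD j (0, 0)).1 < 24 := by
    rw [List.getD_eq_getElem _ _ (by rw [hl.length]; exact j.isLt)]
    exact (hl.valid _ (List.getElem_mem _)).1
  rw [unpack, unpack, show (sourceIndex l j).val = (l.getD j (0, 0)).1 from Nat.mod_eq_of_lt h3]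
  rfl

/-- The permutation of the coordinates. -/
noncomputable def IsCodeAut.perm {l : List (ℕ × ℕ)} (hl : IsCodeAut l) : Equiv.Perm (Fin 24) :=
  Equiv.ofBijective _ hl.bijective

/-- The action of the signed permutation on words. -/
noncomputable def IsCodeAut.act {l : List (ℕ × ℕ)} (hl : IsCodeAut l) {n : ℕ}
    (c : Fin 24 → ZMod n) : Fin 24 → ZMod n := signedPerm hl.perm (sourceSign l) c

section Automorphisms

variable {θ : ℤ_[3]} {l : List (ℕ × ℕ)}

theorem IsCodeAut.act_apply (hl : IsCodeAut l) {n : ℕ} (c : Fin 24 → ZMod n) (j : Fin 24) :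
    hl.act c j = ((sourceSign l j : ℤ) : ZMod n) * c (sourceIndex l j) := rfl

theorem IsCodeAut.act_mem_five (hl : IsCodeAut l) (hθ : IsCodeRoot θ) {c : Fin 24 → ZMod (3 ^ 5)}
    (hc : c ∈ qrTower θ 5) : hl.act c ∈ qrTower θ 5 := by
  have h5 : PadicInt.toZModPow 5 θ = 93 := toZModPow_five hθ.root hθ.red
  rw [hθ.tower.mem_iff]
  intro d hd
  obtain ⟨u, rfl⟩ := mem_qrCode.1 hc
  obtain ⟨v, rfl⟩ := mem_qrCode.1 hd
  rw [h5]
  have h : ∀ j, (∑ k, v k * qrRow (93 : ZMod (3 ^ 5)) k j) *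
      hl.act (fun j => ∑ i, u i * qrRow (93 : ZMod (3 ^ 5)) i j) j
      = ∑ k, ∑ i, v k * u i * (((sourceSign l j : ℤ) : ZMod (3 ^ 5)) *
        qrRow (93 : ZMod (3 ^ 5)) i (sourceIndex l j) * qrRow (93 : ZMod (3 ^ 5)) k j) := by
    intro j
    rw [hl.act_apply, Finset.sum_mul]
    refine Finset.sum_congr rfl fun k _ => ?_
    rw [Finset.mul_sum, Finset.mul_sum]
    exact Finset.sum_congr rfl fun i _ => by ring
  rw [Finset.sum_congr rfl fun j _ => h j, Finset.sum_comm]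
  refine Finset.sum_eq_zero fun k _ => ?_
  rw [Finset.sum_comm]
  refine Finset.sum_eq_zero fun i _ => ?_
  rw [← Finset.mul_sum, hl.sum_eq_zero, mul_zero]

theorem IsCodeAut.act_mem (hl : IsCodeAut l) (hθ : IsCodeRoot θ) {m : ℕ} (hm : m ≤ 5)
    {c : Fin 24 → ZMod (3 ^ m)} (hc : c ∈ qrTower θ m) : hl.act c ∈ qrTower θ m := by
  obtain ⟨D, hD, rfl⟩ := hθ.tower.lift hm c hc
  have := hθ.tower.red hm _ (hl.act_mem_five hθ hD)
  convert this using 1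
  funext i
  exact (redMod_signedPerm _ _ hm D i).symm

theorem IsCodeAut.act_injective (hl : IsCodeAut l) (n : ℕ) :
    Function.Injective (hl.act : (Fin 24 → ZMod n) → _) := signedPerm_injective _ _ _

/-- The action on words as a bijection. -/
noncomputable def IsCodeAut.actEquiv (hl : IsCodeAut l) (n : ℕ) [NeZero n] :
    (Fin 24 → ZMod n) ≃ (Fin 24 → ZMod n) :=
  Equiv.ofBijective hl.act (Finite.injective_iff_bijective.1 (hl.act_injective n))

theorem IsCodeAut.act_mem_iff (hl : IsCodeAut l) (hθ : IsCodeRoot θ) {m : ℕ} (hm : m ≤ 5)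
    (c : Fin 24 → ZMod (3 ^ m)) : hl.act c ∈ qrTower θ m ↔ c ∈ qrTower θ m := by
  refine ⟨fun h => ?_, hl.act_mem hθ hm⟩
  have hinj : Function.Injective (fun d : qrTower θ m =>
      (⟨hl.act d.1, hl.act_mem hθ hm d.2⟩ : qrTower θ m)) := fun d d' hdd =>
    Subtype.ext (hl.act_injective _ (Subtype.ext_iff.1 hdd))
  obtain ⟨d, hd⟩ := Finite.surjective_of_injective hinj ⟨hl.act c, h⟩
  rw [← hl.act_injective _ (Subtype.ext_iff.1 hd)]
  exact d.2

theorem residue_act (hl : IsCodeAut l) {m : ℕ} (hm : m ≠ 0) (c : Fin 24 → ZMod (3 ^ m)) :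
    residue (hl.act c) = hl.act (residue c) := by
  have h : ∀ (c : Fin 24 → ZMod (3 ^ m)) (i : Fin 24),
      residue c i = ZMod.castHom (dvd_pow_self 3 hm) (ZMod 3) (c i) := by
    intro c i
    conv_rhs => rw [← ZMod.natCast_zmod_val (c i)]
    rw [map_natCast, residue]
  funext i
  rw [h, hl.act_apply, hl.act_apply, h, map_mul, map_intCast]

theorem act_eq_zero_iff (hl : IsCodeAut l) {n : ℕ} (c : Fin 24 → ZMod n) (i : Fin 24) :
    hl.act c i = 0 ↔ c (hl.perm i) = 0 := signedPerm_eq_zero_iff _ _ _ _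

theorem unitWt_act (hl : IsCodeAut l) {m : ℕ} (hm : m ≠ 0) (c : Fin 24 → ZMod (3 ^ m)) :
    unitWt (hl.act c) = unitWt c := by
  rw [unitWt_eq_card_residue, unitWt_eq_card_residue, residue_act hl hm]
  refine Finset.card_bij (fun i _ => hl.perm i) ?_ (fun i _ j _ h => hl.perm.injective h) ?_
  · intro i hi
    simpa [act_eq_zero_iff] using hi
  · intro j hj
    refine ⟨hl.perm.symm j, ?_, hl.perm.apply_symm_apply j⟩
    simpa [act_eq_zero_iff] using hj

end Automorphisms

section FiberSum

variable {θ : ℤ_[3]} {l : List (ℕ × ℕ)}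

/-- A function of pairs of codewords that vanishes unless the words have disjoint supports, and that
is invariant under the automorphisms of the codes and under multiplication by units. -/
structure IsPairInvariant (θ : ℤ_[3]) (m ℓ : ℕ) {M : Type} [AddCommMonoid M]
    (f : (Fin 24 → ZMod (3 ^ m)) → (Fin 24 → ZMod (3 ^ ℓ)) → M) : Prop where
  act : ∀ {l : List (ℕ × ℕ)} (hl : IsCodeAut l), ∀ c ∈ qrTower θ m, ∀ d ∈ qrTower θ ℓ,
    f (hl.act c) (hl.act d) = f c d
  smul_left : ∀ u : (ZMod (3 ^ m))ˣ, ∀ c ∈ qrTower θ m, ∀ d ∈ qrTower θ ℓ,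
    f ((u : ZMod (3 ^ m)) • c) d = f c d
  smul_right : ∀ u : (ZMod (3 ^ ℓ))ˣ, ∀ c ∈ qrTower θ m, ∀ d ∈ qrTower θ ℓ,
    f c ((u : ZMod (3 ^ ℓ)) • d) = f c d
  disj : ∀ c d, ¬ DisjSupp c d → f c d = 0

theorem isPairInvariant_pairTerm (hθ : IsCodeRoot θ) {m ℓ : ℕ} (h5 : m + ℓ ≤ 5) :
    IsPairInvariant θ m ℓ (pairTerm θ m ℓ) := by
  refine ⟨?_, ?_, ?_, ?_⟩
  · intro l hl c hc d hd
    rw [pairTerm, pairTerm, IsCodeAut.act, IsCodeAut.act,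
      hθ.tower.pairWt_signedPerm hl.perm (sourceSign l) rfl
        (fun c hc => hl.act_mem hθ (by omega) hc) (fun c hc => hl.act_mem hθ h5 hc) hc hd,
      pairMon_signedPerm]
  · intro u c hc d hd
    have h1 := pairMon_unit_smul (p := 3) ℚ u.isUnit (isUnit_one (M := ZMod (3 ^ ℓ))) c d
    rw [one_smul] at h1
    rw [pairTerm, pairTerm, hθ.tower.pairWt_unit_smul_left rfl hc hd u.isUnit, h1]
  · intro u c hc d hd
    have h1 := pairMon_unit_smul (p := 3) ℚ (isUnit_one (M := ZMod (3 ^ m))) u.isUnit c d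
    rw [one_smul] at h1
    rw [pairTerm, pairTerm, hθ.tower.pairWt_unit_smul_right rfl hc hd u.isUnit, h1]
  · intro c d h
    rw [pairTerm, pairWt_eq_zero_of_not_disjSupp h, map_zero, zero_mul]

variable {M : Type} [AddCommMonoid M]

open Classical in
/-- The sum of a function over the pairs whose first word reduces to `w`, and whose second word has
`b` entries not divisible by three. -/
noncomputable def fiberSum (θ : ℤ_[3]) {m ℓ : ℕ}
    (f : (Fin 24 → ZMod (3 ^ m)) → (Fin 24 → ZMod (3 ^ ℓ)) → M) (b : ℕ) (w : Fin 24 → ZMod 3) : M :=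
  ∑ c : Fin 24 → ZMod (3 ^ m) with c ∈ qrTower θ m ∧ residue c = w,
    ∑ d : Fin 24 → ZMod (3 ^ ℓ) with d ∈ qrTower θ ℓ ∧ unitWt d = b, f c d

open Classical in
theorem fiberSum_act (hl : IsCodeAut l) (hθ : IsCodeRoot θ) {m ℓ : ℕ} (hm : m ≠ 0) (hℓ : ℓ ≠ 0)
    (hm5 : m ≤ 5) (hℓ5 : ℓ ≤ 5) {f : (Fin 24 → ZMod (3 ^ m)) → (Fin 24 → ZMod (3 ^ ℓ)) → M}
    (hf : IsPairInvariant θ m ℓ f) (b : ℕ) (w : Fin 24 → ZMod 3) :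
    fiberSum θ f b (hl.act w) = fiberSum θ f b w := by
  rw [fiberSum, fiberSum, Finset.sum_filter, Finset.sum_filter,
    ← Equiv.sum_comp (hl.actEquiv (3 ^ m))]
  refine Finset.sum_congr rfl fun c _ => ?_
  have h1 : hl.actEquiv (3 ^ m) c = hl.act c := rfl
  rw [h1]
  have h2 : (hl.act c ∈ qrTower θ m ∧ residue (hl.act c) = hl.act w) ↔
      (c ∈ qrTower θ m ∧ residue c = w) := by
    rw [hl.act_mem_iff hθ hm5, residue_act hl hm]
    exact and_congr_right fun _ => (hl.act_injective _).eq_iff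
  by_cases hc : c ∈ qrTower θ m ∧ residue c = w
  · rw [if_pos hc, if_pos (h2.2 hc), Finset.sum_filter, Finset.sum_filter,
      ← Equiv.sum_comp (hl.actEquiv (3 ^ ℓ))]
    refine Finset.sum_congr rfl fun d _ => ?_
    have h3 : hl.actEquiv (3 ^ ℓ) d = hl.act d := rfl
    rw [h3, hl.act_mem_iff hθ hℓ5, unitWt_act hl hℓ]
    refine ite_congr rfl (fun hd => ?_) fun _ => rfl
    rw [hf.act hl c hc.1 d hd.1]
  · rw [if_neg hc, if_neg fun h => hc (h2.1 h)]

open Classical in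
/-- The sum of a function over the pairs whose words have `a` and `b` entries, respectively, that
are not divisible by three. -/
noncomputable def weightSum (θ : ℤ_[3]) {m ℓ : ℕ}
    (f : (Fin 24 → ZMod (3 ^ m)) → (Fin 24 → ZMod (3 ^ ℓ)) → M) (a b : ℕ) : M :=
  ∑ c : Fin 24 → ZMod (3 ^ m) with c ∈ qrTower θ m ∧ unitWt c = a,
    ∑ d : Fin 24 → ZMod (3 ^ ℓ) with d ∈ qrTower θ ℓ ∧ unitWt d = b, f c d

theorem partWE_eq_weightSum (θ : ℤ_[3]) (m ℓ a b : ℕ) :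
    partWE (qrTower θ) m ℓ a b = weightSum θ (pairTerm θ m ℓ) a b := by
  rw [partWE, weightSum]
  refine Finset.sum_congr (by congr!) fun c _ => Finset.sum_congr (by congr!) fun d _ => ?_
  rw [pairTerm]

open Classical in
theorem weightSum_eq_sum_fiberSum (θ : ℤ_[3]) {m ℓ : ℕ}
    (f : (Fin 24 → ZMod (3 ^ m)) → (Fin 24 → ZMod (3 ^ ℓ)) → M) (a b : ℕ) :
    weightSum θ f a b = ∑ w : Fin 24 → ZMod 3 with
      (Finset.univ.filter fun i => w i ≠ 0).card = a ∧ (∃ c ∈ qrTower θ m, residue c = w),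
        fiberSum θ f b w := by
  rw [weightSum, ← Finset.sum_fiberwise_of_maps_to (g := residue)
    (t := Finset.univ.filter fun w : Fin 24 → ZMod 3 =>
      (Finset.univ.filter fun i => w i ≠ 0).card = a ∧ (∃ c ∈ qrTower θ m, residue c = w))]
  · refine Finset.sum_congr rfl fun w hw => ?_
    rw [fiberSum]
    refine Finset.sum_congr ?_ fun _ _ => by congr!
    obtain ⟨-, hw, -⟩ := Finset.mem_filter.1 hw
    ext c
    simp only [Finset.mem_filter, Finset.mem_univ, true_and]
    constructor
    · rintro ⟨⟨h1, h2⟩, h3⟩; exact ⟨h1, h3⟩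
    · rintro ⟨h1, h3⟩
      refine ⟨⟨h1, ?_⟩, h3⟩
      rw [unitWt_eq_card_residue, h3]; exact hw
  · intro c hc
    obtain ⟨-, h1, h2⟩ := Finset.mem_filter.1 hc
    exact Finset.mem_filter.2 ⟨Finset.mem_univ _, by rw [← h2, unitWt_eq_card_residue], c, h1, rfl⟩

end FiberSum

/-! ### The weight distribution of the code modulo three -/

/-- The weight of a packed word modulo three. -/
def triWeight (v : ℕ) : List ℕ → ℕ
  | [] => 0
  | i :: P => match tri v i with
    | 0 => triWeight v P
    | _ + 1 => Nat.succ (triWeight v P)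

theorem triWeight_eq (v : ℕ) (P : List ℕ) :
    triWeight v P = (P.map fun i => if tri v i = 0 then 0 else 1).sum := by
  induction P with
  | nil => rfl
  | cons i P ih =>
    rw [triWeight, ih, List.map_cons, List.sum_cons]
    rcases h : tri v i with _ | t
    · rw [if_pos rfl, zero_add]
    · rw [if_neg (Nat.succ_ne_zero t), add_comm 1]

theorem unitWt_unpack_eq_triWeight {m : ℕ} (hm : m ≠ 0) (v : ℕ) :
    unitWt (unpack (3 ^ m) v) = triWeight v positions := by
  rw [triWeight_eq, sum_positions (fun i => if tri v i = 0 then 0 else 1), unitWt_eq_card_residue,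
    residue_unpack hm, Finset.card_filter]
  refine Finset.sum_congr rfl fun i _ => ?_
  simp only [tri_eq_zero_iff, ne_eq, ite_not]

open Classical in
/-- The search finds all matching codewords. -/
theorem IsCodeRoot.exists_mem_searchWords {θ : ℤ_[3]} (hθ : IsCodeRoot θ) {cs : List (ℕ × List ℕ)}
    (hcs : ∀ c ∈ cs, c.1 < 24 ∧ c.2.Nodup ∧ ∀ a ∈ c.2, a < 3) (k : ℕ)
    {c : Fin 24 → ZMod (3 ^ 1)} (hc : c ∈ qrTower θ 1)
    (hm : Matches cs k (fun i => upOne.symm (c i))) :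
    ∃ v ∈ searchWords cs k 0 codeRows, unpack (3 ^ 1) v = c := by
  by_contra! hcon
  have h := hθ.sum_matches hcs k (fun d => if d = c then 1 else 0)
  have h1 : ((searchWords cs k 0 codeRows).map fun v =>
      if unpack (3 ^ 1) v = c then 1 else 0).sum = 0 :=
    List.sum_eq_zero fun x hx => by
      obtain ⟨v, hv, rfl⟩ := List.mem_map.1 hx
      exact if_neg (hcon v hv)
  rw [h1] at h
  have h2 := Finset.sum_eq_zero_iff.1 h c (Finset.mem_filter.2 ⟨Finset.mem_univ _, hc⟩)
  rw [if_pos hm, if_pos rfl] at h2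
  exact one_ne_zero h2

theorem matches_of_card_le {w : Fin 24 → ZMod 3} {idx : List ℕ} {k : ℕ}
    (h : (idx.map fun i => if w (Fin.ofNat 24 i) = 0 then 0 else 1).sum ≤ k) :
    Matches (idx.map fun i => (i, [0, 1, 2])) k w := by
  induction idx generalizing k with
  | nil => exact trivial
  | cons i idx ih =>
    rw [List.map_cons, List.sum_cons] at h
    rw [List.map_cons, Matches]
    by_cases h0 : w (Fin.ofNat 24 i) = 0
    · rw [if_pos h0, zero_add] at h
      exact ⟨0, by simp, by rw [Nat.cast_zero]; exact h0.symm, k, rfl, ih h⟩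
    · rw [if_neg h0] at h
      obtain ⟨k, rfl⟩ := Nat.exists_eq_succ_of_ne_zero (show k ≠ 0 by omega)
      have h12 : ∀ y : ZMod 3, y ≠ 0 → ((1 : ℕ) : ZMod 3) = y ∨ ((2 : ℕ) : ZMod 3) = y := by decide
      rcases h12 _ h0 with h1 | h1
      · exact ⟨1, by simp, h1, k, rfl, ih (by omega)⟩
      · exact ⟨2, by simp, h1, k, rfl, ih (by omega)⟩

/-- The index `0` and the squares: `invMap` exchanges this set with its complement. -/
def infoPositions : List ℕ := [0, 1, 2, 3, 4, 6, 8, 9, 12, 13, 16, 18]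

set_option maxRecDepth 100000 in
/-- There are no nonzero words of weight at most six with at most three nonzero letters on the
information set `infoPositions`. -/
theorem triWeight_search :
    ((searchWords (infoPositions.map fun i => (i, [0, 1, 2])) 3 0 codeRows).all fun v =>
      (Nat.beq (triWeight v positions) 0).or (Nat.ble 9 (triWeight v positions))) = true := by
  decide +kernel

section Weights

variable {θ : ℤ_[3]}

theorem IsCodeRoot.nine_le_unitWt_of_info (hθ : IsCodeRoot θ) {c : Fin 24 → ZMod (3 ^ 1)}
    (hc : c ∈ qrTower θ 1) (h0 : unitWt c ≠ 0)
    (h : (infoPositions.map fun i => if c (Fin.ofNat 24 i) = 0 then 0 else 1).sum ≤ 3) :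
    9 ≤ unitWt c := by
  obtain ⟨v, hv, rfl⟩ := hθ.exists_mem_searchWords (k := 3)
    (cs := infoPositions.map fun i => (i, [0, 1, 2])) (by decide) hc
    (matches_of_card_le (by simpa [map_eq_zero_iff _ upOne.symm.injective] using h))
  have h1 := List.all_eq_true.1 triWeight_search v hv
  rw [unitWt_unpack_eq_triWeight one_ne_zero] at h0 ⊢
  rw [Bool.or_eq_true, Nat.ble_eq] at h1
  exact h1.resolve_left fun h2 => h0 (Nat.eq_of_beq_eq_true h2)

/-- A word of weight `w` has inner product `w` with itself, and the code is self-dual. -/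
theorem three_dvd_unitWt (hθ : IsCodeRoot θ) {c : Fin 24 → ZMod (3 ^ 1)} (hc : c ∈ qrTower θ 1) :
    3 ∣ unitWt c := by
  have h := (hθ.tower.mem_iff c).1 hc c hc
  have h1 : ∀ y : ZMod (3 ^ 1), y * y = if ¬ 3 ∣ y.val then 1 else 0 := by decide
  simp only [h1, Finset.sum_boole] at h
  exact (pow_one 3).symm.dvd.trans ((ZMod.natCast_eq_zero_iff _ _).1 h)

theorem sum_infoPositions (f : Fin 24 → ℕ) :
    (infoPositions.map fun i => f (Fin.ofNat 24 i)).sum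
      + (infoPositions.map fun i => f (sourceIndex invMap (Fin.ofNat 24 i))).sum = ∑ i, f i := by
  have hp : (infoPositions.map (Fin.ofNat 24) ++
      infoPositions.map fun i => sourceIndex invMap (Fin.ofNat 24 i)).Perm (List.finRange 24) := by
    decide +kernel
  rw [Fin.sum_univ_def, ← (hp.map f).sum_eq, List.map_append, List.sum_append, List.map_map,
    List.map_map]
  rfl

/-- The minimum distance of the code modulo three is nine: a word of weight at most six, or its
image under the inversion, has at most three nonzero letters on an information set. -/
theorem nine_le_unitWt (hθ : IsCodeRoot θ) {c : Fin 24 → ZMod (3 ^ 1)} (hc : c ∈ qrTower θ 1)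
    (h0 : unitWt c ≠ 0) : 9 ≤ unitWt c := by
  by_contra hlt
  obtain ⟨k, hk⟩ := three_dvd_unitWt hθ hc
  have hz : ∀ y : ZMod (3 ^ 1), (¬ 3 ∣ y.val) ↔ y ≠ 0 := by decide
  have hw : ∑ i, (if c i = 0 then 0 else 1) = unitWt c := by
    simp only [unitWt, hz, Finset.card_filter, ne_eq, ite_not]
  have hsum := sum_infoPositions (fun i => if c i = 0 then 0 else 1)
  rw [hw] at hsum
  rcases le_or_gt (infoPositions.map fun i => if c (Fin.ofNat 24 i) = 0 then 0 else 1).sum 3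
    with h | h
  · exact hlt (hθ.nine_le_unitWt_of_info hc h0 h)
  · -- The inversion moves at most three nonzero letters to the information set.
    have hu := unitWt_act isCodeAut_invMap one_ne_zero c
    refine hlt ?_
    rw [← hu]
    refine hθ.nine_le_unitWt_of_info (isCodeAut_invMap.act_mem hθ (by norm_num) hc)
      (by rwa [hu]) ?_
    have : (infoPositions.map fun i =>
        if isCodeAut_invMap.act c (Fin.ofNat 24 i) = 0 then 0 else 1)
        = infoPositions.map fun i =>
          if c (sourceIndex invMap (Fin.ofNat 24 i)) = 0 then 0 else 1 := by
      refine List.map_congr_left fun i _ => ?_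
      exact if_congr (act_eq_zero_iff _ _ _) rfl rfl
    rw [this]
    omega

theorem unitWt_cases (hθ : IsCodeRoot θ) {c : Fin 24 → ZMod (3 ^ 1)} (hc : c ∈ qrTower θ 1) :
    unitWt c ∈ ({0, 9, 12, 15, 18, 21, 24} : Finset ℕ) := by
  by_cases h0 : unitWt c = 0
  · simp [h0]
  · have h9 := nine_le_unitWt hθ hc h0
    have h3 := three_dvd_unitWt hθ hc
    have h24 : unitWt c ≤ 24 := (Finset.card_le_univ _).trans_eq (Fintype.card_fin 24)
    simp only [Finset.mem_insert, Finset.mem_singleton]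
    omega

open Classical in
/-- The number of words of a given weight in the code modulo three. -/
noncomputable def wtCount (θ : ℤ_[3]) (a : ℕ) : ℕ :=
  (Finset.univ.filter fun c : Fin 24 → ZMod (3 ^ 1) => c ∈ qrTower θ 1 ∧ unitWt c = a).card

open Classical in
theorem sum_unitWt (hθ : IsCodeRoot θ) {M : Type*} [AddCommMonoid M] (f : ℕ → M) :
    ∑ c : Fin 24 → ZMod (3 ^ 1) with c ∈ qrTower θ 1, f (unitWt c)
      = ∑ a ∈ ({0, 9, 12, 15, 18, 21, 24} : Finset ℕ), wtCount θ a • f a := by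
  rw [← Finset.sum_fiberwise_of_maps_to (g := unitWt)
    (fun c hc => unitWt_cases hθ (Finset.mem_filter.1 hc).2)]
  refine Finset.sum_congr rfl fun a _ => ?_
  rw [Finset.sum_congr rfl fun c hc => by rw [(Finset.mem_filter.1 hc).2], Finset.sum_const,
    Finset.filter_filter, wtCount]

theorem wtCount_zero (θ : ℤ_[3]) : wtCount θ 0 = 1 := by
  classical
  rw [wtCount, Finset.card_eq_one]
  refine ⟨0, ?_⟩
  ext c
  simp only [Finset.mem_filter, Finset.mem_univ, true_and, Finset.mem_singleton, unitWt_eq_zero_iff]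
  constructor
  · exact fun h => h.2
  · rintro rfl
    exact ⟨zero_mem _, rfl⟩

theorem natVar_level_one (w : ℕ → WVar) (y : ZMod (3 ^ 1)) :
    natVar 3 w y.val = if 3 ∣ y.val then WVar.z else w 0 := by
  have h3 : y.val < 3 := ZMod.val_lt y
  unfold natVar
  by_cases h : y.val = 0
  · simp [h]
  · have h1 : ¬ 3 ∣ y.val := fun hd => h (Nat.eq_zero_of_dvd_of_lt hd h3)
    rw [if_neg h, if_neg h1, padicValNat.eq_zero_of_not_dvd h1]

theorem prod_natVar_level_one (w : ℕ → WVar) (c : Fin 24 → ZMod (3 ^ 1)) :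
    ∏ i, (MvPolynomial.X (natVar 3 w (c i).val) : MvPolynomial WVar ℚ)
      = MvPolynomial.X WVar.z ^ (24 - unitWt c) * MvPolynomial.X (w 0) ^ unitWt c := by
  have h : ∀ i, (MvPolynomial.X (natVar 3 w (c i).val) : MvPolynomial WVar ℚ)
      = if ¬ 3 ∣ (c i).val then MvPolynomial.X (w 0) else MvPolynomial.X WVar.z := by
    intro i
    rw [natVar_level_one]
    split_ifs <;> simp_all
  have hc := Finset.card_filter_add_card_filter_not (s := (Finset.univ : Finset (Fin 24)))
    (fun i => ¬ 3 ∣ (c i).val)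
  rw [Finset.prod_congr rfl fun i _ => h i, Finset.prod_ite, Finset.prod_const, Finset.prod_const,
    mul_comm]
  rw [Finset.card_univ, Fintype.card_fin] at hc
  congr 2
  unfold unitWt
  omega

open Classical in
/-- The MacWilliams identity for the self-dual code modulo three. -/
theorem macWilliams (hθ : IsCodeRoot θ) (t : ℚ) :
    ∑ c : Fin 24 → ZMod (3 ^ 1) with c ∈ qrTower θ 1, t ^ unitWt c = (3 ^ 12)⁻¹ *
      ∑ c : Fin 24 → ZMod (3 ^ 1) with c ∈ qrTower θ 1,
        (1 + 2 * t) ^ (24 - unitWt c) * (1 - t) ^ unitWt c := by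
  have h : disjointWE 3 (qrTower θ) 1 0 = MvPolynomial.C ((Nat.card (qrTower θ 1) : ℚ)⁻¹) *
      MvPolynomial.aeval (upSubst 3 0 0) (disjointWE 3 (qrTower θ) 0 1) :=
    hθ.tower.disjointWE_succ 0 0
  have h1 : disjointWE 3 (qrTower θ) 0 1 = ∑ c : Fin 24 → ZMod (3 ^ 1) with c ∈ qrTower θ 1,
      MvPolynomial.X WVar.z ^ (24 - unitWt c) * MvPolynomial.X (WVar.y 0) ^ unitWt c := by
    rw [disjointWE, hθ.tower.dual, swe]
    refine Finset.sum_congr (by congr!) fun c _ => ?_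
    simp only [letterVar_eq_natVar]
    exact prod_natVar_level_one WVar.y c
  rw [hθ.tower.disjointWE_zero_right, h1, card_qrTower_one] at h
  -- The identity is the recursion for `A_{1,0}`, evaluated at `z = 1` and `x_0 = t`.
  obtain ⟨ev, hz, hx, hy⟩ : ∃ ev : MvPolynomial WVar ℚ →ₐ[ℚ] ℚ, ev (MvPolynomial.X WVar.z) = 1 ∧
      (∀ i, ev (MvPolynomial.X (WVar.x i)) = t) ∧ ∀ j, ev (MvPolynomial.X (WVar.y j)) = t :=
    ⟨MvPolynomial.aeval fun v : WVar => match v with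
      | WVar.z => 1
      | _ => t, by simp, by simp, by simp⟩
  have h2 := congrArg ev h
  rw [map_sum, map_mul, map_sum, map_sum, MvPolynomial.algHom_C] at h2
  have h3 : ∀ c : Fin 24 → ZMod (3 ^ 1), ev (wordMon c) = t ^ unitWt c := by
    intro c
    rw [wordMon, prod_natVar_level_one WVar.x c, map_mul, map_pow, map_pow, hz, hx, one_pow,
      one_mul]
  have h4 : ∀ a b : ℕ, ev (MvPolynomial.aeval (upSubst 3 0 0) ((MvPolynomial.X WVar.z :
    MvPolynomial WVar ℚ) ^ a *
      MvPolynomial.X (WVar.y 0) ^ b)) = (1 + 2 * t) ^ a * (1 - t) ^ b := by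
    intro a b
    have h5 : (3 : ℚ) - 1 = 2 := by norm_num
    rw [map_mul, map_pow, map_pow, MvPolynomial.aeval_X, MvPolynomial.aeval_X]
    simp only [upSubst, if_true, map_mul, map_pow, map_add, map_sub, hz, hx, MvPolynomial.algHom_C,
      Algebra.algebraMap_self, RingHom.id_apply, Nat.cast_ofNat, h5]
  simp only [h3, h4, Algebra.algebraMap_self, RingHom.id_apply] at h2
  refine Eq.trans (Finset.sum_congr (by congr!) fun _ _ => rfl) (h2.trans ?_)
  refine congrArg₂ _ (by norm_num) (Finset.sum_congr (by congr!) fun _ _ => rfl)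

/-- Three divides all weights, and the minimum is nine; the MacWilliams identity, evaluated at
sufficiently many numbers, then determines the remaining six numbers of words. -/
theorem wtCount_eq (hθ : IsCodeRoot θ) : wtCount θ 9 = 4048 ∧ wtCount θ 12 = 61824 ∧
    wtCount θ 15 = 242880 ∧ wtCount θ 18 = 198352 ∧ wtCount θ 21 = 24288 ∧ wtCount θ 24 = 48 := by
  have h : ∀ t : ℚ, ∑ a ∈ ({0, 9, 12, 15, 18, 21, 24} : Finset ℕ), wtCount θ a • t ^ a
      = (3 ^ 12)⁻¹ * ∑ a ∈ ({0, 9, 12, 15, 18, 21, 24} : Finset ℕ),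
        wtCount θ a • ((1 + 2 * t) ^ (24 - a) * (1 - t) ^ a) := by
    classical
    intro t
    have := macWilliams hθ t
    rwa [sum_unitWt hθ (fun a => t ^ a),
      sum_unitWt hθ (fun a => (1 + 2 * t) ^ (24 - a) * (1 - t) ^ a)] at this
  simp only [Finset.sum_insert (show (0 : ℕ) ∉ ({9, 12, 15, 18, 21, 24} : Finset ℕ) by decide),
    Finset.sum_insert (show (9 : ℕ) ∉ ({12, 15, 18, 21, 24} : Finset ℕ) by decide),
    Finset.sum_insert (show (12 : ℕ) ∉ ({15, 18, 21, 24} : Finset ℕ) by decide),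
    Finset.sum_insert (show (15 : ℕ) ∉ ({18, 21, 24} : Finset ℕ) by decide),
    Finset.sum_insert (show (18 : ℕ) ∉ ({21, 24} : Finset ℕ) by decide),
    Finset.sum_insert (show (21 : ℕ) ∉ ({24} : Finset ℕ) by decide), Finset.sum_singleton,
    wtCount_zero, nsmul_eq_mul, Nat.cast_one] at h
  have e1 := h 1
  have e2 := h (-1)
  have e3 := h 2
  have e4 := h 3
  have e5 := h (-3)
  have e6 := h 4
  clear h
  norm_num at e1 e2 e3 e4 e5 e6
  have key : (wtCount θ 9 : ℚ) = 4048 ∧ (wtCount θ 12 : ℚ) = 61824 ∧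
    (wtCount θ 15 : ℚ) = 242880 ∧ (wtCount θ 18 : ℚ) = 198352 ∧ (wtCount θ 21 : ℚ) = 24288 ∧
      (wtCount θ 24 : ℚ) = 48 := by
    refine ⟨?_, ?_, ?_, ?_, ?_, ?_⟩ <;> linarith
  exact_mod_cast key

/-- The partial weight enumerator `D_{1,0}`. -/
theorem partialWE_one_zero (hθ : IsCodeRoot θ) : partialWE 3 (qrTower θ) 1 0 =
    4048 * MvPolynomial.X WVar.z ^ 15 * MvPolynomial.X (WVar.x 0) ^ 9
      + 61824 * MvPolynomial.X WVar.z ^ 12 * MvPolynomial.X (WVar.x 0) ^ 12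
      + 242880 * MvPolynomial.X WVar.z ^ 9 * MvPolynomial.X (WVar.x 0) ^ 15
      + 198352 * MvPolynomial.X WVar.z ^ 6 * MvPolynomial.X (WVar.x 0) ^ 18
      + 24288 * MvPolynomial.X WVar.z ^ 3 * MvPolynomial.X (WVar.x 0) ^ 21
      + 48 * MvPolynomial.X (WVar.x 0) ^ 24 := by
  classical
  obtain ⟨h9, h12, h15, h18, h21, h24⟩ := wtCount_eq hθ
  rw [hθ.tower.partialWE_zero_right]
  have h : ∀ c : Fin 24 → ZMod (3 ^ 1), wordMon c = MvPolynomial.X WVar.z ^ (24 - unitWt c) *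
      MvPolynomial.X (WVar.x 0) ^ unitWt c := fun c => prod_natVar_level_one WVar.x c
  have h1 := sum_unitWt hθ (fun a => if a ≠ 0 then (MvPolynomial.X WVar.z ^ (24 - a) *
    MvPolynomial.X (WVar.x 0) ^ a : MvPolynomial WVar ℚ) else 0)
  rw [← Finset.sum_filter, Finset.filter_filter] at h1
  simp only [one_ne_zero, false_or]
  rw [Finset.sum_congr rfl fun c _ => h c]
  refine Eq.trans ?_ (h1.trans ?_)
  · congr!
  simp [h9, h12, h15, h18, h21, h24]
  ring

end Weights

/-! ### The words of weight nine form one orbit -/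

/-- The word whose entries are the ternary digits of a number. -/
def wordOf (v : ℕ) (i : Fin 24) : ZMod (3 ^ 1) := ((v / 3 ^ i.val : ℕ) : ZMod (3 ^ 1))

/-- The action of a signed permutation on the ternary digits of a number. -/
def applyMonomial (v : ℕ) : List (ℕ × ℕ) → ℕ
  | [] => 0
  | x :: l => Nat.add (Nat.mod (Nat.mul x.2 (Nat.div v (Nat.pow 3 x.1))) 3)
      (Nat.mul 3 (applyMonomial v l))

/-- The iterated images of `v` under a signed permutation. -/
def iterates (l : List (ℕ × ℕ)) : ℕ → ℕ → List ℕ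
  | 0, _ => []
  | n + 1, v => v :: iterates l n (applyMonomial v l)

/-- The cyclic shift of the first `23` of `24` ternary digits; the constants are `3 ^ 22` and
`3 ^ 23`. -/
def shiftWord (v : ℕ) : ℕ :=
  Nat.add (Nat.add (Nat.mul 3 (Nat.mod v 31381059609)) (Nat.mod (Nat.div v 31381059609) 3))
    (Nat.mul (Nat.div v 94143178827) 94143178827)

/-- The iterated cyclic shifts of `v`. -/
def shifts : ℕ → ℕ → List ℕ
  | 0, _ => []
  | n + 1, v => v :: shifts n (shiftWord v)

/-- The chosen word of weight nine, as a number with ternary digits. -/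
def repDigits : ℕ :=
  [1, 0, 2, 1, 0, 0, 1, 1, 0, 0, 2, 0, 1, 1, 2].foldr (fun a s => Nat.add a (Nat.mul 3 s)) 0

/-- The chosen word of weight nine, as a packed word. -/
def repWord : ℕ :=
  addMul 2 (addMul 1 (addMul 1 (Nat.mul 2 (codeRow 3)) (codeRow 2)) (codeRow 1)) (codeRow 0)

/-- Representatives for the orbits of the group generated by the shift and the multiplication by `2`
on the words of weight nine. -/
def orbitSeeds : List ℕ := [0, 1, 3, 4, 5, 8, 9, 10].flatMap fun i =>
  [applyMonomial ((iterates shiftMap 11 repDigits).getD i repDigits) invMap,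
    applyMonomial (applyMonomial ((iterates shiftMap 11 repDigits).getD i repDigits) invMap) negMap]

/-- The images of the representatives under the multiplications by powers of `2` and the shifts. -/
def orbitWords : List ℕ := (orbitSeeds.flatMap (iterates doubleMap 11)).flatMap (shifts 23)

/-- The last twelve of the first `23` ternary digits; the constants are `3 ^ 11` and `3 ^ 12`. -/
def infoKey (v : ℕ) : ℕ := Nat.mod (Nat.div v 177147) 531441

/-- The words have distinct keys, which are also different from the indices of the bits of `m`. -/
def distinctKeys : ℕ → List ℕ → Bool
  | _, [] => true
  | m, v :: l => match Nat.mod (Nat.shiftRight m (infoKey v)) 2 with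
    | 0 => distinctKeys (Nat.lor m (Nat.shiftLeft 1 (infoKey v))) l
    | _ + 1 => false

set_option maxRecDepth 100000 in
/-- The images of the chosen word are distinct already on an information set. -/
theorem distinctKeys_orbitWords : distinctKeys 0 orbitWords = true := by decide +kernel

theorem nodup_of_distinctKeys {m : ℕ} {l : List ℕ} (h : distinctKeys m l = true) :
    (∀ v ∈ l, m.testBit (infoKey v) = false) ∧ (l.map infoKey).Nodup := by
  induction l generalizing m with
  | nil => simp
  | cons v l ih =>
    rw [distinctKeys] at h
    rcases hv : Nat.mod (Nat.shiftRight m (infoKey v)) 2 with _ | t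
    · rw [hv] at h
      obtain ⟨h1, h2⟩ := ih h
      have h3 : m.testBit (infoKey v) = false := by
        rw [Nat.testBit_eq_decide_div_mod_eq, ← Nat.shiftRight_eq_div_pow,
          show (m >>> infoKey v) % 2 = 0 from hv]
        rfl
      have h4 : ∀ w ∈ l, m.testBit (infoKey w) = false ∧ infoKey v ≠ infoKey w := by
        intro w hw
        have h5 : (m ||| 1 <<< infoKey v).testBit (infoKey w) = false := h1 w hw
        rw [Nat.testBit_or, Bool.or_eq_false_iff, Nat.one_shiftLeft, Nat.testBit_two_pow,
          decide_eq_false_iff_not] at h5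
        exact h5
      refine ⟨List.forall_mem_cons.2 ⟨h3, fun w hw => (h4 w hw).1⟩, ?_⟩
      rw [List.map_cons, List.nodup_cons, List.mem_map]
      refine ⟨?_, h2⟩
      rintro ⟨w, hw, h5⟩
      exact (h4 w hw).2 h5.symm
    · rw [hv] at h
      exact absurd h (by simp)

theorem mod_pow_eq_of_digits {v w : ℕ} (n : ℕ) (h : ∀ i < n, v / 3 ^ i % 3 = w / 3 ^ i % 3) :
    v % 3 ^ n = w % 3 ^ n := by
  induction n with
  | zero => simp [Nat.mod_one]
  | succ n ih =>
    rw [Nat.mod_pow_succ, Nat.mod_pow_succ, ih fun i hi => h i (by omega), h n (by omega)]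

theorem wordOf_eq_iff {v w : ℕ} {i j : Fin 24} :
    wordOf v i = wordOf w j ↔ v / 3 ^ i.val % 3 = w / 3 ^ j.val % 3 :=
  ZMod.natCast_eq_natCast_iff' _ _ _

theorem infoKey_eq_of_wordOf_eq {v w : ℕ} (h : wordOf v = wordOf w) : infoKey v = infoKey w := by
  have h1 : v / 3 ^ 11 % 3 ^ 12 = w / 3 ^ 11 % 3 ^ 12 := by
    refine mod_pow_eq_of_digits 12 fun i hi => ?_
    rw [Nat.div_div_eq_div_mul, Nat.div_div_eq_div_mul, ← pow_add]
    exact wordOf_eq_iff.1 (congrFun h ⟨11 + i, by omega⟩)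
  exact h1

theorem nodup_wordOf_orbitWords : (orbitWords.map wordOf).Nodup := by
  have h := (nodup_of_distinctKeys distinctKeys_orbitWords).2
  refine List.Nodup.map_on (fun v hv w hw hvw => ?_) h.of_map
  exact List.inj_on_of_nodup_map h hv hw (infoKey_eq_of_wordOf_eq hvw)

theorem length_iterates (l : List (ℕ × ℕ)) (n v : ℕ) : (iterates l n v).length = n := by
  induction n generalizing v with
  | zero => rfl
  | succ n ih => rw [iterates, List.length_cons, ih]

theorem length_shifts (n v : ℕ) : (shifts n v).length = n := by
  induction n generalizing v with
  | zero => rfl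
  | succ n ih => rw [shifts, List.length_cons, ih]

theorem length_orbitWords : orbitWords.length = 4048 := by
  simp [orbitWords, List.length_flatMap, length_shifts, length_iterates, orbitSeeds]

theorem digit_applyMonomial (v : ℕ) (l : List (ℕ × ℕ)) {j : ℕ} (hj : j < l.length) :
    applyMonomial v l / 3 ^ j % 3 = (l.getD j (0, 0)).2 * (v / 3 ^ (l.getD j (0, 0)).1) % 3 := by
  induction l generalizing j with
  | nil => simp at hj
  | cons x l ih =>
    have h1 : applyMonomial v (x :: l) = x.2 * (v / 3 ^ x.1) % 3 + 3 * applyMonomial v l := rfl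
    rw [h1]
    rcases j with _ | j
    · rw [List.getD_cons_zero, pow_zero, Nat.div_one]
      omega
    · rw [List.getD_cons_succ, ← ih (by simpa using hj), pow_succ', ← Nat.div_div_eq_div_mul]
      congr 2
      omega

theorem wordOf_applyMonomial {l : List (ℕ × ℕ)} (hl : IsCodeAut l) (v : ℕ) :
    wordOf (applyMonomial v l) = hl.act (wordOf v) := by
  funext j
  have hj : j.val < l.length := by rw [hl.length]; exact j.isLt
  obtain ⟨h1, h2⟩ := hl.valid (l.getD j (0, 0)) (by
    rw [List.getD_eq_getElem _ _ hj]; exact List.getElem_mem _)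
  have h3 : (sourceIndex l j).val = (l.getD j (0, 0)).1 := Nat.mod_eq_of_lt h1
  have h4 : wordOf (applyMonomial v l) j
      = (((l.getD j (0, 0)).2 * (v / 3 ^ (l.getD j (0, 0)).1) : ℕ) : ZMod (3 ^ 1)) :=
    (ZMod.natCast_eq_natCast_iff' _ _ _).2 (digit_applyMonomial v l hj)
  rw [h4, hl.act_apply, wordOf, h3, Nat.cast_mul, sourceSign]
  congr 1
  rcases h2 with h2 | h2 <;> rw [h2] <;> decide

theorem digit_add (a t : ℕ) {k n : ℕ} (hk : k < n) :
    (a + 3 ^ n * t) / 3 ^ k % 3 = a / 3 ^ k % 3 := by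
  obtain ⟨m, rfl⟩ := Nat.exists_eq_add_of_lt hk
  rw [show 3 ^ (k + m + 1) * t = 3 ^ k * (3 * (3 ^ m * t)) by ring,
    Nat.add_mul_div_left _ _ (by positivity), Nat.add_mul_mod_self_left]

theorem wordOf_shiftWord (v : ℕ) :
    wordOf (shiftWord v) = isCodeAut_shiftMap.act (wordOf v) := by
  funext j
  have h1 : shiftWord v = 3 * (v % 31381059609) + v / 31381059609 % 3
    + v / 94143178827 * 94143178827 := rfl
  have hs : sourceSign shiftMap j = 1 := by revert j; decide
  rw [IsCodeAut.act_apply, hs, Units.val_one, Int.cast_one, one_mul, wordOf_eq_iff, h1]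
  rcases Nat.lt_or_ge j.val 23 with hj | hj
  · rcases hj0 : j.val with _ | k
    · have h2 : (sourceIndex shiftMap j).val = 22 := by
        rw [show j = 0 from Fin.ext hj0]; decide
      rw [h2, pow_zero, Nat.div_one]
      norm_num only
      omega
    · have h2 : (sourceIndex shiftMap j).val = k := by
        have h3 : ∀ j : Fin 24, j.val ≠ 0 → j.val < 23 →
            (sourceIndex shiftMap j).val + 1 = j.val := by decide
        have := h3 j (by omega) hj
        omega
      have h4 : (3 * (v % 31381059609) + v / 31381059609 % 3 + v / 94143178827 * 94143178827) / 3
          = v % 31381059609 + 3 ^ 22 * (v / 94143178827) := by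
        norm_num only
        omega
      have h5 : v = v % 31381059609 + 3 ^ 22 * (v / 31381059609) := by
        norm_num only
        omega
      rw [h2, pow_succ', ← Nat.div_div_eq_div_mul, h4, digit_add _ _ (by omega)]
      conv_rhs => rw [h5, digit_add _ _ (by omega)]
  · have hj23 : j.val = 23 := by omega
    have h2 : (sourceIndex shiftMap j).val = 23 := by
      rw [show j = 23 from Fin.ext hj23]; decide
    have h3 : (3 : ℕ) ^ 23 = 94143178827 := by norm_num
    rw [h2, hj23, h3, Nat.add_mul_div_right _ _ (by norm_num), Nat.div_eq_of_lt (by omega),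
      zero_add]

section Orbit

variable {P : (Fin 24 → ZMod (3 ^ 1)) → Prop}

theorem of_mem_iterates {l : List (ℕ × ℕ)} (hl : IsCodeAut l) (hP : ∀ c, P c → P (hl.act c))
    {n v w : ℕ} (hv : P (wordOf v)) (hw : w ∈ iterates l n v) : P (wordOf w) := by
  induction n generalizing v with
  | zero => simp [iterates] at hw
  | succ n ih =>
    rw [iterates, List.mem_cons] at hw
    rcases hw with rfl | hw
    · exact hv
    · exact ih (by rw [wordOf_applyMonomial hl]; exact hP _ hv) hw

theorem of_mem_shifts (hP : ∀ c, P c → P (isCodeAut_shiftMap.act c)) {n v w : ℕ}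
    (hv : P (wordOf v)) (hw : w ∈ shifts n v) : P (wordOf w) := by
  induction n generalizing v with
  | zero => simp [shifts] at hw
  | succ n ih =>
    rw [shifts, List.mem_cons] at hw
    rcases hw with rfl | hw
    · exact hv
    · exact ih (by rw [wordOf_shiftWord]; exact hP _ hv) hw

/-- A property that is preserved by the automorphisms holds for all images of the chosen word. -/
theorem of_mem_orbitWords (hP : ∀ l, ∀ hl : IsCodeAut l, ∀ c, P c → P (hl.act c))
    (h0 : P (wordOf repDigits)) {w : ℕ} (hw : w ∈ orbitWords) : P (wordOf w) := by
  have hseed : ∀ v, P (wordOf v) → ∀ i, P (wordOf ((iterates shiftMap 11 v).getD i v)) := by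
    intro v hv i
    by_cases hi : i < (iterates shiftMap 11 v).length
    · rw [List.getD_eq_getElem _ _ hi]
      exact of_mem_iterates isCodeAut_shiftMap (hP _ _) hv (List.getElem_mem _)
    · rwa [List.getD_eq_default _ _ (by omega)]
  have hinv : ∀ v, P (wordOf v) → P (wordOf (applyMonomial v invMap)) := by
    intro v hv
    rw [wordOf_applyMonomial isCodeAut_invMap]
    exact hP _ _ _ hv
  have hneg : ∀ v, P (wordOf v) → P (wordOf (applyMonomial v negMap)) := by
    intro v hv
    rw [wordOf_applyMonomial isCodeAut_negMap]
    exact hP _ _ _ hv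
  rw [orbitWords, List.mem_flatMap] at hw
  obtain ⟨v, hv, hw⟩ := hw
  refine of_mem_shifts (hP _ _) ?_ hw
  rw [List.mem_flatMap] at hv
  obtain ⟨u, hu, hv⟩ := hv
  refine of_mem_iterates isCodeAut_doubleMap (hP _ _) ?_ hv
  rw [orbitSeeds, List.mem_flatMap] at hu
  obtain ⟨i, -, hu⟩ := hu
  rw [List.mem_cons, List.mem_singleton] at hu
  rcases hu with hu | hu
  · rw [hu]
    exact hinv _ (hseed _ h0 i)
  · rw [hu]
    exact hneg _ (hinv _ (hseed _ h0 i))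

end Orbit

section WeightNine

variable {θ : ℤ_[3]} {M : Type} [AddCommMonoid M]

theorem IsCodeRoot.packs_repWord (hθ : IsCodeRoot θ) : Packs (qrTower θ 5) rowBound repWord := by
  have h0 := hθ.packs_codeRow 0
  have h1 := hθ.packs_codeRow 1
  have h2 := hθ.packs_codeRow 2
  have h3 := hθ.packs_codeRow 3
  have e3 : Packs (qrTower θ 5) 484 (Nat.mul 2 (codeRow 3)) := by
    have h4 : Packs (qrTower θ 5) 0 0 :=
      ⟨isPacked_zero 0, by rw [unpack_zero]; exact zero_mem _⟩
    have h5 := h4.addMul h3 (t := 2) (by norm_num [laneBase])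
    have h6 : addMul 2 0 (codeRow ((3 : Fin 12) : ℕ)) = Nat.mul 2 (codeRow 3) := by decide +kernel
    rw [h6] at h5
    exact h5.mono (by norm_num)
  refine Packs.mono (((e3.addMul h2 (t := 1) (by norm_num [laneBase])).addMul h1 (t := 1)
    (by norm_num [laneBase])).addMul h0 (t := 2) (by norm_num [laneBase])) (by norm_num [rowBound])

theorem wordOf_repDigits : wordOf repDigits = unpack (3 ^ 1) repWord := by
  have h : ∀ i, wordOf repDigits i = unpack (3 ^ 1) repWord i := by decide +kernel
  exact funext h

theorem residue_wordOf_repDigits : residue (wordOf repDigits) = unpack 3 repWord := by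
  rw [wordOf_repDigits, residue_unpack one_ne_zero]

open Classical in
theorem weightSum_eq_sum_residue (hθ : IsCodeRoot θ) {m ℓ : ℕ} (hm : m ≠ 0)
    (f : (Fin 24 → ZMod (3 ^ m)) → (Fin 24 → ZMod (3 ^ ℓ)) → M) (a b : ℕ) :
    weightSum θ f a b = ∑ c : Fin 24 → ZMod (3 ^ 1) with c ∈ qrTower θ 1 ∧ unitWt c = a,
      fiberSum θ f b (residue c) := by
  rw [weightSum_eq_sum_fiberSum]
  have hres : ∀ w : Fin 24 → ZMod 3, residue (fun i => upOne (w i)) = w := by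
    intro w
    funext i
    have : ∀ y : ZMod 3, (((upOne y).val : ℕ) : ZMod 3) = y := by
      intro y
      rw [upOne, ZMod.ringEquivCongr_val, ZMod.natCast_zmod_val]
    exact this _
  have hup : ∀ c : Fin 24 → ZMod (3 ^ 1), (fun i => upOne (residue c i)) = c := by
    intro c
    funext i
    rw [residue, upOne_natCast, ZMod.natCast_zmod_val]
  symm
  refine Finset.sum_nbij' residue (fun w i => upOne (w i)) ?_ ?_ (fun c _ => hup c)
    (fun w _ => hres w) fun _ _ => rfl
  · intro c hc
    obtain ⟨-, h1, h2⟩ := Finset.mem_filter.1 hc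
    refine Finset.mem_filter.2 ⟨Finset.mem_univ _, by rw [← h2, unitWt_eq_card_residue], ?_⟩
    obtain ⟨C, hC, hCc⟩ := hθ.tower.lift (show 1 ≤ m by omega) c h1
    exact ⟨C, hC, by rw [← hCc, residue_redMod _ one_ne_zero C]⟩
  · intro w hw
    obtain ⟨-, h1, C, hC, rfl⟩ := Finset.mem_filter.1 hw
    have h3 := hθ.tower.red (show 1 ≤ m by omega) _ hC
    have h4 := residue_redMod (show 1 ≤ m by omega) one_ne_zero C
    refine Finset.mem_filter.2 ⟨Finset.mem_univ _, ?_, ?_⟩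
    · rw [← h4, hup]; exact h3
    · rw [← h1, unitWt_eq_card_residue, hres]

open Classical in
/-- The words of weight nine are images of the chosen one under signed permutations that preserve
the codes. -/
theorem weightSum_nine (hθ : IsCodeRoot θ) {m ℓ : ℕ} (hm : m ≠ 0) (hℓ : ℓ ≠ 0) (hm5 : m ≤ 5)
    (hℓ5 : ℓ ≤ 5) {f : (Fin 24 → ZMod (3 ^ m)) → (Fin 24 → ZMod (3 ^ ℓ)) → M}
    (hf : IsPairInvariant θ m ℓ f) (b : ℕ) :
    weightSum θ f 9 b = 4048 • fiberSum θ f b (unpack 3 repWord) := by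
  have horbit : ∀ v ∈ orbitWords, (wordOf v ∈ qrTower θ 1 ∧ unitWt (wordOf v) = 9) ∧
      fiberSum θ f b (residue (wordOf v)) = fiberSum θ f b (unpack 3 repWord) := by
    intro v hv
    refine of_mem_orbitWords (P := fun c => (c ∈ qrTower θ 1 ∧ unitWt c = 9) ∧
      fiberSum θ f b (residue c) = fiberSum θ f b (unpack 3 repWord)) ?_ ?_ hv
    · rintro l hl c ⟨⟨h1, h2⟩, h3⟩
      refine ⟨⟨hl.act_mem hθ (by norm_num) h1, ?_⟩, ?_⟩
      · rw [unitWt_act hl one_ne_zero, h2]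
      · rw [residue_act hl one_ne_zero, fiberSum_act hl hθ hm hℓ hm5 hℓ5 hf, h3]
    · refine ⟨⟨?_, ?_⟩, by rw [residue_wordOf_repDigits]⟩
      · rw [wordOf_repDigits]
        have := hθ.tower.red (show 1 ≤ 5 by norm_num) _ hθ.packs_repWord.mem
        simpa only [redMod_unpack] using this
      · rw [wordOf_repDigits, unitWt_unpack_eq_triWeight one_ne_zero]
        decide +kernel
  -- The images are `4048` different words of weight nine, and there are no more.
  have hset : (Finset.univ.filter fun c : Fin 24 → ZMod (3 ^ 1) => c ∈ qrTower θ 1 ∧ unitWt c = 9)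
      = (orbitWords.map wordOf).toFinset := by
    symm
    refine Finset.eq_of_subset_of_card_le ?_ ?_
    · intro c hc
      obtain ⟨v, hv, rfl⟩ := List.mem_map.1 (List.mem_toFinset.1 hc)
      exact Finset.mem_filter.2 ⟨Finset.mem_univ _, (horbit v hv).1⟩
    · rw [List.toFinset_card_of_nodup nodup_wordOf_orbitWords, List.length_map, length_orbitWords]
      exact (wtCount_eq hθ).1.le
  rw [weightSum_eq_sum_residue hθ hm, hset, Finset.sum_congr rfl (g := fun _ =>
    fiberSum θ f b (unpack 3 repWord)), Finset.sum_const,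
    List.toFinset_card_of_nodup nodup_wordOf_orbitWords, List.length_map, length_orbitWords]
  intro c hc
  obtain ⟨v, hv, rfl⟩ := List.mem_map.1 (List.mem_toFinset.1 hc)
  exact (horbit v hv).2

end WeightNine

/-! ### Normalization of words by units -/

section Normalization

/-- A sum of a function that is invariant under a set `V` of units is a multiple of the sum over the
normalized words, if each word is a unique multiple, by a unit in `V`, of a normalized one. -/
theorem sum_eq_card_smul_sum_normalized {n : ℕ} {ι M : Type*} [AddCommMonoid M]
    (V : Finset (ZMod n)ˣ) (S : Finset (ι → ZMod n)) (Nrm : (ι → ZMod n) → Prop)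
    [DecidablePred Nrm] (f : (ι → ZMod n) → M)
    (hS : ∀ u ∈ V, ∀ c, (u : ZMod n) • c ∈ S ↔ c ∈ S)
    (hf : ∀ u ∈ V, ∀ c ∈ S, f ((u : ZMod n) • c) = f c)
    (hex : ∀ c ∈ S, ∃ u ∈ V, Nrm (((u⁻¹ : (ZMod n)ˣ) : ZMod n) • c))
    (huniq : ∀ c ∈ S, ∀ u ∈ V, ∀ u' ∈ V, Nrm (((u⁻¹ : (ZMod n)ˣ) : ZMod n) • c) →
      Nrm (((u'⁻¹ : (ZMod n)ˣ) : ZMod n) • c) → u = u') :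
    ∑ c ∈ S, f c = V.card • ∑ c ∈ S with Nrm c, f c := by
  have hinv : ∀ (u : (ZMod n)ˣ) (c : ι → ZMod n),
      ((u⁻¹ : (ZMod n)ˣ) : ZMod n) • ((u : ZMod n) • c) = c := by
    intro u c
    rw [smul_smul, Units.inv_mul, one_smul]
  have hinv' : ∀ (u : (ZMod n)ˣ) (c : ι → ZMod n),
      (u : ZMod n) • (((u⁻¹ : (ZMod n)ˣ) : ZMod n) • c) = c := by
    intro u c
    rw [smul_smul, Units.mul_inv, one_smul]
  rw [← Finset.sum_const, ← Finset.sum_product']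
  symm
  refine Finset.sum_bij (fun p _ => (p.1 : ZMod n) • p.2) ?_ ?_ ?_ ?_
  · intro p hp
    obtain ⟨h1, h2⟩ := Finset.mem_product.1 hp
    exact (hS _ h1 _).2 (Finset.mem_filter.1 h2).1
  · rintro ⟨u, c⟩ hp ⟨u', c'⟩ hp' h
    obtain ⟨h1, h2⟩ := Finset.mem_product.1 hp
    obtain ⟨h1', h2'⟩ := Finset.mem_product.1 hp'
    dsimp only at h h1 h2 h1' h2'
    have h3 : u = u' := by
      refine huniq _ ((hS _ h1 _).2 (Finset.mem_filter.1 h2).1) u h1 u' h1' ?_ ?_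
      · rw [hinv]; exact (Finset.mem_filter.1 h2).2
      · rw [h, hinv]; exact (Finset.mem_filter.1 h2').2
    subst h3
    have h4 := congrArg (((u⁻¹ : (ZMod n)ˣ) : ZMod n) • ·) h
    rw [hinv, hinv] at h4
    rw [h4]
  · intro c hc
    obtain ⟨u, hu, h⟩ := hex c hc
    refine ⟨(u, ((u⁻¹ : (ZMod n)ˣ) : ZMod n) • c), Finset.mem_product.2 ⟨hu,
      Finset.mem_filter.2 ⟨?_, h⟩⟩, hinv' u c⟩
    rwa [← hS u hu, hinv']
  · intro p hp
    obtain ⟨h1, h2⟩ := Finset.mem_product.1 hp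
    exact (hf _ h1 _ (Finset.mem_filter.1 h2).1).symm

theorem natCast_val_mul {m : ℕ} (hm : m ≠ 0) (a b : ZMod (3 ^ m)) :
    (((a * b).val : ℕ) : ZMod 3) = (a.val : ZMod 3) * (b.val : ZMod 3) := by
  rw [ZMod.val_mul, ← Nat.cast_mul, ZMod.natCast_eq_natCast_iff',
    Nat.mod_mod_of_dvd _ (dvd_pow_self 3 hm)]

theorem residue_smul {ι : Type*} {m : ℕ} (hm : m ≠ 0) (a : ZMod (3 ^ m)) (c : ι → ZMod (3 ^ m))
    (i : ι) : residue (a • c) i = (a.val : ZMod 3) * residue c i := natCast_val_mul hm a (c i)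

theorem natCast_val_unit_ne_zero {m : ℕ} (hm : m ≠ 0) (u : (ZMod (3 ^ m))ˣ) :
    (((u : ZMod (3 ^ m)).val : ℕ) : ZMod 3) ≠ 0 := by
  intro h
  have h1 := natCast_val_mul hm (u : ZMod (3 ^ m)) ((u⁻¹ : (ZMod (3 ^ m))ˣ) : ZMod (3 ^ m))
  rw [h, zero_mul, Units.mul_inv] at h1
  have : Fact (1 < 3 ^ m) := ⟨Nat.one_lt_pow hm (by norm_num)⟩
  rw [ZMod.val_one, Nat.cast_one] at h1
  exact one_ne_zero h1

theorem isUnit_of_natCast_val_ne_zero {m : ℕ} {a : ZMod (3 ^ m)} (h : (a.val : ZMod 3) ≠ 0) :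
    IsUnit a := by
  rw [← ZMod.natCast_zmod_val a, ZMod.isUnit_iff_coprime]
  refine Nat.Coprime.pow_right m ?_
  rw [Nat.coprime_comm, Nat.Prime.coprime_iff_not_dvd Nat.prime_three]
  rwa [Ne, ZMod.natCast_eq_zero_iff] at h

theorem unitWt_unit_smul {m : ℕ} (hm : m ≠ 0) (u : (ZMod (3 ^ m))ˣ) (c : Fin 24 → ZMod (3 ^ m)) :
    unitWt ((u : ZMod (3 ^ m)) • c) = unitWt c := by
  simp only [unitWt_eq_card_residue, residue_smul hm, ne_eq, mul_eq_zero,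
    natCast_val_unit_ne_zero hm u, false_or]

variable {θ : ℤ_[3]}

theorem unit_smul_mem_iff (θ : ℤ_[3]) {m : ℕ} (u : (ZMod (3 ^ m))ˣ) (c : Fin 24 → ZMod (3 ^ m)) :
    (u : ZMod (3 ^ m)) • c ∈ qrTower θ m ↔ c ∈ qrTower θ m := by
  refine ⟨fun h => ?_, fun h => (qrTower θ m).smul_mem _ h⟩
  have := (qrTower θ m).smul_mem ((u⁻¹ : (ZMod (3 ^ m))ˣ) : ZMod (3 ^ m)) h
  rwa [smul_smul, Units.inv_mul, one_smul] at this

open Classical in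
/-- Normalization of the second words of pairs. -/
theorem sum_eq_totient_smul (θ : ℤ_[3]) {ℓ b : ℕ} (hℓ : ℓ ≠ 0) (hb : b ≠ 0) {M : Type*}
    [AddCommMonoid M] (f : (Fin 24 → ZMod (3 ^ ℓ)) → M)
    (hf : ∀ u : (ZMod (3 ^ ℓ))ˣ, ∀ d ∈ qrTower θ ℓ, f ((u : ZMod (3 ^ ℓ)) • d) = f d) :
    ∑ d : Fin 24 → ZMod (3 ^ ℓ) with d ∈ qrTower θ ℓ ∧ unitWt d = b, f d
      = Nat.totient (3 ^ ℓ) • ∑ d : Fin 24 → ZMod (3 ^ ℓ) with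
          (d ∈ qrTower θ ℓ ∧ unitWt d = b) ∧ IsNormalized d, f d := by
  have hset : (Finset.univ.filter fun d : Fin 24 → ZMod (3 ^ ℓ) =>
      (d ∈ qrTower θ ℓ ∧ unitWt d = b) ∧ IsNormalized d)
      = (Finset.univ.filter fun d => d ∈ qrTower θ ℓ ∧ unitWt d = b).filter IsNormalized := by
    ext d
    simp
  rw [hset, ← ZMod.card_units_eq_totient, ← Finset.card_univ]
  refine sum_eq_card_smul_sum_normalized Finset.univ _ IsNormalized f ?_ ?_ ?_ ?_
  · intro u _ c
    simp only [Finset.mem_filter, Finset.mem_univ, true_and, unit_smul_mem_iff,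
      unitWt_unit_smul hℓ]
  · intro u _ c hc
    exact hf u c (Finset.mem_filter.1 hc).2.1
  · intro c hc
    obtain ⟨-, h1, h2⟩ := Finset.mem_filter.1 hc
    have hne : ∃ i, residue c i ≠ 0 := by
      by_contra! hcon
      rw [unitWt_eq_card_residue, Finset.filter_false_of_mem fun i _ => not_not.2 (hcon i)] at h2
      exact hb h2.symm
    have hne' : ∃ s, ∃ hs : s < 24, residue c ⟨s, hs⟩ ≠ 0 := by
      obtain ⟨i, hi⟩ := hne
      exact ⟨i.val, i.isLt, hi⟩
    obtain ⟨hs, h3⟩ := Nat.find_spec hne'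
    obtain ⟨u, hu⟩ := isUnit_of_natCast_val_ne_zero h3
    refine ⟨u, Finset.mem_univ _, ⟨Nat.find hne', hs⟩, ?_, ?_⟩
    · rw [Pi.smul_apply, smul_eq_mul, ← hu, Units.inv_mul]
    · intro j hj
      have h4 := Nat.find_min hne' (m := j.val) hj
      rw [residue_smul hℓ]
      by_contra h5
      exact h4 ⟨j.isLt, fun h6 => h5 (by rw [show residue c j = 0 from h6, mul_zero])⟩
  · intro c _ u _ u' _ h h'
    obtain ⟨s, h1, h2⟩ := h
    obtain ⟨s', h1', h2'⟩ := h'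
    have key : ∀ (u v : (ZMod (3 ^ ℓ))ˣ) (s s' : Fin 24),
        ((u⁻¹ : (ZMod (3 ^ ℓ))ˣ) : ZMod (3 ^ ℓ)) * c s = 1 →
        (∀ j < s', residue (((v⁻¹ : (ZMod (3 ^ ℓ))ˣ) : ZMod (3 ^ ℓ)) • c) j = 0) → ¬ s < s' := by
      intro u v s s' h1 h2 hlt
      have h3 := h2 s hlt
      rw [residue_smul hℓ, mul_eq_zero] at h3
      have h4 := h3.resolve_left (natCast_val_unit_ne_zero hℓ _)
      have h5 := natCast_val_mul hℓ ((u⁻¹ : (ZMod (3 ^ ℓ))ˣ) : ZMod (3 ^ ℓ)) (c s)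
      have : Fact (1 < 3 ^ ℓ) := ⟨Nat.one_lt_pow hℓ (by norm_num)⟩
      rw [h1, show ((c s).val : ZMod 3) = 0 from h4, mul_zero, ZMod.val_one, Nat.cast_one] at h5
      exact one_ne_zero h5
    have hss : s = s' := le_antisymm (not_lt.1 (key u' u s' s h1' h2))
      (not_lt.1 (key u u' s s' h1 h2'))
    subst hss
    have hc : ∀ v : (ZMod (3 ^ ℓ))ˣ, ((v⁻¹ : (ZMod (3 ^ ℓ))ˣ) : ZMod (3 ^ ℓ)) * c s = 1 →
        (v : ZMod (3 ^ ℓ)) = c s := by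
      intro v hv
      rw [← mul_one (v : ZMod (3 ^ ℓ)), ← hv, ← mul_assoc, Units.mul_inv, one_mul]
    exact Units.ext ((hc u h1).trans (hc u' h1').symm)

open Classical in
/-- Normalization of the first words of pairs, by the units congruent to one modulo three. -/
theorem sum_eq_card_smul (θ : ℤ_[3]) {m : ℕ} (hm : m ≠ 0) {w : Fin 24 → ZMod 3} (hw : w 0 = 1)
    {M : Type*} [AddCommMonoid M] (f : (Fin 24 → ZMod (3 ^ m)) → M)
    (hf : ∀ u : (ZMod (3 ^ m))ˣ, ∀ c ∈ qrTower θ m, f ((u : ZMod (3 ^ m)) • c) = f c) :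
    ∑ c : Fin 24 → ZMod (3 ^ m) with c ∈ qrTower θ m ∧ residue c = w, f c
      = (Finset.univ.filter fun u : (ZMod (3 ^ m))ˣ =>
            (((u : ZMod (3 ^ m)).val : ℕ) : ZMod 3) = 1).card •
          ∑ c : Fin 24 → ZMod (3 ^ m) with c ∈ qrTower θ m ∧ residue c = w ∧ c 0 = 1, f c := by
  have h : (Finset.univ.filter fun c : Fin 24 → ZMod (3 ^ m) =>
      c ∈ qrTower θ m ∧ residue c = w ∧ c 0 = 1)
      = (Finset.univ.filter fun c => c ∈ qrTower θ m ∧ residue c = w).filter fun c => c 0 = 1 := by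
    ext c
    simp [and_assoc]
  rw [h]
  refine sum_eq_card_smul_sum_normalized _ _ (fun c => c 0 = 1) f ?_ ?_ ?_ ?_
  · intro u hu c
    have h1 : residue ((u : ZMod (3 ^ m)) • c) = residue c := by
      funext i
      rw [residue_smul hm, (Finset.mem_filter.1 hu).2, one_mul]
    simp only [Finset.mem_filter, Finset.mem_univ, true_and, unit_smul_mem_iff, h1]
  · intro u _ c hc
    exact hf u c (Finset.mem_filter.1 hc).2.1
  · intro c hc
    obtain ⟨-, -, h2⟩ := Finset.mem_filter.1 hc
    have h3 : ((c 0).val : ZMod 3) = 1 := by rw [← hw, ← h2]; rfl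
    obtain ⟨u, hu⟩ := isUnit_of_natCast_val_ne_zero (a := c 0) (by rw [h3]; exact one_ne_zero)
    refine ⟨u, Finset.mem_filter.2 ⟨Finset.mem_univ _, by rw [hu, h3]⟩, ?_⟩
    rw [Pi.smul_apply, smul_eq_mul, ← hu, Units.inv_mul]
  · intro c _ u _ u' _ h1 h2
    have hc : ∀ v : (ZMod (3 ^ m))ˣ, ((v⁻¹ : (ZMod (3 ^ m))ˣ) : ZMod (3 ^ m)) * c 0 = 1 →
        (v : ZMod (3 ^ m)) = c 0 := by
      intro v hv
      rw [← mul_one (v : ZMod (3 ^ m)), ← hv, ← mul_assoc, Units.mul_inv, one_mul]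
    exact Units.ext ((hc u h1).trans (hc u' h2).symm)

variable {M : Type} [AddCommMonoid M]

open Classical in
/-- The sum over a fiber is a multiple of the sum over an enumeration of the normalized pairs. -/
theorem fiberSum_eq {m ℓ b r L : ℕ} {l : List (ℕ × ℕ)} (hm : m ≠ 0) (hℓ : ℓ ≠ 0) (hb : b ≠ 0)
    (hl : Enumerates θ r m ℓ L l) (hr : unpack 3 r 0 = 1)
    {f : (Fin 24 → ZMod (3 ^ m)) → (Fin 24 → ZMod (3 ^ ℓ)) → M} (hf : IsPairInvariant θ m ℓ f) :
    fiberSum θ f b (unpack 3 r) =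
      ((Finset.univ.filter fun u : (ZMod (3 ^ m))ˣ =>
          (((u : ZMod (3 ^ m)).val : ℕ) : ZMod 3) = 1).card * Nat.totient (3 ^ ℓ)) •
        (l.map fun p => if unitWt (unpack (3 ^ ℓ) p.2) = b then
          f (unpack (3 ^ m) p.1) (unpack (3 ^ ℓ) p.2) else 0).sum := by
  rw [← hl.sum (fun c d => if unitWt d = b then f c d else 0)]
  have hinner : ∀ c ∈ qrTower θ m,
      ∑ d : Fin 24 → ZMod (3 ^ ℓ) with d ∈ qrTower θ ℓ ∧ unitWt d = b, f c d
      = Nat.totient (3 ^ ℓ) • ∑ d : Fin 24 → ZMod (3 ^ ℓ) with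
          (d ∈ qrTower θ ℓ ∧ IsNormalized d) ∧ DisjSupp c d,
          (if unitWt d = b then f c d else 0) := by
    intro c hc
    rw [sum_eq_totient_smul θ hℓ hb _ fun u d hd => hf.smul_right u c hc d hd]
    congr 1
    rw [← Finset.sum_filter, Finset.filter_filter]
    symm
    refine Finset.sum_subset_zero_on_sdiff ?_ ?_ fun _ _ => rfl
    · intro d hd
      simp only [Finset.mem_filter, Finset.mem_univ, true_and] at hd ⊢
      tauto
    · intro d hd
      simp only [Finset.mem_sdiff, Finset.mem_filter, Finset.mem_univ, true_and] at hd
      exact hf.disj c d fun h => hd.2 ⟨⟨⟨hd.1.1.1, hd.1.2⟩, h⟩, hd.1.1.2⟩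
  rw [fiberSum, Finset.sum_congr rfl fun c hc => hinner c (Finset.mem_filter.1 hc).2.1,
    ← Finset.smul_sum, sum_eq_card_smul θ hm hr, smul_smul, mul_comm (Nat.totient _)]
  intro u c hc
  have hdisj : ∀ d : Fin 24 → ZMod (3 ^ ℓ), DisjSupp ((u : ZMod (3 ^ m)) • c) d ↔ DisjSupp c d := by
    intro d
    simp [DisjSupp]
  simp only [hdisj]
  refine Finset.sum_congr rfl fun d hd => ?_
  rw [hf.smul_left u c hc d (Finset.mem_filter.1 hd).2.1.1]

theorem unpack_repWord_zero : unpack 3 repWord 0 = 1 := by decide +kernel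

open Classical in
theorem card_units_one_mod_three : (Finset.univ.filter fun u : (ZMod (3 ^ 1))ˣ =>
      (((u : ZMod (3 ^ 1)).val : ℕ) : ZMod 3) = 1).card = 1 ∧
    (Finset.univ.filter fun u : (ZMod (3 ^ 2))ˣ =>
      (((u : ZMod (3 ^ 2)).val : ℕ) : ZMod 3) = 1).card = 3 ∧
    (Finset.univ.filter fun u : (ZMod (3 ^ 3))ˣ =>
      (((u : ZMod (3 ^ 3)).val : ℕ) : ZMod 3) = 1).card = 9 := by
  refine ⟨?_, ?_, ?_⟩ <;> (convert_to (Finset.filter _ _).card = _; decide +kernel)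

open Classical in
/-- A sum over the pairs whose first word has nine entries not divisible by three, in terms of an
enumeration of the normalized pairs over the chosen word of weight nine. -/
theorem weightSum_nine_eq (hθ : IsCodeRoot θ) {m ℓ L : ℕ} {l : List (ℕ × ℕ)}
    (hl : Enumerates θ repWord m ℓ L l) (hm : m ≠ 0) (hm3 : m ≤ 3) (hℓ : ℓ ≠ 0) (hℓ5 : ℓ ≤ 5)
    {f : (Fin 24 → ZMod (3 ^ m)) → (Fin 24 → ZMod (3 ^ ℓ)) → M} (hf : IsPairInvariant θ m ℓ f)
    {b : ℕ} (hb : b ≠ 0) : weightSum θ f 9 b = (4048 * (3 ^ (m - 1) * Nat.totient (3 ^ ℓ))) •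
      (l.map fun p => if unitWt (unpack (3 ^ ℓ) p.2) = b then
        f (unpack (3 ^ m) p.1) (unpack (3 ^ ℓ) p.2) else 0).sum := by
  rw [weightSum_nine hθ hm hℓ (by omega) hℓ5 hf, fiberSum_eq hm hℓ hb hl unpack_repWord_zero hf,
    smul_smul]
  congr 3
  obtain ⟨h1, h2, h3⟩ := card_units_one_mod_three
  interval_cases m
  · exact absurd rfl hm
  · exact Eq.trans (by congr!) h1
  · exact Eq.trans (by congr!) h2
  · exact Eq.trans (by congr!) h3

/-- The part of a disjoint weight enumerator that comes from first words of weight nine, in terms of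
the tally of the exponents of the normalized pairs. -/
theorem partWE_nine_eq_tallySum (hθ : IsCodeRoot θ) {m ℓ L : ℕ} {l : List (ℕ × ℕ)}
    (hl : Enumerates θ repWord m ℓ L l) (hm : m ≠ 0) (hm3 : m ≤ 3) (hℓ : ℓ ≠ 0) (hℓ2 : ℓ ≤ 2)
    {t : List (ℕ × List ℕ)} (ht : ∀ x ∈ t, ∀ a ∈ x.2, a < 25)
    (hperm : (expandTally t).isPerm (l.map (pairKey (3 ^ m) (3 ^ ℓ) (3 ^ (m + ℓ)))) = true)
    {b : ℕ} (hb : b ≠ 0) : partWE (qrTower θ) m ℓ 9 b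
      = (4048 * (3 ^ (m - 1) * Nat.totient (3 ^ ℓ))) • tallySum b t := by
  rw [partWE_eq_weightSum, weightSum_nine_eq hθ hl hm hm3 hℓ (by omega)
    (isPairInvariant_pairTerm hθ (by omega)) hb, hθ.sum_eq_tallySum hl hm hm3 hℓ hℓ2 ht hperm]

end Normalization

/-! ### The normalized pairs over a word of weight nine -/

/-- The normalized pairs modulo `(3, 3)`. -/
def pairs11 : List (ℕ × ℕ) := pairsOne repWord

/-- The normalized pairs modulo `(9, 3)`. -/
def pairs21 : List (ℕ × ℕ) := liftLeft (3 ^ 1) (3 ^ 1) pairs11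

/-- The normalized pairs modulo `(9, 9)`. -/
def pairs22 : List (ℕ × ℕ) := liftRight (3 ^ 2) (3 ^ 1) pairs21

/-- The normalized pairs modulo `(27, 9)`. -/
def pairs32 : List (ℕ × ℕ) := liftLeft (3 ^ 2) (3 ^ 2) pairs22

/-- The normalized pairs modulo `(27, 27)`. -/
def pairs33 : List (ℕ × ℕ) := liftRight (3 ^ 3) (3 ^ 2) pairs32

/-- The exponents of `z, x_0, x_1, x_2, y_0, y_1`, with the code of the weight, of the pairs modulo
`(3, 3)`. -/
def tally11 : List (ℕ × List ℕ) := [(7, [6, 9, 0, 0, 9, 0, 2]), (18, [6, 9, 0, 0, 9, 0, 1]),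
  (6, [3, 9, 0, 0, 12, 0, 2]), (9, [3, 9, 0, 0, 12, 0, 1])]

/-- The exponents and weights of the pairs modulo `(9, 3)`. -/
def tally21 : List (ℕ × List ℕ) := [(18, [4, 9, 2, 0, 9, 0, 1]), (6, [4, 9, 2, 0, 9, 0, 2]),
  (16, [3, 9, 3, 0, 9, 0, 2]), (26, [3, 9, 3, 0, 9, 0, 1]), (15, [2, 9, 4, 0, 9, 0, 2]),
  (30, [2, 9, 4, 0, 9, 0, 1]), (24, [1, 9, 5, 0, 9, 0, 2]), (42, [1, 9, 5, 0, 9, 0, 1]),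
  (2, [0, 9, 6, 0, 9, 0, 2]), (10, [0, 9, 6, 0, 9, 0, 1]), (6, [0, 9, 3, 0, 12, 0, 1])]

/-- The exponents and weights of the pairs modulo `(9, 9)`. -/
def tally22 : List (ℕ × List ℕ) := [(1, [0, 9, 3, 0, 9, 3, 2]), (15, [0, 9, 3, 0, 9, 3, 1]),
  (26, [0, 9, 3, 0, 9, 3, 0]), (6, [2, 9, 2, 0, 9, 2, 2]), (12, [2, 9, 2, 0, 9, 2, 1]),
  (54, [2, 9, 2, 0, 9, 2, 0]), (6, [0, 9, 3, 0, 12, 0, 0])]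

/-- The exponents and weights of the pairs modulo `(27, 9)`. -/
def tally32 : List (ℕ × List ℕ) := [(1, [0, 9, 3, 0, 9, 3, 1]), (15, [0, 9, 3, 0, 9, 3, 0]),
  (6, [0, 9, 2, 2, 9, 2, 2]), (6, [0, 9, 2, 2, 9, 2, 1]), (24, [0, 9, 2, 2, 9, 2, 0]),
  (6, [1, 9, 2, 1, 9, 2, 1]), (12, [1, 9, 2, 1, 9, 2, 0])]

set_option maxRecDepth 100000 in
/-- The tallies are correct; and the pairs modulo `(27, 9)` that extend to pairs modulo `(27, 27)`
have nonzero inner product modulo `3 ^ 5`. The facts are stated together because the evaluation of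
each list of pairs builds on the previous one. -/
theorem tallies_correct :
    ((((expandTally tally11).isPerm (pairs11.map (pairKey (3 ^ 1) (3 ^ 1) (3 ^ (1 + 1)))) &&
      (expandTally tally21).isPerm (pairs21.map (pairKey (3 ^ 2) (3 ^ 1) (3 ^ (2 + 1))))) &&
    ((expandTally tally22).isPerm (pairs22.map (pairKey (3 ^ 2) (3 ^ 2) (3 ^ (2 + 2)))) &&
      (expandTally tally32).isPerm (pairs32.map (pairKey (3 ^ 3) (3 ^ 2) (3 ^ (3 + 2)))))) &&
    pairs33.all fun p => !Nat.beq (Nat.mod (pairSum (3 ^ 3) p.1 p.2 positions) 243) 0) = true := by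
  decide +kernel

/-! ### Pairs of words of weight twelve -/

/-- The word `(1, …, 1, 2)` of weight `24`, as a packed word. -/
def fullWord : ℕ :=
  addMul 2 (addMul 1 (addMul 1 (addMul 2 (addMul 2 (addMul 1 (addMul 1 (codeRow 11) (codeRow 10))
    (codeRow 9)) (codeRow 8)) (codeRow 7)) (codeRow 5)) (codeRow 3)) (codeRow 0)

/-- The word `(1, …, 1, 2)` of weight `24`, as a number with ternary digits: `(3 ^ 24 - 1) / 2 + 3 ^
23`. -/
def fullDigits : ℕ := 235357947067

/-- The images of the word `(1, …, 1, 2)` under the automorphisms. -/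
def fullOrbit : List ℕ := fullDigits :: applyMonomial fullDigits negMap ::
  [applyMonomial fullDigits invMap, applyMonomial (applyMonomial fullDigits invMap) negMap].flatMap
    (shifts 23)

/-- The letters of the words whose entries vanish or agree with those of `(1, …, 1, 2)`. -/
def halfEntries : List (ℕ × List ℕ) := positions.map fun i => (i, [0, tri fullWord i])

/-- The words whose entries vanish or agree with those of `(1, …, 1, 2)`. -/
def halfWords : List ℕ := searchWords halfEntries 24 0 codeRows

set_option maxRecDepth 100000 in
theorem distinctKeys_fullOrbit : distinctKeys 0 fullOrbit = true := by decide +kernel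

set_option maxRecDepth 100000 in
/-- There are `46` words of weight `12` whose entries vanish or agree with those of `(1, …, 1, 2)`;
each forms, with its complement, a pair with the weight of code `1`. -/
theorem halfWords_correct :
    ((halfWords.all fun v => (!Nat.beq (triWeight v positions) 12) ||
      Nat.beq (pairKey (3 ^ 1) (3 ^ 1) (3 ^ (1 + 1)) (v, addMul 242 fullWord v))
        (tallyKey [0, 12, 0, 0, 12, 0, 1])) &&
    Nat.beq (halfWords.filter fun v => Nat.beq (triWeight v positions) 12).length 46) = true := by
  decide +kernel

section WeightTwelve

variable {θ : ℤ_[3]} {M : Type} [AddCommMonoid M]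

theorem IsCodeRoot.packs_fullWord (hθ : IsCodeRoot θ) : Packs (qrTower θ 5) rowBound fullWord := by
  have h : ∀ i : Fin 12, Packs (qrTower θ 5) 242 (codeRow i) := hθ.packs_codeRow
  refine Packs.mono (((((((((h 11).addMul (h 10) (t := 1) (by norm_num [laneBase])).addMul (h 9)
    (t := 1) (by norm_num [laneBase])).addMul (h 8) (t := 2) (by norm_num [laneBase])).addMul (h 7)
    (t := 2) (by norm_num [laneBase])).addMul (h 5) (t := 1) (by norm_num [laneBase])).addMul (h 3)
    (t := 1) (by norm_num [laneBase])).addMul (h 0) (t := 2) (by norm_num [laneBase])))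
    (by norm_num [rowBound])

theorem wordOf_fullDigits : wordOf fullDigits = unpack (3 ^ 1) fullWord := by
  have h : ∀ i, wordOf fullDigits i = unpack (3 ^ 1) fullWord i := by decide +kernel
  exact funext h

/-- The word `c` arises from `u` by replacing some entries by zero. -/
def IsPartOf {n : ℕ} (c u : Fin 24 → ZMod n) : Prop := ∀ i, c i = 0 ∨ c i = u i

theorem unitWt_add {c d : Fin 24 → ZMod (3 ^ 1)} (h : DisjSupp c d) :
    unitWt (c + d) = unitWt c + unitWt d := by
  unfold unitWt
  rw [← Finset.card_union_of_disjoint]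
  · congr 1
    ext i
    simp only [Finset.mem_filter, Finset.mem_univ, true_and, Finset.mem_union, Pi.add_apply]
    rcases h i with h | h <;> simp [h]
  · rw [Finset.disjoint_filter]
    intro i _ h1 h2
    rcases h i with h | h
    · exact h1 (by rw [h, ZMod.val_zero]; exact dvd_zero _)
    · exact h2 (by rw [h, ZMod.val_zero]; exact dvd_zero _)

open Classical in
/-- The sum of a function over the decompositions of `u` into two words of weight `12` with disjoint
supports. -/
noncomputable def splitSum (θ : ℤ_[3])
    (f : (Fin 24 → ZMod (3 ^ 1)) → (Fin 24 → ZMod (3 ^ 1)) → M) (u : Fin 24 → ZMod (3 ^ 1)) : M :=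
  ∑ c : Fin 24 → ZMod (3 ^ 1) with (c ∈ qrTower θ 1 ∧ unitWt c = 12) ∧ IsPartOf c u, f c (u - c)

open Classical in
/-- Two words of weight twelve with disjoint supports add up to a word of weight `24`; the sum over
pairs is rearranged by these words of weight `24`. -/
theorem weightSum_twelve_eq_sum_splitSum
    {f : (Fin 24 → ZMod (3 ^ 1)) → (Fin 24 → ZMod (3 ^ 1)) → M} (hf : IsPairInvariant θ 1 1 f) :
    weightSum θ f 12 12 = ∑ u : Fin 24 → ZMod (3 ^ 1) with u ∈ qrTower θ 1 ∧ unitWt u = 24,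
      splitSum θ f u := by
  have hinner : ∀ c : Fin 24 → ZMod (3 ^ 1), c ∈ qrTower θ 1 ∧ unitWt c = 12 →
      ∑ d : Fin 24 → ZMod (3 ^ 1) with d ∈ qrTower θ 1 ∧ unitWt d = 12, f c d
      = ∑ u : Fin 24 → ZMod (3 ^ 1) with (u ∈ qrTower θ 1 ∧ unitWt u = 24) ∧ IsPartOf c u,
          f c (u - c) := by
    rintro c ⟨hc, hc12⟩
    have h1 : ∑ d : Fin 24 → ZMod (3 ^ 1) with d ∈ qrTower θ 1 ∧ unitWt d = 12, f c d
        = ∑ d : Fin 24 → ZMod (3 ^ 1) with (d ∈ qrTower θ 1 ∧ unitWt d = 12) ∧ DisjSupp c d,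
            f c d := by
      rw [← Finset.filter_filter _ (DisjSupp c)]
      symm
      refine Finset.sum_filter_of_ne fun d _ h => ?_
      by_contra h2
      exact h (hf.disj c d h2)
    rw [h1]
    refine Finset.sum_bij' (fun d _ => c + d) (fun u _ => u - c) ?_ ?_ ?_ ?_ ?_
    · intro d hd
      obtain ⟨-, ⟨h2, h3⟩, h4⟩ := Finset.mem_filter.1 hd
      refine Finset.mem_filter.2 ⟨Finset.mem_univ _, ⟨add_mem hc h2, ?_⟩, fun i => ?_⟩
      · rw [unitWt_add h4, hc12, h3]
      · rcases h4 i with h | h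
        · exact Or.inl h
        · exact Or.inr (by rw [Pi.add_apply, h, add_zero])
    · intro u hu
      obtain ⟨-, ⟨h2, h3⟩, h4⟩ := Finset.mem_filter.1 hu
      have h5 : DisjSupp c (u - c) := fun i => (h4 i).imp_right fun h => by
        rw [Pi.sub_apply, h, sub_self]
      refine Finset.mem_filter.2 ⟨Finset.mem_univ _, ⟨sub_mem h2 hc, ?_⟩, h5⟩
      have h6 := unitWt_add h5
      rw [add_sub_cancel, h3, hc12] at h6
      omega
    · intro d _
      exact add_sub_cancel_left c d
    · intro u _
      exact add_sub_cancel c u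
    · intro d _
      rw [add_sub_cancel_left]
  rw [weightSum, Finset.sum_congr rfl fun c hc => hinner c (Finset.mem_filter.1 hc).2]
  refine Finset.sum_comm' fun c u => ?_
  simp only [Finset.mem_filter, Finset.mem_univ, true_and]
  tauto

theorem act_sub {l : List (ℕ × ℕ)} (hl : IsCodeAut l) {n : ℕ} (u c : Fin 24 → ZMod n) :
    hl.act (u - c) = hl.act u - hl.act c := by
  funext i
  simp only [IsCodeAut.act_apply, Pi.sub_apply, mul_sub]

theorem isPartOf_act_iff {l : List (ℕ × ℕ)} (hl : IsCodeAut l) {n : ℕ} (c u : Fin 24 → ZMod n) :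
    IsPartOf (hl.act c) (hl.act u) ↔ IsPartOf c u := by
  have h : ∀ i, (hl.act c i = 0 ∨ hl.act c i = hl.act u i) ↔
      (c (hl.perm i) = 0 ∨ c (hl.perm i) = u (hl.perm i)) := by
    intro i
    refine or_congr (act_eq_zero_iff hl c i) ?_
    rw [eq_comm, ← sub_eq_zero, ← Pi.sub_apply, ← act_sub, act_eq_zero_iff, Pi.sub_apply,
      sub_eq_zero, eq_comm]
  rw [IsPartOf, forall_congr' h]
  exact hl.perm.forall_congr_right (q := fun i => c i = 0 ∨ c i = u i)

open Classical in
theorem splitSum_act {l : List (ℕ × ℕ)} (hl : IsCodeAut l) (hθ : IsCodeRoot θ)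
    {f : (Fin 24 → ZMod (3 ^ 1)) → (Fin 24 → ZMod (3 ^ 1)) → M} (hf : IsPairInvariant θ 1 1 f)
    {u : Fin 24 → ZMod (3 ^ 1)} (hu : u ∈ qrTower θ 1) :
    splitSum θ f (hl.act u) = splitSum θ f u := by
  rw [splitSum, splitSum, Finset.sum_filter, Finset.sum_filter,
    ← Equiv.sum_comp (hl.actEquiv (3 ^ 1))]
  refine Finset.sum_congr rfl fun c _ => ?_
  have h1 : hl.actEquiv (3 ^ 1) c = hl.act c := rfl
  rw [h1, hl.act_mem_iff hθ (by norm_num), unitWt_act hl one_ne_zero, isPartOf_act_iff]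
  refine ite_congr rfl (fun hc => ?_) fun _ => rfl
  rw [← act_sub, hf.act hl c hc.1.1 _ (sub_mem hu hc.1.1)]

theorem halfEntries_valid : ∀ c ∈ halfEntries, c.1 < 24 ∧ c.2.Nodup ∧ ∀ a ∈ c.2, a < 3 := by
  decide +kernel

theorem matches_halfEntries_iff (w : Fin 24 → ZMod 3) :
    Matches halfEntries 24 w ↔ IsPartOf w (unpack 3 fullWord) := by
  rw [matches_iff (by simp [halfEntries, positions]), halfEntries, IsPartOf]
  simp only [List.forall_mem_map]
  rw [← forall_positions (P := fun i => w i = 0 ∨ w i = unpack 3 fullWord i)]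
  refine forall₂_congr fun i hi => ?_
  have h24 : (Fin.ofNat 24 i : Fin 24).val = i := Nat.mod_eq_of_lt (List.mem_range.1 hi)
  have h2 : ((tri fullWord i : ℕ) : ZMod 3) = unpack 3 fullWord (Fin.ofNat 24 i) := by
    rw [unpack, h24]
    exact ZMod.natCast_mod (lane fullWord i) 3
  simp only [List.mem_cons, List.not_mem_nil, or_false, exists_eq_or_imp, exists_eq_left,
    Nat.cast_zero, h2, eq_comm (b := w _)]

theorem isPartOf_upOne_symm (v : ℕ) (c : Fin 24 → ZMod (3 ^ 1)) :
    IsPartOf (fun i => upOne.symm (c i)) (unpack 3 v) ↔ IsPartOf c (unpack (3 ^ 1) v) := by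
  refine forall_congr' fun i => or_congr (map_eq_zero_iff _ upOne.symm.injective) ?_
  rw [RingEquiv.symm_apply_eq, unpack, unpack, upOne_natCast]

theorem IsCodeRoot.packs_halfWords (hθ : IsCodeRoot θ) {v : ℕ} (hv : v ∈ halfWords) :
    Packs (qrTower θ 5) rowBound v := hθ.packs_searchWords halfEntries_valid 24 hv

theorem IsCodeRoot.unpack_complement (hθ : IsCodeRoot θ) {v : ℕ} (hv : v ∈ halfWords) :
    unpack (3 ^ 1) (addMul 242 fullWord v) = unpack (3 ^ 1) fullWord - unpack (3 ^ 1) v := by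
  have h242 : ((242 : ℕ) : ZMod (3 ^ 1)) = -1 := by decide
  rw [unpack_addMul _ hθ.packs_fullWord.packed (hθ.packs_halfWords hv).packed
    (by norm_num [rowBound, laneBase]), h242, neg_one_smul, sub_eq_add_neg]

theorem IsCodeRoot.disjSupp_halfWords (hθ : IsCodeRoot θ) {v : ℕ} (hv : v ∈ halfWords) :
    DisjSupp (unpack (3 ^ 1) v) (unpack (3 ^ 1) (addMul 242 fullWord v)) := by
  have h1 := (matches_halfEntries_iff _).1 (hθ.matches_of_mem halfEntries_valid 24 hv)
  have h2 : unpack 3 v = fun i => upOne.symm (unpack (3 ^ 1) v i) := by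
    funext i
    rw [eq_comm, RingEquiv.symm_apply_eq, unpack, unpack, upOne_natCast]
  rw [h2, isPartOf_upOne_symm] at h1
  rw [hθ.unpack_complement hv]
  exact fun i => (h1 i).imp_right fun h => by rw [Pi.sub_apply, h, sub_self]

open Classical in
theorem splitSum_fullWord (hθ : IsCodeRoot θ)
    {f : (Fin 24 → ZMod (3 ^ 1)) → (Fin 24 → ZMod (3 ^ 1)) → M} :
    splitSum θ f (unpack (3 ^ 1) fullWord) = (halfWords.map fun v =>
      if unitWt (unpack (3 ^ 1) v) = 12 then
        f (unpack (3 ^ 1) v) (unpack (3 ^ 1) (addMul 242 fullWord v)) else 0).sum := by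
  have h := hθ.sum_matches halfEntries_valid 24 (fun c => if unitWt c = 12 then
    f c (unpack (3 ^ 1) fullWord - c) else 0)
  rw [List.map_congr_left fun v hv => by rw [hθ.unpack_complement hv]]
  refine Eq.trans ?_ h
  rw [splitSum, Finset.sum_filter, Finset.sum_filter]
  refine Finset.sum_congr rfl fun c _ => ?_
  rw [matches_halfEntries_iff, isPartOf_upOne_symm]
  by_cases h1 : c ∈ qrTower θ 1 <;> by_cases h2 : unitWt c = 12 <;>
    by_cases h3 : IsPartOf c (unpack (3 ^ 1) fullWord) <;> simp_all

open Classical in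
/-- The words of weight `24` are the images of `(1, …, 1, 2)` under automorphisms. -/
theorem weightSum_twelve (hθ : IsCodeRoot θ)
    {f : (Fin 24 → ZMod (3 ^ 1)) → (Fin 24 → ZMod (3 ^ 1)) → M} (hf : IsPairInvariant θ 1 1 f) :
    weightSum θ f 12 12 = 48 • (halfWords.map fun v => if unitWt (unpack (3 ^ 1) v) = 12 then
        f (unpack (3 ^ 1) v) (unpack (3 ^ 1) (addMul 242 fullWord v)) else 0).sum := by
  rw [weightSum_twelve_eq_sum_splitSum hf, ← splitSum_fullWord hθ]
  set P : (Fin 24 → ZMod (3 ^ 1)) → Prop := fun u => (u ∈ qrTower θ 1 ∧ unitWt u = 24) ∧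
    splitSum θ f u = splitSum θ f (unpack (3 ^ 1) fullWord) with hPdef
  have hP : ∀ l, ∀ hl : IsCodeAut l, ∀ u, P u → P (hl.act u) := by
    rintro l hl u ⟨⟨h1, h2⟩, h3⟩
    refine ⟨⟨hl.act_mem hθ (by norm_num) h1, ?_⟩, ?_⟩
    · rw [unitWt_act hl one_ne_zero, h2]
    · rw [splitSum_act hl hθ hf h1, h3]
  have h0 : P (wordOf fullDigits) := by
    rw [wordOf_fullDigits]
    refine ⟨⟨hθ.mem_unpack (by norm_num) hθ.packs_fullWord, ?_⟩, rfl⟩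
    rw [unitWt_unpack_eq_triWeight one_ne_zero]
    decide +kernel
  have hinv : P (wordOf (applyMonomial fullDigits invMap)) := by
    rw [wordOf_applyMonomial isCodeAut_invMap]
    exact hP _ _ _ h0
  have hneg : ∀ v, P (wordOf v) → P (wordOf (applyMonomial v negMap)) := by
    intro v hv
    rw [wordOf_applyMonomial isCodeAut_negMap]
    exact hP _ _ _ hv
  have horbit : ∀ v ∈ fullOrbit, P (wordOf v) := by
    intro v hv
    rw [fullOrbit, List.mem_cons, List.mem_cons, List.mem_flatMap] at hv
    rcases hv with hv | hv | ⟨w, hw, hv⟩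
    · rw [hv]; exact h0
    · rw [hv]; exact hneg _ h0
    · refine of_mem_shifts (hP _ _) ?_ hv
      rw [List.mem_cons, List.mem_singleton] at hw
      rcases hw with hw | hw
      · rw [hw]; exact hinv
      · rw [hw]; exact hneg _ hinv
  have hnodup : (fullOrbit.map wordOf).Nodup := by
    have h := (nodup_of_distinctKeys distinctKeys_fullOrbit).2
    refine List.Nodup.map_on (fun v hv w hw hvw => ?_) h.of_map
    exact List.inj_on_of_nodup_map h hv hw (infoKey_eq_of_wordOf_eq hvw)
  have hlen : fullOrbit.length = 48 := by
    simp [fullOrbit, length_shifts]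
  have hset : (Finset.univ.filter fun c : Fin 24 → ZMod (3 ^ 1) => c ∈ qrTower θ 1 ∧ unitWt c = 24)
      = (fullOrbit.map wordOf).toFinset := by
    symm
    refine Finset.eq_of_subset_of_card_le ?_ ?_
    · intro c hc
      obtain ⟨v, hv, rfl⟩ := List.mem_map.1 (List.mem_toFinset.1 hc)
      exact Finset.mem_filter.2 ⟨Finset.mem_univ _, (horbit v hv).1⟩
    · rw [List.toFinset_card_of_nodup hnodup, List.length_map, hlen]
      exact (wtCount_eq hθ).2.2.2.2.2.le
  rw [hset, Finset.sum_congr rfl (g := fun _ => splitSum θ f (unpack (3 ^ 1) fullWord)),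
    Finset.sum_const, List.toFinset_card_of_nodup hnodup, List.length_map, hlen]
  intro c hc
  obtain ⟨v, hv, rfl⟩ := List.mem_map.1 (List.mem_toFinset.1 hc)
  exact (horbit v hv).2

end WeightTwelve

/-! ### Vanishing of terms -/

section Vanishing

variable {θ : ℤ_[3]}

theorem avgPsi_three_eq_one_iff {N : ℕ} (s : ZMod (3 ^ N)) : avgPsi 3 N s = 1 ↔ s = 0 := by
  unfold avgPsi
  split_ifs with h1 h2
  · simp [h1]
  · simp only [h1, iff_false]
    norm_num
  · simp [h1]

theorem avgPsi_eq_zero_of_redMod {k N : ℕ} (h : k < N) {s : ZMod (3 ^ N)}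
    (hs : redMod 3 h.le s ≠ 0) : avgPsi 3 N s = 0 := by
  have h1 : s ≠ 0 := by
    rintro rfl
    exact hs (map_zero _)
  have h2 : ((3 : ℕ) : ZMod (3 ^ N)) * s ≠ 0 := by
    intro h3
    refine hs ((redMod_eq_zero_iff _ _).2 ?_)
    rw [← ZMod.natCast_zmod_val s, ← Nat.cast_mul, ZMod.natCast_eq_zero_iff] at h3
    obtain ⟨j, rfl⟩ := Nat.exists_eq_add_of_lt h
    have h4 : 3 * 3 ^ (k + j) ∣ 3 * s.val := by rwa [← pow_succ']
    exact (pow_dvd_pow 3 (Nat.le_add_right k j)).trans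
      (Nat.dvd_of_mul_dvd_mul_left (by norm_num) h4)
  rw [avgPsi, if_neg h1, if_neg h2]

/-- A pair has weight zero if its reduction modulo smaller powers has weight different from one: the
inner product does not vanish modulo a smaller power, so that three times it does not vanish. -/
theorem pairWt_eq_zero_of_redMod (hθ : IsCodeRoot θ) {m ℓ m' ℓ' : ℕ} (hm : m' ≤ m) (hℓ : ℓ' ≤ ℓ)
    (hlt : m' + ℓ' < m + ℓ) {c : Fin 24 → ZMod (3 ^ m)} (hc : c ∈ qrTower θ m)
    {d : Fin 24 → ZMod (3 ^ ℓ)} (hd : d ∈ qrTower θ ℓ) (hcd : DisjSupp c d)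
    (h : pairWt (qrTower θ) (m' + ℓ') (fun i => redMod 3 hm (c i))
      (fun i => redMod 3 hℓ (d i)) ≠ 1) :
    pairWt (qrTower θ) (m + ℓ) c d = 0 := by
  obtain ⟨D, hD, rfl⟩ := hθ.tower.lift (show ℓ ≤ m + ℓ by omega) d hd
  rw [hθ.tower.pairWt_eq rfl hc hD (fun _ => rfl) hcd]
  refine avgPsi_eq_zero_of_redMod hlt ?_
  have hcd' : DisjSupp (fun i => redMod 3 hm (c i))
      (fun i => redMod 3 hℓ (redMod 3 (show ℓ ≤ m + ℓ by omega) (D i))) := fun i =>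
    (hcd i).imp (fun h => by simp only [h, map_zero]) fun h => by simp only [h, map_zero]
  rw [hθ.tower.pairWt_eq rfl (hθ.tower.red hm c hc) (hθ.tower.red hlt.le D hD)
    (fun i => by rw [redMod_redMod, redMod_redMod]) hcd', Ne, avgPsi_three_eq_one_iff] at h
  rwa [redMod_pairing rfl rfl hm hℓ hcd]

open Classical in
/-- The indicator of the pairs with disjoint supports whose reduction modulo `3 ^ m'` and `3 ^ ℓ'`
has weight one. -/
noncomputable def lowerIndicator (θ : ℤ_[3]) {m ℓ m' ℓ' : ℕ} (hm : m' ≤ m) (hℓ : ℓ' ≤ ℓ)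
    (c : Fin 24 → ZMod (3 ^ m)) (d : Fin 24 → ZMod (3 ^ ℓ)) : ℕ :=
  if DisjSupp c d ∧ pairWt (qrTower θ) (m' + ℓ') (fun i => redMod 3 hm (c i))
    (fun i => redMod 3 hℓ (d i)) = 1 then 1 else 0

theorem redMod_unit_smul {m m' : ℕ} (hm : m' ≤ m) (u : (ZMod (3 ^ m))ˣ)
    (c : Fin 24 → ZMod (3 ^ m)) : (fun i => redMod 3 hm (((u : ZMod (3 ^ m)) • c) i))
      = redMod 3 hm (u : ZMod (3 ^ m)) • fun i => redMod 3 hm (c i) :=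
  funext fun _ => map_mul _ _ _

theorem redMod_act {l : List (ℕ × ℕ)} (hl : IsCodeAut l) {m m' : ℕ} (hm : m' ≤ m)
    (c : Fin 24 → ZMod (3 ^ m)) :
    (fun i => redMod 3 hm (hl.act c i)) = hl.act fun i => redMod 3 hm (c i) :=
  funext fun i => redMod_signedPerm _ _ hm c i

theorem isPairInvariant_lowerIndicator (hθ : IsCodeRoot θ) {m ℓ m' ℓ' : ℕ} (hm : m' ≤ m)
    (hℓ : ℓ' ≤ ℓ) (h5 : m' + ℓ' ≤ 5) :
    IsPairInvariant θ m ℓ (lowerIndicator θ hm hℓ) := by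
  refine ⟨?_, ?_, ?_, ?_⟩
  · intro l hl c hc d hd
    have h1 : DisjSupp (hl.act c) (hl.act d) ↔ DisjSupp c d := by
      simp only [DisjSupp, act_eq_zero_iff]
      exact hl.perm.forall_congr_right (q := fun i => c i = 0 ∨ d i = 0)
    rw [lowerIndicator, lowerIndicator, h1, redMod_act, redMod_act, IsCodeAut.act, IsCodeAut.act,
      hθ.tower.pairWt_signedPerm hl.perm (sourceSign l) rfl
        (fun c hc => hl.act_mem hθ (by omega) hc) (fun c hc => hl.act_mem hθ h5 hc)
        (hθ.tower.red hm c hc) (hθ.tower.red hℓ d hd)]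
  · intro u c hc d hd
    have h1 : DisjSupp ((u : ZMod (3 ^ m)) • c) d ↔ DisjSupp c d := by simp [DisjSupp]
    rw [lowerIndicator, lowerIndicator, h1, redMod_unit_smul,
      hθ.tower.pairWt_unit_smul_left rfl (hθ.tower.red hm c hc) (hθ.tower.red hℓ d hd)
        (u.isUnit.map _)]
  · intro u c hc d hd
    have h1 : DisjSupp c ((u : ZMod (3 ^ ℓ)) • d) ↔ DisjSupp c d := by simp [DisjSupp]
    rw [lowerIndicator, lowerIndicator, h1, redMod_unit_smul,
      hθ.tower.pairWt_unit_smul_right rfl (hθ.tower.red hm c hc) (hθ.tower.red hℓ d hd)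
        (u.isUnit.map _)]
  · intro c d h
    rw [lowerIndicator, if_neg fun h1 => h h1.1]

theorem lowerIndicator_unpack {m ℓ m' ℓ' : ℕ} (hm : m' ≤ m) (hℓ : ℓ' ≤ ℓ) {v w : ℕ}
    (h : pairWt (qrTower θ) (m' + ℓ') (unpack (3 ^ m') v) (unpack (3 ^ ℓ') w) ≠ 1) :
    lowerIndicator θ hm hℓ (unpack (3 ^ m) v) (unpack (3 ^ ℓ) w) = 0 := by
  rw [lowerIndicator, if_neg]
  rintro ⟨-, h1⟩
  simp only [redMod_unpack] at h1
  exact h h1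

theorem unitWt_redMod {m m' : ℕ} (hm : m' ≤ m) (hm0 : m' ≠ 0) (c : Fin 24 → ZMod (3 ^ m)) :
    unitWt (fun i => redMod 3 hm (c i)) = unitWt c := by
  rw [unitWt_eq_card_residue, unitWt_eq_card_residue, residue_redMod hm hm0]

/-- If the pairs modulo `(3 ^ m₁, 3 ^ ℓ₁)` have pairings that do not vanish modulo
`3 ^ (m' + ℓ')`, where `m' + ℓ' < m + ℓ`, then the pairs modulo `(3 ^ m, 3 ^ ℓ)` above them have
weight zero. -/
theorem partWE_eq_zero_of_lowerIndicator (hθ : IsCodeRoot θ) {m ℓ m₁ ℓ₁ m' ℓ' a b : ℕ}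
    (hm₁ : m₁ ≤ m) (hℓ₁ : ℓ₁ ≤ ℓ) (hm' : m' ≤ m₁) (hℓ' : ℓ' ≤ ℓ₁) (hm0 : m₁ ≠ 0) (hℓ0 : ℓ₁ ≠ 0)
    (hlt : m' + ℓ' < m + ℓ) (h : weightSum θ (lowerIndicator θ hm' hℓ') a b = 0) :
    partWE (qrTower θ) m ℓ a b = 0 := by
  classical
  rw [partWE_eq_weightSum]
  refine Finset.sum_eq_zero fun c hc => Finset.sum_eq_zero fun d hd => ?_
  obtain ⟨-, hc, hca⟩ := Finset.mem_filter.1 hc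
  obtain ⟨-, hd, hdb⟩ := Finset.mem_filter.1 hd
  rw [pairTerm]
  by_cases hcd : DisjSupp c d
  · have h1 := Finset.sum_eq_zero_iff.1 (Finset.sum_eq_zero_iff.1 h (fun i => redMod 3 hm₁ (c i))
      (Finset.mem_filter.2 ⟨Finset.mem_univ _, hθ.tower.red hm₁ c hc,
        by rw [unitWt_redMod hm₁ hm0, hca]⟩))
      (fun i => redMod 3 hℓ₁ (d i))
      (Finset.mem_filter.2 ⟨Finset.mem_univ _, hθ.tower.red hℓ₁ d hd,
        by rw [unitWt_redMod hℓ₁ hℓ0, hdb]⟩)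
    have hcd' : DisjSupp (fun i => redMod 3 hm₁ (c i)) (fun i => redMod 3 hℓ₁ (d i)) := fun i =>
      (hcd i).imp (fun h => by simp only [h, map_zero]) fun h => by simp only [h, map_zero]
    rw [pairWt_eq_zero_of_redMod hθ (hm'.trans hm₁) (hℓ'.trans hℓ₁) hlt hc hd hcd, map_zero,
      zero_mul]
    intro h2
    rw [lowerIndicator, if_pos ⟨hcd', by simpa only [redMod_redMod] using h2⟩] at h1
    exact one_ne_zero h1
  · rw [pairWt_eq_zero_of_not_disjSupp hcd, map_zero, zero_mul]

end Vanishing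

/-! ### The pairs of words of weights nine and twelve -/

section Values

variable {θ : ℤ_[3]}

theorem enumerates_pairs11 (hθ : IsCodeRoot θ) : Enumerates θ repWord 1 1 rowBound pairs11 :=
  hθ.enumerates_pairsOne le_rfl hθ.packs_repWord (by decide +kernel)

theorem enumerates_pairs21 (hθ : IsCodeRoot θ) :
    Enumerates θ repWord 2 1 (rowBound + 3 ^ 1 * rowBound) pairs21 :=
  hθ.enumerates_liftLeft (enumerates_pairs11 hθ) (by norm_num) (by norm_num)
    (by norm_num [rowBound, laneBase])

theorem enumerates_pairs22 (hθ : IsCodeRoot θ) :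
    Enumerates θ repWord 2 2 (rowBound + 3 ^ 1 * rowBound + 3 ^ 1 * rowBound) pairs22 :=
  hθ.enumerates_liftRight (enumerates_pairs21 hθ) (by norm_num) (by norm_num)
    (by norm_num [rowBound, laneBase])

theorem enumerates_pairs32 (hθ : IsCodeRoot θ) : Enumerates θ repWord 3 2
    (rowBound + 3 ^ 1 * rowBound + 3 ^ 1 * rowBound + 3 ^ 2 * rowBound) pairs32 :=
  hθ.enumerates_liftLeft (enumerates_pairs22 hθ) (by norm_num) (by norm_num)
    (by norm_num [rowBound, laneBase])

theorem enumerates_pairs33 (hθ : IsCodeRoot θ) : Enumerates θ repWord 3 3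
    (rowBound + 3 ^ 1 * rowBound + 3 ^ 1 * rowBound + 3 ^ 2 * rowBound + 3 ^ 2 * rowBound) pairs33 :=
  hθ.enumerates_liftRight (enumerates_pairs32 hθ) (by norm_num) (by norm_num)
    (by norm_num [rowBound, laneBase])

theorem tallies_correct' :
    ((expandTally tally11).isPerm (pairs11.map (pairKey (3 ^ 1) (3 ^ 1) (3 ^ (1 + 1)))) = true ∧
      (expandTally tally21).isPerm (pairs21.map (pairKey (3 ^ 2) (3 ^ 1) (3 ^ (2 + 1)))) = true) ∧
    ((expandTally tally22).isPerm (pairs22.map (pairKey (3 ^ 2) (3 ^ 2) (3 ^ (2 + 2)))) = true ∧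
      (expandTally tally32).isPerm (pairs32.map (pairKey (3 ^ 3) (3 ^ 2) (3 ^ (3 + 2)))) = true) := by
  have h := tallies_correct
  rw [Bool.and_eq_true, Bool.and_eq_true, Bool.and_eq_true, Bool.and_eq_true] at h
  exact h.1

theorem partWE_one_one_nine (hθ : IsCodeRoot θ) {b : ℕ} (hb : b ≠ 0) :
    partWE (qrTower θ) 1 1 9 b = 8096 * tallySum b tally11 := by
  rw [partWE_nine_eq_tallySum hθ (enumerates_pairs11 hθ) (by norm_num) (by norm_num) (by norm_num)
    (by norm_num) (by decide) tallies_correct'.1.1 hb, show Nat.totient (3 ^ 1) = 2 by decide,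
    nsmul_eq_mul]
  norm_num

theorem partWE_two_one_nine (hθ : IsCodeRoot θ) {b : ℕ} (hb : b ≠ 0) :
    partWE (qrTower θ) 2 1 9 b = 24288 * tallySum b tally21 := by
  rw [partWE_nine_eq_tallySum hθ (enumerates_pairs21 hθ) (by norm_num) (by norm_num) (by norm_num)
    (by norm_num) (by decide) tallies_correct'.1.2 hb, show Nat.totient (3 ^ 1) = 2 by decide,
    nsmul_eq_mul]
  norm_num

theorem partWE_two_two_nine (hθ : IsCodeRoot θ) {b : ℕ} (hb : b ≠ 0) :
    partWE (qrTower θ) 2 2 9 b = 72864 * tallySum b tally22 := by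
  rw [partWE_nine_eq_tallySum hθ (enumerates_pairs22 hθ) (by norm_num) (by norm_num) (by norm_num)
    (by norm_num) (by decide) tallies_correct'.2.1 hb, show Nat.totient (3 ^ 2) = 6 by decide,
    nsmul_eq_mul]
  norm_num

theorem partWE_three_two_nine (hθ : IsCodeRoot θ) {b : ℕ} (hb : b ≠ 0) :
    partWE (qrTower θ) 3 2 9 b = 218592 * tallySum b tally32 := by
  rw [partWE_nine_eq_tallySum hθ (enumerates_pairs32 hθ) (by norm_num) (by norm_num) (by norm_num)
    (by norm_num) (by decide) tallies_correct'.2.2 hb, show Nat.totient (3 ^ 2) = 6 by decide,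
    nsmul_eq_mul]
  norm_num

/-- The first words have weight nine. Of two words modulo `27` with disjoint supports, the inner
product does not vanish modulo `3 ^ 5`, so that modulo `3 ^ 6` it has weight zero, and so have all
lifts. -/
theorem partWE_nine_eq_zero (hθ : IsCodeRoot θ) {m ℓ b : ℕ} (hm : 3 ≤ m) (hℓ : 3 ≤ ℓ) (hb : b ≠ 0) :
    partWE (qrTower θ) m ℓ 9 b = 0 := by
  classical
  refine partWE_eq_zero_of_lowerIndicator hθ hm hℓ (le_refl 3) (show 2 ≤ 3 by norm_num) (by norm_num)
    (by norm_num) (by omega) ?_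
  have h3 := enumerates_pairs33 hθ
  rw [weightSum_nine_eq hθ h3 (by norm_num) le_rfl (by norm_num) (by norm_num)
    (isPairInvariant_lowerIndicator hθ _ _ (by norm_num)) hb, List.sum_eq_zero, smul_zero]
  intro x hx
  obtain ⟨p, hp, rfl⟩ := List.mem_map.1 hx
  have h := tallies_correct
  rw [Bool.and_eq_true] at h
  have h1 := List.all_eq_true.1 h.2 p hp
  -- The pairs modulo `(27, 9)` below those modulo `(27, 27)` do not have weight one.
  rw [lowerIndicator_unpack, ite_self]
  have hdisj : DisjSupp (unpack (3 ^ 3) p.1) (unpack (3 ^ 2) p.2) := fun i => by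
    refine (h3.disj p hp i).imp_right fun h2 => ?_
    have := redMod_unpack (show 2 ≤ 3 by norm_num) p.2 i
    rw [h2, map_zero] at this
    exact this.symm
  have hp5 := h3.packs p hp
  rw [hθ.tower.pairWt_eq rfl (hθ.mem_unpack (by norm_num) hp5.1)
    (hθ.mem_unpack (by norm_num) hp5.2) (fun i => redMod_unpack _ _ _) hdisj,
    pairing_unpack rfl hdisj, Ne, avgPsi_three_eq_one_iff, ZMod.natCast_eq_zero_iff]
  intro h2
  rw [show (3 : ℕ) ^ (3 + 2) = 243 by norm_num] at h2
  rw [show Nat.mod (pairSum (3 ^ 3) p.1 p.2 positions) 243 = 0 from Nat.mod_eq_zero_of_dvd h2] at h1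
  exact absurd h1 (by decide)

theorem pairKey_halfWords {v : ℕ} (hv : v ∈ halfWords)
    (h12 : unitWt (unpack (3 ^ 1) v) = 12) :
    pairKey (3 ^ 1) (3 ^ 1) (3 ^ (1 + 1)) (v, addMul 242 fullWord v)
      = tallyKey [0, 12, 0, 0, 12, 0, 1] := by
  have h := halfWords_correct
  rw [Bool.and_eq_true] at h
  have h1 := List.all_eq_true.1 h.1 v hv
  rw [unitWt_unpack_eq_triWeight one_ne_zero] at h12
  rw [h12, Bool.or_eq_true] at h1
  exact Nat.eq_of_beq_eq_true (h1.resolve_left (by decide))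

theorem card_halfWords :
    (halfWords.filter fun v => Nat.beq (triWeight v positions) 12).length = 46 := by
  have h := halfWords_correct
  rw [Bool.and_eq_true] at h
  exact Nat.eq_of_beq_eq_true h.2

theorem sum_map_ite_eq {α M : Type*} [AddCommMonoid M] (l : List α) (p : α → Bool) (f : α → M) :
    (l.map fun a => if p a = true then f a else 0).sum = ((l.filter p).map f).sum := by
  induction l with
  | nil => rfl
  | cons a l ih =>
    rw [List.map_cons, List.sum_cons, ih, List.filter_cons]
    split_ifs <;> simp

theorem two_mul_C_neg_half : (2 : MvPolynomial WVar ℚ) * MvPolynomial.C (-1 / 2) = -1 := by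
  rw [show (2 : MvPolynomial WVar ℚ) = MvPolynomial.C 2 from rfl, ← map_mul]
  norm_num

theorem partWE_twelve_one_one (hθ : IsCodeRoot θ) : partWE (qrTower θ) 1 1 12 12
    = -1104 * MvPolynomial.X (WVar.x 0) ^ 12 * MvPolynomial.X (WVar.y 0) ^ 12 := by
  rw [partWE_eq_weightSum, weightSum_twelve hθ (isPairInvariant_pairTerm hθ (by norm_num))]
  have h1 : ∀ v ∈ halfWords, (if unitWt (unpack (3 ^ 1) v) = 12 then
      pairTerm θ 1 1 (unpack (3 ^ 1) v)
      (unpack (3 ^ 1) (addMul 242 fullWord v)) else 0)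
      = if Nat.beq (triWeight v positions) 12 = true then
          keyTerm fun j => [0, 12, 0, 0, 12, 0, 1].getD j 0 else 0 := by
    intro v hv
    have h3 : Nat.beq (triWeight v positions) 12 = true ↔ unitWt (unpack (3 ^ 1) v) = 12 := by
      rw [unitWt_unpack_eq_triWeight one_ne_zero]
      exact Nat.beq_eq.to_iff
    rw [if_congr h3 rfl rfl]
    split_ifs with h12
    · have h2 := hθ.pairTerm_unpack (m := 1) (ℓ := 1) one_ne_zero (by norm_num) one_ne_zero
        (by norm_num) (p := (v, addMul 242 fullWord v))
        ⟨(hθ.packs_halfWords hv).mono (M' := rowBound + 242 * rowBound) (by omega),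
          hθ.packs_fullWord.addMul (hθ.packs_halfWords hv) (by norm_num [rowBound, laneBase])⟩
        (hθ.disjSupp_halfWords hv)
      rw [h2, pairKey_halfWords hv h12]
      congr 1
      exact funext fun j => lane_tallyKey (by decide) j
    · rfl
  rw [List.map_congr_left h1, sum_map_ite_eq, List.map_const', List.sum_replicate, card_halfWords]
  simp only [keyTerm, weightVal, Finset.prod_range_succ, Finset.prod_range_zero, slotVar,
    nsmul_eq_mul, List.getD_cons_zero, List.getD_cons_succ]
  push_cast
  linear_combination (1104 * MvPolynomial.X (WVar.x 0) ^ 12 * MvPolynomial.X (WVar.y 0) ^ 12) *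
    two_mul_C_neg_half

/-- The inner products of two words of weight twelve with disjoint supports do not vanish modulo
nine. -/
theorem partWE_twelve_eq_zero (hθ : IsCodeRoot θ) {m ℓ : ℕ} (hm : m ≠ 0) (hℓ : ℓ ≠ 0)
    (h3 : 3 ≤ m + ℓ) : partWE (qrTower θ) m ℓ 12 12 = 0 := by
  classical
  refine partWE_eq_zero_of_lowerIndicator hθ (show 1 ≤ m by omega) (show 1 ≤ ℓ by omega) (le_refl 1)
    (le_refl 1) one_ne_zero one_ne_zero (by omega) ?_
  rw [weightSum_twelve hθ (isPairInvariant_lowerIndicator hθ _ _ (by norm_num)), List.sum_eq_zero,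
    smul_zero]
  intro x hx
  obtain ⟨v, hv, rfl⟩ := List.mem_map.1 hx
  split_ifs with h12
  · refine lowerIndicator_unpack _ _ ?_
    have h2 := hθ.pairWt_unpack (m := 1) (ℓ := 1) rfl (by norm_num) (p := (v, addMul 242 fullWord v))
      ⟨(hθ.packs_halfWords hv).mono (M' := rowBound + 242 * rowBound) (by omega),
        hθ.packs_fullWord.addMul (hθ.packs_halfWords hv) (by norm_num [rowBound, laneBase])⟩
      (hθ.disjSupp_halfWords hv)
    rw [h2, pairKey_halfWords hv h12, lane_tallyKey (by decide)]
    norm_num [weightVal]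
  · rfl

end Values

/-! ### The partial weight enumerators -/

section PartialWE

variable {θ : ℤ_[3]}

theorem unitWt_cases_of_mem (hθ : IsCodeRoot θ) {m : ℕ} (hm : m ≠ 0) {c : Fin 24 → ZMod (3 ^ m)}
    (hc : c ∈ qrTower θ m) : unitWt c ∈ ({0, 9, 12, 15, 18, 21, 24} : Finset ℕ) := by
  rw [← unitWt_redMod (show 1 ≤ m by omega) one_ne_zero]
  exact unitWt_cases hθ (hθ.tower.red _ c hc)

theorem unitWt_add_le {m ℓ : ℕ} {c : Fin 24 → ZMod (3 ^ m)} {d : Fin 24 → ZMod (3 ^ ℓ)}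
    (h : DisjSupp c d) : unitWt c + unitWt d ≤ 24 := by
  unfold unitWt
  rw [← Finset.card_union_of_disjoint]
  · exact (Finset.card_le_univ _).trans_eq (Fintype.card_fin 24)
  · rw [Finset.disjoint_filter]
    intro i _ h1 h2
    rcases h i with h | h
    · exact h1 (by rw [h, ZMod.val_zero]; exact dvd_zero _)
    · exact h2 (by rw [h, ZMod.val_zero]; exact dvd_zero _)

theorem partWE_eq_zero_of_weights (hθ : IsCodeRoot θ) {m ℓ a b : ℕ} (hm : m ≠ 0) (hℓ : ℓ ≠ 0)
    (h : ¬ (a ∈ ({0, 9, 12, 15, 18, 21, 24} : Finset ℕ) ∧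
      b ∈ ({0, 9, 12, 15, 18, 21, 24} : Finset ℕ) ∧ a + b ≤ 24)) :
    partWE (qrTower θ) m ℓ a b = 0 := by
  classical
  refine Finset.sum_eq_zero fun c hcm => Finset.sum_eq_zero fun d hdm => ?_
  obtain ⟨-, hc, rfl⟩ := Finset.mem_filter.1 hcm
  obtain ⟨-, hd, rfl⟩ := Finset.mem_filter.1 hdm
  rw [pairWt_eq_zero_of_not_disjSupp, map_zero, zero_mul]
  exact fun hcd => h ⟨unitWt_cases_of_mem hθ hm hc, unitWt_cases_of_mem hθ hℓ hd, unitWt_add_le hcd⟩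

/-- Both words are nonzero modulo three, of weight at least nine and divisible by three, and their
supports modulo three are disjoint. -/
theorem partialWE_eq_six (hθ : IsCodeRoot θ) {m ℓ : ℕ} (hm : m ≠ 0) (hℓ : ℓ ≠ 0) :
    partialWE 3 (qrTower θ) m ℓ = partWE (qrTower θ) m ℓ 9 9 + partWE (qrTower θ) m ℓ 9 12
      + partWE (qrTower θ) m ℓ 9 15 + partWE (qrTower θ) m ℓ 12 9 + partWE (qrTower θ) m ℓ 12 12
      + partWE (qrTower θ) m ℓ 15 9 := by
  rw [hθ.tower.partialWE_eq_sum_partWE hm hℓ, ← Finset.sum_product', Fintype.card_fin]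
  have hsub : ({(9, 9), (9, 12), (9, 15), (12, 9), (12, 12), (15, 9)} : Finset (ℕ × ℕ)) ⊆
      Finset.Icc 1 24 ×ˢ Finset.Icc 1 24 := by decide
  rw [← Finset.sum_subset hsub]
  · rw [Finset.sum_insert (by decide), Finset.sum_insert (by decide), Finset.sum_insert (by decide),
      Finset.sum_insert (by decide), Finset.sum_insert (by decide), Finset.sum_singleton]
    ring
  · rintro ⟨a, b⟩ hab h
    refine partWE_eq_zero_of_weights hθ hm hℓ ?_
    simp only [Finset.mem_product, Finset.mem_Icc, Finset.mem_insert, Finset.mem_singleton,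
      Prod.mk.injEq] at hab h ⊢
    omega

theorem C_inv_card (θ : ℤ_[3]) :
    (MvPolynomial.C ((Nat.card (qrTower θ 1) : ℚ)⁻¹) : MvPolynomial WVar ℚ)
    = MvPolynomial.C (1 / 3 ^ 12) := by
  rw [card_qrTower_one]
  norm_num


open MvPolynomial in
theorem partWE_one_one_values (hθ : IsCodeRoot θ) :
    partWE (qrTower θ) 1 1 9 9 = -16192 * X WVar.z ^ 6 * X (WVar.x 0) ^ 9 * X (WVar.y 0) ^ 9 ∧
    partWE (qrTower θ) 1 1 9 12 = 12144 * X WVar.z ^ 3 * X (WVar.x 0) ^ 9 * X (WVar.y 0) ^ 12 ∧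
    partWE (qrTower θ) 1 1 9 15 = 0 := by
  refine ⟨?_, ?_, ?_⟩ <;> rw [partWE_one_one_nine hθ (by norm_num)] <;>
    simp [tallySum, tally11, keyTerm, weightVal, Finset.prod_range_succ, slotVar]
  · linear_combination (4048 * 18 * X WVar.z ^ 6 * X (WVar.x 0) ^ 9 * X (WVar.y 0) ^ 9) *
      two_mul_C_neg_half
  · linear_combination (4048 * 9 * X WVar.z ^ 3 * X (WVar.x 0) ^ 9 * X (WVar.y 0) ^ 12) *
      two_mul_C_neg_half

open MvPolynomial in
theorem partWE_two_one_values (hθ : IsCodeRoot θ) :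
    partWE (qrTower θ) 2 1 9 9 = 72864 * X (WVar.x 0) ^ 9 * X (WVar.y 0) ^ 9 *
      (-(X (WVar.x 1) ^ 2 * X WVar.z ^ 4) + X (WVar.x 1) ^ 3 * X WVar.z ^ 3
        + X (WVar.x 1) ^ 5 * X WVar.z - X (WVar.x 1) ^ 6) ∧
    partWE (qrTower θ) 2 1 9 12 = -72864 * X (WVar.x 0) ^ 9 * X (WVar.x 1) ^ 3 *
      X (WVar.y 0) ^ 12 ∧
    partWE (qrTower θ) 2 1 9 15 = 0 := by
  refine ⟨?_, ?_, ?_⟩ <;> rw [partWE_two_one_nine hθ (by norm_num)] <;>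
    simp [tallySum, tally21, keyTerm, weightVal, Finset.prod_range_succ, slotVar]
  · linear_combination (12144 * X (WVar.x 0) ^ 9 * X (WVar.y 0) ^ 9 *
      (18 * X WVar.z ^ 4 * X (WVar.x 1) ^ 2 + 26 * X WVar.z ^ 3 * X (WVar.x 1) ^ 3
        + 30 * X WVar.z ^ 2 * X (WVar.x 1) ^ 4 + 42 * X WVar.z * X (WVar.x 1) ^ 5
        + 10 * X (WVar.x 1) ^ 6)) * two_mul_C_neg_half
  · linear_combination (12144 * 6 * X (WVar.x 0) ^ 9 * X (WVar.x 1) ^ 3 * X (WVar.y 0) ^ 12) *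
      two_mul_C_neg_half

open MvPolynomial in
theorem partWE_two_two_values (hθ : IsCodeRoot θ) :
    partWE (qrTower θ) 2 2 9 9 = -473616 * X (WVar.x 0) ^ 9 * X (WVar.y 0) ^ 9 *
      X (WVar.x 1) ^ 3 * X (WVar.y 1) ^ 3 ∧
    partWE (qrTower θ) 2 2 9 12 = 0 ∧
    partWE (qrTower θ) 2 2 9 15 = 0 := by
  refine ⟨?_, ?_, ?_⟩ <;> rw [partWE_two_two_nine hθ (by norm_num)] <;>
    simp [tallySum, tally22, keyTerm, weightVal, Finset.prod_range_succ, slotVar]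
  linear_combination (36432 * X (WVar.x 0) ^ 9 * X (WVar.y 0) ^ 9 *
    (15 * X (WVar.x 1) ^ 3 * X (WVar.y 1) ^ 3
      + 12 * X WVar.z ^ 2 * X (WVar.x 1) ^ 2 * X (WVar.y 1) ^ 2)) * two_mul_C_neg_half

open MvPolynomial in
theorem partWE_three_two_values (hθ : IsCodeRoot θ) :
    partWE (qrTower θ) 3 2 9 9 = 109296 * X (WVar.x 0) ^ 9 * X (WVar.y 0) ^ 9 *
      (-6 * X (WVar.x 1) ^ 2 * X (WVar.y 1) ^ 2 * X (WVar.x 2) * X WVar.z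
        + 6 * X (WVar.x 1) ^ 2 * X (WVar.y 1) ^ 2 * X (WVar.x 2) ^ 2
        - X (WVar.x 1) ^ 3 * X (WVar.y 1) ^ 3) ∧
    partWE (qrTower θ) 3 2 9 12 = 0 ∧
    partWE (qrTower θ) 3 2 9 15 = 0 := by
  refine ⟨?_, ?_, ?_⟩ <;> rw [partWE_three_two_nine hθ (by norm_num)] <;>
    simp [tallySum, tally32, keyTerm, weightVal, Finset.prod_range_succ, slotVar]
  linear_combination (109296 * X (WVar.x 0) ^ 9 * X (WVar.y 0) ^ 9 *
    (X (WVar.x 1) ^ 3 * X (WVar.y 1) ^ 3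
      + 6 * X (WVar.x 1) ^ 2 * X (WVar.x 2) ^ 2 * X (WVar.y 1) ^ 2
      + 6 * X WVar.z * X (WVar.x 1) ^ 2 * X (WVar.x 2) * X (WVar.y 1) ^ 2)) * two_mul_C_neg_half

/-- Exchanging the two words and then moving one digit from the second word to the first. -/
theorem partWE_succ_swap (hθ : IsCodeRoot θ) {m ℓ : ℕ} (hm : m ≠ 0) (hℓ : ℓ ≠ 0) (a b : ℕ) :
    partWE (qrTower θ) (m + 1) ℓ a b = MvPolynomial.C (1 / 3 ^ 12) *
      MvPolynomial.aeval (upSubst 3 m ℓ)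
        (MvPolynomial.rename swapVar (partWE (qrTower θ) (ℓ + 1) m b a)) := by
  rw [hθ.tower.partWE_succ hm hℓ, C_inv_card, hθ.tower.partWE_swap (ℓ + 1) m b a]

open MvPolynomial in
/-- The terms with a first word of weight nine come from the tally, those with a second word of
weight nine from the exchange of the words. -/
theorem partialWE_one_one (hθ : IsCodeRoot θ) : partialWE 3 (qrTower θ) 1 1 =
    -16192 * X WVar.z ^ 6 * X (WVar.x 0) ^ 9 * X (WVar.y 0) ^ 9
      + 12144 * X WVar.z ^ 3 * X (WVar.x 0) ^ 9 * X (WVar.y 0) ^ 12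
      + 12144 * X WVar.z ^ 3 * X (WVar.x 0) ^ 12 * X (WVar.y 0) ^ 9
      - 1104 * X (WVar.x 0) ^ 12 * X (WVar.y 0) ^ 12 := by
  obtain ⟨h1, h2, h3⟩ := partWE_one_one_values hθ
  rw [partialWE_eq_six hθ one_ne_zero one_ne_zero, hθ.tower.partWE_swap 1 1 9 12,
    hθ.tower.partWE_swap 1 1 9 15, h1, h2, h3, partWE_twelve_one_one hθ]
  simp only [map_mul, map_pow, rename_X, swapVar, map_ofNat, map_zero]
  ring

open MvPolynomial in
/-- The pairs with a second word of weight nine are obtained from those modulo `(3, 9)`, by the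
recursion; these are exchanged with the pairs modulo `(9, 3)` whose first word has weight nine. -/
theorem partialWE_two_one (hθ : IsCodeRoot θ) : partialWE 3 (qrTower θ) 2 1 =
    4048 * 18 * X (WVar.x 0) ^ 9 * X (WVar.y 0) ^ 9 *
      (-(X (WVar.x 1) ^ 2 * X WVar.z ^ 4) + X (WVar.x 1) ^ 3 * X WVar.z ^ 3
        + X (WVar.x 1) ^ 5 * X WVar.z - X (WVar.x 1) ^ 6 - X (WVar.x 0) ^ 3 * X WVar.z ^ 3
        + 3 * X (WVar.x 0) ^ 3 * X (WVar.x 1) * X WVar.z ^ 2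
        - 3 * X (WVar.x 0) ^ 3 * X (WVar.x 1) ^ 2 * X WVar.z
        + X (WVar.x 0) ^ 3 * X (WVar.x 1) ^ 3 - X (WVar.x 1) ^ 3 * X (WVar.y 0) ^ 3) := by
  obtain ⟨h1, h2, h3⟩ := partWE_two_one_values hθ
  have hC : (3 : MvPolynomial WVar ℚ) ^ 12 * MvPolynomial.C (1 / 3 ^ 12) = 1 := by
    rw [show (3 : MvPolynomial WVar ℚ) = MvPolynomial.C 3 from rfl, ← map_pow, ← map_mul]
    norm_num
  have h4 : partWE (qrTower θ) 2 1 12 9 = -72864 * X (WVar.x 0) ^ 12 * X (WVar.y 0) ^ 9 *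
      (X WVar.z - X (WVar.x 1)) ^ 3 := by
    rw [partWE_succ_swap hθ one_ne_zero one_ne_zero, h2]
    simp only [map_mul, map_neg, map_pow, rename_X, swapVar, map_ofNat, MvPolynomial.aeval_X, upSubst,
      Nat.cast_ofNat, if_true, if_neg (show ¬ (0 = 1) by decide)]
    linear_combination (-72864 * X (WVar.x 0) ^ 12 * X (WVar.y 0) ^ 9 *
      (X WVar.z - X (WVar.x 1)) ^ 3) * hC
  have h5 : partWE (qrTower θ) 2 1 15 9 = 0 := by
    rw [partWE_succ_swap hθ one_ne_zero one_ne_zero, h3, map_zero, map_zero, mul_zero]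
  rw [partialWE_eq_six hθ two_ne_zero one_ne_zero, h1, h2, h3, h4, h5,
    partWE_twelve_eq_zero hθ two_ne_zero one_ne_zero le_rfl]
  ring

open MvPolynomial in
theorem partialWE_two_two (hθ : IsCodeRoot θ) : partialWE 3 (qrTower θ) 2 2 =
    4048 * 117 * X (WVar.x 0) ^ 9 * X (WVar.y 0) ^ 9 *
      (-(X (WVar.x 1) ^ 3 * X (WVar.y 1) ^ 3)) := by
  obtain ⟨h1, h2, h3⟩ := partWE_two_two_values hθ
  rw [partialWE_eq_six hθ two_ne_zero two_ne_zero, hθ.tower.partWE_swap 2 2 9 12,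
    hθ.tower.partWE_swap 2 2 9 15, h1, h2, h3,
    partWE_twelve_eq_zero hθ two_ne_zero two_ne_zero (by norm_num), map_zero]
  ring

open MvPolynomial in
theorem partialWE_three_two (hθ : IsCodeRoot θ) : partialWE 3 (qrTower θ) 3 2 =
    4048 * 27 * X (WVar.x 0) ^ 9 * X (WVar.y 0) ^ 9 *
      (-6 * X (WVar.x 1) ^ 2 * X (WVar.y 1) ^ 2 * X (WVar.x 2) * X WVar.z
        + 6 * X (WVar.x 1) ^ 2 * X (WVar.y 1) ^ 2 * X (WVar.x 2) ^ 2
        - X (WVar.x 1) ^ 3 * X (WVar.y 1) ^ 3) := by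
  obtain ⟨h1, h2, h3⟩ := partWE_three_two_values hθ
  rw [partialWE_eq_six hθ three_ne_zero two_ne_zero, h1, h2, h3,
    partWE_succ_swap hθ two_ne_zero two_ne_zero 12 9,
    partWE_succ_swap hθ two_ne_zero two_ne_zero 15 9,
    h2, h3, partWE_twelve_eq_zero hθ three_ne_zero two_ne_zero (by norm_num)]
  simp only [map_zero]
  ring

theorem partialWE_swap (hθ : IsCodeRoot θ) {m ℓ : ℕ} (hm : m ≠ 0) (hℓ : ℓ ≠ 0) :
    partialWE 3 (qrTower θ) ℓ m = MvPolynomial.rename swapVar (partialWE 3 (qrTower θ) m ℓ) := by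
  rw [hθ.tower.partialWE_eq_sum_partWE hℓ hm, hθ.tower.partialWE_eq_sum_partWE hm hℓ,
    Finset.sum_comm, map_sum]
  refine Finset.sum_congr rfl fun a _ => ?_
  rw [map_sum]
  exact Finset.sum_congr rfl fun b _ => hθ.tower.partWE_swap m ℓ a b

theorem partialWE_succ_eq (hθ : IsCodeRoot θ) {m ℓ : ℕ} (hm : m ≠ 0) (hℓ : ℓ ≠ 0) :
    partialWE 3 (qrTower θ) (m + 1) ℓ = MvPolynomial.C (1 / 3 ^ 12) *
      MvPolynomial.aeval (upSubst 3 m ℓ) (partialWE 3 (qrTower θ) m (ℓ + 1)) := by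
  rw [hθ.tower.partialWE_succ hm hℓ, C_inv_card]

theorem partialWE_eq_zero_of_three_le (hθ : IsCodeRoot θ) {m ℓ : ℕ} (hm : 3 ≤ m) (hℓ : 3 ≤ ℓ) :
    partialWE 3 (qrTower θ) m ℓ = 0 := by
  rw [partialWE_eq_six hθ (by omega) (by omega), hθ.tower.partWE_swap ℓ m 9 12,
    hθ.tower.partWE_swap ℓ m 9 15, partWE_nine_eq_zero hθ hm hℓ (by norm_num),
    partWE_nine_eq_zero hθ hm hℓ (by norm_num), partWE_nine_eq_zero hθ hm hℓ (by norm_num),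
    partWE_nine_eq_zero hθ hℓ hm (by norm_num), partWE_nine_eq_zero hθ hℓ hm (by norm_num),
    partWE_twelve_eq_zero hθ (by omega) (by omega) (by omega)]
  simp only [map_zero, add_zero]

/-- From the pairs with both moduli at least `27` one reaches the others by moving digits from the
second word to the first, and by exchanging the words. -/
theorem partialWE_eq_zero (hθ : IsCodeRoot θ) {m ℓ : ℕ} (hm : m ≠ 0) (hℓ : ℓ ≠ 0)
    (h : 6 ≤ m + ℓ) : partialWE 3 (qrTower θ) m ℓ = 0 := by
  -- The recursion leads from `(m, ℓ + 1)` to `(m + 1, ℓ)`; only `m ≥ 3` is preserved.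
  have key : ∀ k m ℓ : ℕ, m = 3 + k → ℓ ≠ 0 → 6 ≤ m + ℓ → partialWE 3 (qrTower θ) m ℓ = 0 := by
    intro k
    induction k with
    | zero => exact fun m ℓ hm hℓ h => partialWE_eq_zero_of_three_le hθ (by omega) (by omega)
    | succ k ih =>
      rintro _ ℓ rfl hℓ h
      rw [← add_assoc, partialWE_succ_eq hθ (by omega) hℓ, ih _ _ rfl (by omega) (by omega),
        map_zero, mul_zero]
  rcases le_total 3 m with h3 | h3
  · exact key (m - 3) m ℓ (by omega) hℓ h
  · rw [partialWE_swap hθ hℓ hm, key (ℓ - 3) ℓ m (by omega) hm (by omega), map_zero]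

end PartialWE

theorem theorem5 (g : ℤ_[3][X]) (hg : IsQRGenerator 3 23 g) (lam : ℤ_[3]) (hlam : IsUnit lam) :
    let K := extCyclicCode 3 23 g lam
    let A := disjointWE 3 K
    let D := partialWE 3 K
    let x : ℕ → MvPolynomial WVar ℚ := fun i => MvPolynomial.X (WVar.x i)
    let y : ℕ → MvPolynomial WVar ℚ := fun j => MvPolynomial.X (WVar.y j)
    let z : MvPolynomial WVar ℚ := MvPolynomial.X WVar.z
    -- the partial weight enumerators
    D 0 0 = z ^ 24 ∧
    D 1 0 = 4048 * z ^ 15 * x 0 ^ 9 + 61824 * z ^ 12 * x 0 ^ 12 + 242880 * z ^ 9 * x 0 ^ 15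
      + 198352 * z ^ 6 * x 0 ^ 18 + 24288 * z ^ 3 * x 0 ^ 21 + 48 * x 0 ^ 24 ∧
    D 1 1 = -16192 * z ^ 6 * x 0 ^ 9 * y 0 ^ 9 + 12144 * z ^ 3 * x 0 ^ 9 * y 0 ^ 12
      + 12144 * z ^ 3 * x 0 ^ 12 * y 0 ^ 9 - 1104 * x 0 ^ 12 * y 0 ^ 12 ∧
    D 2 1 = 4048 * 18 * x 0 ^ 9 * y 0 ^ 9 *
      (-(x 1 ^ 2 * z ^ 4) + x 1 ^ 3 * z ^ 3 + x 1 ^ 5 * z - x 1 ^ 6 - x 0 ^ 3 * z ^ 3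
        + 3 * x 0 ^ 3 * x 1 * z ^ 2 - 3 * x 0 ^ 3 * x 1 ^ 2 * z + x 0 ^ 3 * x 1 ^ 3
        - x 1 ^ 3 * y 0 ^ 3) ∧
    D 2 2 = 4048 * 117 * x 0 ^ 9 * y 0 ^ 9 * (-(x 1 ^ 3 * y 1 ^ 3)) ∧
    D 3 2 = 4048 * 27 * x 0 ^ 9 * y 0 ^ 9 *
      (-6 * x 1 ^ 2 * y 1 ^ 2 * x 2 * z + 6 * x 1 ^ 2 * y 1 ^ 2 * x 2 ^ 2
        - x 1 ^ 3 * y 1 ^ 3) ∧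
    (∀ m ℓ : ℕ, 1 ≤ m → 1 ≤ ℓ → 6 ≤ m + ℓ → D m ℓ = 0) ∧
    -- they determine the symmetrized weight enumerator of every lift
    (∀ m : ℕ, A m 0 = swe 3 m WVar.x (K m)) ∧
    (∀ m : ℕ, swe 3 m WVar.x (K m) =
      ∑ i ∈ Finset.range (m + 1), MvPolynomial.rename (shiftX (m - i)) (D i 0)) ∧
    (∀ m : ℕ, 1 ≤ m → D (m + 1) 0 =
      MvPolynomial.C (1 / 3 ^ 12) * MvPolynomial.aeval (upSubst 3 m 0) (D m 0 + D m 1)) ∧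
    (∀ m ℓ : ℕ, 1 ≤ m → 1 ≤ ℓ → D (m + 1) ℓ =
      MvPolynomial.C (1 / 3 ^ 12) * MvPolynomial.aeval (upSubst 3 m ℓ) (D m (ℓ + 1))) ∧
    -- the code modulo 9
    swe 3 2 WVar.x (K 2) =
      MvPolynomial.C (1 / 3 ^ 12) * MvPolynomial.aeval (upSubst 3 1 0)
        (z ^ 24
          + (4048 * z ^ 15 * x 0 ^ 9 + 61824 * z ^ 12 * x 0 ^ 12 + 242880 * z ^ 9 * x 0 ^ 15
            + 198352 * z ^ 6 * x 0 ^ 18 + 24288 * z ^ 3 * x 0 ^ 21 + 48 * x 0 ^ 24)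
          + (4048 * z ^ 15 * y 0 ^ 9 + 61824 * z ^ 12 * y 0 ^ 12 + 242880 * z ^ 9 * y 0 ^ 15
            + 198352 * z ^ 6 * y 0 ^ 18 + 24288 * z ^ 3 * y 0 ^ 21 + 48 * y 0 ^ 24)
          + (-16192 * z ^ 6 * x 0 ^ 9 * y 0 ^ 9 + 12144 * z ^ 3 * x 0 ^ 9 * y 0 ^ 12
            + 12144 * z ^ 3 * x 0 ^ 12 * y 0 ^ 9 - 1104 * x 0 ^ 12 * y 0 ^ 12)) := by
  intro K A D x y z
  obtain ⟨θ, h1, h2, hA, hswe⟩ := exists_qrTower hg hlam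
  have hθ : IsCodeRoot θ := ⟨h1, h2⟩
  have hA' : A = disjointWE 3 (qrTower θ) := hA
  have hD' : D = partialWE 3 (qrTower θ) := by
    funext m ℓ
    simp only [D, K, partialWE, hA]
  have hS : ∀ m, swe 3 m WVar.x (K m) = swe 3 m WVar.x (qrTower θ m) := hswe
  have hcard : Fintype.card (Fin 24) = 24 := Fintype.card_fin 24
  simp only [hA', hD', hS]
  refine ⟨?_, partialWE_one_zero hθ, partialWE_one_one hθ, partialWE_two_one hθ,
    partialWE_two_two hθ, partialWE_three_two hθ,
    fun m ℓ hm hℓ h => partialWE_eq_zero hθ (by omega) (by omega) h,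
    hθ.tower.disjointWE_zero_right_eq_swe, hθ.tower.swe_eq_sum_partialWE, fun m hm => ?_,
    fun m ℓ hm hℓ => partialWE_succ_eq hθ (by omega) (by omega), ?_⟩
  · rw [hθ.tower.partialWE_zero_zero, hcard]
  · rw [hθ.tower.partialWE_succ_zero (by omega), C_inv_card]
  · rw [← hθ.tower.disjointWE_zero_right_eq_swe, hθ.tower.disjointWE_succ, C_inv_card,
      hθ.tower.disjointWE_one_one, hcard, partialWE_one_zero hθ, partialWE_one_one hθ]
    simp only [map_add, map_mul, map_pow, map_ofNat, MvPolynomial.rename_X, swapVar, x, y, z]
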